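/- Let $d\ge 4$, $\epsilon=-l_\epsilon^2<0$, $l_P>0$, $q\neq0$, and $M_0\in\mathbb R$. Consider Eddington-inspired Born–Infeld gravity with $\lambda=1$ in the metric-affine formalism: the metric $g$ and the symmetric connection $\Gamma$ are independent, $q_{\mu\nu}:=g_{\mu\nu}+\epsilon R_{\mu\nu}(\Gamma)$, and the field equations are $$\sqrt{-\det q}\,(q^{-1})^{\mu\nu}-\lambda\sqrt{-\det g}\,g^{\mu\nu}=-8\pi l_P^{d-2}\epsilon\sqrt{-\det g}\,T^{\mu\nu},\qquad \nabla^\Gamma_\alpha\big(\sqrt{-\det q}\,(q^{-1})^{\mu\nu}\big)=0,$$ together with $dF=0$, $\nabla_\mu F^{\mu\nu}=0$, where $T_\mu{}^\nu=-\frac{l_P^{d-4}}{4\pi}\big(F_\mu{}^\alpha F_\alpha{}^\nu-\frac14F_\alpha{}^\beta F_\beta{}^\alpha\,\delta_\mu^\nu\big)$. Put $$r_c^{2d-4}=q^2l_P^{2d-6}l_\epsilon^2,\qquad r^{d-2}=\tfrac12\Big(|x|^{d-2}+\sqrt{x^{2(d-2)}+4r_c^{2(d-2)}}\Big),\qquad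 z=\frac r{r_c},$$ $$\Omega_{(2)}=\frac{1+z^{4-2d}}{(1-z^{4-2d})^{(d-4)/(d-2)}},\qquad \Omega_{(n)}=(1-z^{4-2d})^{2/(d-2)},$$ $$G_d(z)=-\tfrac{z^{3-d}}{d-3}\,{}_2F_1\!\Big[\tfrac1{d-2},\tfrac{d-3}{2d-4};\tfrac{3d-7}{2d-4};z^{4-2d}\Big]+\tfrac{z^{d-1}}{d-1}\,{}_2F_1\!\Big[\tfrac1{d-2},-\tfrac{d-1}{2d-4};\tfrac{d-3}{2d-4};z^{4-2d}\Big]-\tfrac{z^{d-1}}{d-1}(1-z^{4-2d})^{\frac{d-1}{d-2}},$$ $$A(x)=1-\frac{2M}{(d-3)|x|^{d-3}},\qquad M=M_0+\frac{(d-3)r_c^{d-1}}{2l_\epsilon^2}\,G_d(z).$$ If $M_0\ne0$ let $\delta_1=\frac{(d-3)r_c^{d-1}}{2M_0l_\epsilon^2}$ and $\delta_2=\frac{(d-3)r_c^{d-3}}{2M_0}$ (both are set to $0$ if $M_0=0$), and let $$\delta_d^{-1}=\frac{-\pi\csc(\pi/(d-2))}{(d-1)\Gamma(\frac1{d-2})}\left(\frac{\Gamma(\frac{d-3}{2d-4})}{\Gamma(\frac{d-5}{2d-4})}-\frac{d-1}{d-3}\,\frac{\Gamma(\frac{3d-7}{2d-4})}{\Gamma(\frac{3(d-3)}{2d-4})}\right),\qquad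 a_d=\frac{\pi\csc(\frac{\pi}{d-2})\,2^{\frac{d-3}{d-2}}(d-2)^{-\frac1{d-2}}}{\Gamma(\frac1{d-2})\,\Gamma(\frac{2d-5}{d-2})}$$ (with $1/\Gamma(0)=0$). **1. Solution.** Where $x\neq0$ and $A(x)\ne0$, $$g=-\frac{A}{\Omega_{(2)}}dt^2+\frac{dx^2}{A\,\Omega_{(2)}}+r^2(x)\,d\Omega^2_{d-2},\qquad F^{tx}=\frac{q}{r^{d-2}\sqrt{-g_{tt}g_{xx}}},$$ and the Levi-Civita connection of $q=-A\,dt^2+dx^2/A+x^2d\Omega_{d-2}^2$ satisfy the field equations, and $g+\epsilon R(\Gamma)$ is this $q$. Conversely, let $a(x)dt^2+b(x)dx^2+r(x)^2d\Omega^2_{d-2}$, with $r>r_c$, solve the field equations on an interval of $x$ with this field and with auxiliary metric $-B\,dt^2+dx^2/B+\rho^2d\Omega_{d-2}^2$, where $B\neq0$ and $\rho>0$ are $C^2$. Then $\rho=kx+m$ is affine, and if $k\ne0$ the solution is the one above for some $M_0$, with $\rho$ in place of $x$ and $t/k$ in place of $t$ (so $B=A(\rho)/k^2$). If $M_0\neq0$,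 then $A=1-\dfrac{1+\delta_1G_d(z)}{\delta_2\,\Omega_{(n)}^{(d-3)/2}z^{d-3}}$. One has $r(0)=r_c$ and $r(x)>r_c$ for $x\neq0$ (the throat is $x=0$). From here on let $d>4$. **2. Curvature.** One has $A\neq0$ for all small $x\neq0$. For all values of the parameters the Kretschmann scalar $R^\alpha{}_{\beta\mu\nu}R_\alpha{}^{\beta\mu\nu}$ of $g$ tends to $+\infty$ as $x\to0$. More precisely, its product with $|x|^k$ tends to a positive constant, where $k=4d-10$ if $\delta_1\ne\delta_d$; $k=2d-4$ if $\delta_1=\delta_d$ and $\delta_2\neq a_d\delta_d(2d-4)^{-\frac{d-3}{d-2}}$; and $k=2d-8$ if $\delta_1=\delta_d$ and $\delta_2=a_d\delta_d(2d-4)^{-\frac{d-3}{d-2}}$. **3. Geodesics.** Use the chart $(t,x,y)$, where $y\in\mathbb R^{d-2}$ are stereographic coordinates of the sphere. Let $\gamma$ be a geodesic of $g$, with affine parameter $\lambda$ in an open interval $I$, in the part of the chart where $x\neq0$, $A\neq0$. Then $E=\frac{A}{\Omega_{(2)}}\frac{dt}{d\lambda}$, $L=r^2\left|\frac{d\omega}{d\lambda}\right|$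 ($\omega$ the position on the unit sphere) and $\kappa=-g(\dot\gamma,\dot\gamma)$ are conserved and $$\Big(\frac1{\Omega_{(2)}}\frac{dx}{d\lambda}\Big)^2=E^2-\frac A{\Omega_{(2)}}\Big(\kappa+\frac{L^2}{r^2}\Big).$$ Suppose that $\kappa\ge0$. Where angular coordinates are said below to be bounded, this can always be achieved by rotating the projection pole off the great circle on which $\omega$ moves. (a) If $M_0\le0$ or $\delta_1>\delta_d$ (time-like throat) and $(\kappa,L)\neq(0,0)$, then $|x|$ is bounded below along $\gamma$ by a positive constant. (Radial null geodesics are not repelled.) (b) If $M_0>0$ and $\delta_1<\delta_d$ (space-like throat), and at some parameter $A<0$ and $|x|$ is decreasing, then $\lambda_0=\sup I$ is finite; if moreover $\gamma$ cannot be continued to the future in this part of the chart and its angular coordinates are bounded near $\lambda_0$, then $x\to0$ as $\lambda\to\lambda_0$. (c) In all cases, either $|x|$ is bounded below along $\gamma$ by a positive constant, or $x\to0$ at a finite end point $\lambda_0$ of $I$. Whenever $x\to0$ at a finite end point $\lambda_0$ of $I$ and the angular coordinates are bounded near $\lambda_0$, the geodesic crosses the throat: near $\lambda_0$ it coincides with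 a curve that runs from one side of $x=0$ to the other and is a geodesic with the same $E,L,\kappa$ on both sides. Along this curve $\lambda$ is a strictly monotone $C^1$ function of $x$ on an interval $(-\eta,\eta)$, including $x=0$, and $$\frac{\lambda-\lambda_0}{x|x|^{s}}\to C\neq0\quad(x\to0),$$ where $s=d-\frac72$ if the throat is space-like and $(\kappa,L)\ne(0,0)$; otherwise $s=d-4$ if $E\neq0$ and $s=\frac{d-4}2$ if $E=0$. The angular coordinates are $C^1$ functions of $\lambda$ across the throat. The coordinate $t$ is a $C^1$ function of $x$ across the throat, except possibly if $\delta_1=\delta_d$ and $\delta_2=a_d\delta_d(2d-4)^{-\frac{d-3}{d-2}}$. In every case, for a suitable choice of sign, there is a $C^1$ function $v$ of $x$ on $(-\eta,\eta)$ with $dv=dt\pm dx/A$ for $x\neq0$. -/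

import Mathlib

open Filter Topology Set

noncomputable section

namespace EiBI

section Chart

variable {ι : Type} [Fintype ι] [DecidableEq ι]

/-- The partial derivative `∂f/∂x^μ` of a function on a coordinate chart `ι → ℝ`. -/
def pd (μ : ι) (f : (ι → ℝ) → ℝ) (p : ι → ℝ) : ℝ :=
  deriv (fun s => f (Function.update p μ s)) (p μ)

/-- The Levi-Civita connection `Γ^α_{μν}` of a metric given by its components in a chart. -/
def christoffel (g : (ι → ℝ) → Matrix ι ι ℝ) (p : ι → ℝ) (α μ ν : ι) : ℝ :=
  (1 / 2) * ∑ β, (g p)⁻¹ α β *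
    (pd μ (fun x => g x β ν) p + pd ν (fun x => g x β μ) p - pd β (fun x => g x μ ν) p)

/-- The curvature `R^α_{βμν}` of a connection `Γ`, in a chart. -/
def riemann (Γ : (ι → ℝ) → ι → ι → ι → ℝ) (p : ι → ℝ) (α β μ ν : ι) : ℝ :=
  pd μ (fun x => Γ x α ν β) p - pd ν (fun x => Γ x α μ β) p
    + ∑ σ, (Γ p α μ σ * Γ p σ ν β - Γ p α ν σ * Γ p σ μ β)

/-- The Ricci tensor `R_{βν} = R^α_{βαν}` of a connection. -/
def ricci (Γ : (ι → ℝ) → ι → ι → ι → ℝ) (p : ι → ℝ) (β ν : ι) : ℝ :=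
  ∑ α, riemann Γ p α β α ν

/-- The Kretschmann scalar `R^α_{βμν} R_α^{βμν}` of (the Levi-Civita connection of) `g`. -/
def kretschmann (g : (ι → ℝ) → Matrix ι ι ℝ) (p : ι → ℝ) : ℝ :=
  ∑ α, ∑ α', ∑ β, ∑ β', ∑ μ, ∑ μ', ∑ ν, ∑ ν',
    g p α α' * (g p)⁻¹ β β' * (g p)⁻¹ μ μ' * (g p)⁻¹ ν ν' *
      riemann (christoffel g) p α β μ ν * riemann (christoffel g) p α' β' μ' ν'

/-- The auxiliary tensor `q_{μν} = g_{μν} + ε R_{μν}(Γ)`. -/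
def auxiliary (ε : ℝ) (g : (ι → ℝ) → Matrix ι ι ℝ) (Γ : (ι → ℝ) → ι → ι → ι → ℝ)
    (p : ι → ℝ) : Matrix ι ι ℝ :=
  g p + ε • Matrix.of (ricci Γ p)

/-- The contravariant energy-momentum tensor `T^{μν}` of the electromagnetic field `F^{μν}`, obtained
by raising the first index of
`T_μ^ν = -(l_P^{d-4} / 4π) (F_μ^α F_α^ν - (1/4) F_α^β F_β^α δ_μ^ν)`. -/
def emStress (d : ℕ) (lP : ℝ) (g F : (ι → ℝ) → Matrix ι ι ℝ) (p : ι → ℝ) : Matrix ι ι ℝ :=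
  (g p)⁻¹ * ((-(lP ^ (d - 4) / (4 * Real.pi))) •
    ((g p * F p) * (g p * F p)
      - ((1 / 4) * ((g p * F p) * (g p * F p)).trace) • (1 : Matrix ι ι ℝ)))

/-- The field equations, at the point `p` of a chart, of `d`-dimensional Eddington-inspired
Born-Infeld gravity with parameters `ε`, `lam`, coupled to a source-free electromagnetic field with
contravariant components `F^{μν}`. The metric `g` and the symmetric connection `Γ` are independent. -/
structure IsSolutionAt (d : ℕ) (ε lam lP : ℝ) (g : (ι → ℝ) → Matrix ι ι ℝ)
    (Γ : (ι → ℝ) → ι → ι → ι → ℝ) (F : (ι → ℝ) → Matrix ι ι ℝ) (p : ι → ℝ) : Prop where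
  metric_symm : (g p).IsSymm
  metric_det : (g p).det < 0
  aux_symm : (auxiliary ε g Γ p).IsSymm
  aux_det : (auxiliary ε g Γ p).det < 0
  connection_symm : ∀ α μ ν, Γ p α μ ν = Γ p α ν μ
  /-- Variation of the metric. -/
  metric_eq :
    √(-(auxiliary ε g Γ p).det) • (auxiliary ε g Γ p)⁻¹ - (lam * √(-(g p).det)) • (g p)⁻¹
      = (-(8 * Real.pi * lP ^ (d - 2) * ε * √(-(g p).det))) • emStress d lP g F p
  /-- Variation of the connection: the covariant derivative with respect to `Γ` of the tensor density
  `√(-q) (q⁻¹)^{μν}` vanishes. -/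
  connection_eq : ∀ κ μ ν,
    let W : (ι → ℝ) → Matrix ι ι ℝ := fun x =>
      √(-(auxiliary ε g Γ x).det) • (auxiliary ε g Γ x)⁻¹
    pd κ (fun x => W x μ ν) p + ∑ σ, Γ p μ κ σ * W p σ ν + ∑ σ, Γ p ν κ σ * W p μ σ
      - (∑ σ, Γ p σ κ σ) * W p μ ν = 0
  field_antisymm : ∀ μ ν, F p μ ν = -F p ν μ
  /-- `∇_μ F^{μν} = 0`. -/
  maxwell : ∀ ν, ∑ μ, pd μ (fun x => √(-(g x).det) * F x μ ν) p = 0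
  /-- `dF = 0`. -/
  bianchi : ∀ α β γ,
    pd α (fun x => (g x * F x * (g x).transpose) β γ) p
      + pd β (fun x => (g x * F x * (g x).transpose) γ α) p
      + pd γ (fun x => (g x * F x * (g x).transpose) α β) p = 0

/-- `γ` is an affinely parametrized geodesic of `g` on the (open) set `I` of parameters. -/
def IsGeodesicOn (g : (ι → ℝ) → Matrix ι ι ℝ) (γ : ℝ → ι → ℝ) (I : Set ℝ) : Prop :=
  ∀ s ∈ I, DifferentiableAt ℝ γ s ∧
    HasDerivAt (deriv γ)
      (fun μ => -∑ α, ∑ β, christoffel g (γ s) μ α β * deriv γ s α * deriv γ s β) s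

end Chart

section Spherical

variable (d : ℕ)

/-- Index set of the chart `(t, x, y_1, …, y_{d-2})` on `ℝ × ℝ × S^{d-2}`; the `y_i` are
stereographic coordinates of the unit sphere. -/
abbrev Idx := Fin 2 ⊕ Fin (d - 2)

variable {d}

/-- The index of the coordinate `t`. -/
def iT : Idx d := Sum.inl 0

/-- The index of the coordinate `x`. -/
def iX : Idx d := Sum.inl 1

/-- The factor `2 / (1 + |y|²)`: the unit round metric on the sphere is its square times `|dy|²`. -/
def sphereFactor (p : Idx d → ℝ) : ℝ := 2 / (1 + ∑ i, p (Sum.inr i) ^ 2)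

/-- The static spherically symmetric metric `a(x) dt² + b(x) dx² + r(x)² dΩ²`. -/
def ssMetric (a b r : ℝ → ℝ) (p : Idx d → ℝ) : Matrix (Idx d) (Idx d) ℝ :=
  Matrix.diagonal (Sum.elim ![a (p iX), b (p iX)] (fun _ => r (p iX) ^ 2 * sphereFactor p ^ 2))

/-- The radial electric field of charge `Q` in the metric `a(x) dt² + b(x) dx² + r(x)² dΩ²`:
`F^{tx} = -F^{xt} = Q / (r^{d-2} √(-a b))`. -/
def coulombField (Q : ℝ) (a b r : ℝ → ℝ) (p : Idx d → ℝ) : Matrix (Idx d) (Idx d) ℝ :=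
  Matrix.fromBlocks
    !![0, Q / (r (p iX) ^ (d - 2) * √(-(a (p iX) * b (p iX))));
      -(Q / (r (p iX) ^ (d - 2) * √(-(a (p iX) * b (p iX))))), 0] 0 0 0

end Spherical

/-- The data of a charged solution: dimension, Born-Infeld parameter, Planck length, charge, and the
mass integration constant. -/
structure Params where
  d : ℕ
  ε : ℝ
  lP : ℝ
  Q : ℝ
  M₀ : ℝ

/-- The function `G_d`. -/
def G (d : ℕ) (z : ℝ) : ℝ :=
  -((z ^ (d - 3))⁻¹ / ((d : ℝ) - 3)) *
      ₂F₁ (1 / ((d : ℝ) - 2)) (((d : ℝ) - 3) / (2 * d - 4)) ((3 * (d : ℝ) - 7) / (2 * d - 4))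
        (z ^ (2 * d - 4))⁻¹
    + z ^ (d - 1) / ((d : ℝ) - 1) *
      ₂F₁ (1 / ((d : ℝ) - 2)) (-((d : ℝ) - 1) / (2 * d - 4)) (((d : ℝ) - 3) / (2 * d - 4))
        (z ^ (2 * d - 4))⁻¹
    - z ^ (d - 1) / ((d : ℝ) - 1) *
      (1 - (z ^ (2 * d - 4))⁻¹) ^ (((d : ℝ) - 1) / ((d : ℝ) - 2))

/-- The critical value `δ_d` of `δ_1`. In dimension `5` the term `1 / Γ(0)` is read as `0`, which is
what `Real.Gamma 0 = 0` and division by zero give. -/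
def deltaCrit (d : ℕ) : ℝ :=
  (-(Real.pi / Real.sin (Real.pi / ((d : ℝ) - 2))) /
      (((d : ℝ) - 1) * Real.Gamma (1 / ((d : ℝ) - 2))) *
    (Real.Gamma (((d : ℝ) - 3) / (2 * d - 4)) / Real.Gamma (((d : ℝ) - 5) / (2 * d - 4))
      - ((d : ℝ) - 1) / ((d : ℝ) - 3) *
        (Real.Gamma ((3 * (d : ℝ) - 7) / (2 * d - 4)) /
          Real.Gamma (3 * ((d : ℝ) - 3) / (2 * d - 4)))))⁻¹

/-- The coefficient `a_d` of `(z - 1)^{(d-3)/(d-2)}` in the expansion of `G_d` at `z = 1`. -/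
def aCoeff (d : ℕ) : ℝ :=
  Real.pi / Real.sin (Real.pi / ((d : ℝ) - 2)) *
    2 ^ (((d : ℝ) - 3) / ((d : ℝ) - 2)) * ((d : ℝ) - 2) ^ (-(1 / ((d : ℝ) - 2))) /
    (Real.Gamma (1 / ((d : ℝ) - 2)) * Real.Gamma ((2 * (d : ℝ) - 5) / ((d : ℝ) - 2)))

namespace Params

variable (P : Params)

/-- The length `l_ε`, with `ε = -l_ε²`. -/
def lε : ℝ := √(-P.ε)

/-- The throat radius: `r_c^{2d-4} = Q² l_P^{2d-6} l_ε²`. -/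
def rc : ℝ := (P.Q ^ 2 * P.lP ^ (2 * P.d - 6) * P.lε ^ 2) ^ (1 / (2 * (P.d : ℝ) - 4))

/-- The area radius: `r^{d-2} = (|x|^{d-2} + √(x^{2(d-2)} + 4 r_c^{2(d-2)})) / 2`. -/
def r (x : ℝ) : ℝ :=
  ((|x| ^ (P.d - 2) + √(x ^ (2 * (P.d - 2)) + 4 * P.rc ^ (2 * (P.d - 2)))) / 2)
    ^ (1 / ((P.d : ℝ) - 2))

/-- `z = r / r_c`. -/
def z (x : ℝ) : ℝ := P.r x / P.rc

/-- `Ω_(2) = (1 + z^{-(2d-4)}) / (1 - z^{-(2d-4)})^{(d-4)/(d-2)}`. -/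
def Ω₂ (x : ℝ) : ℝ :=
  (1 + (P.z x ^ (2 * P.d - 4))⁻¹) /
    (1 - (P.z x ^ (2 * P.d - 4))⁻¹) ^ (((P.d : ℝ) - 4) / ((P.d : ℝ) - 2))

/-- `Ω_(n) = (1 - z^{-(2d-4)})^{2/(d-2)}`. -/
def Ωₙ (x : ℝ) : ℝ := (1 - (P.z x ^ (2 * P.d - 4))⁻¹) ^ (2 / ((P.d : ℝ) - 2))

/-- The mass function. For `M₀ ≠ 0` it is `M₀ (1 + δ₁ G_d(z))`. -/
def mass (x : ℝ) : ℝ :=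
  P.M₀ + ((P.d : ℝ) - 3) * P.rc ^ (P.d - 1) / (2 * P.lε ^ 2) * G P.d (P.z x)

/-- The metric function `A`, an even function of `x`. -/
def A (x : ℝ) : ℝ := 1 - 2 * P.mass x / (((P.d : ℝ) - 3) * |x| ^ (P.d - 3))

/-- `δ₁`; for `M₀ = 0` it takes the value `0`. -/
def δ₁ : ℝ := ((P.d : ℝ) - 3) * P.rc ^ (P.d - 1) / (2 * P.M₀ * P.lε ^ 2)

/-- `δ₂`; for `M₀ = 0` it takes the value `0`. -/
def δ₂ : ℝ := ((P.d : ℝ) - 3) * P.rc ^ (P.d - 3) / (2 * P.M₀)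

/-- `g_tt`. -/
def gtt (x : ℝ) : ℝ := -(P.A x / P.Ω₂ x)

/-- `g_xx`. -/
def gxx (x : ℝ) : ℝ := 1 / (P.A x * P.Ω₂ x)

/-- The space-time metric `-(A/Ω_(2)) dt² + dx²/(A Ω_(2)) + r(x)² dΩ²`. -/
def metric : (Idx P.d → ℝ) → Matrix (Idx P.d) (Idx P.d) ℝ := ssMetric P.gtt P.gxx P.r

/-- The auxiliary metric `-A dt² + dx²/A + x² dΩ²`. -/
def auxMetric : (Idx P.d → ℝ) → Matrix (Idx P.d) (Idx P.d) ℝ :=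
  ssMetric (fun x => -P.A x) (fun x => 1 / P.A x) (fun x => x)

/-- The electromagnetic field `F^{μν}`. -/
def field : (Idx P.d → ℝ) → Matrix (Idx P.d) (Idx P.d) ℝ :=
  coulombField P.Q P.gtt P.gxx P.r

/-- The part of the chart off the throat `x = 0` and off the horizons `A = 0`. -/
def domain : Set (Idx P.d → ℝ) := {p | p iX ≠ 0 ∧ P.A (p iX) ≠ 0}

/-- The throat `x = 0` is time-like. (For `M₀ < 0` and for `M₀ = 0` this is always so.) -/
def TimelikeThroat : Prop := P.M₀ ≤ 0 ∨ deltaCrit P.d < P.δ₁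

/-- The throat `x = 0` is space-like. -/
def SpacelikeThroat : Prop := 0 < P.M₀ ∧ P.δ₁ < deltaCrit P.d

/-- The throat `x = 0` is null. -/
def NullThroat : Prop := P.δ₁ = deltaCrit P.d

/-- The exceptional null case, in which `A` vanishes at the throat. -/
def Exceptional : Prop :=
  P.NullThroat ∧
    P.δ₂ = aCoeff P.d * deltaCrit P.d *
      (2 * (P.d : ℝ) - 4) ^ (-(((P.d : ℝ) - 3) / ((P.d : ℝ) - 2)))

open Classical in
/-- The exponent `k` in the divergence `1 / |x|^k` of the Kretschmann scalar at the throat. -/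
def kretschmannExponent : ℕ :=
  if P.Exceptional then 2 * P.d - 8 else if P.NullThroat then 2 * P.d - 4 else 4 * P.d - 10

/-- The energy `E = (A/Ω_(2)) dt/dλ`. -/
def energy (γ : ℝ → Idx P.d → ℝ) (s : ℝ) : ℝ :=
  P.A (γ s iX) / P.Ω₂ (γ s iX) * deriv γ s iT

/-- The angular momentum `L = r² |dω/dλ|`, with `|dω/dλ|` the speed on the unit sphere. -/
def angularMomentum (γ : ℝ → Idx P.d → ℝ) (s : ℝ) : ℝ :=
  P.r (γ s iX) ^ 2 * (sphereFactor (γ s) * √(∑ i, deriv γ s (Sum.inr i) ^ 2))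

/-- `κ = -g(γ', γ')`, positive for time-like and zero for null geodesics. -/
def normSq (γ : ℝ → Idx P.d → ℝ) (s : ℝ) : ℝ :=
  -∑ μ, ∑ ν, P.metric (γ s) μ ν * deriv γ s μ * deriv γ s ν

/-- `γ` is a geodesic of the space-time metric on `I`, in the domain of the chart, with conserved
quantities `E`, `L`, `κ`. -/
structure IsGeodesicWith (γ : ℝ → Idx P.d → ℝ) (I : Set ℝ) (E L κ : ℝ) : Prop where
  mem_domain : ∀ s ∈ I, γ s ∈ P.domain
  geodesic : IsGeodesicOn P.metric γ I
  energy_eq : ∀ s ∈ I, P.energy γ s = E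
  angularMomentum_eq : ∀ s ∈ I, P.angularMomentum γ s = L
  normSq_eq : ∀ s ∈ I, P.normSq γ s = κ

/-- The geodesic `γ`, defined on the interval `I`, cannot be continued in the domain of the chart to
parameters beyond all those in `I`. -/
def FutureInextendible (γ : ℝ → Idx P.d → ℝ) (I : Set ℝ) : Prop :=
  ∀ (γ' : ℝ → Idx P.d → ℝ) (I' : Set ℝ), IsOpen I' → I'.OrdConnected → I ⊆ I' →
    (∀ s ∈ I', γ' s ∈ P.domain) → IsGeodesicOn P.metric γ' I' → EqOn γ' γ I →
    ∀ s' ∈ I', ∃ s ∈ I, s' ≤ s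

open Classical in
/-- The exponent `q` in the behaviour `λ - λ₀ ≈ C x |x|^q` of the affine parameter at the throat. -/
def throatExponent (E L κ : ℝ) : ℝ :=
  if P.SpacelikeThroat ∧ (κ ≠ 0 ∨ L ≠ 0) then (P.d : ℝ) - 7 / 2
  else if E ≠ 0 then (P.d : ℝ) - 4
  else ((P.d : ℝ) - 4) / 2

/-- The geodesic `γ` on `I` crosses the throat `x = 0` at the value `s₀` of its affine parameter: it
coincides near `s₀` with a curve `c` which runs from one side of the throat to the other, which is a
geodesic with the same `E`, `L`, `κ` on both sides, and along which the affine parameter is a strictly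
monotone continuously differentiable function `lam` of `x`, also at `x = 0`. -/
def CrossesThroat (γ : ℝ → Idx P.d → ℝ) (I : Set ℝ) (E L κ s₀ : ℝ) : Prop :=
  ∃ δ > 0, ∃ (lam : ℝ → ℝ) (c : ℝ → Idx P.d → ℝ),
    lam 0 = s₀ ∧
    ContDiffOn ℝ 1 lam (Ioo (-δ) δ) ∧
    (StrictMonoOn lam (Ioo (-δ) δ) ∨ StrictAntiOn lam (Ioo (-δ) δ)) ∧
    (∃ C : ℝ, C ≠ 0 ∧
      Tendsto (fun x => (lam x - s₀) / (x * |x| ^ P.throatExponent E L κ)) (𝓝[≠] 0) (𝓝 C)) ∧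
    (∀ x ∈ Ioo (-δ) δ, c (lam x) iX = x) ∧
    P.IsGeodesicWith c (lam '' (Ioo (-δ) δ \ {0})) E L κ ∧
    EqOn c γ (I ∩ lam '' Ioo (-δ) δ) ∧
    -- the angular coordinates are continuously differentiable across the throat
    (∀ i, ContDiffOn ℝ 1 (fun s => c s (Sum.inr i)) (lam '' Ioo (-δ) δ)) ∧
    -- so is `t`, as a function of `x`, unless `A` vanishes at the throat
    (¬ P.Exceptional → ContDiffOn ℝ 1 (fun x => c (lam x) iT) (Ioo (-δ) δ)) ∧
    -- and, in every case, a null time `v` with `dv = dt ± dx / A`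
    (∃ σ : ℝ, (σ = 1 ∨ σ = -1) ∧ ∃ v : ℝ → ℝ, ContDiffOn ℝ 1 v (Ioo (-δ) δ) ∧
      ∀ x ∈ Ioo (-δ) δ \ {0},
        HasDerivAt (fun y => c (lam y) iT) (deriv v x - σ / P.A x) x)

end Params

end EiBI

end

/-!
Throughout, `n = d - 2`. The functions of the solution become manageable in terms of
`w = (r_c / r)^{2n}` and of `D = 1 / Ω_(2)`. The definition of the area radius is the algebraic equation
`|x|^n = r^n (1 - w)`, which gives `D = r r' / x` and the continuity of `D` across the throat, where it
vanishes as `|x|^{n-2}` (`abs_pow`, `hasDerivAt_r`, `tendsto_D_div`).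

*The solution.* All tensors are diagonal in the chart, and the curvature of
`a dt² + b dx² + r² dΩ²` is diagonal on coordinate planes (`ProfileAt.riemann_eq`). For a Coulomb field the
metric equation therefore consists of three scalar algebraic equations (`metric_equation_iff`), which can be
solved for the space-time metric in terms of the auxiliary one (`eq_of_metric_equation`); the equation for
the density `√(-q) q⁻¹` holds because the connection is the Levi-Civita connection of `q`
(`density_parallel`). What remains is `g + ε R = q`. For `q = -B dt² + dx²/B + ρ² dΩ²` it forces `ρ'' = 0`,
and then becomes the linear equation `x A' = (n - 1) (1 - A) - (r² - x²) / l_ε²` along `ρ`, in which the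
mass `M₀` is the constant of integration (`auxiliary_eq`, `general_solution`). The function in the statement
solves this equation since `G_d` is, up to an elementary term, the incomplete beta function
`w^b ₂F₁(a, b; b + 1; w)` with `a = 1/n`, `b = (n-1)/(2n)` (`G_eq`, `G_hasDerivAt`).

*The throat.* For `n ≥ 3` the value of `G_d` at `z = 1` is a complete beta function, equal to `-1/δ_d`
(`tendsto_G`, `deltaCrit_inv`). With `M_*` the value of the mass function at the throat (`massThroat`),
`A = A₀ - 2 M_* / ((n-1) |x|^{n-1}) + x² / ((n+1) l_ε²) + o(x²)` (`tendsto_A_expansion`). The sign of `M_*`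
decides whether the throat is time-like, null or space-like, and the exceptional case is that of
`M_* = A₀ = 0` (`exceptional_iff`). So `A` behaves as `|x|^{n-e}` with `e = 2n - 1`, `n` or `n - 2`, and this
may be differentiated twice (`ThroatRate`). The Kretschmann scalar is a sum of squares of sectional
curvatures, of which that of the `(t, x)` plane dominates and behaves as `|x|^{-e}`
(`exists_tendsto_kretschmann`).

*Geodesics.* The conserved quantities reduce the motion to `(D x')² = radial(x)`, where `radial` is
`E² - A D (κ + L²/r²)` (`first_integral`). Near the throat the sign and the size of `radial` follow from
the expansion of `A`: either it is negative, and the geodesic is repelled, or the geodesic is at rest, or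
`dλ/dx = ± D/√radial` behaves as a positive power of `|x|` (`radial_cases`). Inside the horizon of a
space-like throat, `A` remains negative down to the throat and the radial speed is bounded below, so that
the geodesic gets there if nothing else stops it (`A_neg_of_le`, `reaches_throat_inside_horizon`).

For the crossing, `λ` as a function of `x`, and the null time `v`, are quadratures whose integrands extend
continuously to `x = 0`; with respect to the time `∫ dλ / r²` the angular motion is that along a great
circle, an equation without any singularity at the throat (`hasDerivAt_angular`, `exists_ode_extension`).
Conversely, a curve with these first integrals is a geodesic wherever `x' ≠ 0`
(`isGeodesicWith_of_first_integrals`). Together they continue the geodesic to the other side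
(`exists_isContinuation`, `crossesThroat`). The same continuation, at a point off the throat, shows that
a geodesic does not end there.
-/

set_option linter.unusedSectionVars false

open Filter Topology Set

noncomputable section

/-! ### Christoffel symbols in a chart and the connection of spherically symmetric metrics -/

namespace EiBI
section Chart

variable {ι : Type} [Fintype ι] [DecidableEq ι]

theorem inv_diagonal_of_ne_zero {v : ι → ℝ} (hv : ∀ i, v i ≠ 0) :
    (Matrix.diagonal v)⁻¹ = Matrix.diagonal fun i => (v i)⁻¹ := by
  refine Matrix.inv_eq_left_inv ?_
  rw [Matrix.diagonal_mul_diagonal, ← Matrix.diagonal_one]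
  congr 1
  funext i
  exact inv_mul_cancel₀ (hv i)

theorem pd_eq_of_hasDerivAt {μ : ι} {f : (ι → ℝ) → ℝ} {p : ι → ℝ} {f' : ℝ}
    (h : HasDerivAt (fun s => f (Function.update p μ s)) f' (p μ)) : pd μ f p = f' :=
  h.deriv

theorem tendsto_update_nhds (p : ι → ℝ) (μ : ι) :
    Tendsto (fun s => Function.update p μ s) (𝓝 (p μ)) (𝓝 p) := by
  have h : Continuous fun s => Function.update p μ s := by fun_prop
  simpa using h.tendsto (p μ)

theorem pd_congr {μ : ι} {f g : (ι → ℝ) → ℝ} {p : ι → ℝ} (h : f =ᶠ[𝓝 p] g) :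
    pd μ f p = pd μ g p :=
  Filter.EventuallyEq.deriv_eq ((tendsto_update_nhds p μ).eventually h)

@[simp]
theorem pd_const (μ : ι) (c : ℝ) (p : ι → ℝ) : pd μ (fun _ => c) p = 0 := by simp [pd]

theorem pd_neg (μ : ι) (f : (ι → ℝ) → ℝ) (p : ι → ℝ) :
    pd μ (fun x => -f x) p = -pd μ f p := by
  simp [pd, deriv.fun_neg]

/-- The Christoffel symbols of a diagonal metric. -/
theorem christoffel_diagonal (H : (ι → ℝ) → ι → ℝ) (p : ι → ℝ) (hH : ∀ i, H p i ≠ 0) (α μ ν : ι) :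
    christoffel (fun x => Matrix.diagonal (H x)) p α μ ν =
      (1 / 2) * (H p α)⁻¹ * ((if α = ν then pd μ (fun x => H x α) p else 0)
        + (if α = μ then pd ν (fun x => H x α) p else 0)
        - (if μ = ν then pd α (fun x => H x μ) p else 0)) := by
  have key : ∀ κ β γ, pd κ (fun x => Matrix.diagonal (H x) β γ) p
      = if β = γ then pd κ (fun x => H x β) p else 0 := by
    intro κ β γ
    by_cases h : β = γ
    · subst h; simp
    · simp [h]
  unfold christoffel
  rw [inv_diagonal_of_ne_zero hH, Finset.sum_eq_single α]
  · rw [Matrix.diagonal_apply_eq, key, key, key]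
    ring
  · intro b _ hb
    rw [Matrix.diagonal_apply_ne' _ hb, zero_mul]
  · simp

end Chart

section Spherical

variable {d : ℕ}

theorem sum_idx (f : Idx d → ℝ) : ∑ μ, f μ = f iT + f iX + ∑ i, f (Sum.inr i) := by
  rw [Fintype.sum_sum_type, Fin.sum_univ_two]; rfl

theorem prod_idx (f : Idx d → ℝ) : ∏ μ, f μ = f iT * f iX * ∏ i, f (Sum.inr i) := by
  rw [Fintype.prod_sum_type, Fin.prod_univ_two]; rfl

theorem forall_idx {C : Idx d → Prop} (hT : C iT) (hX : C iX) (hy : ∀ i, C (Sum.inr i)) :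
    ∀ μ, C μ := by
  rintro (i | i)
  · fin_cases i
    · exact hT
    · exact hX
  · exact hy i

@[simp] theorem iT_ne_iX : (iT : Idx d) ≠ iX := by simp [iT, iX]
@[simp] theorem iX_ne_iT : (iX : Idx d) ≠ iT := by simp [iT, iX]
@[simp] theorem iT_ne_inr (i : Fin (d - 2)) : (iT : Idx d) ≠ Sum.inr i := by simp [iT]
@[simp] theorem iX_ne_inr (i : Fin (d - 2)) : (iX : Idx d) ≠ Sum.inr i := by simp [iX]
@[simp] theorem inr_ne_iT (i : Fin (d - 2)) : (Sum.inr i : Idx d) ≠ iT := by simp [iT]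
@[simp] theorem inr_ne_iX (i : Fin (d - 2)) : (Sum.inr i : Idx d) ≠ iX := by simp [iX]

theorem sphereFactor_pos (p : Idx d → ℝ) : 0 < sphereFactor p := by
  unfold sphereFactor
  positivity

theorem sphereFactor_mul (p : Idx d → ℝ) :
    sphereFactor p * (1 + ∑ i, p (Sum.inr i) ^ 2) = 2 := by
  unfold sphereFactor
  exact div_mul_cancel₀ _ (by positivity)

@[simp]
theorem sphereFactor_update_iT (p : Idx d → ℝ) (s : ℝ) :
    sphereFactor (Function.update p iT s) = sphereFactor p := by
  simp [sphereFactor]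

@[simp]
theorem sphereFactor_update_iX (p : Idx d → ℝ) (s : ℝ) :
    sphereFactor (Function.update p iX s) = sphereFactor p := by
  simp [sphereFactor]

theorem hasDerivAt_sphereFactor_update (p : Idx d → ℝ) (j : Fin (d - 2)) :
    HasDerivAt (fun s => sphereFactor (Function.update p (Sum.inr j) s))
      (-(sphereFactor p ^ 2 * p (Sum.inr j))) (p (Sum.inr j)) := by
  have h1 : HasDerivAt (fun s : ℝ => ∑ i, Function.update p (Sum.inr j) s (Sum.inr i) ^ 2)
      (∑ i, if i = j then 2 * p (Sum.inr j) else 0) (p (Sum.inr j)) := by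
    refine HasDerivAt.fun_sum fun i _ => ?_
    by_cases h : i = j
    · subst h
      simpa using hasDerivAt_pow 2 (p (Sum.inr i))
    · simpa [Function.update_of_ne, h] using hasDerivAt_const (p (Sum.inr j)) (p (Sum.inr i) ^ 2)
  rw [Finset.sum_ite_eq' Finset.univ j] at h1
  simp only [Finset.mem_univ, if_true] at h1
  have h0 : (1 + ∑ i, p (Sum.inr i) ^ 2 : ℝ) ≠ 0 := by positivity
  have h2 := ((hasDerivAt_const (p (Sum.inr j)) (2 : ℝ)).fun_div (h1.const_add 1)
    (by rw [Function.update_eq_self]; exact h0))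
  refine h2.congr_deriv ?_
  simp only [Function.update_eq_self, sphereFactor]
  field_simp
  ring

/-- The diagonal entries of `ssMetric`. -/
def ssDiag (a b r : ℝ → ℝ) (p : Idx d → ℝ) : Idx d → ℝ :=
  Sum.elim ![a (p iX), b (p iX)] (fun _ => r (p iX) ^ 2 * sphereFactor p ^ 2)

theorem ssMetric_eq (a b r : ℝ → ℝ) :
    (ssMetric a b r : (Idx d → ℝ) → _) = fun p => Matrix.diagonal (ssDiag a b r p) := rfl

@[simp] theorem ssDiag_iT (a b r : ℝ → ℝ) (p : Idx d → ℝ) : ssDiag a b r p iT = a (p iX) := rfl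
@[simp] theorem ssDiag_iX (a b r : ℝ → ℝ) (p : Idx d → ℝ) : ssDiag a b r p iX = b (p iX) := rfl
@[simp] theorem ssDiag_inr (a b r : ℝ → ℝ) (p : Idx d → ℝ) (i : Fin (d - 2)) :
    ssDiag a b r p (Sum.inr i) = r (p iX) ^ 2 * sphereFactor p ^ 2 := rfl

/-- The connection with `Γ^t_{tx} = u`, `Γ^x_{tt} = k`, `Γ^x_{xx} = h`, `Γ^x_{ij} = c σ² δ_{ij}`,
`Γ^i_{xj} = e δ_{ij}` (functions of `x`, with `σ` the conformal factor of the sphere) and with the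
connection of the round sphere in the remaining directions. -/
def ssConn (u k h c e : ℝ → ℝ) (p : Idx d → ℝ) : Idx d → Idx d → Idx d → ℝ
  | .inl 0, .inl 0, .inl 1 => u (p iX)
  | .inl 0, .inl 1, .inl 0 => u (p iX)
  | .inl 1, .inl 0, .inl 0 => k (p iX)
  | .inl 1, .inl 1, .inl 1 => h (p iX)
  | .inl 1, .inr i, .inr j => if i = j then c (p iX) * sphereFactor p ^ 2 else 0
  | .inr i, .inl 1, .inr j => if i = j then e (p iX) else 0
  | .inr i, .inr j, .inl 1 => if i = j then e (p iX) else 0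
  | .inr i, .inr j, .inr k => -(sphereFactor p * ((if i = j then p (.inr k) else 0)
      + (if i = k then p (.inr j) else 0) - (if j = k then p (.inr i) else 0)))
  | _, _, _ => 0

section
variable (u k h c e : ℝ → ℝ) (p : Idx d → ℝ) (i j l : Fin (d - 2))
@[simp] theorem ssConn_ttt : ssConn u k h c e p iT iT iT = 0 := rfl
@[simp] theorem ssConn_ttx : ssConn u k h c e p iT iT iX = u (p iX) := rfl
@[simp] theorem ssConn_tty : ssConn u k h c e p iT iT (.inr j) = 0 := rfl
@[simp] theorem ssConn_txt : ssConn u k h c e p iT iX iT = u (p iX) := rfl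
@[simp] theorem ssConn_txx : ssConn u k h c e p iT iX iX = 0 := rfl
@[simp] theorem ssConn_txy : ssConn u k h c e p iT iX (.inr j) = 0 := rfl
@[simp] theorem ssConn_tyt : ssConn u k h c e p iT (.inr i) iT = 0 := rfl
@[simp] theorem ssConn_tyx : ssConn u k h c e p iT (.inr i) iX = 0 := rfl
@[simp] theorem ssConn_tyy : ssConn u k h c e p iT (.inr i) (.inr j) = 0 := rfl
@[simp] theorem ssConn_xtt : ssConn u k h c e p iX iT iT = k (p iX) := rfl
@[simp] theorem ssConn_xtx : ssConn u k h c e p iX iT iX = 0 := rfl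
@[simp] theorem ssConn_xty : ssConn u k h c e p iX iT (.inr j) = 0 := rfl
@[simp] theorem ssConn_xxt : ssConn u k h c e p iX iX iT = 0 := rfl
@[simp] theorem ssConn_xxx : ssConn u k h c e p iX iX iX = h (p iX) := rfl
@[simp] theorem ssConn_xxy : ssConn u k h c e p iX iX (.inr j) = 0 := rfl
@[simp] theorem ssConn_xyt : ssConn u k h c e p iX (.inr i) iT = 0 := rfl
@[simp] theorem ssConn_xyx : ssConn u k h c e p iX (.inr i) iX = 0 := rfl
@[simp] theorem ssConn_xyy : ssConn u k h c e p iX (.inr i) (.inr j) =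
    if i = j then c (p iX) * sphereFactor p ^ 2 else 0 := rfl
@[simp] theorem ssConn_ytt : ssConn u k h c e p (.inr l) iT iT = 0 := rfl
@[simp] theorem ssConn_ytx : ssConn u k h c e p (.inr l) iT iX = 0 := rfl
@[simp] theorem ssConn_yty : ssConn u k h c e p (.inr l) iT (.inr j) = 0 := rfl
@[simp] theorem ssConn_yxt : ssConn u k h c e p (.inr l) iX iT = 0 := rfl
@[simp] theorem ssConn_yxx : ssConn u k h c e p (.inr l) iX iX = 0 := rfl
@[simp] theorem ssConn_yxy : ssConn u k h c e p (.inr l) iX (.inr j) =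
    if l = j then e (p iX) else 0 := rfl
@[simp] theorem ssConn_yyt : ssConn u k h c e p (.inr l) (.inr i) iT = 0 := rfl
@[simp] theorem ssConn_yyx : ssConn u k h c e p (.inr l) (.inr i) iX =
    if l = i then e (p iX) else 0 := rfl
@[simp] theorem ssConn_yyy : ssConn u k h c e p (.inr l) (.inr i) (.inr j) =
    -(sphereFactor p * ((if l = i then p (.inr j) else 0)
      + (if l = j then p (.inr i) else 0) - (if i = j then p (.inr l) else 0))) := rfl
end

theorem pd_iT_comp (φ : ℝ → ℝ) (p : Idx d → ℝ) : pd iT (fun x => φ (x iX)) p = 0 := by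
  simp [pd]

theorem pd_iX_comp (φ : ℝ → ℝ) (p : Idx d → ℝ) :
    pd iX (fun x => φ (x iX)) p = deriv φ (p iX) := by
  simp [pd]

theorem pd_inr_comp (φ : ℝ → ℝ) (p : Idx d → ℝ) (i : Fin (d - 2)) :
    pd (.inr i) (fun x => φ (x iX)) p = 0 := by
  simp [pd]

theorem pd_iT_mul_sphere (φ : ℝ → ℝ) (p : Idx d → ℝ) :
    pd iT (fun x => φ (x iX) * sphereFactor x ^ 2) p = 0 := by
  simp [pd]

theorem pd_iX_mul_sphere (φ : ℝ → ℝ) (p : Idx d → ℝ) :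
    pd iX (fun x => φ (x iX) * sphereFactor x ^ 2) p = deriv φ (p iX) * sphereFactor p ^ 2 := by
  simp [pd]

theorem pd_inr_mul_sphere (φ : ℝ → ℝ) (p : Idx d → ℝ) (i : Fin (d - 2)) :
    pd (.inr i) (fun x => φ (x iX) * sphereFactor x ^ 2) p
      = -2 * φ (p iX) * sphereFactor p ^ 3 * p (.inr i) := by
  have h := ((hasDerivAt_sphereFactor_update p i).fun_pow 2).const_mul (φ (p iX))
  have h2 : HasDerivAt (fun s => φ (Function.update p (.inr i) s iX)
      * sphereFactor (Function.update p (.inr i) s) ^ 2)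
      (-2 * φ (p iX) * sphereFactor p ^ 3 * p (.inr i)) (p (.inr i)) := by
    simp only [Function.update_of_ne (iX_ne_inr i)]
    refine h.congr_deriv ?_
    simp only [Function.update_eq_self]
    push_cast
    ring
  exact pd_eq_of_hasDerivAt h2

/-- The Levi-Civita connection of `a(x) dt² + b(x) dx² + r(x)² dΩ²`. -/
theorem christoffel_ssMetric {a b r : ℝ → ℝ} {p : Idx d → ℝ} {a' b' r' : ℝ}
    (ha : HasDerivAt a a' (p iX)) (hb : HasDerivAt b b' (p iX)) (hr : HasDerivAt r r' (p iX))
    (ha0 : a (p iX) ≠ 0) (hb0 : b (p iX) ≠ 0) (hr0 : r (p iX) ≠ 0) :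
    christoffel (ssMetric a b r) p =
      ssConn (fun _ => a' / (2 * a (p iX))) (fun _ => -(a' / (2 * b (p iX))))
        (fun _ => b' / (2 * b (p iX))) (fun _ => -(r (p iX) * r' / b (p iX)))
        (fun _ => r' / r (p iX)) p := by
  have hσ := (sphereFactor_pos p).ne'
  have hr2 : deriv (fun x => r x ^ 2) (p iX) = 2 * r (p iX) * r' := by
    simpa using (hr.fun_pow 2).deriv
  have hne : ∀ i, ssDiag a b r p i ≠ 0 := by
    refine forall_idx ha0 hb0 fun i => ?_
    simp [hr0, hσ]
  have e1 := fun μ => pd_inr_mul_sphere (fun x => r x ^ 2) p μ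
  have e2 := pd_iX_mul_sphere (fun x => r x ^ 2) p
  have e3 := pd_iT_mul_sphere (fun x => r x ^ 2) p
  simp only [hr2] at e1 e2 e3
  funext α μ ν
  rw [ssMetric_eq, christoffel_diagonal _ _ hne]
  revert α μ ν
  refine forall_idx (forall_idx (forall_idx ?_ ?_ ?_) (forall_idx ?_ ?_ ?_)
      fun i => (forall_idx ?_ ?_ ?_)) (forall_idx (forall_idx ?_ ?_ ?_) (forall_idx ?_ ?_ ?_)
      fun i => (forall_idx ?_ ?_ ?_)) fun l => (forall_idx (forall_idx ?_ ?_ ?_) (forall_idx ?_ ?_ ?_)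
      fun i => (forall_idx ?_ ?_ ?_)) <;> (try intro j) <;>
    simp only [ssDiag_iT, ssDiag_iX, ssDiag_inr, pd_iT_comp, pd_iX_comp, pd_inr_comp, e1, e2, e3,
      ha.deriv, hb.deriv, iT_ne_iX, iX_ne_iT, iT_ne_inr, iX_ne_inr, inr_ne_iT, inr_ne_iX,
      if_false, if_true, ssConn_ttt, ssConn_ttx, ssConn_tty, ssConn_txt, ssConn_txx, ssConn_txy,
      ssConn_tyt, ssConn_tyx, ssConn_tyy, ssConn_xtt, ssConn_xtx, ssConn_xty, ssConn_xxt,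
      ssConn_xxx, ssConn_xxy, ssConn_xyt, ssConn_xyx, ssConn_xyy, ssConn_ytt, ssConn_ytx,
      ssConn_yty, ssConn_yxt, ssConn_yxx, ssConn_yxy, ssConn_yyt, ssConn_yyx, ssConn_yyy,
      Sum.inr.injEq] <;>
    (try split_ifs) <;>
    first
    | ring1
    | (field_simp; done)
    | (field_simp; ring1)

end Spherical
end EiBI

/-! ### Curvature of static spherically symmetric metrics -/

namespace EiBI
section Spherical
variable {d : ℕ}

theorem pd_ite {ι : Type} [DecidableEq ι] (C : Prop) [Decidable C] (μ : ι) (f : (ι → ℝ) → ℝ)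
    (p : ι → ℝ) :
    pd μ (fun x => if C then f x else 0) p = if C then pd μ f p else 0 := by
  split_ifs <;> simp [pd]

theorem pd_iT_sphereConn (p : Idx d → ℝ) (l i j : Fin (d - 2)) :
    pd iT (fun x : Idx d → ℝ => -(sphereFactor x * ((if l = i then x (.inr j) else 0)
      + (if l = j then x (.inr i) else 0) - (if i = j then x (.inr l) else 0)))) p = 0 := by
  simp [pd]

theorem pd_iX_sphereConn (p : Idx d → ℝ) (l i j : Fin (d - 2)) :
    pd iX (fun x : Idx d → ℝ => -(sphereFactor x * ((if l = i then x (.inr j) else 0)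
      + (if l = j then x (.inr i) else 0) - (if i = j then x (.inr l) else 0)))) p = 0 := by
  simp [pd]

theorem hasDerivAt_update_inr (p : Idx d → ℝ) (m j : Fin (d - 2)) :
    HasDerivAt (fun s => Function.update p (Sum.inr m) s (Sum.inr j)) (if j = m then 1 else 0)
      (p (.inr m)) := by
  by_cases h : j = m
  · subst h
    simpa using hasDerivAt_id' (p (Sum.inr j))
  · simpa [Function.update_of_ne, h] using hasDerivAt_const (p (Sum.inr m)) (p (Sum.inr j))

theorem pd_inr_sphereConn (p : Idx d → ℝ) (m l i j : Fin (d - 2)) :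
    pd (.inr m) (fun x : Idx d → ℝ => -(sphereFactor x * ((if l = i then x (.inr j) else 0)
      + (if l = j then x (.inr i) else 0) - (if i = j then x (.inr l) else 0)))) p =
      sphereFactor p ^ 2 * p (.inr m) * ((if l = i then p (.inr j) else 0)
      + (if l = j then p (.inr i) else 0) - (if i = j then p (.inr l) else 0))
      - sphereFactor p * ((if l = i then if j = m then 1 else 0 else 0)
      + (if l = j then if i = m then 1 else 0 else 0)
      - (if i = j then if l = m then 1 else 0 else 0)) := by
  have hite : ∀ (C : Prop) [Decidable C] (k : Fin (d - 2)), HasDerivAt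
      (fun s => if C then Function.update p (Sum.inr m) s (Sum.inr k) else 0)
      (if C then if k = m then 1 else 0 else 0) (p (.inr m)) := by
    intro C _ k
    by_cases hC : C
    · simp only [hC, if_true]; exact hasDerivAt_update_inr p m k
    · simp only [hC, if_false]; exact hasDerivAt_const _ _
  have h := ((hasDerivAt_sphereFactor_update p m).fun_mul
    (((hite (l = i) j).fun_add (hite (l = j) i)).fun_sub (hite (i = j) l))).fun_neg
  refine pd_eq_of_hasDerivAt (h.congr_deriv ?_)
  simp only [Function.update_eq_self]
  ring

/-- The sectional curvatures of a spherically symmetric metric, as a function of the pair of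
coordinate directions: `s₁` for `(t, x)`, `s₂` for `(t, y_i)`, `s₃` for `(x, y_i)`, and `s₄` for
`(y_i, y_j)`. -/
def ssCurv (s₁ s₂ s₃ s₄ : ℝ) : Idx d → Idx d → ℝ
  | .inl _, .inl _ => s₁
  | .inl 0, .inr _ => s₂
  | .inr _, .inl 0 => s₂
  | .inl 1, .inr _ => s₃
  | .inr _, .inl 1 => s₃
  | .inr _, .inr _ => s₄

section
variable (s₁ s₂ s₃ s₄ : ℝ) (i j : Fin (d - 2))
@[simp] theorem ssCurv_tt : ssCurv s₁ s₂ s₃ s₄ (iT : Idx d) iT = s₁ := rfl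
@[simp] theorem ssCurv_tx : ssCurv s₁ s₂ s₃ s₄ (iT : Idx d) iX = s₁ := rfl
@[simp] theorem ssCurv_xt : ssCurv s₁ s₂ s₃ s₄ (iX : Idx d) iT = s₁ := rfl
@[simp] theorem ssCurv_xx : ssCurv s₁ s₂ s₃ s₄ (iX : Idx d) iX = s₁ := rfl
@[simp] theorem ssCurv_ty : ssCurv s₁ s₂ s₃ s₄ (iT : Idx d) (.inr i) = s₂ := rfl
@[simp] theorem ssCurv_yt : ssCurv s₁ s₂ s₃ s₄ (.inr i : Idx d) iT = s₂ := rfl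
@[simp] theorem ssCurv_xy : ssCurv s₁ s₂ s₃ s₄ (iX : Idx d) (.inr i) = s₃ := rfl
@[simp] theorem ssCurv_yx : ssCurv s₁ s₂ s₃ s₄ (.inr i : Idx d) iX = s₃ := rfl
@[simp] theorem ssCurv_yy : ssCurv s₁ s₂ s₃ s₄ (.inr i : Idx d) (.inr j) = s₄ := rfl
end

theorem riemann_congr {Γ Γ' : (Idx d → ℝ) → Idx d → Idx d → Idx d → ℝ} {p : Idx d → ℝ}
    (h : Γ =ᶠ[𝓝 p] Γ') (α β μ ν : Idx d) : riemann Γ p α β μ ν = riemann Γ' p α β μ ν := by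
  unfold riemann
  rw [pd_congr (h.mono fun x hx => congrFun (congrFun (congrFun hx α) ν) β),
    pd_congr (h.mono fun x hx => congrFun (congrFun (congrFun hx α) μ) β), h.eq_of_nhds]

/-- The Riemann tensor of a connection of the form `ssConn`, where `ρ` is the square of the area
radius and `G₁`, `G₂` are the coefficients of `dt²` and `dx²`. The hypotheses say of each component that
does not vanish identically that it is a sectional curvature `s₁`, …, `s₄` times a coefficient of the
metric; `h₁` and `h₁'`, for instance, belong to the two components in the `(t, x)` plane. -/
theorem riemann_ssConn {u k h c e : ℝ → ℝ} {p : Idx d → ℝ} {u' k' c' e' G₁ G₂ s₁ s₂ s₃ s₄ ρ : ℝ}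
    (hu : HasDerivAt u u' (p iX)) (hk : HasDerivAt k k' (p iX)) (hc : HasDerivAt c c' (p iX))
    (he : HasDerivAt e e' (p iX))
    (h₁ : -u' + u (p iX) * h (p iX) - u (p iX) ^ 2 = s₁ * G₂)
    (h₁' : k' + h (p iX) * k (p iX) - k (p iX) * u (p iX) = s₁ * G₁)
    (h₂ : u (p iX) * c (p iX) = s₂ * ρ) (h₂' : e (p iX) * k (p iX) = s₂ * G₁)
    (h₃ : c' + h (p iX) * c (p iX) - c (p iX) * e (p iX) = s₃ * ρ)
    (h₃' : -e' - e (p iX) ^ 2 + e (p iX) * h (p iX) = s₃ * G₂)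
    (h₄ : 1 + e (p iX) * c (p iX) = s₄ * ρ)
    (α β μ ν : Idx d) :
    riemann (ssConn u k h c e) p α β μ ν = ssCurv s₁ s₂ s₃ s₄ α β *
      ((if α = μ ∧ β = ν then
        (Sum.elim ![G₁, G₂] (fun _ => ρ * sphereFactor p ^ 2) β : ℝ) else 0)
      - (if α = ν ∧ β = μ then
        (Sum.elim ![G₁, G₂] (fun _ => ρ * sphereFactor p ^ 2) β : ℝ) else 0)) := by
  have hσ := sphereFactor_mul p
  have hT : (Sum.elim ![G₁, G₂] (fun _ => ρ * sphereFactor p ^ 2) (iT : Idx d) : ℝ) = G₁ := rfl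
  have hX : (Sum.elim ![G₁, G₂] (fun _ => ρ * sphereFactor p ^ 2) (iX : Idx d) : ℝ) = G₂ := rfl
  revert α β μ ν
  refine forall_idx ?_ ?_ fun i => ?_ <;> refine forall_idx ?_ ?_ fun j => ?_ <;>
    refine forall_idx ?_ ?_ fun l => ?_ <;> refine forall_idx ?_ ?_ fun m => ?_ <;>
    simp only [riemann, sum_idx, pd_ite, pd_const, pd_iT_comp, pd_iX_comp, pd_inr_comp,
      pd_iT_mul_sphere, pd_iX_mul_sphere, pd_inr_mul_sphere, pd_iT_sphereConn, pd_iX_sphereConn,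
      pd_inr_sphereConn, hu.deriv, hk.deriv, hc.deriv, he.deriv, iT_ne_iX, iX_ne_iT, iT_ne_inr,
      iX_ne_inr, inr_ne_iT, inr_ne_iX,
      ssConn_ttt, ssConn_ttx, ssConn_tty, ssConn_txt, ssConn_txx, ssConn_txy,
      ssConn_tyt, ssConn_tyx, ssConn_tyy, ssConn_xtt, ssConn_xtx, ssConn_xty, ssConn_xxt,
      ssConn_xxx, ssConn_xxy, ssConn_xyt, ssConn_xyx, ssConn_xyy, ssConn_ytt, ssConn_ytx,
      ssConn_yty, ssConn_yxt, ssConn_yxx, ssConn_yxy, ssConn_yyt, ssConn_yyx, ssConn_yyy,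
      ssCurv_tt, ssCurv_tx, ssCurv_xt, ssCurv_xx, ssCurv_ty, ssCurv_yt, ssCurv_xy, ssCurv_yx,
      ssCurv_yy, hT, hX, Sum.elim_inr,
      Sum.inr.injEq, if_false, if_true, mul_zero, zero_mul, sub_zero, zero_sub, add_zero, zero_add,
      Finset.sum_const_zero, and_self, and_false, false_and, and_true, true_and, sub_self, ite_self] <;>
    try first
    | ring1
    | linear_combination h₁
    | linear_combination -h₁
    | linear_combination h₁'
    | linear_combination -h₁'
  · rcases eq_or_ne j m with rfl | hjm
    · simp only [if_true]; linear_combination sphereFactor p ^ 2 * h₂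
    · simp [hjm, hjm.symm]
  · rcases eq_or_ne j l with rfl | hjm
    · simp only [if_true]; linear_combination -sphereFactor p ^ 2 * h₂
    · simp [hjm, hjm.symm]
  · rw [Finset.sum_sub_distrib]
    simp only [ite_mul, zero_mul, Finset.sum_ite_eq, Finset.mem_univ, if_true]
    split_ifs <;> (try subst_vars) <;> first | ring1 | (exfalso; simp_all)
  · rcases eq_or_ne j m with rfl | hjm
    · simp; linear_combination sphereFactor p ^ 2 * h₃
    · simp [hjm, hjm.symm]
  · rcases eq_or_ne j l with rfl | hjm
    · simp; linear_combination -sphereFactor p ^ 2 * h₃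
    · simp [hjm, hjm.symm]
  · simp only [ite_mul, zero_mul, Finset.sum_sub_distrib, Finset.sum_ite_eq, Finset.mem_univ,
      if_true]
    split_ifs <;> (try subst_vars) <;> first | ring1 | (exfalso; simp_all)
  · rcases eq_or_ne i m with rfl | hjm
    · simp only [if_true]; linear_combination -h₂'
    · simp [hjm]
  · rcases eq_or_ne i l with rfl | hjm
    · simp only [if_true]; linear_combination h₂'
    · simp [hjm]
  · rcases eq_or_ne i m with rfl | hjm
    · simp; linear_combination -h₃'
    · simp [hjm]
  · rcases eq_or_ne i l with rfl | hjm
    · simp; linear_combination h₃'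
    · simp [hjm]
  · simp only [mul_ite, mul_zero, Finset.sum_sub_distrib, Finset.sum_ite_eq', Finset.mem_univ,
      if_true]
    split_ifs <;> (try subst_vars) <;> first | ring1 | (exfalso; simp_all)
  · simp only [ite_mul, mul_ite, mul_zero, zero_mul, Finset.sum_sub_distrib, Finset.sum_ite_eq,
      Finset.sum_ite_eq', Finset.mem_univ, if_true]
    split_ifs <;> (try subst_vars) <;> ring1
  · simp only [ite_mul, mul_ite, mul_zero, zero_mul, Finset.sum_sub_distrib, Finset.sum_ite_eq,
      Finset.sum_ite_eq', Finset.mem_univ, if_true]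
    split_ifs <;> (try subst_vars) <;> ring1
  · have key : ∀ l m : Fin (d - 2), ∑ a, (-(sphereFactor p *
              (((if i = l then p (Sum.inr a) else 0) + if i = a then p (Sum.inr l) else 0) -
                if l = a then p (Sum.inr i) else 0)) *
          -(sphereFactor p *
              (((if a = m then p (Sum.inr j) else 0) + if a = j then p (Sum.inr m) else 0) -
                if m = j then p (Sum.inr a) else 0)))
        = sphereFactor p ^ 2 * ((if i = l then 2 * p (.inr m) * p (.inr j)
              - (if m = j then ∑ a, p (Sum.inr a) ^ 2 else 0) else 0)
            + p (.inr l) * ((if i = m then p (.inr j) else 0) + (if i = j then p (.inr m) else 0)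
              - (if m = j then p (.inr i) else 0))
            - p (.inr i) * ((if l = m then p (.inr j) else 0) + (if l = j then p (.inr m) else 0)
              - (if m = j then p (.inr l) else 0))) := by
      intro l m
      have hs : ∀ f g : Fin (d - 2) → ℝ, ∑ a, (-(sphereFactor p * f a) * -(sphereFactor p * g a))
          = sphereFactor p ^ 2 * ∑ a, f a * g a := by
        intro f g
        rw [Finset.mul_sum]
        exact Finset.sum_congr rfl fun a _ => by ring
      rw [hs]
      congr 1
      simp only [sub_mul, add_mul, Finset.sum_sub_distrib, Finset.sum_add_distrib]
      simp only [ite_mul, zero_mul, Finset.sum_ite_eq, Finset.mem_univ, if_true]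
      congr 2
      by_cases hil : i = l
      · simp only [hil, if_true, mul_sub, mul_add, mul_ite, mul_zero, Finset.sum_sub_distrib,
          Finset.sum_add_distrib, Finset.sum_ite_eq', Finset.mem_univ]
        by_cases hmj : m = j
        · simp only [hmj, if_true, pow_two]; ring
        · simp only [hmj, if_false, Finset.sum_const_zero]; ring
      · simp [hil]
    rw [Finset.sum_sub_distrib, key, key]
    generalize hY : ∑ a, p (Sum.inr a) ^ 2 = Y at hσ
    have h5 : sphereFactor p ^ 2 + e (p iX) * c (p iX) * sphereFactor p ^ 2
      = s₄ * ρ * sphereFactor p ^ 2 := by linear_combination sphereFactor p ^ 2 * h₄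
    have h6 : sphereFactor p ^ 2 * Y = 2 * sphereFactor p - sphereFactor p ^ 2 := by
      linear_combination sphereFactor p * hσ
    clear key hσ h₄ hY
    have hc : ∀ a b : Fin (d - 2), a ≠ b → (a = b) = False ∧ (b = a) = False := fun a b h =>
      ⟨eq_false h, eq_false h.symm⟩
    rcases eq_or_ne i l with rfl | h1 <;> rcases eq_or_ne i m with rfl | h2
    · ring
    · rcases eq_or_ne j m with rfl | h3
      · simp only [hc i j h2, if_true, if_false, and_self]
        linear_combination h5 - h6
      · rcases eq_or_ne i j with rfl | h4
        · simp only [hc i m h2, if_true, if_false, and_false, false_and]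
          ring
        · simp only [hc i m h2, hc j m h3, hc i j h4, if_true, if_false, and_false]
          ring
    · rcases eq_or_ne j l with rfl | h3
      · simp only [hc i j h1, if_true, if_false, and_self]
        linear_combination -h5 + h6
      · rcases eq_or_ne i j with rfl | h4
        · simp only [hc i l h1, if_true, if_false, and_false, false_and]
          ring
        · simp only [hc i l h1, hc j l h3, hc i j h4, if_true, if_false, and_false]
          ring
    · rcases eq_or_ne l m with rfl | h3
      · ring
      · rcases eq_or_ne i j with rfl | h4
        · simp only [hc i l h1, hc i m h2, hc l m h3, if_true, if_false, false_and]
          ring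
        · rcases eq_or_ne j l with rfl | h5
          · simp only [hc i j h1, hc i m h2, hc j m h3, if_true, if_false, false_and]
            ring
          · rcases eq_or_ne j m with rfl | h6
            · simp only [hc i l h1, hc i j h2, hc l j h3, if_true, if_false, false_and]
              ring
            · simp only [hc i l h1, hc i m h2, hc l m h3, hc i j h4, hc j l h5, hc j m h6, if_false,
                false_and]
              ring

/-- The functions `a`, `b`, `r` of a metric `a dt² + b dx² + r² dΩ²` do not vanish at `x`, and have
first derivatives `a₁`, `b₁`, `r₁` near `x` and second derivatives `a₂`, `b₂`, `r₂` at `x`. -/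
structure ProfileAt (a a₁ b b₁ r r₁ : ℝ → ℝ) (a₂ b₂ r₂ x : ℝ) : Prop where
  ha : ∀ᶠ y in 𝓝 x, HasDerivAt a (a₁ y) y
  hb : ∀ᶠ y in 𝓝 x, HasDerivAt b (b₁ y) y
  hr : ∀ᶠ y in 𝓝 x, HasDerivAt r (r₁ y) y
  ha₁ : HasDerivAt a₁ a₂ x
  hb₁ : HasDerivAt b₁ b₂ x
  hr₁ : HasDerivAt r₁ r₂ x
  ha0 : a x ≠ 0
  hb0 : b x ≠ 0
  hr0 : r x ≠ 0

section
variable {a a₁ b b₁ r r₁ : ℝ → ℝ} {a₂ b₂ r₂ : ℝ} {p : Idx d → ℝ}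

theorem tendsto_iX_nhds (p : Idx d → ℝ) : Tendsto (fun q : Idx d → ℝ => q iX) (𝓝 p) (𝓝 (p iX)) :=
  (continuous_apply iX).tendsto p

theorem ProfileAt.christoffel_eventuallyEq (h : ProfileAt a a₁ b b₁ r r₁ a₂ b₂ r₂ (p iX)) :
    christoffel (ssMetric a b r) =ᶠ[𝓝 p] ssConn (fun x => a₁ x / (2 * a x))
      (fun x => -(a₁ x / (2 * b x))) (fun x => b₁ x / (2 * b x)) (fun x => -(r x * r₁ x / b x))
      (fun x => r₁ x / r x) := by
  have h1 := h.ha.self_of_nhds.continuousAt.eventually_ne h.ha0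
  have h2 := h.hb.self_of_nhds.continuousAt.eventually_ne h.hb0
  have h3 := h.hr.self_of_nhds.continuousAt.eventually_ne h.hr0
  filter_upwards [(tendsto_iX_nhds p).eventually h1, (tendsto_iX_nhds p).eventually h2,
    (tendsto_iX_nhds p).eventually h3, (tendsto_iX_nhds p).eventually h.ha,
    (tendsto_iX_nhds p).eventually h.hb, (tendsto_iX_nhds p).eventually h.hr] with q k1 k2 k3 k4 k5 k6
  rw [christoffel_ssMetric k4 k5 k6 k1 k2 k3]
  funext α μ ν
  revert α μ ν
  refine forall_idx ?_ ?_ fun i => ?_ <;> refine forall_idx ?_ ?_ fun j => ?_ <;>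
    refine forall_idx ?_ ?_ fun l => ?_ <;> rfl

/-- The curvature of `a dt² + b dx² + r² dΩ²` is diagonal on coordinate planes. -/
theorem ProfileAt.riemann_eq (h : ProfileAt a a₁ b b₁ r r₁ a₂ b₂ r₂ (p iX)) {s₁ s₂ s₃ s₄ : ℝ}
    (h₁ : s₁ = (-(a₂ / (2 * a (p iX))) + a₁ (p iX) ^ 2 / (4 * a (p iX) ^ 2)
      + a₁ (p iX) * b₁ (p iX) / (4 * a (p iX) * b (p iX))) / b (p iX))
    (h₂ : s₂ = -(a₁ (p iX) * r₁ (p iX) / (2 * a (p iX) * r (p iX) * b (p iX))))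
    (h₃ : s₃ = (-(r₂ / b (p iX)) + r₁ (p iX) * b₁ (p iX) / (2 * b (p iX) ^ 2)) / r (p iX))
    (h₄ : s₄ = (1 - r₁ (p iX) ^ 2 / b (p iX)) / r (p iX) ^ 2) (α β μ ν : Idx d) :
    riemann (christoffel (ssMetric a b r)) p α β μ ν = ssCurv s₁ s₂ s₃ s₄ α β *
      ((if α = μ ∧ β = ν then ssDiag a b r p β else 0)
      - (if α = ν ∧ β = μ then ssDiag a b r p β else 0)) := by
  have ha := h.ha.self_of_nhds
  have hb := h.hb.self_of_nhds
  have hr := h.hr.self_of_nhds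
  have ha0 := h.ha0
  have hb0 := h.hb0
  have hr0 := h.hr0
  rw [riemann_congr h.christoffel_eventuallyEq]
  refine riemann_ssConn (h.ha₁.fun_div (ha.const_mul 2) (by simpa using ha0))
    (h.ha₁.fun_div (hb.const_mul 2) (by simpa using hb0)).fun_neg
    ((hr.fun_mul h.hr₁).fun_div hb hb0).fun_neg (h.hr₁.fun_div hr hr0)
    (G₁ := a (p iX)) (G₂ := b (p iX)) (ρ := r (p iX) ^ 2) ?_ ?_ ?_ ?_ ?_ ?_ ?_ α β μ ν
  · rw [h₁]; field_simp; ring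
  · rw [h₁]; field_simp; ring
  · rw [h₂]; field_simp
  · rw [h₂]; field_simp
  · rw [h₃]; field_simp; ring
  · rw [h₃]; field_simp; ring
  · rw [h₄]; field_simp; ring

/-- The contraction that turns a Riemann tensor which is diagonal on coordinate planes into its Ricci
tensor. -/
theorem sum_eq_of_riemann_eq {G : Idx d → ℝ} {S : Idx d → Idx d → ℝ} (β ν : Idx d) :
    (∑ α, S α β * ((if β = ν then G β else 0) - (if α = ν ∧ β = α then G β else 0)))
      = if β = ν then G β * ((∑ α, S α β) - S β β) else 0 := by
  by_cases h : β = ν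
  · subst h
    simp only [if_true, mul_sub, Finset.sum_sub_distrib]
    rw [Finset.sum_eq_single β (f := fun x => S x β * if x = β ∧ β = x then G β else 0)]
    · simp only [and_self, if_true, ← Finset.sum_mul]; ring
    · intro x _ hx; simp [hx]
    · simp
  · simp only [h, if_false]
    refine Finset.sum_eq_zero fun α _ => ?_
    rw [if_neg (by rintro ⟨rfl, rfl⟩; exact h rfl)]
    simp

/-- The Ricci tensor of `a dt² + b dx² + r² dΩ²`. -/
theorem ProfileAt.ricci_eq (h : ProfileAt a a₁ b b₁ r r₁ a₂ b₂ r₂ (p iX)) {s₁ s₂ s₃ s₄ : ℝ}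
    (h₁ : s₁ = (-(a₂ / (2 * a (p iX))) + a₁ (p iX) ^ 2 / (4 * a (p iX) ^ 2)
      + a₁ (p iX) * b₁ (p iX) / (4 * a (p iX) * b (p iX))) / b (p iX))
    (h₂ : s₂ = -(a₁ (p iX) * r₁ (p iX) / (2 * a (p iX) * r (p iX) * b (p iX))))
    (h₃ : s₃ = (-(r₂ / b (p iX)) + r₁ (p iX) * b₁ (p iX) / (2 * b (p iX) ^ 2)) / r (p iX))
    (h₄ : s₄ = (1 - r₁ (p iX) ^ 2 / b (p iX)) / r (p iX) ^ 2) :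
    Matrix.of (ricci (christoffel (ssMetric a b r)) p) = Matrix.diagonal
      (Sum.elim ![a (p iX) * (s₁ + (d - 2 : ℕ) * s₂), b (p iX) * (s₁ + (d - 2 : ℕ) * s₃)]
        fun _ => r (p iX) ^ 2 * sphereFactor p ^ 2 * (s₂ + s₃ + ((d - 2 : ℕ) - 1) * s₄)) := by
  ext β ν
  simp only [Matrix.of_apply, ricci, h.riemann_eq h₁ h₂ h₃ h₄, true_and]
  rw [sum_eq_of_riemann_eq, Matrix.diagonal_apply]
  congr 1
  rw [sum_idx]
  revert β
  refine forall_idx ?_ ?_ fun i => ?_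
  · simp only [ssCurv_tt, ssCurv_xt, ssCurv_yt, ssDiag_iT, Finset.sum_const, Finset.card_univ,
      Fintype.card_fin, nsmul_eq_mul]
    change _ = a (p iX) * (s₁ + (d - 2 : ℕ) * s₂)
    ring
  · simp only [ssCurv_tx, ssCurv_xx, ssCurv_yx, ssDiag_iX, Finset.sum_const, Finset.card_univ,
      Fintype.card_fin, nsmul_eq_mul]
    change _ = b (p iX) * (s₁ + (d - 2 : ℕ) * s₃)
    ring
  · simp only [ssCurv_ty, ssCurv_xy, ssCurv_yy, ssDiag_inr, Finset.sum_const, Finset.card_univ,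
      Fintype.card_fin, nsmul_eq_mul, Sum.elim_inr]
    ring

/-- The Kretschmann scalar of `a dt² + b dx² + r² dΩ²`, in terms of the sectional curvatures. -/
theorem ProfileAt.kretschmann_eq (h : ProfileAt a a₁ b b₁ r r₁ a₂ b₂ r₂ (p iX)) {s₁ s₂ s₃ s₄ : ℝ}
    (h₁ : s₁ = (-(a₂ / (2 * a (p iX))) + a₁ (p iX) ^ 2 / (4 * a (p iX) ^ 2)
      + a₁ (p iX) * b₁ (p iX) / (4 * a (p iX) * b (p iX))) / b (p iX))
    (h₂ : s₂ = -(a₁ (p iX) * r₁ (p iX) / (2 * a (p iX) * r (p iX) * b (p iX))))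
    (h₃ : s₃ = (-(r₂ / b (p iX)) + r₁ (p iX) * b₁ (p iX) / (2 * b (p iX) ^ 2)) / r (p iX))
    (h₄ : s₄ = (1 - r₁ (p iX) ^ 2 / b (p iX)) / r (p iX) ^ 2) :
    kretschmann (ssMetric a b r) p = 4 * s₁ ^ 2 + 4 * (d - 2 : ℕ) * (s₂ ^ 2 + s₃ ^ 2)
      + 2 * (d - 2 : ℕ) * ((d - 2 : ℕ) - 1) * s₄ ^ 2 := by
  have hG : ∀ i, ssDiag a b r p i ≠ 0 := forall_idx h.ha0 h.hb0 fun i => by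
    simp [h.hr0, (sphereFactor_pos p).ne']
  have hdiag : ∀ (f : Idx d → ℝ) (v : Idx d → ℝ) (i : Idx d),
      ∑ j, Matrix.diagonal v i j * f j = v i * f i := by
    intro f v i
    rw [Finset.sum_eq_single i]
    · rw [Matrix.diagonal_apply_eq]
    · intro j _ hj; rw [Matrix.diagonal_apply_ne' _ hj, zero_mul]
    · simp
  have hinv : (ssMetric a b r p)⁻¹ = Matrix.diagonal fun i => (ssDiag a b r p i)⁻¹ :=
    inv_diagonal_of_ne_zero hG
  have hsum : kretschmann (ssMetric a b r) p = ∑ α, ∑ β, ∑ μ, ∑ ν,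
      ssDiag a b r p α * (ssDiag a b r p β)⁻¹ * (ssDiag a b r p μ)⁻¹ * (ssDiag a b r p ν)⁻¹ *
        riemann (christoffel (ssMetric a b r)) p α β μ ν ^ 2 := by
    unfold kretschmann
    rw [hinv, show ssMetric a b r p = Matrix.diagonal (ssDiag a b r p) from rfl]
    simp only [mul_assoc]
    simp only [← Finset.mul_sum, hdiag]
    simp only [Finset.mul_sum, pow_two]
  -- on the plane of `α` and `β` only the two components with `{μ, ν} = {α, β}` contribute
  have hpair : ∀ α β : Idx d, ∑ μ, ∑ ν,
      ssDiag a b r p α * (ssDiag a b r p β)⁻¹ * (ssDiag a b r p μ)⁻¹ * (ssDiag a b r p ν)⁻¹ *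
        riemann (christoffel (ssMetric a b r)) p α β μ ν ^ 2
      = if α = β then 0 else 2 * ssCurv s₁ s₂ s₃ s₄ α β ^ 2 := by
    intro α β
    simp only [h.riemann_eq h₁ h₂ h₃ h₄]
    by_cases hαβ : α = β
    · subst hαβ
      rw [if_pos rfl]
      refine Finset.sum_eq_zero fun μ _ => Finset.sum_eq_zero fun ν _ => ?_
      simp only [and_comm (a := α = ν), sub_self]
      ring
    · rw [if_neg hαβ, Fintype.sum_eq_add α β hαβ, Fintype.sum_eq_single β, Fintype.sum_eq_single α]
      · have := hG α
        have := hG β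
        simp [hαβ, Ne.symm hαβ]
        field_simp
        ring
      · intro ν hν; simp [hαβ, hν.symm]
      · intro ν hν; simp [Ne.symm hαβ, hν.symm]
      · rintro μ ⟨h1, h2⟩
        exact Finset.sum_eq_zero fun ν _ => by simp [h1.symm, h2.symm]
  rw [hsum]
  simp only [hpair]
  -- the sum over `β ≠ α` as a full sum minus its diagonal term
  have hoff : ∀ α : Idx d, (∑ β, if α = β then 0 else 2 * ssCurv s₁ s₂ s₃ s₄ α β ^ 2)
      = (∑ β, 2 * ssCurv s₁ s₂ s₃ s₄ α β ^ 2) - 2 * ssCurv s₁ s₂ s₃ s₄ α α ^ 2 := by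
    intro α
    rw [eq_sub_iff_add_eq, ← Finset.sum_erase_add _ _ (Finset.mem_univ α),
      ← Finset.sum_erase_add _ (fun β => 2 * ssCurv s₁ s₂ s₃ s₄ α β ^ 2) (Finset.mem_univ α),
      if_pos rfl, add_zero]
    congr 1
    exact Finset.sum_congr rfl fun β hβ => if_neg (Finset.ne_of_mem_erase hβ).symm
  simp only [hoff, sum_idx, ssCurv_tt, ssCurv_tx, ssCurv_xt, ssCurv_xx, ssCurv_ty, ssCurv_yt,
    ssCurv_xy, ssCurv_yx, ssCurv_yy, Finset.sum_const, Finset.card_univ, Fintype.card_fin,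
    nsmul_eq_mul]
  ring
end
end Spherical
end EiBI

/-! ### The field equations for a Coulomb field -/

namespace EiBI
section Chart

variable {ι : Type} [Fintype ι] [DecidableEq ι]

theorem hasDerivAt_sqrt_neg_prod {h : ℝ → ι → ℝ} {h' : ι → ℝ} {s : ℝ}
    (hd : ∀ i, HasDerivAt (fun s => h s i) (h' i) s) (h0 : ∀ i, h s i ≠ 0)
    (hneg : ∏ i, h s i < 0) :
    HasDerivAt (fun s => √(-∏ i, h s i))
      (√(-∏ i, h s i) * ∑ i, h' i / (2 * h s i)) s := by
  have hprod : HasDerivAt (fun s => ∏ i, h s i) ((∏ i, h s i) * ∑ i, h' i / h s i) s := by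
    have h1 := HasDerivAt.fun_finsetProd (u := Finset.univ) (f := fun i s => h s i) fun i _ => hd i
    refine h1.congr_deriv ?_
    rw [Finset.mul_sum]
    refine Finset.sum_congr rfl fun i _ => ?_
    rw [← Finset.mul_prod_erase _ _ (Finset.mem_univ i), smul_eq_mul]
    have := h0 i
    field_simp
  refine (hprod.fun_neg.sqrt (by linarith)).congr_deriv ?_
  have hpos : 0 < -∏ i, h s i := by linarith
  have h2 : √(-∏ i, h s i) ≠ 0 := (Real.sqrt_pos.2 hpos).ne'
  have h3 : (∑ i, h' i / (2 * h s i)) = (∑ i, h' i / h s i) / 2 := by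
    rw [Finset.sum_div]
    refine Finset.sum_congr rfl fun i _ => ?_
    have := h0 i
    field_simp
  rw [h3]
  field_simp
  rw [Real.sq_sqrt hpos.le]
  ring

/-- The Levi-Civita connection of a diagonal metric annihilates the tensor density `√(-g) g^{μν}`. -/
theorem density_parallel {H : (ι → ℝ) → ι → ℝ} {p : ι → ℝ} (hH : ∀ i, H p i ≠ 0)
    (hneg : ∏ i, H p i < 0)
    (hd : ∀ κ i, DifferentiableAt ℝ (fun s => H (Function.update p κ s) i) (p κ)) (κ μ ν : ι) :
    let W : (ι → ℝ) → Matrix ι ι ℝ := fun x =>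
      √(-(Matrix.diagonal (H x)).det) • (Matrix.diagonal (H x))⁻¹
    let Γ := christoffel fun x => Matrix.diagonal (H x)
    pd κ (fun x => W x μ ν) p + ∑ σ, Γ p μ κ σ * W p σ ν + ∑ σ, Γ p ν κ σ * W p μ σ
      - (∑ σ, Γ p σ κ σ) * W p μ ν = 0 := by
  intro W Γ
  have hWp : ∀ x, (∀ i, H x i ≠ 0) → W x = Matrix.diagonal fun i => √(-∏ i, H x i) * (H x i)⁻¹ := by
    intro x hx
    simp only [W]
    rw [inv_diagonal_of_ne_zero hx, Matrix.det_diagonal, ← Matrix.diagonal_smul]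
    rfl
  have hder : ∀ i, HasDerivAt (fun s => H (Function.update p κ s) i) (pd κ (fun x => H x i) p) (p κ) :=
    fun i => (hd κ i).hasDerivAt
  have hev : ∀ᶠ s in 𝓝 (p κ), ∀ i, H (Function.update p κ s) i ≠ 0 := by
    rw [eventually_all]
    exact fun i => (hd κ i).continuousAt.eventually_ne (by simpa using hH i)
  have hpd : pd κ (fun x => W x μ ν) p = if μ = ν then
      √(-∏ i, H p i) * (∑ i, pd κ (fun x => H x i) p / (2 * H p i)) * (H p μ)⁻¹
        - √(-∏ i, H p i) * (pd κ (fun x => H x μ) p / (H p μ) ^ 2) else 0 := by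
    have h1 : (fun s => W (Function.update p κ s) μ ν) =ᶠ[𝓝 (p κ)] fun s =>
        if μ = ν then √(-∏ i, H (Function.update p κ s) i) * (H (Function.update p κ s) μ)⁻¹ else 0 := by
      filter_upwards [hev] with s hs
      rw [hWp _ hs, Matrix.diagonal_apply]
    unfold pd
    rw [h1.deriv_eq]
    split_ifs with h
    · have h2 := (hasDerivAt_sqrt_neg_prod hder (by simpa using hH) (by simpa using hneg)).fun_mul
        ((hder μ).fun_inv (by simpa using hH μ))
      refine (h2.congr_deriv ?_).deriv
      simp only [Function.update_eq_self, pd]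
      ring
    · simp
  have hΓ : ∀ α μ ν, Γ p α μ ν = (1 / 2) * (H p α)⁻¹ * ((if α = ν then pd μ (fun x => H x α) p else 0)
        + (if α = μ then pd ν (fun x => H x α) p else 0)
        - (if μ = ν then pd α (fun x => H x μ) p else 0)) := christoffel_diagonal H p hH
  have htr : ∑ σ, Γ p σ κ σ = ∑ i, pd κ (fun x => H x i) p / (2 * H p i) := by
    refine Finset.sum_congr rfl fun σ _ => ?_
    rw [hΓ]
    rcases eq_or_ne σ κ with rfl | h
    · simp; ring
    · simp [h, h.symm]; ring
  have hl : ∑ σ, Γ p μ κ σ * W p σ ν = Γ p μ κ ν * (√(-∏ i, H p i) * (H p ν)⁻¹) := by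
    rw [hWp p hH, Finset.sum_eq_single ν, Matrix.diagonal_apply_eq]
    · intro σ _ hσ; rw [Matrix.diagonal_apply_ne _ hσ, mul_zero]
    · simp
  have hr : ∑ σ, Γ p ν κ σ * W p μ σ = Γ p ν κ μ * (√(-∏ i, H p i) * (H p μ)⁻¹) := by
    rw [hWp p hH, Finset.sum_eq_single μ, Matrix.diagonal_apply_eq]
    · intro σ _ hσ; rw [Matrix.diagonal_apply_ne' _ hσ, mul_zero]
    · simp
  rw [hpd, htr, hl, hr, hWp p hH, Matrix.diagonal_apply, hΓ, hΓ]
  · have h1 := hH μ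
    have h2 := hH ν
    rcases eq_or_ne μ ν with rfl | h
    · rcases eq_or_ne μ κ with rfl | h'
      · simp only [if_true]; field_simp; ring
      · simp only [if_true, h', h'.symm, if_false]; field_simp; ring
    · simp only [h, h.symm, if_false]
      by_cases h3 : κ = μ
      · subst h3
        simp only [h, if_true, h.symm, if_false]
        field_simp; ring
      · by_cases h4 : κ = ν
        · subst h4; simp only [h, h.symm, if_true, if_false]; field_simp; ring
        · simp [h3, h4, Ne.symm h3, Ne.symm h4]

end Chart

section Spherical
variable {d : ℕ}

theorem det_ssMetric (a b r : ℝ → ℝ) (p : Idx d → ℝ) :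
    (ssMetric a b r p).det = a (p iX) * b (p iX) * (r (p iX) ^ 2 * sphereFactor p ^ 2) ^ (d - 2) := by
  rw [ssMetric_eq, Matrix.det_diagonal, prod_idx]
  simp

theorem sqrt_neg_det_ssMetric {a b r : ℝ → ℝ} {p : Idx d → ℝ} :
    √(-(ssMetric a b r p).det)
      = √(-(a (p iX) * b (p iX))) * |r (p iX)| ^ (d - 2) * sphereFactor p ^ (d - 2) := by
  rw [det_ssMetric, ← neg_mul, Real.sqrt_mul' _ (by positivity), mul_assoc, ← mul_pow]
  congr 1
  rw [Real.sqrt_eq_iff_eq_sq (by positivity) (by have := sphereFactor_pos p; positivity),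
    show (r (p iX) * sphereFactor p) ^ 2 = (|r (p iX)| * sphereFactor p) ^ 2 by
      rw [mul_pow, mul_pow, sq_abs]]
  ring

@[simp] theorem coulombField_tt (Q : ℝ) (a b r : ℝ → ℝ) (p : Idx d → ℝ) :
    coulombField Q a b r p iT iT = 0 := rfl
@[simp] theorem coulombField_xx (Q : ℝ) (a b r : ℝ → ℝ) (p : Idx d → ℝ) :
    coulombField Q a b r p iX iX = 0 := rfl
@[simp] theorem coulombField_tx (Q : ℝ) (a b r : ℝ → ℝ) (p : Idx d → ℝ) :
    coulombField Q a b r p iT iX = Q / (r (p iX) ^ (d - 2) * √(-(a (p iX) * b (p iX)))) := rfl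
@[simp] theorem coulombField_xt (Q : ℝ) (a b r : ℝ → ℝ) (p : Idx d → ℝ) :
    coulombField Q a b r p iX iT = -(Q / (r (p iX) ^ (d - 2) * √(-(a (p iX) * b (p iX))))) := rfl
@[simp] theorem coulombField_inr_left (Q : ℝ) (a b r : ℝ → ℝ) (p : Idx d → ℝ) (i : Fin (d - 2)) :
    ∀ ν, coulombField Q a b r p (.inr i) ν = 0 := by
  rintro (ν | ν) <;> rfl
@[simp] theorem coulombField_inr_right (Q : ℝ) (a b r : ℝ → ℝ) (p : Idx d → ℝ) (i : Fin (d - 2)) :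
    ∀ ν, coulombField Q a b r p ν (.inr i) = 0 := by
  rintro (ν | ν) <;> rfl

theorem coulombField_antisymm (Q : ℝ) (a b r : ℝ → ℝ) (p : Idx d → ℝ) (μ ν : Idx d) :
    coulombField Q a b r p μ ν = -coulombField Q a b r p ν μ := by
  revert μ ν
  refine forall_idx ?_ ?_ fun i => ?_ <;> refine forall_idx ?_ ?_ fun j => ?_ <;> simp

/-- The energy-momentum tensor of the Coulomb field is diagonal, with mixed components of equal
magnitude and of opposite signs along and across the `(t, x)` plane. -/
theorem emStress_coulombField {Q lP : ℝ} {a b r : ℝ → ℝ} {p : Idx d → ℝ}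
    (hab : a (p iX) * b (p iX) < 0) (hr : r (p iX) ≠ 0) :
    emStress d lP (ssMetric a b r) (coulombField Q a b r) p = Matrix.diagonal fun i =>
      (ssDiag a b r p i)⁻¹ * (-(lP ^ (d - 4) / (8 * Real.pi)) * (Q / r (p iX) ^ (d - 2)) ^ 2 *
        Sum.elim (fun _ => 1) (fun _ => -1) i) := by
  have hG : ∀ i, ssDiag a b r p i ≠ 0 := forall_idx (left_ne_zero_of_mul hab.ne)
    (right_ne_zero_of_mul hab.ne) fun i => by simp [hr, (sphereFactor_pos p).ne']
  set φ := (Q / r (p iX) ^ (d - 2)) ^ 2 with hφ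
  have hs : √(-(a (p iX) * b (p iX))) ^ 2 = -(a (p iX) * b (p iX)) := Real.sq_sqrt (by linarith)
  have hs0 : √(-(a (p iX) * b (p iX))) ≠ 0 := (Real.sqrt_pos.2 (by linarith)).ne'
  have hsq : (Q / (r (p iX) ^ (d - 2) * √(-(a (p iX) * b (p iX))))) ^ 2 * (a (p iX) * b (p iX)) = -φ := by
    rw [hφ, div_pow, mul_pow, hs, div_pow]
    have hm := hab.ne
    generalize a (p iX) * b (p iX) = m at hm
    field_simp
  have hmul : (ssMetric a b r p * coulombField Q a b r p) * (ssMetric a b r p * coulombField Q a b r p)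
      = Matrix.diagonal (Sum.elim (fun _ => φ) (fun _ => 0)) := by
    ext μ ν
    rw [Matrix.mul_apply, sum_idx, ssMetric_eq]
    simp only [Matrix.diagonal_mul, coulombField_inr_left, coulombField_inr_right, mul_zero,
      Finset.sum_const_zero, add_zero]
    revert μ ν
    refine forall_idx ?_ ?_ fun i => ?_ <;> refine forall_idx ?_ ?_ fun j => ?_ <;>
      simp only [coulombField_tt, coulombField_xx, coulombField_tx, coulombField_xt, ssDiag_iT,
        ssDiag_iX, coulombField_inr_left, coulombField_inr_right, mul_zero, zero_mul, add_zero,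
        zero_add, Matrix.diagonal_apply, iT_ne_iX, iX_ne_iT, iT_ne_inr, iX_ne_inr, inr_ne_iT,
        inr_ne_iX, if_false, if_true, Sum.elim_inr, ite_self]
    · change _ = φ
      linear_combination -hsq
    · change _ = φ
      linear_combination -hsq
  unfold emStress
  rw [hmul, ssMetric_eq, inv_diagonal_of_ne_zero hG, Matrix.trace_diagonal, sum_idx]
  ext μ ν
  rw [Matrix.diagonal_mul]
  by_cases h : μ = ν
  · subst h
    simp only [Matrix.smul_apply, Matrix.sub_apply, Matrix.diagonal_apply_eq, Matrix.one_apply_eq,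
      smul_eq_mul]
    congr 1
    have hpi := Real.pi_ne_zero
    rcases μ with i | i
    · simp [iT, iX]; field_simp; ring
    · simp [iT, iX]; field_simp; ring
  · simp [h]

/-- For metrics of the given form, the first field equation amounts to three scalar equations. -/
theorem metric_equation_iff {Q ε lP : ℝ} {a b r B ρ : ℝ → ℝ} {p : Idx d → ℝ}
    (hd : 4 ≤ d) (hB : B (p iX) ≠ 0) (hρ : ρ (p iX) ≠ 0)
    (hab : a (p iX) * b (p iX) < 0) (hr : 0 < r (p iX)) {w S : ℝ}
    (hw : w = -ε * lP ^ (2 * d - 6) * (Q / r (p iX) ^ (d - 2)) ^ 2)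
    (hS : S = √(-(a (p iX) * b (p iX))) * r (p iX) ^ (d - 2)) :
    (√(-(ssMetric (fun x => -B x) (fun x => 1 / B x) ρ p).det) •
        (ssMetric (fun x => -B x) (fun x => 1 / B x) ρ p)⁻¹
        - ((1 : ℝ) * √(-(ssMetric a b r p).det)) • (ssMetric a b r p)⁻¹
      = (-(8 * Real.pi * lP ^ (d - 2) * ε * √(-(ssMetric a b r p).det))) •
        emStress d lP (ssMetric a b r) (coulombField Q a b r) p) ↔
    (|ρ (p iX)| ^ (d - 2) * (-B (p iX))⁻¹ = S * (1 - w) * (a (p iX))⁻¹ ∧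
      |ρ (p iX)| ^ (d - 2) * B (p iX) = S * (1 - w) * (b (p iX))⁻¹ ∧
      |ρ (p iX)| ^ (d - 2) * (ρ (p iX) ^ 2)⁻¹ = S * (1 + w) * (r (p iX) ^ 2)⁻¹) := by
  have hσ := sphereFactor_pos p
  have hG : ∀ i, ssDiag a b r p i ≠ 0 := forall_idx (left_ne_zero_of_mul hab.ne)
    (right_ne_zero_of_mul hab.ne) fun i => by simp [hr.ne', (sphereFactor_pos p).ne']
  have hq : ∀ i, ssDiag (fun x => -B x) (fun x => 1 / B x) ρ p i ≠ 0 :=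
    forall_idx (by simpa using hB) (by simpa using hB) fun i => by
      simp [hρ, (sphereFactor_pos p).ne']
  have hone : √(-(-B (p iX) * (1 / B (p iX)))) = 1 := by
    rw [show -(-B (p iX) * (1 / B (p iX))) = 1 by field_simp, Real.sqrt_one]
  rw [emStress_coulombField hab hr.ne', sqrt_neg_det_ssMetric, sqrt_neg_det_ssMetric, hone, ssMetric_eq,
    ssMetric_eq, inv_diagonal_of_ne_zero hG, inv_diagonal_of_ne_zero hq, ← Matrix.diagonal_smul,
    ← Matrix.diagonal_smul, ← Matrix.diagonal_smul, Matrix.diagonal_sub, abs_of_pos hr,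
    ← hS, Matrix.diagonal_injective.eq_iff, funext_iff]
  have hpow : lP ^ (2 * d - 6) = lP ^ (d - 2) * lP ^ (d - 4) := by
    rw [← pow_add]; congr 1; omega
  have hpi := Real.pi_ne_zero
  have hσn : sphereFactor p ^ (d - 2) ≠ 0 := by positivity
  -- one diagonal component of the equation; `e = ±1` is the sign of the stress in it
  have key : ∀ u v e : ℝ, ((1 * |ρ (p iX)| ^ (d - 2) * sphereFactor p ^ (d - 2)) * u⁻¹
      - (1 * (S * sphereFactor p ^ (d - 2))) * v⁻¹ =
      -(8 * Real.pi * lP ^ (d - 2) * ε * (S * sphereFactor p ^ (d - 2))) *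
        (v⁻¹ * (-(lP ^ (d - 4) / (8 * Real.pi)) * (Q / r (p iX) ^ (d - 2)) ^ 2 * e))) ↔
      |ρ (p iX)| ^ (d - 2) * u⁻¹ = S * (1 - w * e) * v⁻¹ := by
    intro u v e
    have h1 : -(8 * Real.pi * lP ^ (d - 2) * ε * (S * sphereFactor p ^ (d - 2))) *
        (v⁻¹ * (-(lP ^ (d - 4) / (8 * Real.pi)) * (Q / r (p iX) ^ (d - 2)) ^ 2 * e))
        = -(sphereFactor p ^ (d - 2) * S * w * e * v⁻¹) := by
      rw [hw, hpow]
      field_simp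
    rw [h1, ← mul_right_inj' hσn (b := |ρ (p iX)| ^ (d - 2) * u⁻¹)]
    constructor <;> intro h <;> linear_combination h
  have eT : Sum.elim (fun _ => (1 : ℝ)) (fun _ : Fin (d - 2) => -1) (iT : Idx d) = 1 := rfl
  have eX : Sum.elim (fun _ => (1 : ℝ)) (fun _ : Fin (d - 2) => -1) (iX : Idx d) = 1 := rfl
  have hne : (sphereFactor p ^ 2)⁻¹ ≠ 0 := by positivity
  constructor
  · intro h
    refine ⟨?_, ?_, ?_⟩
    · simpa [eT] using (key _ _ _).1 (h iT)
    · simpa [eX] using (key _ _ _).1 (h iX)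
    · have h3 := (key _ _ _).1 (h (.inr ⟨0, by omega⟩))
      simp only [ssDiag_inr, Sum.elim_inr, mul_inv] at h3
      refine mul_right_cancel₀ hne ?_
      linear_combination h3
  · rintro ⟨h1, h2, h3⟩
    refine forall_idx ((key _ _ _).2 ?_) ((key _ _ _).2 ?_) fun i => (key _ _ _).2 ?_
    · simpa [eT] using h1
    · simpa [eX] using h2
    · simp only [ssDiag_inr, Sum.elim_inr, mul_inv]
      linear_combination (sphereFactor p ^ 2)⁻¹ * h3

/-- The Coulomb field is source-free, as its density `√(-g) F^{tx}` depends only on the angles. -/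
theorem maxwell_coulombField {Q : ℝ} {a b r : ℝ → ℝ} {p : Idx d → ℝ}
    (hab : ∀ᶠ x in 𝓝 (p iX), a x * b x < 0) (hr : ∀ᶠ x in 𝓝 (p iX), 0 < r x) (ν : Idx d) :
    ∑ μ, pd μ (fun x => √(-(ssMetric a b r x).det) * coulombField Q a b r x μ ν) p = 0 := by
  simp only [sqrt_neg_det_ssMetric]
  rw [sum_idx]
  simp only [coulombField_inr_left, mul_zero, pd_const, Finset.sum_const_zero, add_zero]
  revert ν
  refine forall_idx ?_ ?_ fun i => ?_
  · simp only [coulombField_tt, coulombField_xt, mul_zero, pd_const, zero_add]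
    have h : (fun x : Idx d → ℝ => √(-(a (x iX) * b (x iX))) * |r (x iX)| ^ (d - 2) *
        sphereFactor x ^ (d - 2) * -(Q / (r (x iX) ^ (d - 2) * √(-(a (x iX) * b (x iX))))))
        =ᶠ[𝓝 p] fun x => -(Q * sphereFactor x ^ (d - 2)) := by
      filter_upwards [(tendsto_iX_nhds p).eventually hab, (tendsto_iX_nhds p).eventually hr] with x h1 h2
      have h3 : √(-(a (x iX) * b (x iX))) ≠ 0 := (Real.sqrt_pos.2 (by linarith)).ne'
      rw [abs_of_pos h2]
      field_simp
    rw [pd_congr h]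
    simp [pd]
  · simp [pd]
  · simp

/-- The Coulomb field is closed, as its only component `F_{tx}` depends only on `x`. -/
theorem bianchi_coulombField (Q : ℝ) (a b r : ℝ → ℝ) (p : Idx d → ℝ) (α β γ : Idx d) :
    pd α (fun x => (ssMetric a b r x * coulombField Q a b r x * (ssMetric a b r x).transpose) β γ) p
      + pd β (fun x => (ssMetric a b r x * coulombField Q a b r x * (ssMetric a b r x).transpose) γ α) p
      + pd γ (fun x => (ssMetric a b r x * coulombField Q a b r x * (ssMetric a b r x).transpose) α β) p
      = 0 := by
  have h1 : ∀ κ μ ν : Idx d,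
      pd κ (fun x => (ssMetric a b r x * coulombField Q a b r x * (ssMetric a b r x).transpose) μ ν) p
      = pd κ (fun x => ssDiag a b r x μ * coulombField Q a b r x μ ν * ssDiag a b r x ν) p := by
    intro κ μ ν
    congr 1
    funext x
    rw [ssMetric_eq, Matrix.diagonal_transpose, Matrix.mul_diagonal, Matrix.diagonal_mul]
  set φ : ℝ → ℝ := fun y => a y * (Q / (r y ^ (d - 2) * √(-(a y * b y)))) * b y with hφ
  have h2 : ∀ κ : Idx d,
      pd κ (fun x => ssDiag a b r x iT * coulombField Q a b r x iT iX * ssDiag a b r x iX) p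
      = if κ = iX then deriv φ (p iX) else 0 := by
    refine forall_idx ?_ ?_ fun i => ?_
    · simpa using pd_iT_comp φ p
    · simpa using pd_iX_comp φ p
    · simpa using pd_inr_comp φ p i
  have h3 : ∀ κ : Idx d,
      pd κ (fun x => ssDiag a b r x iX * coulombField Q a b r x iX iT * ssDiag a b r x iT) p
      = if κ = iX then -deriv φ (p iX) else 0 := by
    intro κ
    have : (fun x : Idx d → ℝ => ssDiag a b r x iX * coulombField Q a b r x iX iT * ssDiag a b r x iT)
        = fun x => -(ssDiag a b r x iT * coulombField Q a b r x iT iX * ssDiag a b r x iX) := by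
      funext x
      simp only [coulombField_tx, coulombField_xt]
      ring
    rw [this, pd_neg, h2]
    split_ifs <;> simp
  rw [h1, h1, h1]
  revert α β γ
  refine forall_idx ?_ ?_ fun i => ?_ <;> refine forall_idx ?_ ?_ fun j => ?_ <;>
    refine forall_idx ?_ ?_ fun k => ?_ <;>
    simp only [h2, h3, coulombField_inr_left, coulombField_inr_right, coulombField_tt,
      coulombField_xx, mul_zero, zero_mul, pd_const, iT_ne_iX, inr_ne_iX, if_true, if_false,
      add_zero, zero_add, add_neg_cancel, neg_add_cancel]

end Spherical
end EiBI

/-! ### Hypergeometric functions and the function `G_d` -/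

namespace EiBI
section Hypergeometric

theorem hyp_radius {a b : ℝ} (ha : ∀ k : ℕ, (k : ℝ) ≠ -a) (hb : ∀ k : ℕ, (k : ℝ) ≠ -b) :
    HasFPowerSeriesOnBall (fun w : ℝ => ₂F₁ a b (b + 1) w)
      (ordinaryHypergeometricSeries ℝ a b (b + 1)) 0 1 := by
  have h := ordinaryHypergeometricSeries_radius_eq_one (𝕂 := ℝ) ℝ a b (b + 1) fun k =>
    ⟨ha k, hb k, fun h => hb (k + 1) (by push_cast; linarith)⟩
  have h2 := (ordinaryHypergeometricSeries ℝ a b (b + 1)).hasFPowerSeriesOnBall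
    (by rw [h]; exact one_pos)
  rwa [h] at h2

/-- The coefficients of `₂F₁(a, b; b + 1)` and of the binomial series differ by the factor
`(b)_n / (b + 1)_n = b / (b + n)`. -/
theorem ascPochhammer_ratio {b : ℝ} (hb : ∀ k : ℕ, (k : ℝ) ≠ -b) (n : ℕ) :
    (b + n) * ((ascPochhammer ℝ n).eval b * ((ascPochhammer ℝ n).eval (b + 1))⁻¹) = b := by
  have h0 : (ascPochhammer ℝ n).eval (b + 1) ≠ 0 := by
    rw [Ne, ascPochhammer_eval_eq_zero_iff]
    rintro ⟨k, -, hk⟩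
    exact hb (k + 1) (by push_cast; linarith)
  have h1 : (ascPochhammer ℝ (n + 1)).eval b = b * (ascPochhammer ℝ n).eval (b + 1) := by
    rw [ascPochhammer_succ_left]
    simp
  rw [ascPochhammer_succ_eval] at h1
  field_simp
  linarith

/-- The first-order equation `(b + w d/dw) ₂F₁(a, b; b + 1; w) = b (1 - w)^{-a}`. -/
theorem hyp_hasDerivAt {a b w : ℝ} (ha : ∀ k : ℕ, (k : ℝ) ≠ -a) (hb : ∀ k : ℕ, (k : ℝ) ≠ -b)
    (hw : |w| < 1) :
    ∃ F', HasDerivAt (fun w : ℝ => ₂F₁ a b (b + 1) w) F' w ∧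
      b * ₂F₁ a b (b + 1) w + w * F' = b * (1 - w) ^ (-a) := by
  have hF := hyp_radius ha hb
  have hmem : w ∈ Metric.eball (0 : ℝ) 1 := by
    simpa [enorm_eq_nnnorm, ← NNReal.coe_lt_one] using hw
  have hd : DifferentiableAt ℝ (fun w : ℝ => ₂F₁ a b (b + 1) w) w :=
    (hF.analyticAt_of_mem hmem).differentiableAt
  refine ⟨_, hd.hasDerivAt, ?_⟩
  have s1 := hF.hasSum hmem
  have s2 := (hF.fderiv.hasSum hmem).mapL (ContinuousLinearMap.apply ℝ ℝ w)
  simp only [zero_add, ContinuousLinearMap.apply_apply] at s1 s2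
  simp only [FormalMultilinearSeries.derivSeries_apply_diag] at s2
  have hlin : fderiv ℝ (fun w : ℝ => ₂F₁ a b (b + 1) w) w w
      = w * deriv (fun w : ℝ => ₂F₁ a b (b + 1) w) w := by
    rw [← fderiv_apply_one_eq_deriv]
    conv_lhs => rw [show w = w • (1 : ℝ) by simp, map_smul]
    simp
  rw [hlin] at s2
  have s3 : HasSum (fun k : ℕ => k • ordinaryHypergeometricSeries ℝ a b (b + 1) k fun _ => w)
      (w * deriv (fun w : ℝ => ₂F₁ a b (b + 1) w) w) := by
    have := (hasSum_nat_add_iff (f := fun k : ℕ =>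
      k • ordinaryHypergeometricSeries ℝ a b (b + 1) k fun _ => w) 1).1 s2
    simpa using this
  have s4 := (s1.mul_left b).add s3
  have s5 := ((Real.one_div_one_sub_rpow_hasFPowerSeriesOnBall_zero a).hasSum hmem).mul_left b
  simp only [zero_add] at s5
  rw [Real.rpow_neg (by linarith [abs_lt.1 hw]), ← one_div]
  refine s4.unique (s5.congr_fun fun k => ?_)
  have hch : Ring.choose (a + k - 1) k = (k.factorial : ℝ)⁻¹ * (ascPochhammer ℝ k).eval a := by
    have h1 := Ring.factorial_nsmul_multichoose_eq_ascPochhammer a k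
    rw [Polynomial.ascPochhammer_smeval_eq_eval, nsmul_eq_mul] at h1
    rw [← h1, Ring.choose, show a + k - 1 - k + 1 = a by ring]
    have : (k.factorial : ℝ) ≠ 0 := by positivity
    field_simp
  have hr := ascPochhammer_ratio hb k
  rw [FormalMultilinearSeries.ofScalars_apply_eq, ordinaryHypergeometricSeries_apply_eq, hch]
  simp only [smul_eq_mul, nsmul_eq_mul]
  linear_combination ((k.factorial : ℝ)⁻¹ * (ascPochhammer ℝ k).eval a * w ^ k) * hr

/-- The derivative of `w ^ b ₂F₁(a, b; b + 1; w)` is the integrand of an incomplete beta function. -/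
theorem rpow_mul_hyp_hasDerivAt {a b w : ℝ} (ha : ∀ k : ℕ, (k : ℝ) ≠ -a)
    (hb : ∀ k : ℕ, (k : ℝ) ≠ -b) (hw0 : 0 < w) (hw : w < 1) :
    HasDerivAt (fun w => w ^ b * ₂F₁ a b (b + 1) w) (b * w ^ (b - 1) * (1 - w) ^ (-a)) w := by
  obtain ⟨F', hF, h⟩ := hyp_hasDerivAt ha hb (abs_lt.2 ⟨by linarith, hw⟩)
  refine ((Real.hasDerivAt_rpow_const (Or.inl hw0.ne')).fun_mul hF).congr_deriv ?_
  have h1 : w ^ b = w ^ (b - 1) * w := by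
    rw [← Real.rpow_add_one hw0.ne', sub_add_cancel]
  rw [h1]
  linear_combination w ^ (b - 1) * h

theorem tendsto_hyp_zero {a b : ℝ} (ha : ∀ k : ℕ, (k : ℝ) ≠ -a) (hb : ∀ k : ℕ, (k : ℝ) ≠ -b) :
    Tendsto (fun w : ℝ => ₂F₁ a b (b + 1) w) (𝓝[>] 0) (𝓝 1) := by
  obtain ⟨F', hF, -⟩ := hyp_hasDerivAt ha hb (w := 0) (by simp)
  have h := hF.continuousAt.tendsto.mono_left (nhdsWithin_le_nhds (s := Ioi 0))
  simpa using h

theorem tendsto_rpow_zero {b : ℝ} (hb : 0 < b) : Tendsto (fun w : ℝ => w ^ b) (𝓝[>] 0) (𝓝 0) := by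
  have h := (Real.continuousAt_rpow_const (0 : ℝ) b (Or.inr hb.le)).tendsto
  rw [Real.zero_rpow hb.ne'] at h
  exact h.mono_left nhdsWithin_le_nhds

/-- Two functions with the same derivative on an interval `(l, u)` and with the same limit at `l`
agree on it. -/
theorem eqOn_of_hasDerivAt_of_tendsto {f g f' : ℝ → ℝ} {l u c : ℝ}
    (hf : ∀ x ∈ Ioo l u, HasDerivAt f (f' x) x) (hg : ∀ x ∈ Ioo l u, HasDerivAt g (f' x) x)
    (hfc : Tendsto f (𝓝[>] l) (𝓝 c)) (hgc : Tendsto g (𝓝[>] l) (𝓝 c)) : EqOn f g (Ioo l u) := by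
  intro x hx
  have hconst : ∀ y ∈ Ioo l u, f y - g y = f x - g x := by
    intro y hy
    refine isOpen_Ioo.is_const_of_deriv_eq_zero isPreconnected_Ioo (f := fun y => f y - g y)
      (fun z hz => ((hf z hz).sub (hg z hz)).differentiableAt.differentiableWithinAt) (fun z hz => ?_)
      hy hx
    simpa using ((hf z hz).fun_sub (hg z hz)).deriv
  have h0 : Tendsto (fun y => f y - g y) (𝓝[>] l) (𝓝 0) := by simpa using hfc.sub hgc
  have h1 : Tendsto (fun y => f y - g y) (𝓝[>] l) (𝓝 (f x - g x)) := by
    refine tendsto_const_nhds.congr' ?_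
    filter_upwards [Ioo_mem_nhdsGT (hx.1.trans hx.2)] with y hy
    exact (hconst y hy).symm
  linarith [tendsto_nhds_unique h0 h1]

/-- Gauss's value of `₂F₁(a, b; b + 1; 1)`, as a limit. -/
theorem tendsto_rpow_mul_hyp_one {a b : ℝ} (ha0 : 0 < a) (ha1 : a < 1) (hb0 : 0 < b) :
    Tendsto (fun w => w ^ b * ₂F₁ a b (b + 1) w) (𝓝[<] 1)
      (𝓝 (b * ProbabilityTheory.beta b (1 - a))) := by
  have ha : ∀ k : ℕ, (k : ℝ) ≠ -a := fun k h => by linarith [k.cast_nonneg (α := ℝ)]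
  have hb : ∀ k : ℕ, (k : ℝ) ≠ -b := fun k h => by linarith [k.cast_nonneg (α := ℝ)]
  have hconv := Complex.betaIntegral_convergent (u := b) (v := (1 - a : ℝ)) (by simpa) (by simp; linarith)
  set φ : ℝ → ℝ := fun t => ((t : ℂ) ^ ((b : ℂ) - 1) * (1 - (t : ℂ)) ^ (((1 - a : ℝ) : ℂ) - 1)).re with hφ
  have hint : IntervalIntegrable φ MeasureTheory.volume 0 1 := by
    rw [intervalIntegrable_iff] at hconv ⊢
    exact hconv.re
  have hφeq : ∀ t ∈ Ioo (0 : ℝ) 1, φ t = t ^ (b - 1) * (1 - t) ^ (-a) := by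
    intro t ht
    have h1 : (t : ℂ) ^ ((b : ℂ) - 1) = ((t ^ (b - 1) : ℝ) : ℂ) := by
      rw [Complex.ofReal_cpow ht.1.le]; push_cast; rfl
    have h2 : (1 - (t : ℂ)) ^ (((1 - a : ℝ) : ℂ) - 1) = (((1 - t) ^ (-a) : ℝ) : ℂ) := by
      rw [Complex.ofReal_cpow (by linarith [ht.2])]; push_cast; congr 1; ring
    simp only [hφ]
    rw [h1, h2, ← Complex.ofReal_mul, Complex.ofReal_re]
  -- the beta integral, whose complex form in Mathlib has the real integrand `φ`
  have hbeta : ∫ t in (0 : ℝ)..1, φ t = ProbabilityTheory.beta b (1 - a) := by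
    rw [ProbabilityTheory.beta_eq_betaIntegralReal b (1 - a) hb0 (by linarith), Complex.betaIntegral]
    rw [intervalIntegral.integral_of_le zero_le_one, intervalIntegral.integral_of_le zero_le_one]
    rw [intervalIntegrable_iff, uIoc_of_le zero_le_one] at hconv
    exact (integral_re (𝕜 := ℂ) hconv)
  have hcont : ContinuousOn (fun w => ∫ t in (0 : ℝ)..w, φ t) (Icc 0 1) := by
    have h := intervalIntegral.continuousOn_primitive_interval (f := φ) (a := 0) (b := 1)
      (μ := MeasureTheory.volume) (by
        rw [uIcc_of_le zero_le_one]
        rwa [intervalIntegrable_iff_integrableOn_Icc_of_le zero_le_one] at hint)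
    rwa [uIcc_of_le zero_le_one] at h
  have hder : ∀ w ∈ Ioo (0 : ℝ) 1, HasDerivAt (fun w => b * ∫ t in (0 : ℝ)..w, φ t)
      (b * w ^ (b - 1) * (1 - w) ^ (-a)) w := by
    intro w hw
    have hcφ : ContinuousOn φ (Ioo 0 1) := by
      refine ContinuousOn.congr ?_ hφeq
      refine ContinuousOn.mul (ContinuousOn.rpow_const continuousOn_id fun t ht => Or.inl ht.1.ne')
        (ContinuousOn.rpow_const (by fun_prop) fun t ht => Or.inl (sub_pos.2 ht.2).ne')
    have h := intervalIntegral.integral_hasDerivAt_right (f := φ) (a := 0) (b := w)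
      (hint.mono_set (by
        rw [uIcc_of_le hw.1.le, uIcc_of_le zero_le_one]; exact Icc_subset_Icc_right hw.2.le))
      (hcφ.stronglyMeasurableAtFilter isOpen_Ioo w hw) (hcφ.continuousAt (isOpen_Ioo.mem_nhds hw))
    refine (h.const_mul b).congr_deriv ?_
    rw [hφeq w hw, mul_assoc]
  have h0 : Tendsto (fun w => b * ∫ t in (0 : ℝ)..w, φ t) (𝓝[>] 0) (𝓝 0) := by
    have h := (hcont 0 (by simp)).tendsto.mono_left
      (nhdsWithin_mono 0 (Ioo_subset_Icc_self (a := (0 : ℝ)) (b := 1)))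
    rw [nhdsWithin_Ioo_eq_nhdsGT zero_lt_one] at h
    simpa using h.const_mul b
  have heq := eqOn_of_hasDerivAt_of_tendsto
    (fun w hw => rpow_mul_hyp_hasDerivAt (w := w) ha hb hw.1 hw.2) hder
    (by simpa using (tendsto_rpow_zero hb0).mul (tendsto_hyp_zero ha hb)) h0
  have h1 := (hcont 1 (by simp)).tendsto.mono_left
      (nhdsWithin_mono 1 (Ioo_subset_Icc_self (a := (0 : ℝ)) (b := 1)))
  rw [nhdsWithin_Ioo_eq_nhdsLT zero_lt_one, hbeta] at h1
  refine (h1.const_mul b).congr' ?_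
  filter_upwards [Ioo_mem_nhdsLT (zero_lt_one (α := ℝ))] with w hw
  exact (heq hw).symm

/-- A contiguous relation, which lowers the parameter `b`. -/
theorem rpow_mul_hyp_contiguous {a b w : ℝ} (ha0 : 0 < a) (hb0 : 0 < b) (hb1 : b < 1)
    (hw : w ∈ Ioo (0 : ℝ) 1) :
    w ^ (b - 1) * ₂F₁ a (b - 1) (b - 1 + 1) w
      = w ^ (b - 1) * (1 - w) ^ (1 - a) + (b - a) / b * (w ^ b * ₂F₁ a b (b + 1) w) := by
  have ha : ∀ k : ℕ, (k : ℝ) ≠ -a := fun k h => by linarith [k.cast_nonneg (α := ℝ)]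
  have hb : ∀ k : ℕ, (k : ℝ) ≠ -b := fun k h => by linarith [k.cast_nonneg (α := ℝ)]
  have hb' : ∀ k : ℕ, (k : ℝ) ≠ -(b - 1) := by
    rintro (_ | k) h
    · simp at h; linarith
    · push_cast at h; linarith [k.cast_nonneg (α := ℝ)]
  have hq : ∀ w ∈ Ioo (0 : ℝ) 1, HasDerivAt (fun w : ℝ => (1 - w) ^ (1 - a))
      (-((1 - a) * (1 - w) ^ (-a))) w := by
    intro w hw
    refine (((hasDerivAt_id' w).const_sub 1).rpow_const (Or.inl (sub_pos.2 hw.2).ne')).congr_deriv ?_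
    rw [show 1 - a - 1 = -a by ring]
    ring
  have hq0 : HasDerivAt (fun w : ℝ => (1 - w) ^ (1 - a)) (-(1 - a)) 0 := by
    refine (((hasDerivAt_id' (0 : ℝ)).const_sub 1).rpow_const (Or.inl (by simp))).congr_deriv ?_
    simp
  obtain ⟨F', hF, -⟩ := hyp_hasDerivAt ha hb' (w := 0) (by simp)
  -- both terms diverge at zero, but their difference is `w^{b-1}` times a function that vanishes to
  -- first order
  have hlim : Tendsto (fun w : ℝ => w ^ (b - 1) * ₂F₁ a (b - 1) (b - 1 + 1) w
      - w ^ (b - 1) * (1 - w) ^ (1 - a)) (𝓝[>] 0) (𝓝 0) := by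
    have h1 := (hF.sub hq0).tendsto_slope_zero.mono_left
      (nhdsWithin_mono 0 fun x (hx : 0 < x) => hx.ne')
    have h2 := (tendsto_rpow_zero hb0).mul h1
    rw [zero_mul] at h2
    refine h2.congr' ?_
    filter_upwards [self_mem_nhdsWithin] with w hw
    have hw0 : w ≠ 0 := (show (0 : ℝ) < w from hw).ne'
    have h3 : w ^ b = w ^ (b - 1) * w := by rw [← Real.rpow_add_one hw0, sub_add_cancel]
    rw [h3]
    simp
    field_simp
  have heq := eqOn_of_hasDerivAt_of_tendsto (l := 0) (u := 1)
    (f := fun w => w ^ (b - 1) * ₂F₁ a (b - 1) (b - 1 + 1) w - w ^ (b - 1) * (1 - w) ^ (1 - a))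
    (g := fun w => (b - a) / b * (w ^ b * ₂F₁ a b (b + 1) w))
    (fun w hw => ((rpow_mul_hyp_hasDerivAt ha hb' hw.1 hw.2).fun_sub
      ((Real.hasDerivAt_rpow_const (Or.inl hw.1.ne')).fun_mul (hq w hw))))
    (fun w hw => ((rpow_mul_hyp_hasDerivAt ha hb hw.1 hw.2).const_mul _).congr_deriv ?_) hlim
    (by simpa using ((tendsto_rpow_zero hb0).mul (tendsto_hyp_zero ha hb)).const_mul ((b - a) / b))
  · have := heq hw
    simp only at this
    linarith
  · have h1 : w ^ (b - 1) = w ^ (b - 1 - 1) * w := by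
      rw [← Real.rpow_add_one hw.1.ne', sub_add_cancel]
    have h2 : (1 - w) ^ (1 - a) = (1 - w) ^ (-a) * (1 - w) := by
      rw [← Real.rpow_add_one (sub_pos.2 hw.2).ne']; congr 1; ring
    rw [h1, h2]
    field_simp
    ring

end Hypergeometric

section GFunction

/-- `G_d` in terms of the incomplete beta function `Φ(w) = w^b ₂F₁(a, b; b + 1; w)` at
`w = z^{-2n}`, where `n = d - 2`, `a = 1 / n` and `b = (n - 1) / (2 n)`. -/
theorem G_eq {n : ℕ} (hn : 2 ≤ n) {z : ℝ} (hz : 1 < z) :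
    G (n + 2) z = -(4 / ((n : ℝ) ^ 2 - 1)) * (((z ^ (2 * n))⁻¹) ^ (((n : ℝ) - 1) / (2 * n)) *
        ₂F₁ (1 / (n : ℝ)) (((n : ℝ) - 1) / (2 * n)) (((n : ℝ) - 1) / (2 * n) + 1) (z ^ (2 * n))⁻¹)
      + z ^ (n + 1) / (n + 1) * ((1 - (z ^ (2 * n))⁻¹) ^ (1 - 1 / (n : ℝ))
          - (1 - (z ^ (2 * n))⁻¹) ^ (1 + 1 / (n : ℝ))) := by
  have hn' : (2 : ℝ) ≤ n := by exact_mod_cast hn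
  have hz0 : 0 < z := by linarith
  set w := (z ^ (2 * n))⁻¹ with hw
  have hwI : w ∈ Ioo (0 : ℝ) 1 :=
    ⟨by positivity, inv_lt_one_of_one_lt₀ (one_lt_pow₀ hz (by omega))⟩
  set b := ((n : ℝ) - 1) / (2 * n) with hb
  have hb0 : 0 < b := by rw [hb]; apply div_pos <;> linarith
  have hb1 : b < 1 := by rw [hb, div_lt_one (by linarith)]; linarith
  have hwpow : ∀ e : ℝ, w ^ e = z ^ (-(2 * n * e)) := by
    intro e
    rw [hw, ← Real.rpow_natCast z, ← Real.rpow_neg hz0.le, ← Real.rpow_mul hz0.le]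
    push_cast; ring_nf
  have h1 : w ^ (b - 1) = z ^ (n + 1) := by
    rw [hwpow, ← Real.rpow_natCast]
    congr 1
    rw [hb]; push_cast; field_simp; ring
  have h2 : w ^ b = (z ^ (n - 1))⁻¹ := by
    rw [hwpow, Real.rpow_neg hz0.le, ← Real.rpow_natCast]
    congr 2
    rw [hb, Nat.cast_sub (by omega)]; push_cast; field_simp
  have hc := rpow_mul_hyp_contiguous (a := 1 / (n : ℝ)) (by positivity) hb0 hb1 hwI
  have e1 : 1 / (((n + 2 : ℕ) : ℝ) - 2) = 1 / (n : ℝ) := by push_cast; ring_nf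
  have e2 : (((n + 2 : ℕ) : ℝ) - 3) / (2 * ((n + 2 : ℕ) : ℝ) - 4) = b := by
    rw [hb]; push_cast; congr 1 <;> ring
  have e3 : (3 * ((n + 2 : ℕ) : ℝ) - 7) / (2 * ((n + 2 : ℕ) : ℝ) - 4) = b + 1 := by
    rw [hb, show 2 * ((n + 2 : ℕ) : ℝ) - 4 = 2 * n by push_cast; ring]
    push_cast; field_simp; ring
  have e4 : -(((n + 2 : ℕ) : ℝ) - 1) / (2 * ((n + 2 : ℕ) : ℝ) - 4) = b - 1 := by
    rw [hb, show 2 * ((n + 2 : ℕ) : ℝ) - 4 = 2 * n by push_cast; ring]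
    push_cast; field_simp; ring
  have e5 : (((n + 2 : ℕ) : ℝ) - 1) / (((n + 2 : ℕ) : ℝ) - 2) = 1 + 1 / n := by
    rw [show ((n + 2 : ℕ) : ℝ) - 2 = n by push_cast; ring]
    push_cast; field_simp; ring
  unfold G
  rw [show 2 * (n + 2) - 4 = 2 * n by omega, show n + 2 - 3 = n - 1 by omega,
    show n + 2 - 1 = n + 1 by omega, ← hw, e1, e3, e4, e5, e2]
  rw [h1, sub_add_cancel, h2] at hc
  rw [h2, show ((n + 2 : ℕ) : ℝ) - 3 = n - 1 by push_cast; ring,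
    show ((n + 2 : ℕ) : ℝ) - 1 = n + 1 by push_cast; ring]
  have hcoef : -((1 : ℝ) / (n - 1)) + (b - 1 / n) / b / (n + 1) = -(4 / ((n : ℝ) ^ 2 - 1)) := by
    have h3 : (n : ℝ) - 1 ≠ 0 := by linarith
    have h4 : (n : ℝ) + 1 ≠ 0 := by linarith
    have h5 : (n : ℝ) ^ 2 - 1 ≠ 0 := by nlinarith
    have h6 : (n : ℝ) ≠ 0 := by linarith
    rw [hb]; field_simp; ring
  linear_combination (1 / ((n : ℝ) + 1)) * hc
    + (z ^ (n - 1))⁻¹ * ₂F₁ (1 / (n : ℝ)) b (b + 1) w * hcoef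

theorem inv_pow_hasDerivAt {n : ℕ} {z : ℝ} (hz : 0 < z) :
    HasDerivAt (fun z : ℝ => (z ^ (2 * n))⁻¹) (-(2 * n * (z ^ (2 * n))⁻¹ / z)) z := by
  refine ((hasDerivAt_pow (2 * n) z).fun_inv (pow_pos hz _).ne').congr_deriv ?_
  rcases Nat.eq_zero_or_pos n with rfl | hn
  · simp
  · obtain ⟨m, hm⟩ : ∃ m, 2 * n = m + 1 := ⟨2 * n - 1, by omega⟩
    have hm' : (2 * n : ℝ) = m + 1 := by exact_mod_cast hm
    rw [hm, hm']
    simp only [Nat.add_sub_cancel]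
    push_cast
    field_simp
    ring

/-- The derivative of `G_d`: the factors `(1 - w)^{∓1/n}` are `(r / |x|)^{± 1}`, so that
`G_d(z(x))` has an elementary derivative in `x`. -/
theorem G_hasDerivAt {n : ℕ} (hn : 2 ≤ n) {z : ℝ} (hz : 1 < z) :
    HasDerivAt (G (n + 2)) (z ^ n * (1 + (z ^ (2 * n))⁻¹) *
      ((1 - (z ^ (2 * n))⁻¹) ^ (-(1 / (n : ℝ))) - (1 - (z ^ (2 * n))⁻¹) ^ (1 / (n : ℝ)))) z := by
  have hn' : (2 : ℝ) ≤ n := by exact_mod_cast hn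
  have hz0 : 0 < z := by linarith
  refine HasDerivAt.congr_of_eventuallyEq ?_
    ((lt_mem_nhds hz).mono fun y hy => G_eq hn hy)
  have hdw := inv_pow_hasDerivAt (n := n) hz0
  have hzw : z ^ (2 * n) * (z ^ (2 * n))⁻¹ = 1 := mul_inv_cancel₀ (by positivity)
  have hwI : (z ^ (2 * n))⁻¹ ∈ Ioo (0 : ℝ) 1 :=
    ⟨by positivity, inv_lt_one_of_one_lt₀ (one_lt_pow₀ hz (by omega))⟩
  have hwpow : ((z ^ (2 * n))⁻¹) ^ (((n : ℝ) - 1) / (2 * n) - 1) = z ^ (n + 1) := by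
    rw [← Real.rpow_natCast z, ← Real.rpow_natCast z, ← Real.rpow_neg hz0.le, ← Real.rpow_mul hz0.le]
    congr 1; push_cast; field_simp; ring
  set w := (z ^ (2 * n))⁻¹ with hw
  have hb0 : 0 < ((n : ℝ) - 1) / (2 * n) := by apply div_pos <;> linarith
  have h1 := (rpow_mul_hyp_hasDerivAt (a := 1 / (n : ℝ)) (b := ((n : ℝ) - 1) / (2 * n)) (w := w)
    (fun k h => by linarith [k.cast_nonneg (α := ℝ), show 0 < 1 / (n : ℝ) by positivity])
    (fun k h => by linarith [k.cast_nonneg (α := ℝ)]) hwI.1 hwI.2).comp z hdw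
  have h2 : ∀ e : ℝ, HasDerivAt (fun z : ℝ => (1 - (z ^ (2 * n))⁻¹) ^ e)
      (2 * n * w / z * e * (1 - w) ^ (e - 1)) z := by
    intro e
    refine ((hdw.const_sub 1).rpow_const (p := e) (Or.inl (sub_pos.2 hwI.2).ne')).congr_deriv ?_
    ring
  have h3 := (hasDerivAt_pow (n + 1) z).div_const ((n : ℝ) + 1)
  refine ((h1.const_mul (-(4 / ((n : ℝ) ^ 2 - 1)))).add
    (h3.fun_mul ((h2 (1 - 1 / n)).fun_sub (h2 (1 + 1 / n))))).congr_deriv ?_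
  rw [hwpow, show (1 - 1 / (n : ℝ)) - 1 = -(1 / n) by ring,
    show (1 + 1 / (n : ℝ)) - 1 = 1 / n by ring, show (1 - 1 / (n : ℝ)) = 1 + -(1 / n) by ring,
    Real.rpow_add (sub_pos.2 hwI.2), Real.rpow_add (sub_pos.2 hwI.2), Real.rpow_one]
  have h4 : (n : ℝ) - 1 ≠ 0 := by linarith
  have h5 : (n : ℝ) + 1 ≠ 0 := by linarith
  have h6 : (n : ℝ) ≠ 0 := by linarith
  rw [show (n : ℝ) ^ 2 - 1 = (n - 1) * (n + 1) by ring, Nat.add_sub_cancel]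
  push_cast
  generalize (1 - w) ^ (-(1 / (n : ℝ))) = X
  generalize (1 - w) ^ (1 / (n : ℝ)) = Y
  clear_value w
  field_simp
  ring

theorem tendsto_inv_pow_one {n : ℕ} (hn : 1 ≤ n) :
    Tendsto (fun z : ℝ => (z ^ (2 * n))⁻¹) (𝓝[>] 1) (𝓝[<] 1) := by
  refine tendsto_nhdsWithin_iff.2 ⟨?_, ?_⟩
  · have : ContinuousAt (fun z : ℝ => (z ^ (2 * n))⁻¹) 1 :=
      (continuousAt_id.pow _).inv₀ (by simp)
    have h := this.tendsto.mono_left (nhdsWithin_le_nhds (s := Ioi 1))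
    simpa using h
  · filter_upwards [self_mem_nhdsWithin] with z hz
    exact inv_lt_one_of_one_lt₀ (one_lt_pow₀ (show 1 < z from hz) (by omega))

/-- At `z = 1` only the incomplete beta function contributes to `G_d`, with the value of the complete
one. -/
theorem tendsto_G {n : ℕ} (hn : 2 ≤ n) :
    Tendsto (G (n + 2)) (𝓝[>] 1) (𝓝 (-(4 / ((n : ℝ) ^ 2 - 1)) * ((((n : ℝ) - 1) / (2 * n)) *
      ProbabilityTheory.beta (((n : ℝ) - 1) / (2 * n)) (1 - 1 / n)))) := by
  have hn' : (2 : ℝ) ≤ n := by exact_mod_cast hn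
  have ha1 : 1 / (n : ℝ) < 1 := by rw [div_lt_one (by linarith)]; linarith
  have h1 := (tendsto_rpow_mul_hyp_one (a := 1 / (n : ℝ)) (b := ((n : ℝ) - 1) / (2 * n))
    (by positivity) ha1 (by apply div_pos <;> linarith)).comp
    (tendsto_inv_pow_one (n := n) (by omega))
  have h2 : ∀ e : ℝ, 0 < e → Tendsto (fun z : ℝ => (1 - (z ^ (2 * n))⁻¹) ^ e) (𝓝[>] 1) (𝓝 0) := by
    intro e he
    refine (tendsto_rpow_zero he).comp (tendsto_nhdsWithin_iff.2 ⟨?_, ?_⟩)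
    · have := ((tendsto_inv_pow_one (n := n) (by omega)).mono_right nhdsWithin_le_nhds).const_sub 1
      simpa using this
    · filter_upwards [(tendsto_inv_pow_one (n := n) (by omega)).eventually self_mem_nhdsWithin]
        with z hz
      exact sub_pos.2 hz
  have h3 : Tendsto (fun z : ℝ => z ^ (n + 1) / ((n : ℝ) + 1)) (𝓝[>] 1) (𝓝 (1 / (n + 1))) := by
    have : ContinuousAt (fun z : ℝ => z ^ (n + 1) / ((n : ℝ) + 1)) 1 := by fun_prop
    have h := this.tendsto.mono_left (nhdsWithin_le_nhds (s := Ioi 1))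
    simpa using h
  have h4 := (h1.const_mul (-(4 / ((n : ℝ) ^ 2 - 1)))).add
    (h3.mul ((h2 (1 - 1 / n) (by linarith)).sub (h2 (1 + 1 / n) (by positivity))))
  rw [sub_zero, mul_zero, add_zero] at h4
  refine h4.congr' ?_
  filter_upwards [self_mem_nhdsWithin] with z hz
  exact (G_eq hn hz).symm

/-- The threshold `δ_d` in terms of a beta function, by the reflection formula for
`Γ(1/n) Γ(1 - 1/n)`. -/
theorem deltaCrit_inv {n : ℕ} (hn : 3 ≤ n) :
    (deltaCrit (n + 2))⁻¹ = (4 / ((n : ℝ) ^ 2 - 1)) * ((((n : ℝ) - 1) / (2 * n)) *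
      ProbabilityTheory.beta (((n : ℝ) - 1) / (2 * n)) (1 - 1 / n)) := by
  have hn' : (3 : ℝ) ≤ n := by exact_mod_cast hn
  have h0 : (n : ℝ) ≠ 0 := by linarith
  set b := ((n : ℝ) - 1) / (2 * n) with hb
  have hb0 : 0 < b := by rw [hb]; apply div_pos <;> linarith
  have ha1 : 1 / (n : ℝ) < 1 := by rw [div_lt_one (by linarith)]; linarith
  have ha0 : 0 < 1 / (n : ℝ) := by positivity
  have e0 : ((n + 2 : ℕ) : ℝ) - 2 = n := by push_cast; ring
  have e1 : 2 * ((n + 2 : ℕ) : ℝ) - 4 = 2 * n := by push_cast; ring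
  have e2 : (((n + 2 : ℕ) : ℝ) - 3) / (2 * n) = b := by rw [hb]; push_cast; congr 1; ring
  have e3 : (((n + 2 : ℕ) : ℝ) - 5) / (2 * n) = b - 1 / n := by
    rw [hb]; push_cast; field_simp; ring
  have e4 : (3 * ((n + 2 : ℕ) : ℝ) - 7) / (2 * n) = b + 1 := by
    rw [hb]; push_cast; field_simp; ring
  have e5 : 3 * (((n + 2 : ℕ) : ℝ) - 3) / (2 * n) = b + (1 - 1 / n) := by
    rw [hb]; push_cast; field_simp; ring
  have e6 : ((n + 2 : ℕ) : ℝ) - 1 = n + 1 := by push_cast; ring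
  have e7 : ((n + 2 : ℕ) : ℝ) - 3 = n - 1 := by push_cast; ring
  unfold deltaCrit
  rw [inv_inv, e0, e1, e2, e3, e4, e5, e6, e7, Real.Gamma_add_one hb0.ne']
  have hrefl := Real.Gamma_mul_Gamma_one_sub (1 / (n : ℝ))
  rw [mul_one_div] at hrefl
  rw [← hrefl, ProbabilityTheory.beta]
  have hG1 := (Real.Gamma_pos_of_pos ha0).ne'
  have hG3 := (Real.Gamma_pos_of_pos (show 0 < b + (1 - 1 / (n : ℝ)) by linarith)).ne'
  -- for `n = 3`, where `b = 1 / n`, both sides vanish because `Γ(0) = 0` by convention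
  have hratio : Real.Gamma b / Real.Gamma (b - 1 / n)
      = (b - 1 / n) * Real.Gamma b / Real.Gamma (b + (1 - 1 / n)) := by
    rcases eq_or_ne (b - 1 / (n : ℝ)) 0 with h | h
    · rw [h]; simp
    · have hG : Real.Gamma (b + (1 - 1 / n)) = (b - 1 / n) * Real.Gamma (b - 1 / n) := by
        rw [← Real.Gamma_add_one h]; congr 1; ring
      rw [hG, mul_div_mul_left _ _ h]
  rw [hratio]
  have h1 : (n : ℝ) - 1 ≠ 0 := by linarith
  have h2 : (n : ℝ) + 1 ≠ 0 := by linarith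
  rw [show (n : ℝ) ^ 2 - 1 = (n - 1) * (n + 1) by ring]
  have hbn : b * (2 * n) = n - 1 := by rw [hb]; field_simp
  have hbn' : b = ((n : ℝ) - 1) / (2 * n) := hb
  generalize Real.Gamma (b + (1 - 1 / n)) = G3 at hG3
  generalize Real.Gamma b = G2
  generalize Real.Gamma (1 - 1 / n) = G4
  rw [hbn']
  clear_value b
  field_simp
  ring

theorem deltaCrit_pos {n : ℕ} (hn : 3 ≤ n) : 0 < deltaCrit (n + 2) := by
  have hn' : (3 : ℝ) ≤ n := by exact_mod_cast hn
  rw [← inv_pos, deltaCrit_inv hn]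
  have hb0 : 0 < ((n : ℝ) - 1) / (2 * n) := by apply div_pos <;> linarith
  have ha1 : 1 / (n : ℝ) < 1 := by rw [div_lt_one (by linarith)]; linarith
  have h1 := ProbabilityTheory.beta_pos hb0 (show 0 < 1 - 1 / (n : ℝ) by linarith)
  have h2 : 0 < (n : ℝ) ^ 2 - 1 := by nlinarith
  positivity

/-- By the reflection formula, the Gamma functions cancel from `a_d`. -/
theorem aCoeff_eq {n : ℕ} (hn : 3 ≤ n) :
    aCoeff (n + 2) * (2 * (n : ℝ)) ^ (-(((n : ℝ) - 1) / n)) = 1 / ((n : ℝ) - 1) := by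
  have hn' : (3 : ℝ) ≤ n := by exact_mod_cast hn
  have h0 : (n : ℝ) ≠ 0 := by linarith
  have h1 : (n : ℝ) - 1 ≠ 0 := by linarith
  have ha1 : 1 / (n : ℝ) < 1 := by rw [div_lt_one (by linarith)]; linarith
  have ha0 : 0 < 1 / (n : ℝ) := by positivity
  have e0 : ((n + 2 : ℕ) : ℝ) - 2 = n := by push_cast; ring
  have e1 : (2 * ((n + 2 : ℕ) : ℝ) - 5) / n = (1 - 1 / n) + 1 := by
    push_cast; field_simp; ring
  have e2 : (((n + 2 : ℕ) : ℝ) - 3) / n = (n - 1) / n := by push_cast; congr 1; ring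
  unfold aCoeff
  rw [e0, e1, e2, Real.Gamma_add_one (by linarith : (1 - 1 / (n : ℝ)) ≠ 0)]
  have hrefl := Real.Gamma_mul_Gamma_one_sub (1 / (n : ℝ))
  rw [mul_one_div] at hrefl
  rw [← hrefl, Real.mul_rpow (by norm_num) (by linarith)]
  have hG1 := (Real.Gamma_pos_of_pos ha0).ne'
  have hG2 := (Real.Gamma_pos_of_pos (show 0 < 1 - 1 / (n : ℝ) by linarith)).ne'
  have hp2 : (2 : ℝ) ^ (-(((n : ℝ) - 1) / n)) = ((2 : ℝ) ^ (((n : ℝ) - 1) / n))⁻¹ :=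
    Real.rpow_neg (by norm_num) _
  have hpn : (n : ℝ) ^ (-(1 / (n : ℝ))) * (n : ℝ) ^ (-(((n : ℝ) - 1) / n)) = (n : ℝ)⁻¹ := by
    rw [← Real.rpow_add (by linarith), ← Real.rpow_neg_one]
    congr 1; field_simp; ring
  have h2 : (2 : ℝ) ^ (((n : ℝ) - 1) / n) ≠ 0 := (Real.rpow_pos_of_pos (by norm_num) _).ne'
  have h3 : 1 - 1 / (n : ℝ) ≠ 0 := by linarith
  rw [hp2]
  calc _ = ((n : ℝ) ^ (-(1 / (n : ℝ))) * (n : ℝ) ^ (-(((n : ℝ) - 1) / n))) / (1 - 1 / n) := by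
        generalize Real.Gamma (1 / (n : ℝ)) = X at *
        generalize Real.Gamma (1 - 1 / (n : ℝ)) = Y at *
        generalize (2 : ℝ) ^ (((n : ℝ) - 1) / n) = Z at *
        generalize 1 - 1 / (n : ℝ) = V at *
        field_simp
    _ = _ := by
        rw [hpn]; field_simp

end GFunction
end EiBI

/-! ### The area radius -/

namespace EiBI

theorem hasDerivAt_of_even {f : ℝ → ℝ} (hf : ∀ x, f (-x) = f x) {f' x : ℝ}
    (h : HasDerivAt f f' (-x)) : HasDerivAt f (-f') x := by
  have h1 := h.comp x (hasDerivAt_neg x)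
  have h2 : (f ∘ fun y => -y) = f := funext hf
  simpa [h2] using h1

namespace Params

/-- The parameters of the solution are admissible, and `n = d - 2` is the dimension of its
spheres. -/
structure Admissible (P : Params) (n : ℕ) : Prop where
  hd : P.d = n + 2
  hn : 2 ≤ n
  hε : P.ε < 0
  hlP : 0 < P.lP
  hQ : P.Q ≠ 0

/-- `w = (r_c / r)^{2d-4} = z^{-(2d-4)}`. -/
def w (P : Params) (x : ℝ) : ℝ := (P.rc / P.r x) ^ (2 * P.d - 4)

/-- The reciprocal of `Ω_(2)`, equal to `r r' / x`; in this form it is continuous also at `x = 0`. -/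
def D (P : Params) (x : ℝ) : ℝ := (|x| / P.r x) ^ (P.d - 4) / (1 + P.w x)

variable {P : Params} {n : ℕ}

namespace Admissible

theorem cast_d (h : P.Admissible n) : (P.d : ℝ) = n + 2 := by rw [h.hd]; push_cast; ring

theorem cast_two_le (h : P.Admissible n) : (2 : ℝ) ≤ n := by exact_mod_cast h.hn

theorem lε_sq (h : P.Admissible n) : P.lε ^ 2 = -P.ε := Real.sq_sqrt (by linarith [h.hε])

theorem lε_pos (h : P.Admissible n) : 0 < P.lε := Real.sqrt_pos.2 (by linarith [h.hε])

theorem rc_pos (h : P.Admissible n) : 0 < P.rc := by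
  have h1 := h.lε_pos
  have h2 := h.hlP
  have h3 := h.hQ
  unfold rc
  positivity

theorem rc_pow (h : P.Admissible n) :
    P.rc ^ (2 * n) = P.Q ^ 2 * P.lP ^ (2 * P.d - 6) * P.lε ^ 2 := by
  have h1 := h.lε_pos
  have h2 := h.hlP
  have hn := h.cast_two_le
  unfold rc
  rw [← Real.rpow_natCast, ← Real.rpow_mul (by positivity), h.cast_d]
  rw [show 1 / (2 * ((n : ℝ) + 2) - 4) * ((2 * n : ℕ) : ℝ) = 1 by
    rw [show 2 * ((n : ℝ) + 2) - 4 = 2 * n by ring]; push_cast; field_simp, Real.rpow_one]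

theorem r_base_pos (h : P.Admissible n) (x : ℝ) :
    0 < (|x| ^ n + √(x ^ (2 * n) + 4 * P.rc ^ (2 * n))) / 2 := by
  have h1 := h.rc_pos
  have h2 : 0 ≤ x ^ (2 * n) := by rw [pow_mul]; positivity
  have : 0 < √(x ^ (2 * n) + 4 * P.rc ^ (2 * n)) := Real.sqrt_pos.2 (by positivity)
  positivity

theorem r_eq (h : P.Admissible n) (x : ℝ) :
    P.r x = ((|x| ^ n + √(x ^ (2 * n) + 4 * P.rc ^ (2 * n))) / 2) ^ (1 / (n : ℝ)) := by
  unfold r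
  rw [h.cast_d, h.hd, Nat.add_sub_cancel, add_sub_cancel_right]

theorem r_pos (h : P.Admissible n) (x : ℝ) : 0 < P.r x := by
  rw [h.r_eq]
  exact Real.rpow_pos_of_pos (h.r_base_pos x) _

theorem r_pow (h : P.Admissible n) (x : ℝ) :
    P.r x ^ n = (|x| ^ n + √(x ^ (2 * n) + 4 * P.rc ^ (2 * n))) / 2 := by
  have hn := h.cast_two_le
  rw [h.r_eq, ← Real.rpow_natCast, ← Real.rpow_mul (h.r_base_pos x).le, one_div_mul_cancel (by linarith),
    Real.rpow_one]

theorem w_eq (h : P.Admissible n) (x : ℝ) : P.w x = P.rc ^ (2 * n) / P.r x ^ (2 * n) := by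
  unfold w
  rw [h.hd, show 2 * (n + 2) - 4 = 2 * n by omega, div_pow]

theorem w_pos (h : P.Admissible n) (x : ℝ) : 0 < P.w x := by
  have h1 := h.rc_pos
  have h2 := h.r_pos x
  unfold w
  positivity

/-- The quadratic equation for `r^n` that the definition of the area radius solves. -/
theorem abs_pow (h : P.Admissible n) (x : ℝ) : |x| ^ n = P.r x ^ n * (1 - P.w x) := by
  have h1 := h.r_pow x
  have h2 : √(x ^ (2 * n) + 4 * P.rc ^ (2 * n)) ^ 2 = (|x| ^ n) ^ 2 + 4 * P.rc ^ (2 * n) := by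
    have h3 := h.rc_pos
    have h4 : x ^ (2 * n) = (|x| ^ n) ^ 2 := by rw [← pow_mul, mul_comm n, pow_mul, pow_mul, sq_abs]
    rw [h4, Real.sq_sqrt (by positivity)]
  have h5 : √(x ^ (2 * n) + 4 * P.rc ^ (2 * n)) = 2 * P.r x ^ n - |x| ^ n := by linarith
  rw [h5] at h2
  have h6 := h.r_pos x
  rw [h.w_eq, mul_comm 2 n, pow_mul (P.r x), mul_sub, mul_div_assoc']
  have h7 : P.r x ^ n ≠ 0 := by positivity
  field_simp
  rw [mul_comm n 2]
  linarith

/-- The area radius is characterized by its algebraic equation. -/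
theorem r_unique (h : P.Admissible n) {x R : ℝ} (hR : 0 < R)
    (hx : |x| ^ n = R ^ n * (1 - P.rc ^ (2 * n) / R ^ (2 * n))) : R = P.r x := by
  have h1 := h.abs_pow x
  rw [h.w_eq] at h1
  have hr := h.r_pos x
  have hc := h.rc_pos
  have hRn : 0 < R ^ n := by positivity
  have hrn : 0 < P.r x ^ n := by positivity
  have e1 : R ^ (2 * n) = (R ^ n) ^ 2 := by rw [← pow_mul, mul_comm]
  have e2 : P.r x ^ (2 * n) = (P.r x ^ n) ^ 2 := by rw [← pow_mul, mul_comm]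
  have h2 : (R ^ n - P.r x ^ n) * (R ^ n * P.r x ^ n + P.rc ^ (2 * n)) = 0 := by
    rw [e1] at hx; rw [e2] at h1
    field_simp at hx h1
    linear_combination (R ^ n) * h1 - (P.r x ^ n) * hx
  have h3 : R ^ n * P.r x ^ n + P.rc ^ (2 * n) ≠ 0 := by positivity
  have h4 : R ^ n = P.r x ^ n := by
    have := (mul_eq_zero.1 h2).resolve_right h3
    linarith
  exact (pow_left_inj₀ hR.le hr.le (by have := h.hn; omega)).1 h4

theorem r_zero (h : P.Admissible n) : P.r 0 = P.rc := by
  have hc := h.rc_pos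
  refine (h.r_unique hc ?_).symm
  have : n ≠ 0 := by have := h.hn; omega
  rw [div_self (by positivity)]
  simp [this]

theorem w_lt_one (h : P.Admissible n) {x : ℝ} (hx : x ≠ 0) : P.w x < 1 := by
  have h1 := h.abs_pow x
  have h2 : 0 < |x| ^ n := by positivity
  rw [h1] at h2
  have h3 := pow_pos (h.r_pos x) n
  nlinarith [(mul_pos_iff_of_pos_left h3).1 h2]

theorem rc_lt_r (h : P.Admissible n) {x : ℝ} (hx : x ≠ 0) : P.rc < P.r x := by
  have h1 := h.w_lt_one hx
  rw [h.w_eq, div_lt_one (pow_pos (h.r_pos x) _)] at h1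
  exact lt_of_pow_lt_pow_left₀ _ (h.r_pos x).le h1

theorem r_neg (h : P.Admissible n) (x : ℝ) : P.r (-x) = P.r x := by
  rw [h.r_eq, h.r_eq, abs_neg, Even.neg_pow (even_two_mul n)]

theorem w_neg (h : P.Admissible n) (x : ℝ) : P.w (-x) = P.w x := by
  unfold w; rw [h.r_neg]

theorem D_neg (h : P.Admissible n) (x : ℝ) : P.D (-x) = P.D x := by
  unfold D; rw [h.r_neg, h.w_neg, abs_neg]

theorem D_eq (h : P.Admissible n) (x : ℝ) : P.D x = (|x| / P.r x) ^ (n - 2) / (1 + P.w x) := by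
  unfold D; rw [h.hd, show n + 2 - 4 = n - 2 by omega]

theorem D_pos (h : P.Admissible n) {x : ℝ} (hx : x ≠ 0) : 0 < P.D x := by
  have h1 := h.r_pos x
  have h2 := h.w_pos x
  unfold D
  positivity

theorem one_sub_w (h : P.Admissible n) (x : ℝ) : 1 - P.w x = (|x| / P.r x) ^ n := by
  rw [div_pow, h.abs_pow, mul_div_cancel_left₀ _ (pow_pos (h.r_pos x) n).ne']

theorem one_sub_w_rpow (h : P.Admissible n) (x e : ℝ) :
    (1 - P.w x) ^ (e / n) = (|x| / P.r x) ^ e := by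
  have hn := h.cast_two_le
  have h1 : 0 ≤ |x| / P.r x := div_nonneg (abs_nonneg x) (h.r_pos x).le
  rw [h.one_sub_w, ← Real.rpow_natCast, ← Real.rpow_mul h1]
  congr 1
  field_simp

theorem inv_z_pow (P : Params) (x : ℝ) : (P.z x ^ (2 * P.d - 4))⁻¹ = P.w x := by
  unfold z w
  rw [← inv_pow, inv_div]

theorem inv_z_pow' (h : P.Admissible n) (x : ℝ) : (P.z x ^ (2 * n))⁻¹ = P.w x := by
  rw [← inv_z_pow, h.hd, show 2 * (n + 2) - 4 = 2 * n by omega]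

theorem Ω₂_eq (h : P.Admissible n) (x : ℝ) : P.Ω₂ x = (P.D x)⁻¹ := by
  unfold Ω₂
  rw [inv_z_pow, h.cast_d, show (n : ℝ) + 2 - 4 = ((n - 2 : ℕ) : ℝ) by
    rw [Nat.cast_sub h.hn]; push_cast; ring, show (n : ℝ) + 2 - 2 = n by ring, h.one_sub_w_rpow,
    Real.rpow_natCast, h.D_eq, inv_div]

theorem abs_lt_r (h : P.Admissible n) (x : ℝ) : |x| < P.r x := by
  have h1 := h.one_sub_w x
  have h2 := h.w_pos x
  have h3 : (|x| / P.r x) ^ n < 1 := by linarith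
  have h4 : |x| / P.r x < 1 := by
    by_contra! hc
    exact absurd h3 (not_lt.2 (one_le_pow₀ hc))
  rwa [div_lt_one (h.r_pos x)] at h4

theorem D_le_one (h : P.Admissible n) (x : ℝ) : P.D x ≤ 1 := by
  rw [h.D_eq, div_le_one (by linarith [h.w_pos x])]
  have h1 : |x| / P.r x ≤ 1 := (div_le_one (h.r_pos x)).2 (h.abs_lt_r x).le
  have h2 : 0 ≤ |x| / P.r x := div_nonneg (abs_nonneg x) (h.r_pos x).le
  linarith [pow_le_one₀ (n := n - 2) h2 h1, h.w_pos x]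

theorem continuous_r (h : P.Admissible n) : Continuous P.r := by
  have : P.r = fun x => ((|x| ^ n + √(x ^ (2 * n) + 4 * P.rc ^ (2 * n))) / 2) ^ (1 / (n : ℝ)) :=
    funext h.r_eq
  rw [this]
  refine Continuous.rpow_const (by fun_prop) fun x => Or.inl (h.r_base_pos x).ne'

theorem continuous_w (h : P.Admissible n) : Continuous P.w := by
  unfold w
  exact (continuous_const.div h.continuous_r fun x => (h.r_pos x).ne').pow _

theorem continuous_D (h : P.Admissible n) : Continuous P.D := by
  unfold D
  exact ((continuous_abs.div h.continuous_r fun x => (h.r_pos x).ne').pow _).div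
    (continuous_const.add h.continuous_w) fun x => by linarith [h.w_pos x]

/-- The identity `r r' = x D`. -/
theorem hasDerivAt_r (h : P.Admissible n) {x : ℝ} (hx : x ≠ 0) :
    HasDerivAt P.r (x * P.D x / P.r x) x := by
  have hpos : ∀ x : ℝ, 0 < x → HasDerivAt P.r (x * P.D x / P.r x) x := by
    intro x hx
    have hn := h.hn
    have hn' := h.cast_two_le
    have hc := h.rc_pos
    have hr := h.r_pos x
    have hw := h.w_pos x
    have hs : √(x ^ (2 * n) + 4 * P.rc ^ (2 * n)) = P.r x ^ n * (1 + P.w x) := by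
      have h1 := h.r_pow x
      have h2 := h.abs_pow x
      linarith
    have hbase : HasDerivAt (fun x : ℝ => (x ^ n + √(x ^ (2 * n) + 4 * P.rc ^ (2 * n))) / 2)
        (n * x ^ (n - 1) / (1 + P.w x)) x := by
      have h1 := ((hasDerivAt_pow (2 * n) x).add_const (4 * P.rc ^ (2 * n))).sqrt (by positivity)
      refine (((hasDerivAt_pow n x).fun_add h1).div_const 2).congr_deriv ?_
      rw [hs]
      have h2 := h.abs_pow x
      rw [abs_of_pos hx] at h2
      have h3 : x ^ (2 * n - 1) = x ^ (n - 1) * x ^ n := by rw [← pow_add]; congr 1; omega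
      have h4 : 0 < P.r x ^ n := by positivity
      rw [h3, h2]
      push_cast
      field_simp
      ring
    have h0 := h.r_base_pos x
    rw [abs_of_pos hx] at h0
    have h1 := hbase.rpow_const (p := 1 / (n : ℝ)) (Or.inl h0.ne')
    have h2 : (fun x : ℝ => ((x ^ n + √(x ^ (2 * n) + 4 * P.rc ^ (2 * n))) / 2) ^ (1 / (n : ℝ)))
        =ᶠ[𝓝 x] P.r := by
      filter_upwards [lt_mem_nhds hx] with y hy
      rw [h.r_eq, abs_of_pos hy]
    refine (h1.congr_of_eventuallyEq h2.symm).congr_deriv ?_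
    have h3 := h.r_pow x
    rw [abs_of_pos hx] at h3
    rw [← h3, h.D_eq, abs_of_pos hx, div_pow, ← Real.rpow_natCast (P.r x) n, ← Real.rpow_mul hr.le,
      show (n : ℝ) * (1 / (n : ℝ) - 1) = 1 - n by field_simp, Real.rpow_sub hr, Real.rpow_one,
      Real.rpow_natCast]
    obtain ⟨m, rfl⟩ : ∃ m, n = m + 2 := ⟨n - 2, by omega⟩
    simp only [Nat.add_sub_cancel, show m + 2 - 1 = m + 1 by omega]
    field_simp
    ring
  rcases lt_or_gt_of_ne hx with h1 | h1
  · refine (hasDerivAt_of_even h.r_neg (hpos (-x) (by linarith))).congr_deriv ?_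
    rw [h.r_neg, h.D_neg]; ring
  · exact hpos x h1

theorem hasDerivAt_w (h : P.Admissible n) {x : ℝ} (hx : x ≠ 0) :
    HasDerivAt P.w (-(2 * n) * P.w x * (x * P.D x / P.r x ^ 2)) x := by
  have hr := h.r_pos x
  have h1 := (h.hasDerivAt_r hx).fun_pow (2 * n)
  have h2 := (h1.fun_inv (by positivity)).const_mul (P.rc ^ (2 * n))
  have h3 : P.w = fun x => P.rc ^ (2 * n) * (P.r x ^ (2 * n))⁻¹ := by
    funext y; rw [h.w_eq, div_eq_mul_inv]
  rw [h3]
  refine h2.congr_deriv ?_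
  obtain ⟨m, hm⟩ : ∃ m, 2 * n = m + 1 := ⟨2 * n - 1, by have := h.hn; omega⟩
  have hm' : (2 * n : ℝ) = m + 1 := by exact_mod_cast hm
  rw [hm, hm', Nat.add_sub_cancel]
  push_cast
  field_simp
  ring

end Admissible
end Params
end EiBI

/-! ### The metric function and its derivatives -/

namespace EiBI

/-- Powers of functions whose derivative is given in logarithmic form. -/
theorem hasDerivAt_pow_log {f : ℝ → ℝ} {c x : ℝ} (h : HasDerivAt f (f x * c) x) (k : ℕ) :
    HasDerivAt (fun y => f y ^ k) (f x ^ k * (k * c)) x := by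
  refine (h.fun_pow k).congr_deriv ?_
  rcases k with _ | k
  · simp
  · rw [Nat.add_sub_cancel]; push_cast; ring

namespace Params

/-- The logarithmic derivative `x r' / r` of the area radius. -/
def pr (P : Params) (x : ℝ) : ℝ := x ^ 2 * P.D x / P.r x ^ 2

/-- The logarithmic derivative `x D' / D` of `D = 1 / Ω_(2)`. -/
def qD (P : Params) (x : ℝ) : ℝ :=
  ((P.d : ℝ) - 4) * (1 - P.pr x) + (2 * P.d - 4) * P.pr x * (P.w x / (1 + P.w x))

/-- The derivative `x q'` of `q = x D' / D`. -/
def qD' (P : Params) (x : ℝ) : ℝ :=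
  P.pr x * (2 + P.qD x - 2 * P.pr x) * (-((P.d : ℝ) - 4) + (2 * P.d - 4) * (P.w x / (1 + P.w x)))
    - (2 * P.d - 4) * P.pr x * ((2 * P.d - 4) * P.w x * P.pr x / (1 + P.w x) ^ 2)

/-- The derivative of `A`. -/
def A₁ (P : Params) (x : ℝ) : ℝ :=
  (((P.d : ℝ) - 3) * (1 - P.A x) - (P.r x ^ 2 - x ^ 2) / P.lε ^ 2) / x

/-- The second derivative of `A`. -/
def A₂ (P : Params) (x : ℝ) : ℝ :=
  -(((P.d : ℝ) - 2) * P.A₁ x / x) + 2 * (1 - P.D x) / P.lε ^ 2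

variable {P : Params} {n : ℕ}

namespace Admissible

theorem pr_neg (h : P.Admissible n) (x : ℝ) : P.pr (-x) = P.pr x := by
  unfold pr; rw [h.D_neg, h.r_neg, neg_sq]

theorem qD_neg (h : P.Admissible n) (x : ℝ) : P.qD (-x) = P.qD x := by
  unfold qD; rw [h.pr_neg, h.w_neg]

theorem A_neg (h : P.Admissible n) (x : ℝ) : P.A (-x) = P.A x := by
  unfold A mass z; rw [h.r_neg, abs_neg]

theorem one_lt_z (h : P.Admissible n) {x : ℝ} (hx : x ≠ 0) : 1 < P.z x :=
  (one_lt_div h.rc_pos).2 (h.rc_lt_r hx)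

theorem hasDerivAt_r' (h : P.Admissible n) {x : ℝ} (hx : x ≠ 0) :
    HasDerivAt P.r (P.r x * (P.pr x / x)) x := by
  refine (h.hasDerivAt_r hx).congr_deriv ?_
  have := h.r_pos x
  unfold pr
  field_simp

theorem hasDerivAt_w' (h : P.Admissible n) {x : ℝ} (hx : x ≠ 0) :
    HasDerivAt P.w (-(2 * n) * P.w x * P.pr x / x) x := by
  refine (h.hasDerivAt_w hx).congr_deriv ?_
  have := h.r_pos x
  unfold pr
  field_simp

theorem qD_eq (h : P.Admissible n) (x : ℝ) :
    P.qD x = ((n : ℝ) - 2) * (1 - P.pr x) + 2 * n * P.pr x * (P.w x / (1 + P.w x)) := by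
  unfold qD; rw [h.cast_d]; ring

theorem hasDerivAt_D (h : P.Admissible n) {x : ℝ} (hx : x ≠ 0) :
    HasDerivAt P.D (P.D x * (P.qD x / x)) x := by
  have hpos : ∀ x : ℝ, 0 < x → HasDerivAt P.D (P.D x * (P.qD x / x)) x := by
    intro x hx
    have hr := h.r_pos x
    have hw := h.w_pos x
    have h1 : HasDerivAt (fun y => y / P.r y) (x / P.r x * ((1 - P.pr x) / x)) x := by
      refine ((hasDerivAt_id' x).fun_div (h.hasDerivAt_r' hx.ne') hr.ne').congr_deriv ?_
      field_simp
    have h2 := (hasDerivAt_pow_log h1 (n - 2)).fun_div ((h.hasDerivAt_w' hx.ne').const_add 1)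
      (by positivity)
    have h3 : P.D =ᶠ[𝓝 x] fun y => (y / P.r y) ^ (n - 2) / (1 + P.w y) := by
      filter_upwards [lt_mem_nhds hx] with y hy
      rw [h.D_eq, abs_of_pos hy]
    refine (h2.congr_of_eventuallyEq h3).congr_deriv ?_
    rw [h.qD_eq, h.D_eq, abs_of_pos hx, Nat.cast_sub h.hn]
    push_cast
    field_simp
    ring
  rcases lt_or_gt_of_ne hx with h1 | h1
  · refine (hasDerivAt_of_even h.D_neg (hpos (-x) (by linarith))).congr_deriv ?_
    rw [h.D_neg, h.qD_neg]; field_simp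
  · exact hpos x h1

theorem hasDerivAt_pr (h : P.Admissible n) {x : ℝ} (hx : x ≠ 0) :
    HasDerivAt P.pr (P.pr x * (2 + P.qD x - 2 * P.pr x) / x) x := by
  have hr := h.r_pos x
  have h1 := ((hasDerivAt_pow 2 x).fun_mul (h.hasDerivAt_D hx)).fun_div
    ((h.hasDerivAt_r' hx).fun_pow 2) (by positivity)
  refine h1.congr_deriv ?_
  have h2 : P.D x = P.pr x * P.r x ^ 2 / x ^ 2 := by unfold pr; field_simp
  rw [h2]
  simp only [Nat.add_one_sub_one, pow_one]
  push_cast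
  field_simp

theorem hasDerivAt_qD (h : P.Admissible n) {x : ℝ} (hx : x ≠ 0) :
    HasDerivAt P.qD (P.qD' x / x) x := by
  have hw := h.w_pos x
  have h1 := h.hasDerivAt_pr hx
  have h2 := (h.hasDerivAt_w' hx).fun_div ((h.hasDerivAt_w' hx).const_add 1)
    (by positivity : 1 + P.w x ≠ 0)
  refine (((h1.const_sub 1).const_mul ((P.d : ℝ) - 4)).fun_add
    ((h1.const_mul (2 * (P.d : ℝ) - 4)).fun_mul h2)).congr_deriv ?_
  unfold qD'
  rw [h.cast_d]
  field_simp
  ring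

theorem mul_D (h : P.Admissible n) (x : ℝ) :
    P.r x ^ (n - 2) * (1 + P.w x) * P.D x = |x| ^ (n - 2) := by
  have hr := h.r_pos x
  have hw := h.w_pos x
  rw [h.D_eq, div_pow]
  field_simp

theorem mass_eq (h : P.Admissible n) (x : ℝ) :
    P.mass x = P.M₀ + ((n : ℝ) - 1) * P.rc ^ (n + 1) / (2 * P.lε ^ 2) * G (n + 2) (P.z x) := by
  unfold mass
  rw [h.cast_d, h.hd, show n + 2 - 1 = n + 1 by omega]
  ring

theorem A_eq (h : P.Admissible n) (x : ℝ) :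
    P.A x = 1 - 2 * P.mass x / (((n : ℝ) - 1) * |x| ^ (n - 1)) := by
  unfold A
  rw [h.cast_d, h.hd, show n + 2 - 3 = n - 1 by omega]
  ring

theorem A₁_eq (h : P.Admissible n) (x : ℝ) :
    P.A₁ x = (((n : ℝ) - 1) * (1 - P.A x) - (P.r x ^ 2 - x ^ 2) / P.lε ^ 2) / x := by
  unfold A₁; rw [h.cast_d]; ring

theorem A₂_eq (h : P.Admissible n) (x : ℝ) :
    P.A₂ x = -(n * P.A₁ x / x) + 2 * (1 - P.D x) / P.lε ^ 2 := by
  unfold A₂; rw [h.cast_d]; ring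

/-- Up to a constant factor, `M' = x^{n-2} (r² - x²)`: the powers of `1 - w` in the derivative of `G_d`
combine with `r'`. -/
theorem hasDerivAt_mass (h : P.Admissible n) {x : ℝ} (hx : 0 < x) :
    HasDerivAt P.mass
      (((n : ℝ) - 1) / (2 * P.lε ^ 2) * ((P.r x ^ 2 - x ^ 2) * x ^ (n - 2))) x := by
  have hr := h.r_pos x
  have hc := h.rc_pos
  have hw := h.w_pos x
  have hz : HasDerivAt P.z (x * P.D x / P.r x / P.rc) x := (h.hasDerivAt_r hx.ne').div_const _
  have hG := (G_hasDerivAt h.hn (h.one_lt_z hx.ne')).comp x hz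
  have h1 := (hG.const_mul (((n : ℝ) - 1) * P.rc ^ (n + 1) / (2 * P.lε ^ 2))).const_add P.M₀
  have h2 : P.mass = fun x => P.M₀ + ((n : ℝ) - 1) * P.rc ^ (n + 1) / (2 * P.lε ^ 2)
    * (G (n + 2) ∘ P.z) x := funext h.mass_eq
  rw [h2]
  refine h1.congr_deriv ?_
  have h3 := h.one_sub_w_rpow x (-1)
  have h4 := h.one_sub_w_rpow x 1
  rw [show (-1 : ℝ) / n = -(1 / (n : ℝ)) by ring, abs_of_pos hx, Real.rpow_neg_one] at h3
  rw [abs_of_pos hx, Real.rpow_one] at h4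
  have h5 := h.mul_D x
  rw [abs_of_pos hx] at h5
  rw [h.inv_z_pow', h3, h4, ← h5]
  have hl := h.lε_pos
  unfold z
  obtain ⟨m, rfl⟩ : ∃ m, n = m + 2 := ⟨n - 2, by have := h.hn; omega⟩
  simp only [Nat.add_sub_cancel]
  rw [div_pow]
  field_simp
  ring

/-- The first-order linear equation `x A' = (n - 1) (1 - A) - (r² - x²) / l_ε²`. -/
theorem hasDerivAt_A (h : P.Admissible n) {x : ℝ} (hx : x ≠ 0) :
    HasDerivAt P.A (P.A₁ x) x := by
  have hpos : ∀ x : ℝ, 0 < x → HasDerivAt P.A (P.A₁ x) x := by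
    intro x hx
    have hn := h.cast_two_le
    have hn1 : (n : ℝ) - 1 ≠ 0 := by linarith
    have hl := h.lε_pos
    have h1 := (((h.hasDerivAt_mass hx).const_mul 2).fun_div
      ((hasDerivAt_pow (n - 1) x).const_mul ((n : ℝ) - 1)) (by positivity)).const_sub 1
    have h3 : P.A =ᶠ[𝓝 x] fun y => 1 - 2 * P.mass y / (((n : ℝ) - 1) * y ^ (n - 1)) := by
      filter_upwards [lt_mem_nhds hx] with y hy
      rw [h.A_eq, abs_of_pos hy]
    refine (h1.congr_of_eventuallyEq h3).congr_deriv ?_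
    rw [h.A₁_eq, h.A_eq, abs_of_pos hx]
    obtain ⟨m, rfl⟩ : ∃ m, n = m + 2 := ⟨n - 2, by have := h.hn; omega⟩
    simp only [Nat.add_sub_cancel, show m + 2 - 1 = m + 1 by omega]
    push_cast at hn1 ⊢
    field_simp
    ring
  rcases lt_or_gt_of_ne hx with h1 | h1
  · refine (hasDerivAt_of_even h.A_neg (hpos (-x) (by linarith))).congr_deriv ?_
    rw [h.A₁_eq, h.A₁_eq, h.A_neg, h.r_neg]; field_simp
  · exact hpos x h1

theorem hasDerivAt_A₁ (h : P.Admissible n) {x : ℝ} (hx : x ≠ 0) :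
    HasDerivAt P.A₁ (P.A₂ x) x := by
  have hr := h.r_pos x
  have hl := h.lε_pos
  have h1 := ((((h.hasDerivAt_A hx).const_sub 1).const_mul ((n : ℝ) - 1)).fun_sub
    ((((h.hasDerivAt_r hx).fun_pow 2).fun_sub (hasDerivAt_pow 2 x)).div_const (P.lε ^ 2))).fun_div
    (hasDerivAt_id' x) hx
  have h2 : P.A₁ = fun x => (((n : ℝ) - 1) * (1 - P.A x) - (P.r x ^ 2 - x ^ 2) / P.lε ^ 2) / x :=
    funext h.A₁_eq
  rw [h2]
  refine h1.congr_deriv ?_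
  rw [h.A₂_eq, h.A₁_eq]
  simp only [Nat.add_one_sub_one, pow_one]
  push_cast
  field_simp
  ring

end Admissible
end Params
end EiBI

/-! ### The solution of the field equations -/

namespace EiBI

section
variable {d : ℕ}

theorem elim_iT (u v : ℝ) (f : Fin (d - 2) → ℝ) : Sum.elim ![u, v] f (iT : Idx d) = u := rfl

theorem elim_iX (u v : ℝ) (f : Fin (d - 2) → ℝ) : Sum.elim ![u, v] f (iX : Idx d) = v := rfl

theorem ssMetric_isSymm (a b r : ℝ → ℝ) (p : Idx d → ℝ) : (ssMetric a b r p).IsSymm :=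
  Matrix.diagonal_transpose _

theorem det_ssMetric_neg {a b r : ℝ → ℝ} {p : Idx d → ℝ} (hab : a (p iX) * b (p iX) < 0)
    (hr : r (p iX) ≠ 0) : (ssMetric a b r p).det < 0 := by
  have := sphereFactor_pos p
  rw [det_ssMetric]
  exact mul_neg_of_neg_of_pos hab (by positivity)

theorem profileAt_static {B B₁ ρ ρ₁ : ℝ → ℝ} {B₂ ρ₂ x : ℝ}
    (hB : ∀ᶠ y in 𝓝 x, HasDerivAt B (B₁ y) y) (hρ : ∀ᶠ y in 𝓝 x, HasDerivAt ρ (ρ₁ y) y)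
    (hB₁ : HasDerivAt B₁ B₂ x) (hρ₁ : HasDerivAt ρ₁ ρ₂ x) (hB0 : B x ≠ 0) (hρ0 : ρ x ≠ 0) :
    ProfileAt (fun y => -B y) (fun y => -B₁ y) (fun y => 1 / B y) (fun y => -(B₁ y / B y ^ 2)) ρ ρ₁
      (-B₂) (-((B₂ * B x ^ 2 - B₁ x * (2 * B x * B₁ x)) / (B x ^ 2) ^ 2)) ρ₂ x where
  ha := hB.mono fun y h => h.neg
  hb := by
    filter_upwards [hB, hB.self_of_nhds.continuousAt.eventually_ne hB0] with y h h0
    simpa [one_div, neg_div] using h.fun_inv h0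
  hr := hρ
  ha₁ := hB₁.neg
  hb₁ := by
    have h := hB₁.fun_div (hB.self_of_nhds.fun_pow 2) (pow_ne_zero 2 hB0)
    simpa using h.fun_neg
  hr₁ := hρ₁
  ha0 := neg_ne_zero.2 hB0
  hb0 := one_div_ne_zero hB0
  hr0 := hρ0

/-- The Ricci tensor of `-B dt² + dx²/B + ρ² dΩ²`. -/
theorem ricci_static {B B₁ ρ ρ₁ : ℝ → ℝ} {B₂ ρ₂ : ℝ} {p : Idx d → ℝ}
    (hB : ∀ᶠ y in 𝓝 (p iX), HasDerivAt B (B₁ y) y)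
    (hρ : ∀ᶠ y in 𝓝 (p iX), HasDerivAt ρ (ρ₁ y) y)
    (hB₁ : HasDerivAt B₁ B₂ (p iX)) (hρ₁ : HasDerivAt ρ₁ ρ₂ (p iX))
    (hB0 : B (p iX) ≠ 0) (hρ0 : ρ (p iX) ≠ 0) :
    Matrix.of (ricci (christoffel (ssMetric (fun y => -B y) (fun y => 1 / B y) ρ)) p)
      = Matrix.diagonal (Sum.elim
        ![B (p iX) * (B₂ / 2 + (d - 2 : ℕ) * (B₁ (p iX) * ρ₁ (p iX) / (2 * ρ (p iX)))),
          -(1 / B (p iX) * (B₂ / 2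
            + (d - 2 : ℕ) * ((ρ₂ * B (p iX) + ρ₁ (p iX) * B₁ (p iX) / 2) / ρ (p iX))))]
        fun _ => sphereFactor p ^ 2 * (-(ρ (p iX) * (B₁ (p iX) * ρ₁ (p iX) + ρ₂ * B (p iX)))
            + ((d - 2 : ℕ) - 1) * (1 - B (p iX) * ρ₁ (p iX) ^ 2))) := by
  rw [(profileAt_static hB hρ hB₁ hρ₁ hB0 hρ0).ricci_eq rfl rfl rfl rfl]
  congr 1
  funext i
  revert i
  refine forall_idx ?_ ?_ fun i => ?_
  · simp only [elim_iT]
    field_simp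
    ring
  · simp only [elim_iX]
    field_simp
    ring
  · simp only [Sum.elim_inr]
    field_simp
    ring

/-- The field equations for a Coulomb field follow from `g + ε R(Γ) = q` near the point, for
`q = -B dt² + dx²/B + ρ² dΩ²` with its Levi-Civita connection, and from the three scalar equations of
`metric_equation_iff`. -/
theorem isSolutionAt_coulomb {lP ε Q : ℝ} {a b r B ρ : ℝ → ℝ} {p : Idx d → ℝ}
    (hd : 4 ≤ d) (hB : B (p iX) ≠ 0) (hρ : ρ (p iX) ≠ 0)
    (hab : ∀ᶠ x in 𝓝 (p iX), a x * b x < 0) (hr : ∀ᶠ x in 𝓝 (p iX), 0 < r x)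
    (hBd : DifferentiableAt ℝ B (p iX)) (hρd : DifferentiableAt ℝ ρ (p iX))
    (haux : auxiliary ε (ssMetric a b r)
        (christoffel (ssMetric (fun x => -B x) (fun x => 1 / B x) ρ))
      =ᶠ[𝓝 p] ssMetric (fun x => -B x) (fun x => 1 / B x) ρ)
    {w S : ℝ} (hw : w = -ε * lP ^ (2 * d - 6) * (Q / r (p iX) ^ (d - 2)) ^ 2)
    (hS : S = √(-(a (p iX) * b (p iX))) * r (p iX) ^ (d - 2))
    (h1 : |ρ (p iX)| ^ (d - 2) * (-B (p iX))⁻¹ = S * (1 - w) * (a (p iX))⁻¹)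
    (h2 : |ρ (p iX)| ^ (d - 2) * B (p iX) = S * (1 - w) * (b (p iX))⁻¹)
    (h3 : |ρ (p iX)| ^ (d - 2) * (ρ (p iX) ^ 2)⁻¹ = S * (1 + w) * (r (p iX) ^ 2)⁻¹) :
    IsSolutionAt d ε 1 lP (ssMetric a b r)
      (christoffel (ssMetric (fun x => -B x) (fun x => 1 / B x) ρ)) (coulombField Q a b r) p := by
  have hp := haux.self_of_nhds
  have hneg : (ssMetric (fun x => -B x) (fun x => 1 / B x) ρ p).det < 0 :=
    det_ssMetric_neg (by simp [hB]) hρ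
  refine ⟨ssMetric_isSymm _ _ _ _, det_ssMetric_neg hab.self_of_nhds hr.self_of_nhds.ne', ?_, ?_, ?_,
    ?_, ?_, coulombField_antisymm _ _ _ _ _, maxwell_coulombField hab hr,
    bianchi_coulombField _ _ _ _ _⟩
  · rw [hp]; exact ssMetric_isSymm _ _ _ _
  · rwa [hp]
  · intro α μ ν
    unfold christoffel
    congr 1
    refine Finset.sum_congr rfl fun β _ => ?_
    have : ∀ x : Idx d → ℝ, ssMetric (fun x => -B x) (fun x => 1 / B x) ρ x μ ν
        = ssMetric (fun x => -B x) (fun x => 1 / B x) ρ x ν μ := fun x =>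
      (congrFun (congrFun (ssMetric_isSymm (fun x => -B x) (fun x => 1 / B x) ρ x) ν) μ)
    simp only [this]
    ring
  · rw [hp]
    exact (metric_equation_iff hd hB hρ hab.self_of_nhds hr.self_of_nhds hw hS).2 ⟨h1, h2, h3⟩
  · intro κ μ ν W
    have hW : W =ᶠ[𝓝 p] fun x => √(-(ssMetric (fun x => -B x) (fun x => 1 / B x) ρ x).det) •
        (ssMetric (fun x => -B x) (fun x => 1 / B x) ρ x)⁻¹ := haux.mono fun x hx => by
      simp only [W, hx]
    rw [hW.self_of_nhds, pd_congr (hW.mono fun x hx => congrFun (congrFun hx μ) ν)]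
    have key := density_parallel (H := ssDiag (fun x => -B x) (fun x => 1 / B x) ρ) (p := p)
      (forall_idx (by simpa using hB) (by simpa using hB) fun i => by
        simp [hρ, (sphereFactor_pos p).ne']) ?_ ?_ κ μ ν
    · exact key
    · rw [← Matrix.det_diagonal]; exact hneg
    · intro κ i
      have hs : ∀ κ : Idx d, DifferentiableAt ℝ
          (fun s => sphereFactor (Function.update p κ s)) (p κ) :=
        forall_idx (by simp) (by simp)
          fun j => (hasDerivAt_sphereFactor_update p j).differentiableAt
      have hc : ∀ φ : ℝ → ℝ, DifferentiableAt ℝ φ (p iX) → ∀ κ : Idx d,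
          DifferentiableAt ℝ (fun s => φ (Function.update p κ s iX)) (p κ) := fun φ hφ =>
        forall_idx (by simp) (by simpa using hφ) fun j => by simp
      revert i
      refine forall_idx ?_ ?_ fun i => ?_
      · simpa only [ssDiag_iT] using hc (fun x => -B x) hBd.fun_neg κ
      · simpa only [ssDiag_iX] using hc (fun x => 1 / B x) ((differentiableAt_const _).fun_div hBd hB) κ
      · simpa only [ssDiag_inr] using ((hc _ hρd κ).fun_pow 2).fun_mul ((hs κ).fun_pow 2)
end

namespace Params
variable {P : Params} {n : ℕ}

theorem eventually_mem_domain (h : P.Admissible n) {x : ℝ} (hx : x ≠ 0) (hA : P.A x ≠ 0) :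
    ∀ᶠ y in 𝓝 x, y ≠ 0 ∧ P.A y ≠ 0 :=
  (eventually_ne_nhds hx).and ((h.hasDerivAt_A hx).continuousAt.eventually_ne hA)

namespace Admissible

theorem gtt_eq (h : P.Admissible n) (x : ℝ) : P.gtt x = -(P.A x * P.D x) := by
  unfold gtt; rw [h.Ω₂_eq, div_inv_eq_mul]

theorem gxx_eq (h : P.Admissible n) (x : ℝ) : P.gxx x = P.D x / P.A x := by
  unfold gxx; rw [h.Ω₂_eq, one_div, mul_inv, inv_inv, div_eq_mul_inv, mul_comm]

theorem gtt_mul_gxx (h : P.Admissible n) {x : ℝ} (hA : P.A x ≠ 0) :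
    P.gtt x * P.gxx x = -P.D x ^ 2 := by
  rw [h.gtt_eq, h.gxx_eq]; field_simp

/-- The identity `g + ε R = q`: its components are the first- and second-order equations for `A`. -/
theorem auxiliary_eq (h : P.Admissible n) {p : Idx P.d → ℝ} (hp : p ∈ P.domain) :
    auxiliary P.ε P.metric (christoffel P.auxMetric) p = P.auxMetric p := by
  obtain ⟨hx, hA⟩ := hp
  have hl := h.lε_pos
  have hl2 := h.lε_sq
  have hD := (h.D_pos hx).ne'
  have hr := h.r_pos (p iX)
  have hev : ∀ᶠ y in 𝓝 (p iX), HasDerivAt P.A (P.A₁ y) y :=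
    (eventually_ne_nhds hx).mono fun y hy => h.hasDerivAt_A hy
  have hR := ricci_static (d := P.d) (p := p) (ρ := fun x => x) (ρ₁ := fun _ => 1) hev
    (Eventually.of_forall fun y => hasDerivAt_id' y) (h.hasDerivAt_A₁ hx) (hasDerivAt_const _ _) hA hx
  have hcast : ((P.d - 2 : ℕ) : ℝ) = n := by rw [h.hd, Nat.add_sub_cancel]
  have hε : P.ε = -P.lε ^ 2 := by rw [hl2]; ring
  unfold auxiliary auxMetric
  rw [hR, metric, ssMetric_eq, ssMetric_eq, ← Matrix.diagonal_smul]
  beta_reduce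
  rw [Matrix.diagonal_add, hε]
  congr 1
  funext i
  revert i
  have hA₁ := h.A₁_eq (p iX)
  have hA₂ := h.A₂_eq (p iX)
  refine forall_idx ?_ ?_ fun i => ?_
  · simp only [elim_iT, ssDiag_iT, Pi.smul_apply, smul_eq_mul, hcast, h.gtt_eq, hA₂]
    field_simp
    ring
  · simp only [elim_iX, ssDiag_iX, Pi.smul_apply, smul_eq_mul, hcast, h.gxx_eq, hA₂]
    field_simp
    ring
  · simp only [Sum.elim_inr, ssDiag_inr, Pi.smul_apply, smul_eq_mul, hcast, hA₁]
    field_simp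
    ring

theorem isSolutionAt (h : P.Admissible n) {p : Idx P.d → ℝ} (hp : p ∈ P.domain) :
    IsSolutionAt P.d P.ε 1 P.lP P.metric (christoffel P.auxMetric) P.field p := by
  obtain ⟨hx, hA⟩ := hp
  have hD := h.D_pos hx
  have hr := h.r_pos (p iX)
  have hd : P.d - 2 = n := by rw [h.hd, Nat.add_sub_cancel]
  have hw := h.abs_pow (p iX)
  have hev := eventually_mem_domain h hx hA
  have hs : √(-(P.gtt (p iX) * P.gxx (p iX))) = P.D (p iX) := by
    rw [h.gtt_mul_gxx hA, neg_neg, Real.sqrt_sq hD.le]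
  refine isSolutionAt_coulomb (by have := h.hn; have := h.hd; omega) hA hx ?_
    (Eventually.of_forall h.r_pos) (h.hasDerivAt_A hx).differentiableAt differentiableAt_id ?_
    (w := P.w (p iX)) (S := P.D (p iX) * P.r (p iX) ^ n) ?_ ?_ ?_ ?_ ?_
  · filter_upwards [hev] with y hy
    rw [h.gtt_mul_gxx hy.2]
    have := h.D_pos hy.1
    nlinarith
  · filter_upwards [(tendsto_iX_nhds p).eventually hev] with q hq
    exact h.auxiliary_eq hq
  · rw [h.w_eq, h.rc_pow, h.lε_sq, hd]
    field_simp
    ring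
  · rw [hs, hd]
  · rw [hd, hw, h.gtt_eq]
    field_simp
  · rw [hd, hw, h.gxx_eq]
    field_simp
  · have h1 := h.mul_D (p iX)
    have h2 : |p iX| ^ n = |p iX| ^ (n - 2) * p iX ^ 2 := by
      rw [← sq_abs (p iX), ← pow_add]; congr 1; have := h.hn; omega
    have h3 : P.r (p iX) ^ n = P.r (p iX) ^ (n - 2) * P.r (p iX) ^ 2 := by
      rw [← pow_add]; congr 1; have := h.hn; omega
    rw [hd, h2, ← h1, h3]
    field_simp

/-- The metric function in terms of the dimensionless parameters. -/
theorem A_closed_form (h : P.Admissible n) (hM : P.M₀ ≠ 0) {x : ℝ} (hx : x ≠ 0) :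
    P.A x = 1 - (1 + P.δ₁ * G P.d (P.z x)) /
        (P.δ₂ * P.Ωₙ x ^ (((P.d : ℝ) - 3) / 2) * P.z x ^ (P.d - 3)) := by
  have hr := h.r_pos x
  have hc := h.rc_pos
  have hl := h.lε_pos
  have hn := h.cast_two_le
  have hx' := abs_pos.2 hx
  have hn1 : (n : ℝ) - 1 ≠ 0 := by linarith
  have hΩ : P.Ωₙ x ^ (((P.d : ℝ) - 3) / 2) = (|x| / P.r x) ^ (n - 1) := by
    unfold Ωₙ
    rw [inv_z_pow, h.cast_d, show (n : ℝ) + 2 - 2 = n by ring, h.one_sub_w_rpow,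
      ← Real.rpow_mul (by positivity), ← Real.rpow_natCast, Nat.cast_sub (by linarith [h.hn])]
    congr 1
    push_cast
    ring
  rw [hΩ, h.A_eq, h.mass_eq]
  unfold δ₁ δ₂ z
  rw [h.cast_d, h.hd, show n + 2 - 1 = n + 1 by omega, show n + 2 - 3 = n - 1 by omega, div_pow,
    div_pow, show (n : ℝ) + 2 - 3 = n - 1 by ring]
  field_simp

end Admissible
end Params
end EiBI

/-! ### The general solution -/

namespace EiBI

theorem ContDiffOn.hasDerivAt_deriv {f : ℝ → ℝ} {J : Set ℝ} (hJ : IsOpen J)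
    (hf : ContDiffOn ℝ 2 f J) {x : ℝ} (hx : x ∈ J) :
    HasDerivAt f (deriv f x) x ∧ HasDerivAt (deriv f) (deriv (deriv f) x) x := by
  have h2 : ContDiffOn ℝ (1 + 1) f J := by rwa [one_add_one_eq_two]
  have h1 := (contDiffOn_succ_iff_deriv_of_isOpen hJ).1 h2
  exact ⟨(h1.1.differentiableAt (hJ.mem_nhds hx)).hasDerivAt,
    ((h1.2.2.differentiableOn one_ne_zero).differentiableAt (hJ.mem_nhds hx)).hasDerivAt⟩

namespace Params
variable {P : Params} {n : ℕ}

namespace Admissible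

theorem with_mass (h : P.Admissible n) (M : ℝ) : ({ P with M₀ := M } : Params).Admissible n :=
  ⟨h.hd, h.hn, h.hε, h.hlP, h.hQ⟩

/-- The metric equation is algebraic, and determines the space-time metric in terms of the auxiliary
one. -/
theorem eq_of_metric_equation (h : P.Admissible n) {a b r B ρ S w : ℝ} (hab : a * b < 0)
    (hr : P.rc < r) (hB : B ≠ 0) (hρ : 0 < ρ) (hw : w = P.rc ^ (2 * n) / r ^ (2 * n))
    (hS : S = √(-(a * b)) * r ^ n)
    (h1 : |ρ| ^ n * (-B)⁻¹ = S * (1 - w) * a⁻¹) (h2 : |ρ| ^ n * B = S * (1 - w) * b⁻¹)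
    (h3 : |ρ| ^ n * (ρ ^ 2)⁻¹ = S * (1 + w) * (r ^ 2)⁻¹) :
    r = P.r ρ ∧ a = -(B * P.D ρ) ∧ b = P.D ρ / B := by
  have hc := h.rc_pos
  have hr0 : 0 < r := hc.trans hr
  have ha0 := left_ne_zero_of_mul hab.ne
  have hb0 := right_ne_zero_of_mul hab.ne
  set s := √(-(a * b)) with hs
  have hs0 : 0 < s := Real.sqrt_pos.2 (by linarith)
  have hs2 : s ^ 2 = -(a * b) := Real.sq_sqrt (by linarith)
  have hρn : 0 < |ρ| ^ n := by positivity
  have hw0 : 0 < w := by rw [hw]; positivity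
  have hw1 : w < 1 := by
    rw [hw, div_lt_one (by positivity)]
    exact pow_lt_pow_left₀ hr hc.le (by have := h.hn; omega)
  have ea : a * |ρ| ^ n = -(B * (S * (1 - w))) := by
    field_simp at h1
    linarith
  have eb : b * B * |ρ| ^ n = S * (1 - w) := by
    field_simp at h2
    linarith
  have hq : (s * |ρ| ^ n) ^ 2 = (s * (r ^ n * (1 - w))) ^ 2 := by
    have : (a * |ρ| ^ n) * (b * B * |ρ| ^ n) = -(B * (S * (1 - w))) * (S * (1 - w)) := by
      rw [ea, eb]
    have e : a * b * (|ρ| ^ n) ^ 2 = -(S * (1 - w)) ^ 2 :=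
      mul_left_cancel₀ hB (by linear_combination this)
    rw [mul_pow, hs2, hS] at *
    linear_combination -e
  -- the product of the `(t, t)` and `(x, x)` equations is free of `B`
  have hρr : |ρ| ^ n = r ^ n * (1 - w) := by
    have := (pow_left_inj₀ (by positivity) (by have : 0 < 1 - w := by linarith
                                               positivity) two_ne_zero).1 hq
    exact mul_left_cancel₀ hs0.ne' this
  have hrr : r = P.r ρ := h.r_unique hr0 (by rw [hρr, hw])
  have hww : w = P.w ρ := by rw [hw, h.w_eq, hrr]
  -- the angular equation then determines `√(-a b)`
  have hsD : s = P.D ρ := by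
    have h5 := h.mul_D ρ
    rw [← hrr, ← hww] at h5
    have e1 : |ρ| ^ n = |ρ| ^ (n - 2) * ρ ^ 2 := by
      rw [← sq_abs ρ, ← pow_add]; congr 1; have := h.hn; omega
    have e2 : r ^ n = r ^ (n - 2) * r ^ 2 := by
      rw [← pow_add]; congr 1; have := h.hn; omega
    rw [hS, e1, ← h5, e2] at h3
    field_simp at h3
    exact h3.symm
  refine ⟨hrr, ?_, ?_⟩
  · refine mul_right_cancel₀ hρn.ne' ?_
    rw [ea, hS, ← hsD, hρr]; ring
  · rw [eq_div_iff hB]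
    refine mul_right_cancel₀ hρn.ne' ?_
    rw [eb, hS, ← hsD, hρr]; ring

/-- The metric equation expresses `g` by `B` and `ρ`. In `g + ε R = q`, the `(t, t)` and `(x, x)`
components differ by a multiple of `ρ''`, so that `ρ` is affine, and the angular components are the linear
equation for `A` along `ρ`, whose solutions differ by the mass. -/
theorem general_solution (h : P.Admissible n) {J : Set ℝ} {a b r B ρ : ℝ → ℝ} (hJ : IsOpen J)
    (hJc : J.OrdConnected) (hJn : J.Nonempty) (hB : ContDiffOn ℝ 2 B J) (hρ : ContDiffOn ℝ 2 ρ J)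
    (hpos : ∀ x ∈ J, B x ≠ 0 ∧ 0 < ρ x ∧ P.rc < r x)
    (hsol : ∀ p : Idx P.d → ℝ, p iX ∈ J →
        IsSolutionAt P.d P.ε 1 P.lP (ssMetric a b r)
          (christoffel (ssMetric (fun x => -B x) (fun x => 1 / B x) ρ)) (coulombField P.Q a b r) p ∧
        auxiliary P.ε (ssMetric a b r)
          (christoffel (ssMetric (fun x => -B x) (fun x => 1 / B x) ρ)) p
          = ssMetric (fun x => -B x) (fun x => 1 / B x) ρ p) :
    ∃ k m : ℝ, (∀ x ∈ J, ρ x = k * x + m) ∧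
      (k ≠ 0 → ∃ M : ℝ, ∀ x ∈ J,
        B x = Params.A { P with M₀ := M } (ρ x) / k ^ 2 ∧
        a x = -(B x / P.Ω₂ (ρ x)) ∧ b x = 1 / (B x * P.Ω₂ (ρ x)) ∧ r x = P.r (ρ x)) := by
  have hd : P.d - 2 = n := by rw [h.hd, Nat.add_sub_cancel]
  have hn := h.cast_two_le
  have hl := h.lε_pos
  have hε : P.ε = -P.lε ^ 2 := by rw [h.lε_sq]; ring
  have hBd := fun x (hx : x ∈ J) => ContDiffOn.hasDerivAt_deriv hJ hB hx
  have hρd := fun x (hx : x ∈ J) => ContDiffOn.hasDerivAt_deriv hJ hρ hx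
  -- the metric equation
  have halg : ∀ x ∈ J, r x = P.r (ρ x) ∧ a x = -(B x * P.D (ρ x)) ∧ b x = P.D (ρ x) / B x := by
    intro x hx
    obtain ⟨hB0, hρ0, hrc⟩ := hpos x hx
    have hr0 : 0 < r x := h.rc_pos.trans hrc
    obtain ⟨hs, haux⟩ := hsol (fun _ => x) hx
    have hdet := hs.metric_det
    have hσ := sphereFactor_pos (fun _ : Idx P.d => x)
    rw [det_ssMetric] at hdet
    have hab : a x * b x < 0 := by
      by_contra! hc
      exact absurd hdet (not_lt.2 (mul_nonneg hc (by positivity)))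
    have hm := hs.metric_eq
    rw [haux] at hm
    obtain ⟨h1, h2, h3⟩ := (metric_equation_iff (p := fun _ : Idx P.d => x)
      (by have := h.hn; have := h.hd; omega) hB0 hρ0.ne' hab hr0 rfl rfl).1 hm
    rw [hd] at h1 h2 h3
    refine h.eq_of_metric_equation hab hrc hB0 hρ0 ?_ rfl h1 h2 h3
    rw [h.rc_pow, h.lε_sq]
    field_simp
    ring
  -- the equation `g + ε R = q`
  have hODE : ∀ x ∈ J, deriv (deriv ρ) x = 0 ∧
      P.r (ρ x) ^ 2 - P.lε ^ 2 * (-(ρ x * (deriv B x * deriv ρ x)) +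
        ((n : ℝ) - 1) * (1 - B x * deriv ρ x ^ 2)) = ρ x ^ 2 := by
    intro x hx
    obtain ⟨hB0, hρ0, hrc⟩ := hpos x hx
    obtain ⟨e1, e2, e3⟩ := halg x hx
    have haux := (hsol (fun _ => x) hx).2
    have hσ := sphereFactor_pos (fun _ : Idx P.d => x)
    have hR := ricci_static (d := P.d) (p := fun _ => x) (B := B) (ρ := ρ)
      (Filter.mem_of_superset (hJ.mem_nhds hx) fun y hy => (hBd y hy).1)
      (Filter.mem_of_superset (hJ.mem_nhds hx) fun y hy => (hρd y hy).1)
      (hBd x hx).2 (hρd x hx).2 hB0 hρ0.ne'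
    unfold auxiliary at haux
    rw [hR, ssMetric_eq, ssMetric_eq, ← Matrix.diagonal_smul] at haux
    beta_reduce at haux
    rw [Matrix.diagonal_add, hε] at haux
    have hv := Matrix.diagonal_injective haux
    have hT := congrFun hv iT
    have hX := congrFun hv iX
    have hY := congrFun hv (.inr ⟨0, by have := h.hn; omega⟩)
    simp only [elim_iT, elim_iX, Sum.elim_inr, ssDiag_iT, ssDiag_iX, ssDiag_inr, Pi.smul_apply,
      smul_eq_mul, hd, e1, e2, e3] at hT hX hY
    have hT' : -P.D (ρ x) - P.lε ^ 2 * (deriv (deriv B) x / 2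
        + n * (deriv B x * deriv ρ x / (2 * ρ x))) = -1 :=
      mul_left_cancel₀ hB0 (by linear_combination hT)
    have hX' : P.D (ρ x) + P.lε ^ 2 * (deriv (deriv B) x / 2
        + n * ((deriv (deriv ρ) x * B x + deriv ρ x * deriv B x / 2) / ρ x)) = 1 := by
      field_simp at hX ⊢
      linear_combination hX
    have h0 : deriv (deriv ρ) x = 0 := by
      have h5 : P.lε ^ 2 * n * B x * deriv (deriv ρ) x / ρ x = 0 := by
        have h6 := congrArg₂ (· + ·) hT' hX'
        simp only [neg_add_cancel] at h6
        rw [← h6]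
        field_simp
        ring
      have h6 : P.lε ^ 2 * n * B x / ρ x ≠ 0 := by
        have : (n : ℝ) ≠ 0 := by linarith
        positivity
      have h7 : P.lε ^ 2 * n * B x / ρ x * deriv (deriv ρ) x = 0 := by rw [← h5]; ring
      exact (mul_eq_zero.1 h7).resolve_left h6
    refine ⟨h0, mul_right_cancel₀ (pow_pos hσ 2).ne' ?_⟩
    rw [h0] at hY
    linear_combination hY
  obtain ⟨x₀, hx₀⟩ := hJn
  have hconn := hJc.isPreconnected
  have hk : ∀ x ∈ J, deriv ρ x = deriv ρ x₀ := fun x hx =>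
    hJ.is_const_of_deriv_eq_zero hconn (fun y hy => (hρd y hy).2.differentiableAt.differentiableWithinAt)
      (fun y hy => (hODE y hy).1) hx hx₀
  set k := deriv ρ x₀ with hk_def
  have hm : ∀ x ∈ J, ρ x - k * x = ρ x₀ - k * x₀ := fun x hx =>
    hJ.is_const_of_deriv_eq_zero (f := fun x => ρ x - k * x) hconn
      (fun y hy => ((hρd y hy).1.differentiableAt.sub
        (differentiableAt_id.const_mul k)).differentiableWithinAt)
      (fun y hy => by
        have := (hρd y hy).1.fun_sub ((hasDerivAt_id' y).const_mul k)
        rw [this.deriv, hk y hy]; simp) hx hx₀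
  refine ⟨k, ρ x₀ - k * x₀, fun x hx => by linarith [hm x hx], fun hk0 => ?_⟩
  -- `k² B` and `A ∘ ρ` solve the same linear equation, so that their difference is `c / ρ^{n-1}`
  have hW : ∀ x ∈ J, HasDerivAt (fun x => (k ^ 2 * B x - P.A (ρ x)) * ρ x ^ (n - 1)) 0 x := by
    intro x hx
    obtain ⟨hB0, hρ0, hrc⟩ := hpos x hx
    have h1 := (h.hasDerivAt_A hρ0.ne').comp x (hρd x hx).1
    have h2 := (((hBd x hx).1.const_mul (k ^ 2)).fun_sub h1).fun_mul ((hρd x hx).1.fun_pow (n - 1))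
    refine h2.congr_deriv ?_
    have h3 := (hODE x hx).2
    rw [hk x hx] at h3 ⊢
    rw [h.A₁_eq]
    obtain ⟨m, rfl⟩ : ∃ m, n = m + 2 := ⟨n - 2, by have := h.hn; omega⟩
    simp only [show m + 2 - 1 = m + 1 by omega, Nat.add_sub_cancel, Function.comp_apply]
    push_cast at h3 ⊢
    field_simp at h3 ⊢
    linear_combination ρ x ^ m * ρ x * k * h3
  have hconst := fun x (hx : x ∈ J) => hJ.is_const_of_deriv_eq_zero hconn
    (fun y hy => (hW y hy).differentiableAt.differentiableWithinAt) (fun y hy => (hW y hy).deriv) hx hx₀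
  set c := (k ^ 2 * B x₀ - P.A (ρ x₀)) * ρ x₀ ^ (n - 1) with hc
  -- a change of the mass by `-(n - 1) c / 2` changes `A` by `c / ρ^{n-1}`
  refine ⟨P.M₀ - ((n : ℝ) - 1) * c / 2, fun x hx => ?_⟩
  obtain ⟨hB0, hρ0, hrc⟩ := hpos x hx
  obtain ⟨e1, e2, e3⟩ := halg x hx
  refine ⟨?_, ?_, ?_, e1⟩
  · have h1 := hconst x hx
    have hA : Params.A { P with M₀ := P.M₀ - ((n : ℝ) - 1) * c / 2 } (ρ x)
        = P.A (ρ x) + c / ρ x ^ (n - 1) := by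
      have hn1 : (n : ℝ) - 1 ≠ 0 := by linarith
      rw [(h.with_mass _).A_eq, h.A_eq, (h.with_mass _).mass_eq, h.mass_eq, abs_of_pos hρ0]
      simp only [lε, rc, z, Params.r]
      field_simp
      ring
    rw [hA, ← h1]
    field_simp
    ring
  · rw [e2, h.Ω₂_eq, div_inv_eq_mul]
  · rw [e3, h.Ω₂_eq]; field_simp

end Admissible
end Params
end EiBI

/-! ### The metric function at the throat -/

namespace EiBI

theorem tendsto_nhdsNE_of_even {f : ℝ → ℝ} {l : Filter ℝ} (hf : ∀ x, f (-x) = f x)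
    (h : Tendsto f (𝓝[>] 0) l) : Tendsto f (𝓝[≠] 0) l := by
  have h1 : f = fun x => f |x| := by
    funext x
    rcases abs_choice x with h | h <;> rw [h]
    exact (hf x).symm
  rw [h1]
  exact h.comp tendsto_abs_nhdsNE_zero

theorem tendsto_abs_pow_zero {e : ℕ} (he : e ≠ 0) :
    Tendsto (fun x : ℝ => |x| ^ e) (𝓝[≠] 0) (𝓝 0) := by
  have h : Continuous fun x : ℝ => |x| ^ e := by fun_prop
  have := h.tendsto 0
  simp only [abs_zero, zero_pow he] at this
  exact this.mono_left nhdsWithin_le_nhds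

namespace Params

/-- The value of the mass function at the throat. -/
def massThroat (P : Params) : ℝ :=
  P.M₀ - ((P.d : ℝ) - 3) * P.rc ^ (P.d - 1) / (2 * P.lε ^ 2) * (deltaCrit P.d)⁻¹

/-- The value at the throat of the regular part of `A`. -/
def A₀ (P : Params) : ℝ := 1 - P.rc ^ 2 / (((P.d : ℝ) - 3) * P.lε ^ 2)

variable {P : Params} {n : ℕ}

namespace Admissible

theorem cast_three_le (hn : 3 ≤ n) : (3 : ℝ) ≤ n := by exact_mod_cast hn

theorem deltaCrit_pos' (h : P.Admissible n) (hn : 3 ≤ n) : 0 < deltaCrit P.d := by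
  rw [h.hd]; exact deltaCrit_pos hn

theorem massThroat_eq (h : P.Admissible n) :
    P.massThroat = P.M₀ - ((n : ℝ) - 1) * P.rc ^ (n + 1) / (2 * P.lε ^ 2) * (deltaCrit P.d)⁻¹ := by
  unfold massThroat
  rw [h.cast_d, h.hd, show n + 2 - 1 = n + 1 by omega, show (n : ℝ) + 2 - 3 = n - 1 by ring]

theorem A₀_eq (h : P.Admissible n) : P.A₀ = 1 - P.rc ^ 2 / (((n : ℝ) - 1) * P.lε ^ 2) := by
  unfold A₀
  rw [h.cast_d, show (n : ℝ) + 2 - 3 = n - 1 by ring]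

theorem δ₁_eq (h : P.Admissible n) :
    P.δ₁ = ((n : ℝ) - 1) * P.rc ^ (n + 1) / (2 * P.lε ^ 2) / P.M₀ := by
  unfold δ₁
  rw [h.cast_d, h.hd, show n + 2 - 1 = n + 1 by omega, show (n : ℝ) + 2 - 3 = n - 1 by ring,
    div_div]
  ring

theorem mass_coeff_pos (h : P.Admissible n) : 0 < ((n : ℝ) - 1) * P.rc ^ (n + 1) / (2 * P.lε ^ 2) := by
  have h1 := h.rc_pos
  have h2 := h.lε_pos
  have h3 := h.cast_two_le
  have : 0 < (n : ℝ) - 1 := by linarith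
  positivity

/-- The causal character of the throat is given by the sign of the mass function there. For
`M₀ ≤ 0` the comparison of `δ₁` with `δ_d` means nothing, and the throat is always time-like. -/
theorem timelikeThroat_iff (h : P.Admissible n) (hn : 3 ≤ n) :
    P.TimelikeThroat ↔ P.massThroat < 0 := by
  have hc := h.mass_coeff_pos
  have hδ := h.deltaCrit_pos' hn
  unfold TimelikeThroat
  rw [h.massThroat_eq, h.δ₁_eq]
  set c := ((n : ℝ) - 1) * P.rc ^ (n + 1) / (2 * P.lε ^ 2)
  rw [← div_eq_mul_inv, sub_neg, lt_div_iff₀ hδ]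
  constructor
  · rintro (hM | hM)
    · nlinarith
    · rcases le_or_gt P.M₀ 0 with h0 | h0
      · exact absurd (hδ.trans hM) (not_lt.2 (div_nonpos_of_nonneg_of_nonpos hc.le h0))
      · rw [lt_div_iff₀ h0] at hM; linarith
  · intro hM
    rcases le_or_gt P.M₀ 0 with h0 | h0
    · exact Or.inl h0
    · exact Or.inr (by rw [lt_div_iff₀ h0]; linarith)

theorem spacelikeThroat_iff (h : P.Admissible n) (hn : 3 ≤ n) :
    P.SpacelikeThroat ↔ 0 < P.massThroat := by
  have hc := h.mass_coeff_pos
  have hδ := h.deltaCrit_pos' hn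
  unfold SpacelikeThroat
  rw [h.massThroat_eq, h.δ₁_eq]
  set c := ((n : ℝ) - 1) * P.rc ^ (n + 1) / (2 * P.lε ^ 2)
  rw [← div_eq_mul_inv, sub_pos, div_lt_iff₀ hδ]
  constructor
  · rintro ⟨h0, hM⟩
    rw [div_lt_iff₀ h0] at hM; linarith
  · intro hM
    have h0 : 0 < P.M₀ := by
      by_contra! h0
      nlinarith
    exact ⟨h0, by rw [div_lt_iff₀ h0]; linarith⟩

/-- For `M₀ = 0` both sides are false, as `δ₁ = 0` by convention and `δ_d > 0`. -/
theorem nullThroat_iff (h : P.Admissible n) (hn : 3 ≤ n) :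
    P.NullThroat ↔ P.massThroat = 0 := by
  have hc := h.mass_coeff_pos
  have hδ := h.deltaCrit_pos' hn
  unfold NullThroat
  rw [h.massThroat_eq, h.δ₁_eq]
  set c := ((n : ℝ) - 1) * P.rc ^ (n + 1) / (2 * P.lε ^ 2)
  rw [← div_eq_mul_inv, sub_eq_zero]
  constructor
  · intro hM
    have h0 : P.M₀ ≠ 0 := by
      rintro h0
      rw [h0, div_zero] at hM
      linarith
    rw [div_eq_iff h0] at hM
    rw [eq_div_iff hδ.ne']; linarith
  · intro hM
    rw [hM, div_div_cancel₀ hc.ne']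

/-- If the mass function vanishes at the throat, the condition on `δ₂` is `r_c² = (d - 3) l_ε²`. -/
theorem exceptional_iff (h : P.Admissible n) (hn : 3 ≤ n) :
    P.Exceptional ↔ P.massThroat = 0 ∧ P.A₀ = 0 := by
  unfold Exceptional
  rw [h.nullThroat_iff hn]
  refine and_congr_right fun hM => ?_
  have hc := h.rc_pos
  have hl := h.lε_pos
  have hδ := h.deltaCrit_pos' hn
  have hn' := cast_three_le hn
  have hn1 : (n : ℝ) - 1 ≠ 0 := by linarith
  have hn0 : (n : ℝ) ≠ 0 := by linarith
  have h1 : P.δ₂ = deltaCrit P.d * P.lε ^ 2 / P.rc ^ 2 := by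
    rw [h.massThroat_eq, sub_eq_zero] at hM
    unfold δ₂
    rw [hM, h.cast_d, show P.d - 3 = n - 1 by rw [h.hd]; omega, show (n : ℝ) + 2 - 3 = n - 1 by ring,
      show n + 1 = n - 1 + 2 by omega, pow_add]
    field_simp
  have h2 : aCoeff P.d * deltaCrit P.d * (2 * (P.d : ℝ) - 4) ^ (-(((P.d : ℝ) - 3) / ((P.d : ℝ) - 2)))
      = deltaCrit P.d / ((n : ℝ) - 1) := by
    have h3 := aCoeff_eq hn
    rw [← h.hd] at h3
    rw [h.cast_d, show 2 * ((n : ℝ) + 2) - 4 = 2 * n by ring,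
      show ((n : ℝ) + 2 - 3) / (n + 2 - 2) = (n - 1) / n by congr 1 <;> ring, mul_right_comm, h3]
    ring
  rw [h1, h2, h.A₀_eq, sub_eq_zero, eq_div_iff (mul_ne_zero hn1 (by positivity)),
    div_eq_div_iff (by positivity) hn1]
  constructor
  · intro h4
    have := mul_left_cancel₀ hδ.ne' (by linear_combination h4 :
      deltaCrit P.d * (P.lε ^ 2 * (n - 1)) = deltaCrit P.d * P.rc ^ 2)
    linarith
  · intro h4
    linear_combination deltaCrit P.d * h4

theorem tendsto_r (h : P.Admissible n) : Tendsto P.r (𝓝[≠] 0) (𝓝 P.rc) := by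
  have := h.continuous_r.tendsto 0
  rw [h.r_zero] at this
  exact this.mono_left nhdsWithin_le_nhds

theorem tendsto_w (h : P.Admissible n) : Tendsto P.w (𝓝[≠] 0) (𝓝 1) := by
  have := h.continuous_w.tendsto 0
  have h1 : P.w 0 = 1 := by
    rw [h.w_eq, h.r_zero, div_self]
    have := h.rc_pos
    positivity
  rw [h1] at this
  exact this.mono_left nhdsWithin_le_nhds

theorem D_zero (h : P.Admissible n) (hn : 3 ≤ n) : P.D 0 = 0 := by
  rw [h.D_eq]; simp [show n - 2 ≠ 0 by omega]

theorem tendsto_D (h : P.Admissible n) (hn : 3 ≤ n) : Tendsto P.D (𝓝[≠] 0) (𝓝 0) := by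
  have := h.continuous_D.tendsto 0
  rw [h.D_zero hn] at this
  exact this.mono_left nhdsWithin_le_nhds

theorem tendsto_D_div (h : P.Admissible n) :
    Tendsto (fun x => P.D x / |x| ^ (n - 2)) (𝓝[≠] 0) (𝓝 (1 / (2 * P.rc ^ (n - 2)))) := by
  have hc := h.rc_pos
  have h1 : Tendsto (fun x => 1 / (P.r x ^ (n - 2) * (1 + P.w x))) (𝓝[≠] 0)
      (𝓝 (1 / (P.rc ^ (n - 2) * (1 + 1)))) :=
    tendsto_const_nhds.div ((h.tendsto_r.pow _).mul (h.tendsto_w.const_add 1)) (by positivity)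
  rw [show 2 * P.rc ^ (n - 2) = P.rc ^ (n - 2) * (1 + 1) by ring]
  refine h1.congr' ?_
  filter_upwards [self_mem_nhdsWithin] with x hx
  have hx' : 0 < |x| := abs_pos.2 hx
  have := h.r_pos x
  have := h.w_pos x
  rw [h.D_eq, div_pow]
  field_simp

theorem tendsto_pr (h : P.Admissible n) : Tendsto P.pr (𝓝[≠] 0) (𝓝 0) := by
  have hc := h.rc_pos
  have h1 : ContinuousAt P.pr 0 :=
    ((continuousAt_id.pow 2).mul h.continuous_D.continuousAt).div (h.continuous_r.continuousAt.pow 2)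
      (by have := h.r_pos 0; positivity)
  have := h1.tendsto.mono_left (nhdsWithin_le_nhds (s := {(0:ℝ)}ᶜ))
  rwa [show P.pr 0 = 0 by simp [pr]] at this

theorem tendsto_qD (h : P.Admissible n) : Tendsto P.qD (𝓝[≠] 0) (𝓝 ((n : ℝ) - 2)) := by
  have h1 := h.tendsto_pr
  have h2 := h.tendsto_w
  have h3 := ((h1.const_sub 1).const_mul ((n : ℝ) - 2)).add
    ((h1.const_mul (2 * (n : ℝ))).mul (h2.div (h2.const_add 1) (by norm_num)))
  have h4 : P.qD = fun x => ((n : ℝ) - 2) * (1 - P.pr x) + 2 * n * P.pr x * (P.w x / (1 + P.w x)) :=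
    funext h.qD_eq
  rw [show ((n : ℝ) - 2) * (1 - 0) + 2 * n * 0 * (1 / (1 + 1)) = n - 2 by ring] at h3
  rw [h4]
  exact h3

theorem tendsto_qD' (h : P.Admissible n) : Tendsto P.qD' (𝓝[≠] 0) (𝓝 0) := by
  have h1 := h.tendsto_pr
  have h2 := h.tendsto_w
  have h3 := h.tendsto_qD
  have h4 := ((h1.mul ((h3.const_add 2).sub (h1.const_mul 2))).mul
    (((h2.div (h2.const_add 1) (by norm_num)).const_mul (2 * (P.d : ℝ) - 4)).const_add
      (-((P.d : ℝ) - 4)))).sub ((h1.const_mul (2 * (P.d : ℝ) - 4)).mul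
      (((h2.const_mul (2 * (P.d : ℝ) - 4)).mul h1).div ((h2.const_add 1).pow 2) (by norm_num)))
  simp only [zero_mul, mul_zero, sub_zero] at h4
  exact h4

theorem tendsto_G_deltaCrit (h : P.Admissible n) (hn : 3 ≤ n) :
    Tendsto (G (n + 2)) (𝓝[>] 1) (𝓝 (-(deltaCrit P.d)⁻¹)) := by
  rw [h.hd, deltaCrit_inv hn]
  convert tendsto_G h.hn using 2
  ring

theorem tendsto_mass (h : P.Admissible n) (hn : 3 ≤ n) :
    Tendsto P.mass (𝓝[≠] 0) (𝓝 P.massThroat) := by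
  have hc := h.rc_pos
  have hz : Tendsto P.z (𝓝[≠] 0) (𝓝[>] 1) := by
    refine tendsto_nhdsWithin_iff.2 ⟨?_, ?_⟩
    · have := h.tendsto_r.div_const P.rc
      rwa [div_self hc.ne'] at this
    · filter_upwards [self_mem_nhdsWithin] with x hx using h.one_lt_z hx
  have h1 := (((h.tendsto_G_deltaCrit hn).comp hz).const_mul
    (((n : ℝ) - 1) * P.rc ^ (n + 1) / (2 * P.lε ^ 2))).const_add P.M₀
  have h2 : P.mass = fun x => P.M₀ + ((n : ℝ) - 1) * P.rc ^ (n + 1) / (2 * P.lε ^ 2) *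
      (G (n + 2) ∘ P.z) x := funext h.mass_eq
  rw [h2, h.massThroat_eq]
  convert h1 using 2
  ring

theorem tendsto_r_sq_sub (h : P.Admissible n) (hn : 3 ≤ n) :
    Tendsto (fun x => (P.r x ^ 2 - P.rc ^ 2) / x ^ 2) (𝓝[≠] 0) (𝓝 0) := by
  refine tendsto_nhdsNE_of_even (fun x => by rw [h.r_neg, neg_sq]) ?_
  have hle : 𝓝[>] (0 : ℝ) ≤ 𝓝[≠] 0 := nhdsWithin_mono _ fun x hx => ne_of_gt hx
  refine HasDerivAt.lhopital_zero_nhdsGT (f' := fun x => 2 * x * P.D x) (g' := fun x => 2 * x) ?_ ?_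
    ?_ ?_ ?_ ?_
  · filter_upwards [self_mem_nhdsWithin] with x hx
    refine (((h.hasDerivAt_r (ne_of_gt hx)).fun_pow 2).sub_const _).congr_deriv ?_
    have := h.r_pos x
    simp only [Nat.add_one_sub_one, pow_one]; push_cast; field_simp
  · exact Eventually.of_forall fun x => by simpa using hasDerivAt_pow 2 x
  · filter_upwards [self_mem_nhdsWithin] with x hx
    have : (0 : ℝ) < x := hx
    positivity
  · have := ((h.tendsto_r.mono_left hle).pow 2).sub_const (P.rc ^ 2)
    rwa [sub_self] at this
  · have : Tendsto (fun x : ℝ => x ^ 2) (𝓝 0) (𝓝 (0 ^ 2)) := (continuous_pow 2).tendsto 0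
    rw [zero_pow two_ne_zero] at this
    exact this.mono_left nhdsWithin_le_nhds
  · refine ((h.tendsto_D hn).mono_left hle).congr' ?_
    filter_upwards [self_mem_nhdsWithin] with x hx
    have : (0 : ℝ) < x := hx
    field_simp

/-- The expansion of the mass function at the throat, by l'Hôpital's rule from `hasDerivAt_mass`. -/
theorem tendsto_mass_sub (h : P.Admissible n) (hn : 3 ≤ n) :
    Tendsto (fun x => (P.mass x - P.massThroat - P.rc ^ 2 / (2 * P.lε ^ 2) * |x| ^ (n - 1))
      / |x| ^ (n + 1)) (𝓝[≠] 0) (𝓝 (-(((n : ℝ) - 1) / (2 * P.lε ^ 2 * (n + 1))))) := by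
  have hm : ∀ x, P.mass (-x) = P.mass x := fun x => by rw [h.mass_eq, h.mass_eq, z, z, h.r_neg]
  refine tendsto_nhdsNE_of_even (fun x => by rw [hm, abs_neg]) ?_
  have hle : 𝓝[>] (0 : ℝ) ≤ 𝓝[≠] 0 := nhdsWithin_mono _ fun x hx => ne_of_gt hx
  have hl := h.lε_pos
  have hn' := cast_three_le hn
  refine Tendsto.congr' (f₁ := fun x => (P.mass x - P.massThroat
    - P.rc ^ 2 / (2 * P.lε ^ 2) * x ^ (n - 1)) / x ^ (n + 1)) ?_ ?_
  · filter_upwards [self_mem_nhdsWithin] with x hx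
    rw [abs_of_pos hx]
  have hcont : ∀ e : ℕ, e ≠ 0 → Tendsto (fun x : ℝ => x ^ e) (𝓝[>] 0) (𝓝 0) := by
    intro e he
    have : Tendsto (fun x : ℝ => x ^ e) (𝓝 0) (𝓝 (0 ^ e)) := (continuous_pow e).tendsto 0
    rw [zero_pow he] at this
    exact this.mono_left nhdsWithin_le_nhds
  refine HasDerivAt.lhopital_zero_nhdsGT
    (f' := fun x => ((n : ℝ) - 1) / (2 * P.lε ^ 2) * ((P.r x ^ 2 - x ^ 2) * x ^ (n - 2))
      - P.rc ^ 2 / (2 * P.lε ^ 2) * ((n - 1 : ℕ) * x ^ (n - 1 - 1)))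
    (g' := fun x => ((n + 1 : ℕ) : ℝ) * x ^ n) ?_ ?_ ?_ ?_ ?_ ?_
  · filter_upwards [self_mem_nhdsWithin] with x hx
    exact ((h.hasDerivAt_mass hx).sub_const _).sub ((hasDerivAt_pow _ _).const_mul _)
  · exact Eventually.of_forall fun x => hasDerivAt_pow (n + 1) x
  · filter_upwards [self_mem_nhdsWithin] with x hx
    have : (0 : ℝ) < x := hx
    positivity
  · have := (((h.tendsto_mass hn).mono_left hle).sub_const P.massThroat).sub
      ((hcont (n - 1) (by omega)).const_mul (P.rc ^ 2 / (2 * P.lε ^ 2)))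
    simpa using this
  · exact hcont _ (by omega)
  · have h1 := (((h.tendsto_r_sq_sub hn).mono_left hle).sub_const 1).const_mul
      (((n : ℝ) - 1) / (2 * P.lε ^ 2 * (n + 1)))
    have h2 : ((n : ℝ) - 1) / (2 * P.lε ^ 2 * (n + 1)) * (0 - 1)
      = -(((n : ℝ) - 1) / (2 * P.lε ^ 2 * (n + 1))) := by ring
    rw [h2] at h1
    refine h1.congr' ?_
    filter_upwards [self_mem_nhdsWithin] with x hx
    have hx : (0 : ℝ) < x := hx
    obtain ⟨m, rfl⟩ : ∃ m, n = m + 3 := ⟨n - 3, by omega⟩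
    simp only [show m + 3 - 2 = m + 1 by omega, show m + 3 - 1 = m + 2 by omega,
      show m + 2 - 1 = m + 1 by omega]
    push_cast
    field_simp
    ring

/-- The expansion of `A` at the throat. -/
theorem tendsto_A_expansion (h : P.Admissible n) (hn : 3 ≤ n) :
    Tendsto (fun x => (P.A x - P.A₀ + 2 * P.massThroat / (((n : ℝ) - 1) * |x| ^ (n - 1))) / x ^ 2)
      (𝓝[≠] 0) (𝓝 (1 / (((n : ℝ) + 1) * P.lε ^ 2))) := by
  have hl := h.lε_pos
  have hn' := cast_three_le hn
  have hn1 : (n : ℝ) - 1 ≠ 0 := by linarith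
  have h1 := (h.tendsto_mass_sub hn).const_mul (-(2 / ((n : ℝ) - 1)))
  have h2 : -(2 / ((n : ℝ) - 1)) * (-(((n : ℝ) - 1) / (2 * P.lε ^ 2 * (n + 1))))
      = 1 / (((n : ℝ) + 1) * P.lε ^ 2) := by field_simp
  rw [h2] at h1
  refine h1.congr' ?_
  filter_upwards [self_mem_nhdsWithin] with x hx
  have hx' : 0 < |x| := abs_pos.2 hx
  rw [h.A_eq, h.A₀_eq, ← sq_abs x]
  obtain ⟨m, rfl⟩ : ∃ m, n = m + 3 := ⟨n - 3, by omega⟩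
  simp only [show m + 3 - 1 = m + 2 by omega]
  push_cast at hn1 ⊢
  field_simp
  ring

end Admissible
end Params
end EiBI

/-! ### Divergence of the curvature at the throat -/

namespace EiBI
namespace Params

/-- `A |x|^e / |x|^n → α`, and this asymptotic relation may be differentiated twice. -/
structure ThroatRate (P : Params) (n e : ℕ) (α : ℝ) : Prop where
  ne_zero : α ≠ 0
  zeroth : Tendsto (fun x => P.A x * (|x| ^ e / |x| ^ n)) (𝓝[≠] 0) (𝓝 α)
  first : Tendsto (fun x => x * P.A₁ x * (|x| ^ e / |x| ^ n)) (𝓝[≠] 0) (𝓝 (((n : ℝ) - e) * α))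
  second : Tendsto (fun x => x * (P.A₁ x + x * P.A₂ x) * (|x| ^ e / |x| ^ n)) (𝓝[≠] 0)
    (𝓝 (((n : ℝ) - e) ^ 2 * α))

variable {P : Params} {n : ℕ}

namespace Admissible

/-- If the mass function does not vanish at the throat, `A` behaves as `|x|^{-(n-1)}`. -/
theorem throatRate_of_massThroat_ne_zero (h : P.Admissible n) (hn : 3 ≤ n) (hM : P.massThroat ≠ 0) :
    P.ThroatRate n (2 * n - 1) (-(2 * P.massThroat / ((n : ℝ) - 1))) := by
  have hn' := cast_three_le hn
  have hn1 : (n : ℝ) - 1 ≠ 0 := by linarith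
  have hl := h.lε_pos
  have e1 : ∀ᶠ x in 𝓝[≠] (0 : ℝ), |x| ^ (2 * n - 1) / |x| ^ n = |x| ^ (n - 1) := by
    filter_upwards [self_mem_nhdsWithin] with x hx
    have hx' : 0 < |x| := abs_pos.2 hx
    rw [div_eq_iff (by positivity), ← pow_add]; congr 1; omega
  have hz : Tendsto (fun x : ℝ => |x| ^ (n - 1)) (𝓝[≠] 0) (𝓝 0) := tendsto_abs_pow_zero (by omega)
  have hx0 : Tendsto (fun x : ℝ => x) (𝓝[≠] 0) (𝓝 0) := tendsto_id.mono_left nhdsWithin_le_nhds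
  have h0 : Tendsto (fun x => P.A x * |x| ^ (n - 1)) (𝓝[≠] 0)
      (𝓝 (-(2 * P.massThroat / ((n : ℝ) - 1)))) := by
    have h1 := hz.sub (((h.tendsto_mass hn).const_mul 2).div_const ((n : ℝ) - 1))
    rw [zero_sub] at h1
    refine h1.congr' ?_
    filter_upwards [self_mem_nhdsWithin] with x hx
    have hx' : 0 < |x| := abs_pos.2 hx
    rw [h.A_eq]
    field_simp
  have h1 : Tendsto (fun x => x * P.A₁ x * |x| ^ (n - 1)) (𝓝[≠] 0)
      (𝓝 (-(((n : ℝ) - 1) * -(2 * P.massThroat / ((n : ℝ) - 1))))) := by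
    have h2 := ((hz.sub h0).const_mul ((n : ℝ) - 1)).sub
      ((((h.tendsto_r.pow 2).sub (hx0.pow 2)).div_const (P.lε ^ 2)).mul hz)
    simp only [zero_sub, mul_zero, sub_zero, mul_neg] at h2 ⊢
    refine h2.congr' ?_
    filter_upwards [self_mem_nhdsWithin] with x hx
    have hx' : x ≠ 0 := hx
    rw [h.A₁_eq]
    field_simp
  have h2 : Tendsto (fun x => x * (P.A₁ x + x * P.A₂ x) * |x| ^ (n - 1)) (𝓝[≠] 0)
      (𝓝 (-(((n : ℝ) - 1) * -(((n : ℝ) - 1) * -(2 * P.massThroat / ((n : ℝ) - 1)))))) := by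
    have h3 := (h1.const_mul ((n : ℝ) - 1)).neg.add
      (((((h.tendsto_D hn).const_sub 1).mul (hx0.pow 2)).const_mul (2 / P.lε ^ 2)).mul hz)
    simp only [mul_zero, add_zero] at h3
    refine h3.congr' ?_
    filter_upwards [self_mem_nhdsWithin] with x hx
    have hx' : x ≠ 0 := hx
    rw [h.A₂_eq]
    field_simp
    ring
  have ec : ((n : ℝ) - (2 * n - 1 : ℕ)) = -(n - 1) := by
    rw [Nat.cast_sub (by omega)]; push_cast; ring
  refine ⟨neg_ne_zero.2 (div_ne_zero (mul_ne_zero two_ne_zero hM) hn1), ?_, ?_, ?_⟩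
  · refine h0.congr' (e1.mono fun x hx => ?_)
    beta_reduce
    rw [hx]
  · rw [ec, neg_mul]
    refine h1.congr' (e1.mono fun x hx => ?_)
    beta_reduce
    rw [hx]
  · rw [ec, show (-((n : ℝ) - 1)) ^ 2 * -(2 * P.massThroat / ((n : ℝ) - 1))
      = -(((n : ℝ) - 1) * -(((n : ℝ) - 1) * -(2 * P.massThroat / ((n : ℝ) - 1)))) by ring]
    refine h2.congr' (e1.mono fun x hx => ?_)
    beta_reduce
    rw [hx]

theorem tendsto_A_of_massThroat_eq_zero (h : P.Admissible n) (hn : 3 ≤ n) (hM : P.massThroat = 0) :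
    Tendsto (fun x => (P.A x - P.A₀) / x ^ 2) (𝓝[≠] 0) (𝓝 (1 / (((n : ℝ) + 1) * P.lε ^ 2))) := by
  simpa [hM] using h.tendsto_A_expansion hn

theorem tendsto_A_zero (h : P.Admissible n) (hn : 3 ≤ n) (hM : P.massThroat = 0) :
    Tendsto P.A (𝓝[≠] 0) (𝓝 P.A₀) := by
  have hx0 : Tendsto (fun x : ℝ => x) (𝓝[≠] 0) (𝓝 0) := tendsto_id.mono_left nhdsWithin_le_nhds
  have h1 := ((h.tendsto_A_of_massThroat_eq_zero hn hM).mul (hx0.pow 2)).const_add P.A₀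
  simp only [ne_eq, OfNat.ofNat_ne_zero, not_false_eq_true, zero_pow, mul_zero, add_zero] at h1
  refine h1.congr' ?_
  filter_upwards [self_mem_nhdsWithin] with x hx
  have hx' : x ≠ 0 := hx
  field_simp
  ring

/-- If the mass function vanishes at the throat, `A` tends to `A₀`. -/
theorem throatRate_of_A₀_ne_zero (h : P.Admissible n) (hn : 3 ≤ n) (hM : P.massThroat = 0)
    (hA : P.A₀ ≠ 0) : P.ThroatRate n n P.A₀ := by
  have hn' := cast_three_le hn
  have hn1 : (n : ℝ) - 1 ≠ 0 := by linarith
  have hl := h.lε_pos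
  have e1 : ∀ᶠ x in 𝓝[≠] (0 : ℝ), |x| ^ n / |x| ^ n = 1 := by
    filter_upwards [self_mem_nhdsWithin] with x hx
    have hx' : 0 < |x| := abs_pos.2 hx
    exact div_self (by positivity)
  have hx0 : Tendsto (fun x : ℝ => x) (𝓝[≠] 0) (𝓝 0) := tendsto_id.mono_left nhdsWithin_le_nhds
  have h0 := h.tendsto_A_zero hn hM
  have h1 : Tendsto (fun x => x * P.A₁ x) (𝓝[≠] 0) (𝓝 0) := by
    have h2 := ((h0.const_sub 1).const_mul ((n : ℝ) - 1)).sub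
      (((h.tendsto_r.pow 2).sub (hx0.pow 2)).div_const (P.lε ^ 2))
    -- the definition of `A₀` makes the right-hand side of the equation for `x A'` vanish at the throat
    have h3 : ((n : ℝ) - 1) * (1 - P.A₀) - (P.rc ^ 2 - 0 ^ 2) / P.lε ^ 2 = 0 := by
      rw [h.A₀_eq]; field_simp; ring
    rw [h3] at h2
    refine h2.congr' ?_
    filter_upwards [self_mem_nhdsWithin] with x hx
    have hx' : x ≠ 0 := hx
    rw [h.A₁_eq]
    field_simp
  have h2 : Tendsto (fun x => x * (P.A₁ x + x * P.A₂ x)) (𝓝[≠] 0) (𝓝 0) := by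
    have h3 := (h1.const_mul ((n : ℝ) - 1)).neg.add
      ((((h.tendsto_D hn).const_sub 1).mul (hx0.pow 2)).const_mul (2 / P.lε ^ 2))
    simp only [ne_eq, OfNat.ofNat_ne_zero, not_false_eq_true, zero_pow, mul_zero, add_zero,
      neg_zero] at h3
    refine h3.congr' ?_
    filter_upwards [self_mem_nhdsWithin] with x hx
    have hx' : x ≠ 0 := hx
    rw [h.A₂_eq]
    field_simp
    ring
  refine ⟨hA, ?_, ?_, ?_⟩
  · refine h0.congr' (e1.mono fun x hx => ?_)
    beta_reduce
    rw [hx, mul_one]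
  · rw [sub_self, zero_mul]
    refine h1.congr' (e1.mono fun x hx => ?_)
    beta_reduce
    rw [hx, mul_one]
  · rw [sub_self, zero_pow two_ne_zero, zero_mul]
    refine h2.congr' (e1.mono fun x hx => ?_)
    beta_reduce
    rw [hx, mul_one]

/-- In the exceptional case `A` behaves as `x²`. -/
theorem throatRate_of_A₀_eq_zero (h : P.Admissible n) (hn : 3 ≤ n) (hM : P.massThroat = 0)
    (hA : P.A₀ = 0) : P.ThroatRate n (n - 2) (1 / (((n : ℝ) + 1) * P.lε ^ 2)) := by
  have hn' := cast_three_le hn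
  have hn1 : (n : ℝ) - 1 ≠ 0 := by linarith
  have hl := h.lε_pos
  have e1 : ∀ᶠ x in 𝓝[≠] (0 : ℝ), |x| ^ (n - 2) / |x| ^ n = (x ^ 2)⁻¹ := by
    filter_upwards [self_mem_nhdsWithin] with x hx
    have hx' : 0 < |x| := abs_pos.2 hx
    rw [← sq_abs x, div_eq_iff (by positivity), ← div_eq_inv_mul, eq_div_iff (by positivity),
      ← pow_add]
    congr 1; omega
  have hx0 : Tendsto (fun x : ℝ => x) (𝓝[≠] 0) (𝓝 0) := tendsto_id.mono_left nhdsWithin_le_nhds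
  have hrc : P.rc ^ 2 = (n - 1) * P.lε ^ 2 := by
    rw [h.A₀_eq] at hA
    field_simp at hA
    linarith
  have h0 : Tendsto (fun x => P.A x / x ^ 2) (𝓝[≠] 0) (𝓝 (1 / (((n : ℝ) + 1) * P.lε ^ 2))) := by
    simpa [hA] using h.tendsto_A_of_massThroat_eq_zero hn hM
  have h1 : Tendsto (fun x => x * P.A₁ x / x ^ 2) (𝓝[≠] 0)
      (𝓝 (2 * (1 / (((n : ℝ) + 1) * P.lε ^ 2)))) := by
    have h2 := ((h0.const_mul ((n : ℝ) - 1)).neg.sub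
      ((h.tendsto_r_sq_sub hn).div_const (P.lε ^ 2))).add_const (1 / P.lε ^ 2)
    have h3 : -(((n : ℝ) - 1) * (1 / (((n : ℝ) + 1) * P.lε ^ 2))) - 0 / P.lε ^ 2 + 1 / P.lε ^ 2
        = 2 * (1 / (((n : ℝ) + 1) * P.lε ^ 2)) := by
      field_simp; ring
    rw [h3] at h2
    refine h2.congr' ?_
    filter_upwards [self_mem_nhdsWithin] with x hx
    have hx' : x ≠ 0 := hx
    rw [h.A₁_eq, hrc]
    field_simp
    ring
  have h2 : Tendsto (fun x => x * (P.A₁ x + x * P.A₂ x) / x ^ 2) (𝓝[≠] 0)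
      (𝓝 (4 * (1 / (((n : ℝ) + 1) * P.lε ^ 2)))) := by
    have h3 := (h1.const_mul ((n : ℝ) - 1)).neg.add
      (((h.tendsto_D hn).const_sub 1).const_mul (2 / P.lε ^ 2))
    have h4 : -(((n : ℝ) - 1) * (2 * (1 / (((n : ℝ) + 1) * P.lε ^ 2)))) + 2 / P.lε ^ 2 * (1 - 0)
        = 4 * (1 / (((n : ℝ) + 1) * P.lε ^ 2)) := by
      field_simp; ring
    rw [h4] at h3
    refine h3.congr' ?_
    filter_upwards [self_mem_nhdsWithin] with x hx
    have hx' : x ≠ 0 := hx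
    rw [h.A₂_eq]
    field_simp
    ring
  have ec : ((n : ℝ) - (n - 2 : ℕ)) = 2 := by
    rw [Nat.cast_sub (by omega)]; push_cast; ring
  refine ⟨by positivity, ?_, ?_, ?_⟩
  · refine h0.congr' (e1.mono fun x hx => ?_)
    beta_reduce
    rw [hx, div_eq_mul_inv]
  · rw [ec]
    refine h1.congr' (e1.mono fun x hx => ?_)
    beta_reduce
    rw [hx, div_eq_mul_inv]
  · rw [ec, show (2 : ℝ) ^ 2 = 4 by norm_num]
    refine h2.congr' (e1.mono fun x hx => ?_)
    beta_reduce
    rw [hx, div_eq_mul_inv]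

/-- The rate at which `A` behaves at the throat determines the divergence of the curvature. -/
theorem exists_throatRate (h : P.Admissible n) (hn : 3 ≤ n) :
    ∃ e α, P.ThroatRate n e α ∧ (e = 2 * n - 1 ∨ e = n ∨ e = n - 2) ∧
      P.kretschmannExponent = 2 * e := by
  have hd := h.hd
  unfold kretschmannExponent
  rcases eq_or_ne P.massThroat 0 with hM | hM
  · rcases eq_or_ne P.A₀ 0 with hA | hA
    · exact ⟨n - 2, _, h.throatRate_of_A₀_eq_zero hn hM hA, by simp,
        by rw [if_pos ((h.exceptional_iff hn).2 ⟨hM, hA⟩)]; omega⟩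
    · refine ⟨n, _, h.throatRate_of_A₀_ne_zero hn hM hA, by simp, ?_⟩
      rw [if_neg fun hc => hA ((h.exceptional_iff hn).1 hc).2,
        if_pos ((h.nullThroat_iff hn).2 hM)]; omega
  · refine ⟨2 * n - 1, _, h.throatRate_of_massThroat_ne_zero hn hM, by simp, ?_⟩
    rw [if_neg fun hc => hM ((h.exceptional_iff hn).1 hc).1,
      if_neg fun hc => hM ((h.nullThroat_iff hn).1 hc)]; omega

theorem eventually_A_ne_zero (h : P.Admissible n) (hn : 3 ≤ n) : ∀ᶠ x in 𝓝[≠] (0 : ℝ), P.A x ≠ 0 := by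
  obtain ⟨e, α, hr, -⟩ := h.exists_throatRate hn
  filter_upwards [hr.zeroth.eventually_ne hr.ne_zero] with x hx
  exact left_ne_zero_of_mul hx

/-- The sectional curvatures of the metric in the planes spanned by `∂_t, ∂_x`, by `∂_t, ∂_i`, by
`∂_x, ∂_i`, and by `∂_i, ∂_j`. -/
def curvature (P : Params) : Fin 4 → ℝ → ℝ := ![
  fun x => -(1 / (2 * P.D x * x ^ 2)) * (x * (P.A₁ x + x * P.A₂ x) + P.A x * P.qD' x
    + P.qD x * (x * P.A₁ x) - x * P.A₁ x - P.qD x * P.A x),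
  fun x => -(1 / 2) * (x * P.A₁ x + P.A x * P.qD x) / P.r x ^ 2,
  fun x => (-P.A x - P.A x * P.qD x / 2 - x * P.A₁ x / 2 + P.pr x * P.A x) / P.r x ^ 2,
  fun x => (1 - P.pr x * P.A x) / P.r x ^ 2]

/-- The Kretschmann scalar is a positive combination of squares of the sectional curvatures, so that no
cancellation is possible between them. -/
theorem kretschmann_metric (h : P.Admissible n) {p : Idx P.d → ℝ} (hp : p ∈ P.domain) :
    kretschmann P.metric p = 4 * curvature P 0 (p iX) ^ 2
      + 4 * n * (curvature P 1 (p iX) ^ 2 + curvature P 2 (p iX) ^ 2)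
      + 2 * n * (n - 1) * curvature P 3 (p iX) ^ 2 := by
  obtain ⟨hx, hA⟩ := hp
  have hD := (h.D_pos hx).ne'
  have hr := (h.r_pos (p iX)).ne'
  have hev := eventually_mem_domain h hx hA
  have ha : ∀ y, y ≠ 0 → HasDerivAt P.gtt (-(P.A₁ y * P.D y + P.A y * (P.D y * (P.qD y / y)))) y := by
    intro y hy
    have : P.gtt = fun x => -(P.A x * P.D x) := funext h.gtt_eq
    rw [this]
    exact ((h.hasDerivAt_A hy).fun_mul (h.hasDerivAt_D hy)).fun_neg
  have hb : ∀ y, y ≠ 0 → P.A y ≠ 0 → HasDerivAt P.gxx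
      ((P.D y * (P.qD y / y) * P.A y - P.D y * P.A₁ y) / P.A y ^ 2) y := by
    intro y hy hAy
    have : P.gxx = fun x => P.D x / P.A x := funext h.gxx_eq
    rw [this]
    exact (h.hasDerivAt_D hy).fun_div (h.hasDerivAt_A hy) hAy
  have hDq : HasDerivAt (fun y => P.D y * (P.qD y / y)) _ (p iX) :=
    (h.hasDerivAt_D hx).fun_mul ((h.hasDerivAt_qD hx).fun_div (hasDerivAt_id' _) hx)
  have hA1 := h.hasDerivAt_A₁ hx
  have hA0 := h.hasDerivAt_A hx
  have hprof : ProfileAt P.gtt (fun y => -(P.A₁ y * P.D y + P.A y * (P.D y * (P.qD y / y)))) P.gxx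
      (fun y => (P.D y * (P.qD y / y) * P.A y - P.D y * P.A₁ y) / P.A y ^ 2) P.r
      (fun y => P.r y * (P.pr y / y)) _ _ _ (p iX) :=
    { ha := hev.mono fun y hy => ha y hy.1
      hb := hev.mono fun y hy => hb y hy.1 hy.2
      hr := hev.mono fun y hy => h.hasDerivAt_r' hy.1
      ha₁ := ((hA1.fun_mul (h.hasDerivAt_D hx)).fun_add (hA0.fun_mul hDq)).fun_neg
      hb₁ := ((hDq.fun_mul hA0).fun_sub ((h.hasDerivAt_D hx).fun_mul hA1)).fun_div (hA0.fun_pow 2)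
        (pow_ne_zero 2 hA)
      hr₁ := (h.hasDerivAt_r' hx).fun_mul ((h.hasDerivAt_pr hx).fun_div (hasDerivAt_id' _) hx)
      ha0 := by rw [h.gtt_eq]; exact neg_ne_zero.2 (mul_ne_zero hA hD)
      hb0 := by rw [h.gxx_eq]; exact div_ne_zero hD hA
      hr0 := hr }
  have hpr : P.D (p iX) = P.pr (p iX) * P.r (p iX) ^ 2 / p iX ^ 2 := by unfold pr; field_simp
  have hp0 : P.pr (p iX) ≠ 0 := by unfold pr; positivity
  have hd : P.d - 2 = n := by rw [h.hd, Nat.add_sub_cancel]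
  unfold metric
  rw [hprof.kretschmann_eq (s₁ := curvature P 0 (p iX)) (s₂ := curvature P 1 (p iX))
    (s₃ := curvature P 2 (p iX)) (s₄ := curvature P 3 (p iX)), hd]
  · simp only [curvature, Matrix.cons_val_zero, h.gtt_eq, h.gxx_eq]
    field_simp
    ring
  · simp only [curvature, Matrix.cons_val, h.gtt_eq, h.gxx_eq, hpr]
    field_simp
  · simp only [curvature, Matrix.cons_val, h.gxx_eq, hpr]
    field_simp
    ring
  · simp only [curvature, Matrix.cons_val, h.gxx_eq, hpr]
    field_simp

/-- The curvature of the `(t, x)` plane behaves as `|x|^{-e}`, because of the factor `1 / (D x²)`. -/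
theorem tendsto_curvature_zero (h : P.Admissible n) {e : ℕ} {α : ℝ} (hr : P.ThroatRate n e α) :
    Tendsto (fun x => curvature P 0 x * |x| ^ e) (𝓝[≠] 0) (𝓝 (-(P.rc ^ (n - 2) *
      (((n : ℝ) - e) ^ 2 * α + ((n : ℝ) - 2) * (((n : ℝ) - e) * α) - ((n : ℝ) - e) * α
        - ((n : ℝ) - 2) * α)))) := by
  have hc := h.rc_pos
  have h1 := ((((hr.second.add (hr.zeroth.mul h.tendsto_qD')).add (h.tendsto_qD.mul hr.first)).sub
    hr.first).sub (h.tendsto_qD.mul hr.zeroth)).mul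
    ((h.tendsto_D_div).inv₀ (by positivity)) |>.const_mul (-(1 / 2))
  have e1 : -(1 / 2) * ((((n : ℝ) - e) ^ 2 * α + α * 0 + ((n : ℝ) - 2) * (((n : ℝ) - e) * α)
      - ((n : ℝ) - e) * α - ((n : ℝ) - 2) * α) * (1 / (2 * P.rc ^ (n - 2)))⁻¹) = -(P.rc ^ (n - 2) *
      (((n : ℝ) - e) ^ 2 * α + ((n : ℝ) - 2) * (((n : ℝ) - e) * α) - ((n : ℝ) - e) * α
        - ((n : ℝ) - 2) * α)) := by
    field_simp
    ring
  rw [e1] at h1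
  refine h1.congr' ?_
  filter_upwards [self_mem_nhdsWithin] with x hx
  have hx' : 0 < |x| := abs_pos.2 hx
  have hx0 : x ≠ 0 := hx
  have hD := h.D_pos hx0
  have e2 : |x| ^ n = |x| ^ (n - 2) * x ^ 2 := by
    rw [← sq_abs x, ← pow_add]; congr 1; have := h.hn; omega
  simp only [curvature, Matrix.cons_val_zero]
  rw [e2]
  field_simp

theorem tendsto_A_mul_abs_pow (h : P.Admissible n) {e : ℕ} {β : ℝ} {f : ℝ → ℝ}
    (hf : Tendsto (fun x => f x * (|x| ^ e / |x| ^ n)) (𝓝[≠] 0) (𝓝 β)) :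
    Tendsto (fun x => f x * |x| ^ e) (𝓝[≠] 0) (𝓝 0) := by
  have h1 := hf.mul (tendsto_abs_pow_zero (e := n) (by have := h.hn; omega))
  rw [mul_zero] at h1
  refine h1.congr' ?_
  filter_upwards [self_mem_nhdsWithin] with x hx
  have hx' : 0 < |x| := abs_pos.2 hx
  field_simp

/-- The other sectional curvatures are negligible at the throat. -/
theorem tendsto_curvature_succ (h : P.Admissible n) {e : ℕ} (he : e ≠ 0) {α : ℝ}
    (hr : P.ThroatRate n e α) (i : Fin 3) :
    Tendsto (fun x => curvature P i.succ x * |x| ^ e) (𝓝[≠] 0) (𝓝 0) := by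
  have hc := h.rc_pos
  have hrr := (h.tendsto_r.pow 2).inv₀ (by positivity)
  have h0 := h.tendsto_A_mul_abs_pow hr.zeroth
  have h1 := h.tendsto_A_mul_abs_pow hr.first
  have hq := h.tendsto_qD
  have hp := h.tendsto_pr
  fin_cases i
  · have := (((h1.add (h0.mul hq)).const_mul (-(1 / 2))).mul hrr)
    simp only [zero_mul, add_zero, mul_zero] at this
    refine this.congr fun x => ?_
    simp [curvature]
    ring
  · have := ((((h0.neg.sub ((h0.mul hq).div_const 2)).sub (h1.div_const 2)).add (hp.mul h0)).mul hrr)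
    simp only [zero_mul, zero_div, sub_zero, neg_zero, add_zero, mul_zero] at this
    refine this.congr fun x => ?_
    simp [curvature]
    ring
  · have := ((tendsto_abs_pow_zero he).sub (hp.mul h0)).mul hrr
    simp only [zero_mul, sub_zero, mul_zero] at this
    refine this.congr fun x => ?_
    simp [curvature]
    ring

/-- The leading coefficient of the curvature in the `(t, x)` plane is a multiple of
`(e - n + 1) (e - 2 n + 2)`, which does not vanish for any of the possible exponents `e`. -/
theorem exists_tendsto_kretschmann (h : P.Admissible n) (hn : 3 ≤ n) :
    ∃ C > 0, Tendsto (fun p => kretschmann P.metric p * |p iX| ^ P.kretschmannExponent)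
      (comap (fun p : Idx P.d → ℝ => p iX) (𝓝[≠] 0)) (𝓝 C) := by
  obtain ⟨e, α, hr, he, hk⟩ := h.exists_throatRate hn
  have hn' := cast_three_le hn
  have hc := h.rc_pos
  have he0 : e ≠ 0 := by omega
  have h0 := h.tendsto_curvature_zero hr
  have h1 := h.tendsto_curvature_succ he0 hr
  set c := -(P.rc ^ (n - 2) * (((n : ℝ) - e) ^ 2 * α + ((n : ℝ) - 2) * (((n : ℝ) - e) * α)
    - ((n : ℝ) - e) * α - ((n : ℝ) - 2) * α)) with hc_def
  have hc0 : c ≠ 0 := by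
    have e1 : c = -(P.rc ^ (n - 2) * α * (((e : ℝ) - n + 1) * ((e : ℝ) - 2 * n + 2))) := by
      rw [hc_def]; ring
    rw [e1]
    refine neg_ne_zero.2 (mul_ne_zero (mul_ne_zero (by positivity) hr.ne_zero) ?_)
    rcases he with rfl | rfl | rfl
    · rw [Nat.cast_sub (by omega)]; push_cast
      refine mul_ne_zero ?_ ?_
      · linarith
      · ring_nf; norm_num
    · refine mul_ne_zero ?_ ?_ <;> intro h <;> linarith
    · rw [Nat.cast_sub (by omega)]; push_cast
      refine mul_ne_zero ?_ ?_ <;> intro h <;> linarith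
  have hlim := (((h0.pow 2).const_mul 4).add
    ((((h1 0).pow 2).add ((h1 1).pow 2)).const_mul (4 * (n : ℝ)))).add
    (((h1 2).pow 2).const_mul (2 * (n : ℝ) * (n - 1)))
  simp only [ne_eq, OfNat.ofNat_ne_zero, not_false_eq_true, zero_pow, add_zero, mul_zero] at hlim
  refine ⟨4 * c ^ 2, by positivity, ?_⟩
  refine (hlim.comp tendsto_comap).congr' ?_
  have hmem : ∀ᶠ x in 𝓝[≠] (0 : ℝ), x ≠ 0 ∧ P.A x ≠ 0 :=
    (eventually_mem_nhdsWithin).and (h.eventually_A_ne_zero hn)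
  filter_upwards [tendsto_comap.eventually hmem] with p hp
  rw [h.kretschmann_metric hp, hk]
  simp only [Function.comp_apply, Fin.succ_zero_eq_one, Fin.succ_one_eq_two,
    show (2 : Fin 3).succ = 3 from rfl]
  ring

theorem kretschmannExponent_ne_zero (h : P.Admissible n) (hn : 3 ≤ n) :
    P.kretschmannExponent ≠ 0 := by
  obtain ⟨e, -, -, he, hk⟩ := h.exists_throatRate hn
  omega

theorem tendsto_kretschmann_atTop (h : P.Admissible n) (hn : 3 ≤ n) :
    Tendsto (kretschmann P.metric) (comap (fun p : Idx P.d → ℝ => p iX) (𝓝[≠] 0)) atTop := by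
  obtain ⟨C, hC, hlim⟩ := h.exists_tendsto_kretschmann hn
  have h1 : Tendsto (fun x : ℝ => (|x| ^ P.kretschmannExponent)⁻¹) (𝓝[≠] 0) atTop := by
    refine Tendsto.inv_tendsto_nhdsGT_zero (tendsto_nhdsWithin_iff.2
      ⟨tendsto_abs_pow_zero (h.kretschmannExponent_ne_zero hn), ?_⟩)
    filter_upwards [self_mem_nhdsWithin] with x hx
    have hx' : 0 < |x| := abs_pos.2 hx
    exact pow_pos hx' _
  refine (hlim.pos_mul_atTop hC (h1.comp tendsto_comap)).congr' ?_
  filter_upwards [tendsto_comap.eventually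
    (eventually_mem_nhdsWithin : ∀ᶠ x in 𝓝[≠] (0 : ℝ), x ∈ ({0} : Set ℝ)ᶜ)] with p hp
  have hx' : 0 < |p iX| := abs_pos.2 hp
  simp only [Function.comp_apply]
  field_simp

end Admissible
end Params
end EiBI

/-! ### Geodesics and their conserved quantities -/

namespace EiBI

section
variable {ι : Type} [Fintype ι] [DecidableEq ι]

theorem IsGeodesicOn.hasDerivAt {g : (ι → ℝ) → Matrix ι ι ℝ} {γ : ℝ → ι → ℝ} {I : Set ℝ}
    (h : IsGeodesicOn g γ I) {s : ℝ} (hs : s ∈ I) (μ : ι) :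
    HasDerivAt (fun s => γ s μ) (deriv γ s μ) s ∧ HasDerivAt (fun s => deriv γ s μ)
      (-∑ α, ∑ β, christoffel g (γ s) μ α β * deriv γ s α * deriv γ s β) s :=
  ⟨hasDerivAt_pi.1 (h s hs).1.hasDerivAt μ, hasDerivAt_pi.1 (h s hs).2 μ⟩

theorem isGeodesicOn_of_hasDerivAt {g : (ι → ℝ) → Matrix ι ι ℝ} {γ γ₁ : ℝ → ι → ℝ} {I : Set ℝ}
    (hI : IsOpen I) (h₁ : ∀ s ∈ I, ∀ μ, HasDerivAt (fun s => γ s μ) (γ₁ s μ) s)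
    (h₂ : ∀ s ∈ I, ∀ μ, HasDerivAt (fun s => γ₁ s μ)
      (-∑ α, ∑ β, christoffel g (γ s) μ α β * γ₁ s α * γ₁ s β) s) : IsGeodesicOn g γ I := by
  have hd : ∀ s ∈ I, HasDerivAt γ (γ₁ s) s := fun s hs => hasDerivAt_pi.2 (h₁ s hs)
  intro s hs
  refine ⟨(hd s hs).differentiableAt, ?_⟩
  have he : deriv γ =ᶠ[𝓝 s] γ₁ := Filter.mem_of_superset (hI.mem_nhds hs) fun u hu => (hd u hu).deriv
  simp only [he.self_of_nhds]
  exact (hasDerivAt_pi.2 (h₂ s hs)).congr_of_eventuallyEq he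

theorem IsGeodesicOn.mono {g : (ι → ℝ) → Matrix ι ι ℝ} {γ : ℝ → ι → ℝ} {I J : Set ℝ}
    (h : IsGeodesicOn g γ I) (hJ : J ⊆ I) : IsGeodesicOn g γ J := fun s hs => h s (hJ hs)

theorem IsGeodesicOn.congr {g : (ι → ℝ) → Matrix ι ι ℝ} {γ c : ℝ → ι → ℝ} {I : Set ℝ} (hI : IsOpen I)
    (h : IsGeodesicOn g γ I) (hc : EqOn c γ I) : IsGeodesicOn g c I := by
  intro s hs
  have h1 : c =ᶠ[𝓝 s] γ := Filter.mem_of_superset (hI.mem_nhds hs) hc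
  have h2 := h1.deriv
  refine ⟨(h1.differentiableAt_iff).2 (h s hs).1, ?_⟩
  rw [h1.self_of_nhds, h2.self_of_nhds]
  exact (h s hs).2.congr_of_eventuallyEq h2

end

section
variable {d : ℕ}

/-- The acceleration of a geodesic in the chart. -/
theorem sum_ssConn (u k h c e : ℝ → ℝ) (p v : Idx d → ℝ) :
    (-∑ α, ∑ β, ssConn u k h c e p iT α β * v α * v β = -(2 * u (p iX) * v iT * v iX)) ∧
    (-∑ α, ∑ β, ssConn u k h c e p iX α β * v α * v β = -(k (p iX) * v iT ^ 2 + h (p iX) * v iX ^ 2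
      + c (p iX) * sphereFactor p ^ 2 * ∑ j, v (.inr j) ^ 2)) ∧
    ∀ i, -∑ α, ∑ β, ssConn u k h c e p (.inr i) α β * v α * v β =
      -(2 * e (p iX) * v iX * v (.inr i)) + sphereFactor p *
        (2 * (∑ j, p (.inr j) * v (.inr j)) * v (.inr i) - (∑ j, v (.inr j) ^ 2) * p (.inr i)) := by
  refine ⟨?_, ?_, fun i => ?_⟩
  · simp only [sum_idx]
    simp
    ring
  · simp only [sum_idx]
    simp [ite_mul, Finset.mul_sum]
    have : ∀ x : Fin (d - 2), c (p iX) * sphereFactor p ^ 2 * v (.inr x) * v (.inr x)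
        = c (p iX) * sphereFactor p ^ 2 * v (.inr x) ^ 2 := fun x => by ring
    simp only [this]
    ring
  · simp only [sum_idx]
    simp [ite_mul]
    have h1 : ∀ x y : Fin (d - 2), sphereFactor p * ((if i = x then p (.inr y) else 0)
        + (if i = y then p (.inr x) else 0) - (if x = y then p (.inr i) else 0)) * v (.inr x) * v (.inr y)
        = (if i = x then sphereFactor p * (p (.inr y) * v (.inr y)) * v (.inr x) else 0)
        + (if i = y then sphereFactor p * (p (.inr x) * v (.inr x)) * v (.inr y) else 0)
        - (if x = y then sphereFactor p * p (.inr i) * (v (.inr x) * v (.inr y)) else 0) := by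
      intro x y
      split_ifs <;> ring
    simp only [h1, Finset.sum_add_distrib, Finset.sum_sub_distrib]
    have h2 : ∀ x : Fin (d - 2), (∑ y, if i = x then
        sphereFactor p * (p (.inr y) * v (.inr y)) * v (.inr x) else 0)
        = if i = x then sphereFactor p * (∑ y, p (.inr y) * v (.inr y)) * v (.inr x) else 0 := by
      intro x
      split_ifs
      · rw [Finset.mul_sum, Finset.sum_mul]
      · simp
    simp only [h2, Finset.sum_neg_distrib, Finset.sum_add_distrib, Finset.sum_sub_distrib,
      Finset.sum_ite_eq, Finset.mem_univ, if_true, ← Finset.sum_mul, ← Finset.mul_sum]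
    have h3 : ∑ y : Fin (d - 2), v (.inr y) * v (.inr y) = ∑ y, v (.inr y) ^ 2 :=
      Finset.sum_congr rfl fun y _ => by ring
    rw [h3]
    ring

/-- Along a curve `γ` with velocity `γ₁`, the factor of the sphere changes by `-σ² y · y'`. -/
theorem hasDerivAt_sphereFactor {γ : ℝ → Idx d → ℝ} {γ₁ : Idx d → ℝ} {s : ℝ}
    (h : ∀ i, HasDerivAt (fun s => γ s (.inr i)) (γ₁ (.inr i)) s) :
    HasDerivAt (fun s => sphereFactor (γ s))
      (-(sphereFactor (γ s) ^ 2 * ∑ i, γ s (.inr i) * γ₁ (.inr i))) s := by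
  have h1 : HasDerivAt (fun s => 1 + ∑ i, γ s (.inr i) ^ 2)
      (∑ i, 2 * (γ s (.inr i) * γ₁ (.inr i))) s := by
    refine (HasDerivAt.fun_sum fun i _ => ((h i).fun_pow 2).congr_deriv ?_).const_add 1
    simp; ring
  have h0 : (1 + ∑ i, γ s (.inr i) ^ 2 : ℝ) ≠ 0 := by positivity
  refine ((hasDerivAt_const s (2 : ℝ)).fun_div h1 h0).congr_deriv ?_
  unfold sphereFactor
  rw [← Finset.mul_sum]
  field_simp
  ring

/-- The equations of motion of a curve with velocity `v` and acceleration `w` at the point `p`, in the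
metric `a dt² + b dx² + r² dΩ²`, where `a₁`, `b₁`, `r₁` are the derivatives of `a`, `b`, `r`. -/
structure IsAccel (a a₁ b b₁ r r₁ : ℝ) (p v w : Idx d → ℝ) : Prop where
  t : w iT = -(a₁ / a * v iT * v iX)
  x : w iX = (a₁ * v iT ^ 2 - b₁ * v iX ^ 2
    + 2 * r * r₁ * sphereFactor p ^ 2 * ∑ j, v (.inr j) ^ 2) / (2 * b)
  y : ∀ i, w (.inr i) = -(2 * (r₁ / r) * v iX * v (.inr i)) + sphereFactor p *
    (2 * (∑ j, p (.inr j) * v (.inr j)) * v (.inr i) - (∑ j, v (.inr j) ^ 2) * p (.inr i))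

theorem isAccel_iff {a b r : ℝ → ℝ} {a₁ b₁ r₁ : ℝ} {p : Idx d → ℝ}
    (ha : HasDerivAt a a₁ (p iX)) (hb : HasDerivAt b b₁ (p iX)) (hr : HasDerivAt r r₁ (p iX))
    (ha0 : a (p iX) ≠ 0) (hb0 : b (p iX) ≠ 0) (hr0 : r (p iX) ≠ 0) (v w : Idx d → ℝ) :
    (∀ μ, w μ = -∑ α, ∑ β, christoffel (ssMetric a b r) p μ α β * v α * v β) ↔
      IsAccel (a (p iX)) a₁ (b (p iX)) b₁ (r (p iX)) r₁ p v w := by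
  rw [christoffel_ssMetric ha hb hr ha0 hb0 hr0]
  obtain ⟨hT, hX, hY⟩ := sum_ssConn (fun _ => a₁ / (2 * a (p iX))) (fun _ => -(a₁ / (2 * b (p iX))))
    (fun _ => b₁ / (2 * b (p iX))) (fun _ => -(r (p iX) * r₁ / b (p iX))) (fun _ => r₁ / r (p iX)) p v
  have eT : -(2 * (a₁ / (2 * a (p iX))) * v iT * v iX) = -(a₁ / a (p iX) * v iT * v iX) := by
    field_simp
  have eX : -(-(a₁ / (2 * b (p iX))) * v iT ^ 2 + b₁ / (2 * b (p iX)) * v iX ^ 2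
      + -(r (p iX) * r₁ / b (p iX)) * sphereFactor p ^ 2 * ∑ j, v (.inr j) ^ 2)
      = (a₁ * v iT ^ 2 - b₁ * v iX ^ 2
    + 2 * r (p iX) * r₁ * sphereFactor p ^ 2 * ∑ j, v (.inr j) ^ 2) / (2 * b (p iX)) := by
    field_simp
    ring
  rw [eT] at hT
  rw [eX] at hX
  constructor
  · intro h
    exact ⟨by rw [h, hT], by rw [h, hX], fun i => by rw [h, hY]⟩
  · intro h
    refine forall_idx ?_ ?_ fun i => ?_
    · rw [h.t, hT]
    · rw [h.x, hX]
    · rw [h.y, hY]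

/-- The three conserved quantities of geodesics of a static spherically symmetric metric. -/
theorem conserved_hasDerivAt {a b r : ℝ → ℝ} {a₁ b₁ r₁ : ℝ} {γ γ₁ : ℝ → Idx d → ℝ} {w : Idx d → ℝ}
    {s : ℝ} (ha : HasDerivAt a a₁ (γ s iX)) (hb : HasDerivAt b b₁ (γ s iX))
    (hr : HasDerivAt r r₁ (γ s iX)) (ha0 : a (γ s iX) ≠ 0) (hb0 : b (γ s iX) ≠ 0)
    (hr0 : r (γ s iX) ≠ 0) (h₁ : ∀ μ, HasDerivAt (fun s => γ s μ) (γ₁ s μ) s)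
    (h₂ : ∀ μ, HasDerivAt (fun s => γ₁ s μ) (w μ) s)
    (hw : IsAccel (a (γ s iX)) a₁ (b (γ s iX)) b₁ (r (γ s iX)) r₁ (γ s) (γ₁ s) w) :
    HasDerivAt (fun s => a (γ s iX) * γ₁ s iT) 0 s ∧
    HasDerivAt (fun s => r (γ s iX) ^ 4 * (sphereFactor (γ s) ^ 2 * ∑ i, γ₁ s (.inr i) ^ 2)) 0 s ∧
    HasDerivAt (fun s => a (γ s iX) * γ₁ s iT ^ 2 + b (γ s iX) * γ₁ s iX ^ 2
      + r (γ s iX) ^ 2 * (sphereFactor (γ s) ^ 2 * ∑ i, γ₁ s (.inr i) ^ 2)) 0 s := by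
  have ha' := ha.comp s (h₁ iX)
  have hb' := hb.comp s (h₁ iX)
  have hr' := hr.comp s (h₁ iX)
  have hσ := hasDerivAt_sphereFactor (γ := γ) (γ₁ := γ₁ s) fun i => h₁ (.inr i)
  set σ := sphereFactor (γ s) with hσ_def
  set YV := ∑ i, γ s (.inr i) * γ₁ s (.inr i) with hYV
  set V2 := ∑ i, γ₁ s (.inr i) ^ 2 with hV2
  have hY : HasDerivAt (fun s => ∑ i, γ₁ s (.inr i) ^ 2)
      (-(4 * (r₁ / r (γ s iX)) * γ₁ s iX * V2) + 2 * σ * YV * V2) s := by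
    refine (HasDerivAt.fun_sum fun i _ => (h₂ (.inr i)).fun_pow 2).congr_deriv ?_
    have e1 : ∀ i : Fin (d - 2), ((2 : ℕ) : ℝ) * γ₁ s (.inr i) ^ (2 - 1) * w (.inr i)
        = (-(4 * (r₁ / r (γ s iX)) * γ₁ s iX) + 4 * σ * YV) * γ₁ s (.inr i) ^ 2
          - 2 * σ * V2 * (γ s (.inr i) * γ₁ s (.inr i)) := by
      intro i
      rw [hw.y]
      simp only [Nat.add_one_sub_one, pow_one]
      push_cast
      ring
    simp only [e1, Finset.sum_sub_distrib, ← Finset.mul_sum]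
    rw [← hV2, ← hYV]
    ring
  have hσY := (hσ.fun_pow 2).fun_mul hY
  simp only [Function.comp_def] at ha' hb' hr'
  refine ⟨?_, ?_, ?_⟩
  · refine (ha'.fun_mul (h₂ iT)).congr_deriv ?_
    rw [hw.t]
    field_simp
    ring
  · refine ((hr'.fun_pow 4).fun_mul hσY).congr_deriv ?_
    rw [← hσ_def, ← hV2]
    simp only [Nat.add_one_sub_one, pow_one, show 4 - 1 = 3 from rfl]
    push_cast
    field_simp
    ring
  · refine (((ha'.fun_mul ((h₂ iT).fun_pow 2)).fun_add (hb'.fun_mul ((h₂ iX).fun_pow 2))).fun_add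
      ((hr'.fun_pow 2).fun_mul hσY)).congr_deriv ?_
    rw [hw.t, hw.x, ← hσ_def, ← hV2]
    simp only [Nat.add_one_sub_one, pow_one]
    push_cast
    field_simp
    ring

end

namespace Params
variable {P : Params} {n : ℕ}

theorem normSq_eq_components (P : Params) (γ : ℝ → Idx P.d → ℝ) (s : ℝ) :
    P.normSq γ s = -(P.gtt (γ s iX) * deriv γ s iT ^ 2 + P.gxx (γ s iX) * deriv γ s iX ^ 2
      + P.r (γ s iX) ^ 2 * (sphereFactor (γ s) ^ 2 * ∑ i, deriv γ s (.inr i) ^ 2)) := by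
  unfold normSq metric
  rw [ssMetric_eq]
  simp only [Matrix.diagonal_apply, ite_mul, zero_mul, Finset.sum_ite_eq, Finset.mem_univ, if_true]
  rw [sum_idx]
  simp only [ssDiag_iT, ssDiag_iX, ssDiag_inr, Finset.mul_sum]
  congr 2
  · ring
  · exact Finset.sum_congr rfl fun i _ => by ring

theorem angularMomentum_nonneg (P : Params) (γ : ℝ → Idx P.d → ℝ) (s : ℝ) :
    0 ≤ P.angularMomentum γ s := by
  have := sphereFactor_pos (γ s)
  unfold angularMomentum
  positivity

theorem angularMomentum_sq (P : Params) (γ : ℝ → Idx P.d → ℝ) (s : ℝ) :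
    P.angularMomentum γ s ^ 2
      = P.r (γ s iX) ^ 4 * (sphereFactor (γ s) ^ 2 * ∑ i, deriv γ s (.inr i) ^ 2) := by
  unfold angularMomentum
  rw [mul_pow, mul_pow, Real.sq_sqrt (by positivity)]
  ring

/-- The first integral of the radial motion, `(x'/Ω_(2))²` as a function of `x`. -/
def radial (P : Params) (E L κ x : ℝ) : ℝ := E ^ 2 - P.A x * P.D x * (κ + L ^ 2 / P.r x ^ 2)

namespace Admissible

theorem hasDerivAt_gtt (h : P.Admissible n) {x : ℝ} (hx : x ≠ 0) :
    HasDerivAt P.gtt (-(P.A₁ x * P.D x + P.A x * (P.D x * (P.qD x / x)))) x := by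
  have : P.gtt = fun x => -(P.A x * P.D x) := funext h.gtt_eq
  rw [this]
  exact ((h.hasDerivAt_A hx).fun_mul (h.hasDerivAt_D hx)).fun_neg

theorem hasDerivAt_gxx (h : P.Admissible n) {x : ℝ} (hx : x ≠ 0) (hA : P.A x ≠ 0) :
    HasDerivAt P.gxx ((P.D x * (P.qD x / x) * P.A x - P.D x * P.A₁ x) / P.A x ^ 2) x := by
  have : P.gxx = fun x => P.D x / P.A x := funext h.gxx_eq
  rw [this]
  exact (h.hasDerivAt_D hx).fun_div (h.hasDerivAt_A hx) hA

theorem gtt_ne_zero (h : P.Admissible n) {x : ℝ} (hx : x ≠ 0) (hA : P.A x ≠ 0) : P.gtt x ≠ 0 := by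
  rw [h.gtt_eq]; exact neg_ne_zero.2 (mul_ne_zero hA (h.D_pos hx).ne')

theorem gxx_ne_zero (h : P.Admissible n) {x : ℝ} (hx : x ≠ 0) (hA : P.A x ≠ 0) : P.gxx x ≠ 0 := by
  rw [h.gxx_eq]; exact div_ne_zero (h.D_pos hx).ne' hA

theorem isAccel_metric_iff (h : P.Admissible n) {p : Idx P.d → ℝ} (hp : p ∈ P.domain)
    (v w : Idx P.d → ℝ) :
    (∀ μ, w μ = -∑ α, ∑ β, christoffel P.metric p μ α β * v α * v β) ↔
      IsAccel (P.gtt (p iX))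
        (-(P.A₁ (p iX) * P.D (p iX) + P.A (p iX) * (P.D (p iX) * (P.qD (p iX) / p iX))))
        (P.gxx (p iX))
        ((P.D (p iX) * (P.qD (p iX) / p iX) * P.A (p iX) - P.D (p iX) * P.A₁ (p iX))
          / P.A (p iX) ^ 2)
        (P.r (p iX)) (P.r (p iX) * (P.pr (p iX) / p iX)) p v w :=
  isAccel_iff (h.hasDerivAt_gtt hp.1) (h.hasDerivAt_gxx hp.1 hp.2) (h.hasDerivAt_r' hp.1)
    (h.gtt_ne_zero hp.1 hp.2) (h.gxx_ne_zero hp.1 hp.2) (h.r_pos _).ne' v w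

theorem energy_eq' (h : P.Admissible n) (γ : ℝ → Idx P.d → ℝ) (s : ℝ) :
    P.energy γ s = -(P.gtt (γ s iX) * deriv γ s iT) := by
  unfold energy; rw [h.gtt_eq, h.Ω₂_eq, div_inv_eq_mul]; ring

/-- Geodesics have conserved energy, angular momentum and norm. -/
theorem exists_isGeodesicWith (h : P.Admissible n) {γ : ℝ → Idx P.d → ℝ} {I : Set ℝ} (hI : IsOpen I)
    (hIc : I.OrdConnected) (hIn : I.Nonempty) (hdom : ∀ s ∈ I, γ s ∈ P.domain)
    (hγ : IsGeodesicOn P.metric γ I) : ∃ E L κ : ℝ, P.IsGeodesicWith γ I E L κ := by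
  obtain ⟨s₀, hs₀⟩ := hIn
  have hc := hIc.isPreconnected
  have hder := fun s (hs : s ∈ I) => conserved_hasDerivAt (h.hasDerivAt_gtt (hdom s hs).1)
    (h.hasDerivAt_gxx (hdom s hs).1 (hdom s hs).2) (h.hasDerivAt_r' (hdom s hs).1)
    (h.gtt_ne_zero (hdom s hs).1 (hdom s hs).2) (h.gxx_ne_zero (hdom s hs).1 (hdom s hs).2)
    (h.r_pos _).ne' (fun μ => (hγ.hasDerivAt hs μ).1) (fun μ => (hγ.hasDerivAt hs μ).2)
    ((h.isAccel_metric_iff (hdom s hs) _ _).1 fun μ => rfl)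
  have key : ∀ f : ℝ → ℝ, (∀ s ∈ I, HasDerivAt f 0 s) → ∀ s ∈ I, f s = f s₀ := fun f hf s hs =>
    hI.is_const_of_deriv_eq_zero hc
      (fun u hu => (hf u hu).differentiableAt.differentiableWithinAt) (fun u hu => (hf u hu).deriv) hs hs₀
  refine ⟨P.energy γ s₀, P.angularMomentum γ s₀, P.normSq γ s₀, hdom, hγ, ?_, ?_, ?_⟩
  · intro s hs
    rw [h.energy_eq', h.energy_eq', key _ (fun u hu => (hder u hu).1) s hs]
  · intro s hs
    rw [← sq_eq_sq₀ (P.angularMomentum_nonneg γ s) (P.angularMomentum_nonneg γ s₀),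
      angularMomentum_sq, angularMomentum_sq, key _ (fun u hu => (hder u hu).2.1) s hs]
  · intro s hs
    rw [normSq_eq_components, normSq_eq_components, key _ (fun u hu => (hder u hu).2.2) s hs]

/-- The equation of the radial motion: `E`, `L` and `κ` determine the square of `x' / Ω_(2)`. -/
theorem first_integral (h : P.Admissible n) {γ : ℝ → Idx P.d → ℝ} {I : Set ℝ} {E L κ : ℝ}
    (hγ : P.IsGeodesicWith γ I E L κ) {s : ℝ} (hs : s ∈ I) :
    (P.D (γ s iX) * deriv γ s iX) ^ 2 = P.radial E L κ (γ s iX) := by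
  obtain ⟨hx, hA⟩ := hγ.mem_domain s hs
  have hE := hγ.energy_eq s hs
  have hL := angularMomentum_sq P γ s
  have hκ := hγ.normSq_eq s hs
  rw [hγ.angularMomentum_eq s hs] at hL
  rw [h.energy_eq', h.gtt_eq] at hE
  rw [normSq_eq_components, h.gtt_eq, h.gxx_eq] at hκ
  have hD := (h.D_pos hx).ne'
  have hr := (h.r_pos (γ s iX)).ne'
  unfold radial
  rw [hL, ← hκ, ← hE]
  field_simp
  ring

/-- A curve whose coordinates satisfy the first integrals of the geodesic equation, and whose radial
velocity does not vanish, is a geodesic. -/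
theorem isGeodesicWith_of_first_integrals (h : P.Admissible n) {γ γ₁ : ℝ → Idx P.d → ℝ} {I : Set ℝ}
    {E L κ : ℝ} {X₂ : ℝ → ℝ} {V : ℝ → Fin (P.d - 2) → ℝ} (hL : 0 ≤ L) (hI : IsOpen I)
    (hdom : ∀ s ∈ I, γ s ∈ P.domain)
    (hx : ∀ s ∈ I, HasDerivAt (fun s => γ s iX) (γ₁ s iX) s)
    (hx₂ : ∀ s ∈ I, HasDerivAt (fun s => γ₁ s iX) (X₂ s) s) (hx0 : ∀ s ∈ I, γ₁ s iX ≠ 0)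
    (hrad : ∀ s ∈ I, (P.D (γ s iX) * γ₁ s iX) ^ 2 = P.radial E L κ (γ s iX))
    (ht : ∀ s ∈ I, HasDerivAt (fun s => γ s iT) (γ₁ s iT) s)
    (ht₁ : ∀ s ∈ I, γ₁ s iT = E / (P.A (γ s iX) * P.D (γ s iX)))
    (hy : ∀ s ∈ I, ∀ i, HasDerivAt (fun s => γ s (.inr i)) (γ₁ s (.inr i)) s)
    (hy₁ : ∀ s ∈ I, ∀ i, γ₁ s (.inr i) = V s i / P.r (γ s iX) ^ 2)
    (hV : ∀ s ∈ I, ∀ i, HasDerivAt (fun s => V s i) (sphereFactor (γ s) *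
      (2 * (∑ j, γ s (.inr j) * V s j) * V s i - (∑ j, V s j ^ 2) * γ s (.inr i))
        / P.r (γ s iX) ^ 2) s)
    (hVL : ∀ s ∈ I, sphereFactor (γ s) ^ 2 * ∑ j, V s j ^ 2 = L ^ 2) :
    P.IsGeodesicWith γ I E L κ := by
  have hev : ∀ s ∈ I, ∀ {p : ℝ → Prop}, (∀ u ∈ I, p u) → ∀ᶠ u in 𝓝 s, p u := fun s hs p hp =>
    Filter.mem_of_superset (hI.mem_nhds hs) hp
  -- the norm; the derivative of this equation is the radial geodesic equation times the radial velocity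
  have hF : ∀ s ∈ I, E ^ 2 / P.gtt (γ s iX) + P.gxx (γ s iX) * γ₁ s iX ^ 2
      + L ^ 2 / P.r (γ s iX) ^ 2 = -κ := by
    intro s hs
    obtain ⟨hx', hA⟩ := hdom s hs
    have hD := (h.D_pos hx').ne'
    have hr := (h.r_pos (γ s iX)).ne'
    have h1 := hrad s hs
    unfold radial at h1
    rw [h.gtt_eq, h.gxx_eq]
    field_simp at h1 ⊢
    linear_combination h1
  have ht' : ∀ s ∈ I, γ₁ s iT = -(E / P.gtt (γ s iX)) := by
    intro s hs
    rw [ht₁ s hs, h.gtt_eq, div_neg, neg_neg]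
  have hder : ∀ s ∈ I, ∀ μ, HasDerivAt (fun s => γ s μ) (γ₁ s μ) s := fun s hs =>
    forall_idx (ht s hs) (hx s hs) (hy s hs)
  have hder₂ : ∀ s ∈ I, ∀ μ, HasDerivAt (fun s => γ₁ s μ)
      (-∑ α, ∑ β, christoffel P.metric (γ s) μ α β * γ₁ s α * γ₁ s β) s := by
    intro s hs
    obtain ⟨hx', hA⟩ := hdom s hs
    have ha := (h.hasDerivAt_gtt hx').comp s (hx s hs)
    have hb := (h.hasDerivAt_gxx hx' hA).comp s (hx s hs)
    have hr := (h.hasDerivAt_r' hx').comp s (hx s hs)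
    have ha0 := h.gtt_ne_zero hx' hA
    have hb0 := h.gxx_ne_zero hx' hA
    have hr0 := (h.r_pos (γ s iX)).ne'
    simp only [Function.comp_def] at ha hb hr
    set a₁ := -(P.A₁ (γ s iX) * P.D (γ s iX) + P.A (γ s iX) *
      (P.D (γ s iX) * (P.qD (γ s iX) / γ s iX))) with ha₁
    set b₁ := (P.D (γ s iX) * (P.qD (γ s iX) / γ s iX) * P.A (γ s iX)
      - P.D (γ s iX) * P.A₁ (γ s iX)) / P.A (γ s iX) ^ 2 with hb₁
    set r₁ := P.r (γ s iX) * (P.pr (γ s iX) / γ s iX) with hr₁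
    have hT := ((hasDerivAt_const s E).fun_div ha ha0).fun_neg.congr_of_eventuallyEq (hev s hs ht')
    have hY := fun i => ((hV s hs i).fun_div (hr.fun_pow 2) (pow_ne_zero 2 hr0)).congr_of_eventuallyEq
      (hev s hs fun u hu => hy₁ u hu i)
    have hX := ((((hasDerivAt_const s (E ^ 2)).fun_div ha ha0).fun_add
      (hb.fun_mul ((hx₂ s hs).fun_pow 2))).fun_add
      ((hasDerivAt_const s (L ^ 2)).fun_div (hr.fun_pow 2) (pow_ne_zero 2 hr0))).unique
      ((hasDerivAt_const s (-κ)).congr_of_eventuallyEq (hev s hs hF))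
    have hVs : sphereFactor (γ s) ^ 2 * ∑ j, γ₁ s (.inr j) ^ 2 = L ^ 2 / P.r (γ s iX) ^ 4 := by
      rw [← hVL s hs]
      simp only [hy₁ s hs, div_pow, ← Finset.sum_div]
      field_simp
    set w : Idx P.d → ℝ := Sum.elim ![_, X₂ s] (fun i => _) with hw_def
    have hw : ∀ μ, HasDerivAt (fun s => γ₁ s μ) (w μ) s := forall_idx hT (hx₂ s hs) hY
    have hacc := (h.isAccel_metric_iff (hdom s hs) (γ₁ s) w).2 ⟨?_, ?_, ?_⟩
    · intro μ
      rw [← hacc μ]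
      exact hw μ
    · rw [ht' s hs, ← ha₁]
      change -((0 * P.gtt (γ s iX) - E * (a₁ * γ₁ s iX)) / P.gtt (γ s iX) ^ 2) = _
      field_simp
      ring
    · change X₂ s = _
      rw [mul_assoc _ (sphereFactor (γ s) ^ 2), hVs, ht' s hs, ← ha₁, ← hb₁, ← hr₁,
        eq_div_iff (by positivity)]
      refine mul_left_cancel₀ (hx0 s hs) ?_
      simp only [Nat.add_one_sub_one, pow_one] at hX
      push_cast at hX
      field_simp at hX ⊢
      linear_combination hX
    · intro i
      change (_ * P.r (γ s iX) ^ 2 - _) / (P.r (γ s iX) ^ 2) ^ 2 = _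
      have e1 : ∑ j, γ s (.inr j) * γ₁ s (.inr j) = (∑ j, γ s (.inr j) * V s j) / P.r (γ s iX) ^ 2 := by
        simp only [hy₁ s hs, Finset.sum_div, mul_div_assoc]
      have e2 : ∑ j, γ₁ s (.inr j) ^ 2 = (∑ j, V s j ^ 2) / P.r (γ s iX) ^ 4 := by
        simp only [hy₁ s hs, div_pow, Finset.sum_div, ← pow_mul]
      rw [e1, e2, hy₁ s hs i, ← hr₁]
      simp only [Nat.add_one_sub_one, pow_one]
      push_cast
      field_simp
      ring
  have hgeo := isGeodesicOn_of_hasDerivAt hI hder hder₂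
  have hderiv : ∀ s ∈ I, ∀ μ, deriv γ s μ = γ₁ s μ := fun s hs μ => by
    rw [(hasDerivAt_pi.2 (hder s hs)).deriv]
  have hVs : ∀ s ∈ I, sphereFactor (γ s) ^ 2 * ∑ j, γ₁ s (.inr j) ^ 2 = L ^ 2 / P.r (γ s iX) ^ 4 := by
    intro s hs
    have hr0 := (h.r_pos (γ s iX)).ne'
    rw [← hVL s hs]
    simp only [hy₁ s hs, div_pow, ← Finset.sum_div]
    field_simp
  refine ⟨hdom, hgeo, fun s hs => ?_, fun s hs => ?_, fun s hs => ?_⟩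
  · obtain ⟨hx', hA⟩ := hdom s hs
    have ha0 := h.gtt_ne_zero hx' hA
    rw [h.energy_eq', hderiv s hs, ht' s hs]
    field_simp
  · have hr0 := (h.r_pos (γ s iX)).ne'
    rw [← sq_eq_sq₀ (P.angularMomentum_nonneg γ s) hL, angularMomentum_sq]
    simp only [hderiv s hs]
    rw [hVs s hs]
    field_simp
  · obtain ⟨hx', hA⟩ := hdom s hs
    have ha0 := h.gtt_ne_zero hx' hA
    have hr0 := (h.r_pos (γ s iX)).ne'
    rw [normSq_eq_components]
    simp only [hderiv s hs]
    rw [hVs s hs, ht' s hs]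
    have := hF s hs
    field_simp at this ⊢
    linear_combination -this

end Admissible
end Params
end EiBI

/-! ### Real functions with speed bounded below, and quadratures -/

namespace EiBI
namespace RealLemmas

theorem contDiffOn_one_of_hasDerivAt {f f' : ℝ → ℝ} {s : Set ℝ} (hs : IsOpen s)
    (h : ∀ x ∈ s, HasDerivAt f (f' x) x) (hc : ContinuousOn f' s) : ContDiffOn ℝ 1 f s := by
  have h1 : ContDiffOn ℝ (0 + 1) f s := by
    refine (contDiffOn_succ_iff_deriv_of_isOpen hs).2
      ⟨fun x hx => (h x hx).differentiableAt.differentiableWithinAt, by simp, ?_⟩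
    rw [contDiffOn_zero]
    exact hc.congr fun x hx => (h x hx).deriv
  rwa [zero_add] at h1

/-- A positive function that decreases at some point, and whose derivative is at least `m` in absolute
value wherever it is at most `η`, keeps decreasing. -/
theorem decreasing_of_abs_deriv_ge {p p' : ℝ → ℝ} {I : Set ℝ} {η m s₁ : ℝ} (hI : I.OrdConnected)
    (hp : ∀ s ∈ I, HasDerivAt p (p' s) s) (hc : ContinuousOn p' I) (hm : 0 < m)
    (hlow : ∀ s ∈ I, p s ≤ η → m ≤ |p' s|) (hs₁ : s₁ ∈ I) (hη : p s₁ ≤ η) (hneg : p' s₁ < 0)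
    {u : ℝ} (hu : u ∈ I) (hsu : s₁ ≤ u) : p u ≤ p s₁ - m * (u - s₁) := by
  have hsub : Icc s₁ u ⊆ I := hI.out hs₁ hu
  have hanti : ∀ b ∈ Icc s₁ u, (∀ s ∈ Ioo s₁ b, p' s ≤ 0) → p b ≤ p s₁ := by
    intro b hb hle
    have hsub' : Icc s₁ b ⊆ I := (Icc_subset_Icc_right hb.2).trans hsub
    refine antitoneOn_of_deriv_nonpos (convex_Icc s₁ b)
      (fun s hs => (hp s (hsub' hs)).continuousAt.continuousWithinAt) (fun s hs => ?_) (fun s hs => ?_)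
      (left_mem_Icc.2 hb.1) (right_mem_Icc.2 hb.1) hb.1
    · rw [interior_Icc] at hs
      exact (hp s (hsub' (Ioo_subset_Icc_self hs))).differentiableAt.differentiableWithinAt
    · rw [interior_Icc] at hs
      rw [(hp s (hsub' (Ioo_subset_Icc_self hs))).deriv]
      exact hle s hs
  have hneg' : ∀ s ∈ Icc s₁ u, p' s < -(m / 2) := by
    by_contra! hex
    set Z := Icc s₁ u ∩ p' ⁻¹' Ici (-(m / 2)) with hZ
    have hZc : IsClosed Z := (hc.mono hsub).preimage_isClosed_of_isClosed isClosed_Icc isClosed_Ici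
    have hZn : Z.Nonempty := by
      obtain ⟨s, hs, hs'⟩ := hex
      exact ⟨s, hs, hs'⟩
    have hZb : BddBelow Z := ⟨s₁, fun s hs => hs.1.1⟩
    have hmem := hZc.csInf_mem hZn hZb
    set b := sInf Z with hb
    have hlt : ∀ s ∈ Ico s₁ b, p' s < -(m / 2) := by
      intro s hs
      by_contra! hcon
      exact absurd (csInf_le hZb (show s ∈ Z from ⟨⟨hs.1, (hs.2.le).trans hmem.1.2⟩, hcon⟩))
        (not_le.2 hs.2)
    have hpb : p b ≤ η := (hanti b hmem.1 fun s hs =>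
      (hlt s ⟨hs.1.le, hs.2⟩).le.trans (by linarith)).trans hη
    have hb1 : s₁ < b := by
      refine lt_of_le_of_ne hmem.1.1 fun h => ?_
      have h1 := hlow s₁ hs₁ hη
      rw [abs_of_neg hneg] at h1
      have h2 : -(m / 2) ≤ p' b := hmem.2
      rw [← h] at h2
      linarith
    have hle : p' b ≤ -(m / 2) := by
      have h1 : ContinuousWithinAt p' (Ico s₁ b) b :=
        (hc b (hsub hmem.1)).mono fun s hs => hsub ⟨hs.1, hs.2.le.trans hmem.1.2⟩
      have h2 : b ∈ closure (Ico s₁ b) := by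
        rw [closure_Ico hb1.ne]; exact right_mem_Icc.2 hb1.le
      have := mem_closure_iff_nhdsWithin_neBot.1 h2
      exact le_of_tendsto h1 (eventually_mem_nhdsWithin.mono fun s hs => (hlt s hs).le)
    have h1 := hlow b (hsub hmem.1) hpb
    rw [abs_of_nonpos (by linarith)] at h1
    have h2 : -(m / 2) ≤ p' b := hmem.2
    linarith
  have hm' : ∀ s ∈ Icc s₁ u, p' s ≤ -m := by
    intro s hs
    have h1 : p s ≤ η := (hanti s hs fun v hv =>
      (hneg' v ⟨hv.1.le, hv.2.le.trans hs.2⟩).le.trans (by linarith)).trans hη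
    have h2 := hlow s (hsub hs) h1
    rw [abs_of_neg ((hneg' s hs).trans (by linarith))] at h2
    linarith
  have := (convex_Icc s₁ u).image_sub_le_mul_sub_of_deriv_le (f := p) (C := -m)
    (fun s hs => (hp s (hsub hs)).continuousAt.continuousWithinAt)
    (fun s hs => (hp s (hsub (interior_subset hs))).differentiableAt.differentiableWithinAt)
    (fun s hs => by rw [(hp s (hsub (interior_subset hs))).deriv]; exact hm' s (interior_subset hs))
    s₁ (left_mem_Icc.2 hsu) u (right_mem_Icc.2 hsu) hsu
  linarith

/-- If `p` gets arbitrarily small to the right, at a speed bounded below, it tends to zero at a finite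
right end point of its interval of definition. -/
theorem exists_right_endpoint {p : ℝ → ℝ} {I : Set ℝ} (hIo : IsOpen I) (hpos : ∀ s ∈ I, 0 < p s)
    (h : ∀ ε > 0, ∃ s ∈ I, ∀ u ∈ I, s ≤ u → p u < ε ∧ p u ≤ p s - (u - s)) :
    ∃ s₀ ∈ closure I \ I, Tendsto p (𝓝[I] s₀) (𝓝 0) := by
  have hbdd : BddAbove I := by
    obtain ⟨s, hs, hsu⟩ := h 1 one_pos
    refine ⟨s + p s, fun u hu => ?_⟩
    rcases le_total s u with hle | hle
    · have := (hsu u hu hle).2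
      linarith [hpos u hu]
    · linarith [hpos s hs]
  have hne : I.Nonempty := by obtain ⟨s, hs, -⟩ := h 1 one_pos; exact ⟨s, hs⟩
  have hlub := isLUB_csSup hne hbdd
  have hnot : sSup I ∉ I := by
    intro hmem
    obtain ⟨ε, hε, hb⟩ := Metric.isOpen_iff.1 hIo _ hmem
    have h1 : sSup I + ε / 2 ∈ I := hb (by simp [abs_of_pos hε, hε])
    linarith [hlub.1 h1]
  refine ⟨sSup I, ⟨hlub.mem_closure hne, hnot⟩, ?_⟩
  rw [Metric.tendsto_nhds]
  intro ε hε
  obtain ⟨s, hs, hsu⟩ := h ε hε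
  have hlt : s < sSup I := lt_of_le_of_ne (hlub.1 hs) fun he => hnot (he ▸ hs)
  filter_upwards [nhdsWithin_le_nhds (lt_mem_nhds hlt), self_mem_nhdsWithin] with u hu huI
  rw [Real.dist_eq, sub_zero, abs_of_pos (hpos u huI)]
  exact (hsu u huI hu.le).1

theorem exists_left_endpoint {p : ℝ → ℝ} {I : Set ℝ} (hIo : IsOpen I) (hpos : ∀ s ∈ I, 0 < p s)
    (h : ∀ ε > 0, ∃ s ∈ I, ∀ u ∈ I, u ≤ s → p u < ε ∧ p u ≤ p s - (s - u)) :
    ∃ s₀ ∈ closure I \ I, Tendsto p (𝓝[I] s₀) (𝓝 0) := by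
  have hcl : closure (Neg.neg ⁻¹' I) = Neg.neg ⁻¹' closure I :=
    ((Homeomorph.neg ℝ).preimage_closure I).symm
  obtain ⟨s₀, ⟨hs, hs'⟩, ht⟩ := exists_right_endpoint (p := fun s => p (-s)) (I := Neg.neg ⁻¹' I)
    (hIo.preimage continuous_neg) (fun s hs => hpos _ hs) (fun ε hε => by
      obtain ⟨s, hs, hsu⟩ := h ε hε
      refine ⟨-s, by simpa using hs, fun u hu hle => ?_⟩
      have := hsu (-u) hu (by linarith)
      refine ⟨this.1, ?_⟩
      rw [neg_neg]
      linarith [this.2])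
  rw [hcl] at hs
  refine ⟨-s₀, ⟨hs, hs'⟩, ?_⟩
  have h1 : Tendsto (fun s : ℝ => -s) (𝓝[I] (-s₀)) (𝓝[Neg.neg ⁻¹' I] s₀) := by
    refine tendsto_nhdsWithin_iff.2 ⟨?_, ?_⟩
    · have := (continuous_neg.tendsto (-s₀)).mono_left (nhdsWithin_le_nhds (s := I))
      rwa [neg_neg] at this
    · filter_upwards [self_mem_nhdsWithin] with s hs
      simpa using hs
  simpa [Function.comp_def] using ht.comp h1

/-- A positive function on an interval, whose speed is at least `1` wherever it is small, is bounded
below, or tends to zero at a finite end point. -/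
theorem bounded_below_or_tendsto_zero {p p' : ℝ → ℝ} {I : Set ℝ} {η : ℝ} (hI : I.OrdConnected)
    (hIo : IsOpen I) (hpos : ∀ s ∈ I, 0 < p s) (hp : ∀ s ∈ I, HasDerivAt p (p' s) s)
    (hc : ContinuousOn p' I) (hη : 0 < η) (hlow : ∀ s ∈ I, p s ≤ η → 1 ≤ |p' s|) :
    (∃ m > 0, ∀ s ∈ I, m ≤ p s) ∨ ∃ s₀ ∈ closure I \ I, Tendsto p (𝓝[I] s₀) (𝓝 0) := by
  by_cases hb : ∃ m > 0, ∀ s ∈ I, m ≤ p s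
  · exact Or.inl hb
  right
  push Not at hb
  by_cases hR : ∀ ε > 0, ∃ s ∈ I, ∀ u ∈ I, s ≤ u → p u < ε ∧ p u ≤ p s - (u - s)
  · exact exists_right_endpoint hIo hpos hR
  refine exists_left_endpoint hIo hpos fun ε hε => ?_
  push Not at hR
  obtain ⟨ε₀, hε₀, hR⟩ := hR
  obtain ⟨s, hs, hlt⟩ := hb (min ε (min ε₀ η)) (by positivity)
  have h1 : p s < ε := hlt.trans_le (min_le_left _ _)
  have h2 : p s < ε₀ := hlt.trans_le ((min_le_right _ _).trans (min_le_left _ _))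
  have h3 : p s ≤ η := (hlt.trans_le ((min_le_right _ _).trans (min_le_right _ _))).le
  have h4 := hlow s hs h3
  rcases lt_trichotomy (p' s) 0 with h0 | h0 | h0
  -- to the right of `s` the function would keep decreasing, against `hR`
  · obtain ⟨u, hu, hsu, hcon⟩ := hR s hs
    have := decreasing_of_abs_deriv_ge hI hp hc one_pos hlow hs h3 h0 hu hsu
    rw [one_mul] at this
    exact absurd this (not_le.2 (hcon (by linarith)))
  · rw [h0, abs_zero] at h4
    linarith
  · refine ⟨s, hs, fun u hu hus => ?_⟩
    have hneg : ∀ v ∈ Neg.neg ⁻¹' I, HasDerivAt (fun v => p (-v)) (-(p' (-v))) v := fun v hv => by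
      simpa [Function.comp_def] using (hp (-v) hv).comp v (hasDerivAt_neg v)
    have hI' : (Neg.neg ⁻¹' I).OrdConnected := by
      refine ⟨fun a ha b hb v hv => hI.out hb ha ⟨?_, ?_⟩⟩ <;> linarith [hv.1, hv.2]
    have := decreasing_of_abs_deriv_ge (p := fun v => p (-v)) (p' := fun v => -(p' (-v)))
      (s₁ := -s) (u := -u) hI' hneg
      ((hc.comp continuous_neg.continuousOn fun v hv => hv).neg) one_pos
      (fun v hv hle => by rw [abs_neg]; exact hlow _ hv hle) (by simpa using hs) (by simpa using h3)
      (by simpa using h0) (by simpa using hu) (by linarith)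
    simp only [neg_neg] at this
    constructor <;> linarith

/-- Inverting a quadrature: the integral of a continuous function that is positive, except perhaps at
one point, extends to a homeomorphism of the line. -/
theorem exists_quadrature {W : ℝ → ℝ} {ξ δ z : ℝ} (hδ : 0 < δ)
    (hW : ContinuousOn W (Icc (ξ - δ) (ξ + δ)))
    (hpos : ∀ x ∈ Ioo (ξ - δ) (ξ + δ), x ≠ z → 0 < W x) :
    ∃ Λ X : ℝ → ℝ, StrictMono Λ ∧ Continuous Λ ∧ Continuous X ∧ (∀ x, X (Λ x) = x) ∧
      (∀ s, Λ (X s) = s) ∧ Λ ξ = 0 ∧ (∀ x ∈ Ioo (ξ - δ) (ξ + δ), HasDerivAt Λ (W x) x) := by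
  have hle : ξ - δ ≤ ξ + δ := by linarith
  have hξ : ξ ∈ Icc (ξ - δ) (ξ + δ) := ⟨by linarith, by linarith⟩
  set F : ℝ → ℝ := fun x => ∫ y in ξ..x, W y with hF
  have hder : ∀ x ∈ Ioo (ξ - δ) (ξ + δ), HasDerivAt F (W x) x := by
    intro x hx
    have hnhds := Icc_mem_nhds hx.1 hx.2
    refine intervalIntegral.integral_hasDerivAt_right ?_ ?_ (hW.continuousAt hnhds)
    · exact (hW.mono (uIcc_subset_Icc hξ (Ioo_subset_Icc_self hx))).intervalIntegrable
    · exact (hW.mono Ioo_subset_Icc_self).stronglyMeasurableAtFilter isOpen_Ioo x hx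
  have hcont : ContinuousOn F (Icc (ξ - δ) (ξ + δ)) := by
    refine (intervalIntegral.continuousOn_primitive_interval' (b₁ := ξ - δ) (b₂ := ξ + δ) ?_ ?_).mono ?_
    · exact (hW.mono (uIcc_subset_Icc (left_mem_Icc.2 hle) (right_mem_Icc.2 hle))).intervalIntegrable
    · rwa [uIcc_of_le hle]
    · rw [uIcc_of_le hle]
  have hmonoF : StrictMonoOn F (Icc (ξ - δ) (ξ + δ)) := by
    have hstep : ∀ x ∈ Icc (ξ - δ) (ξ + δ), ∀ y ∈ Icc (ξ - δ) (ξ + δ), x < y → z ∉ Ioo x y →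
        F x < F y := by
      intro x hx y hy hxy hz
      have hsub : Ioo x y ⊆ Ioo (ξ - δ) (ξ + δ) := Ioo_subset_Ioo hx.1 hy.2
      refine strictMonoOn_of_deriv_pos (convex_Icc x y) (hcont.mono (Icc_subset_Icc hx.1 hy.2))
        (fun u hu => ?_) (left_mem_Icc.2 hxy.le) (right_mem_Icc.2 hxy.le) hxy
      rw [interior_Icc] at hu
      rw [(hder u (hsub hu)).deriv]
      exact hpos u (hsub hu) fun h => hz (h ▸ hu)
    intro x hx y hy hxy
    by_cases hz : z ∈ Ioo x y
    · have hz' : z ∈ Icc (ξ - δ) (ξ + δ) := ⟨hx.1.trans hz.1.le, hz.2.le.trans hy.2⟩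
      exact (hstep x hx z hz' hz.1 fun h => lt_irrefl _ h.2).trans
        (hstep z hz' y hy hz.2 fun h => lt_irrefl _ h.1)
    · exact hstep x hx y hy hxy hz
  -- outside the interval the primitive is continued with slope `1`
  set cl : ℝ → ℝ := fun x => max (ξ - δ) (min x (ξ + δ)) with hcl
  have hclm : ∀ x, cl x ∈ Icc (ξ - δ) (ξ + δ) := fun x =>
    ⟨le_max_left _ _, max_le hle (min_le_right _ _)⟩
  have hclc : Continuous cl := by fun_prop
  have hclid : ∀ x ∈ Icc (ξ - δ) (ξ + δ), cl x = x := fun x hx => by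
    simp only [hcl]; rw [min_eq_left hx.2, max_eq_right hx.1]
  have hclmono : Monotone cl := fun x y hxy => max_le_max le_rfl (min_le_min_right _ hxy)
  have hcllip : ∀ x y, x ≤ y → cl y - cl x ≤ y - x := by
    intro x y hxy
    simp only [hcl]
    rcases le_total x (ξ + δ) with h1 | h1 <;> rcases le_total y (ξ + δ) with h2 | h2 <;>
      simp only [min_eq_left, min_eq_right, h1, h2] <;>
      rcases le_total (ξ - δ) x with h3 | h3 <;> rcases le_total (ξ - δ) y with h4 | h4 <;>
      simp only [max_eq_left, max_eq_right, h3, h4, hle] <;> linarith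
  set Λ : ℝ → ℝ := fun x => F (cl x) + (x - cl x) with hΛ
  have hΛc : Continuous Λ :=
    (hcont.comp_continuous hclc hclm).add (continuous_id.sub hclc)
  have hΛm : StrictMono Λ := by
    intro x y hxy
    have h1 := hcllip x y hxy.le
    rcases (hclmono hxy.le).lt_or_eq with h2 | h2
    · have := hmonoF (hclm x) (hclm y) h2
      simp only [hΛ]; linarith
    · simp only [hΛ]; rw [h2]; linarith
  have hsurj : Function.Surjective Λ := by
    refine hΛc.surjective ?_ ?_
    · refine tendsto_atTop_mono (f := fun x => F (ξ - δ) + (x - (ξ + δ))) (fun x => ?_) ?_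
      · have := hmonoF.monotoneOn (left_mem_Icc.2 hle) (hclm x) (hclm x).1
        have := (hclm x).2
        simp only [hΛ]; linarith
      · exact tendsto_atTop_add_const_left _ _ (tendsto_atTop_add_const_right _ _ tendsto_id)
    · refine tendsto_atBot_mono (f := fun x => F (ξ + δ) + (x - (ξ - δ))) (fun x => ?_) ?_
      · have := hmonoF.monotoneOn (hclm x) (right_mem_Icc.2 hle) (hclm x).2
        have := (hclm x).1
        simp only [hΛ]; linarith
      · exact tendsto_atBot_add_const_left _ _ (tendsto_atBot_add_const_right _ _ tendsto_id)
  set e := hΛm.orderIsoOfSurjective Λ hsurj with he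
  refine ⟨Λ, e.symm, hΛm, hΛc, e.symm.continuous, fun x => e.symm_apply_apply x,
    fun s => e.apply_symm_apply s, ?_, fun x hx => ?_⟩
  · simp only [hΛ]
    rw [hclid ξ hξ]
    simp [hF]
  · refine (hder x hx).congr_of_eventuallyEq ?_
    filter_upwards [Ioo_mem_nhds hx.1 hx.2] with y hy
    simp only [hΛ]
    rw [hclid y (Ioo_subset_Icc_self hy), sub_self, add_zero]

end RealLemmas
end EiBI

/-! ### Radial motion near the throat -/

namespace EiBI
namespace Params

/-- Radial motion with the given conserved quantities reaches the throat: there `dλ/dx` behaves as a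
positive power of `|x|`, and the singular part of `dt/dx` is that of an ingoing or outgoing radial null
geodesic. -/
structure ReachesThroat (P : Params) (E L κ c : ℝ) : Prop where
  pos : ∀ᶠ x in 𝓝[≠] (0 : ℝ), 0 < P.radial E L κ x
  coeff_pos : 0 < c
  exponent_pos : 0 < P.throatExponent E L κ
  rate : Tendsto (fun x => P.D x / √(P.radial E L κ x) / |x| ^ P.throatExponent E L κ) (𝓝[≠] 0) (𝓝 c)
  time : ∃ τ : ℝ, (τ = 1 ∨ τ = -1) ∧ ∃ ℓ,
    Tendsto (fun x => E / (P.A x * √(P.radial E L κ x)) + τ / P.A x) (𝓝[≠] 0) (𝓝 ℓ)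

variable {P : Params} {n : ℕ} {E L κ : ℝ}

theorem radial_pos_factor (hκ : 0 ≤ κ) (hK : κ ≠ 0 ∨ L ≠ 0) {R : ℝ} (hR : 0 < R) :
    0 < κ + L ^ 2 / R ^ 2 := by
  rcases hK with h | h
  · have : 0 < κ := lt_of_le_of_ne hκ (Ne.symm h)
    positivity
  · have : 0 < L ^ 2 := by positivity
    positivity

namespace Admissible

theorem tendsto_centrifugal (h : P.Admissible n) (L κ : ℝ) :
    Tendsto (fun x => κ + L ^ 2 / P.r x ^ 2) (𝓝[≠] 0) (𝓝 (κ + L ^ 2 / P.rc ^ 2)) :=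
  (tendsto_const_nhds.div (h.tendsto_r.pow 2) (by have := h.rc_pos; positivity)).const_add κ

theorem tendsto_AD (h : P.Admissible n) {e : ℕ} {α : ℝ} (hr : P.ThroatRate n e α) :
    Tendsto (fun x => P.A x * P.D x * (|x| ^ e / |x| ^ (2 * n - 2))) (𝓝[≠] 0)
      (𝓝 (α * (1 / (2 * P.rc ^ (n - 2))))) := by
  refine (hr.zeroth.mul h.tendsto_D_div).congr' ?_
  filter_upwards [self_mem_nhdsWithin] with x hx
  have hx' : 0 < |x| := abs_pos.2 hx
  have e1 : |x| ^ (2 * n - 2) = |x| ^ n * |x| ^ (n - 2) := by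
    rw [← pow_add]; congr 1; have := h.hn; omega
  rw [e1]
  field_simp

theorem tendsto_AD_mul_abs (h : P.Admissible n) (hn : 3 ≤ n) (hM : P.massThroat ≠ 0) :
    Tendsto (fun x => P.A x * P.D x * |x|) (𝓝[≠] 0)
      (𝓝 (-(2 * P.massThroat / ((n : ℝ) - 1)) * (1 / (2 * P.rc ^ (n - 2))))) := by
  refine (h.tendsto_AD (h.throatRate_of_massThroat_ne_zero hn hM)).congr' ?_
  filter_upwards [self_mem_nhdsWithin] with x hx
  have hx' : 0 < |x| := abs_pos.2 hx
  congr 1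
  rw [div_eq_iff (by positivity), ← pow_succ']
  congr 1; omega

theorem tendsto_AD_div (h : P.Admissible n) (hn : 3 ≤ n) (hM : P.massThroat = 0) :
    Tendsto (fun x => P.A x * P.D x / |x| ^ (n - 2)) (𝓝[≠] 0)
      (𝓝 (P.A₀ * (1 / (2 * P.rc ^ (n - 2))))) := by
  refine ((h.tendsto_A_zero hn hM).mul h.tendsto_D_div).congr fun x => ?_
  rw [mul_div_assoc]

/-- Except in the exceptional case, `dx / A` is regular at the throat. -/
theorem exists_tendsto_inv_A (h : P.Admissible n) (hn : 3 ≤ n) (hE : ¬ P.Exceptional) :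
    ∃ ℓ, Tendsto (fun x => 1 / P.A x) (𝓝[≠] 0) (𝓝 ℓ) := by
  rw [h.exceptional_iff hn] at hE
  rcases eq_or_ne P.massThroat 0 with hM | hM
  · exact ⟨_, tendsto_const_nhds.div (h.tendsto_A_zero hn hM) fun h0 => hE ⟨hM, h0⟩⟩
  · have hr := h.throatRate_of_massThroat_ne_zero hn hM
    refine ⟨0, ?_⟩
    have h1 := (tendsto_abs_pow_zero (e := n - 1) (by omega)).div hr.zeroth hr.ne_zero
    rw [zero_div] at h1
    refine h1.congr' ?_
    filter_upwards [self_mem_nhdsWithin] with x hx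
    have hx' : 0 < |x| := abs_pos.2 hx
    have e1 : |x| ^ (2 * n - 1) = |x| ^ n * |x| ^ (n - 1) := by
      rw [← pow_add]; congr 1; omega
    simp only [Pi.div_apply]
    rw [e1]
    field_simp

theorem throatExponent_eq (h : P.Admissible n) (hn : 3 ≤ n) (E L κ : ℝ) :
    (0 < P.massThroat → (κ ≠ 0 ∨ L ≠ 0) → P.throatExponent E L κ = (n : ℝ) - 3 / 2) ∧
    (¬ (0 < P.massThroat ∧ (κ ≠ 0 ∨ L ≠ 0)) → E ≠ 0 → P.throatExponent E L κ = (n : ℝ) - 2) ∧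
    (¬ (0 < P.massThroat ∧ (κ ≠ 0 ∨ L ≠ 0)) → E = 0 → P.throatExponent E L κ = ((n : ℝ) - 2) / 2) := by
  unfold throatExponent
  rw [h.spacelikeThroat_iff hn, h.cast_d]
  refine ⟨fun h1 h2 => ?_, fun h1 h2 => ?_, fun h1 h2 => ?_⟩
  · rw [if_pos ⟨h1, h2⟩]; ring
  · rw [if_neg h1, if_pos h2]; ring
  · rw [if_neg h1, if_neg (not_not.2 h2)]; ring

/-- If the effective potential vanishes at the throat and `E ≠ 0`, the motion near the throat is that of
a radial null geodesic. -/
theorem reachesThroat_of_energy_ne_zero (h : P.Admissible n) (hn : 3 ≤ n) (hE : E ≠ 0)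
    (hs : P.throatExponent E L κ = (n : ℝ) - 2)
    (hv : Tendsto (P.radial E L κ) (𝓝[≠] 0) (𝓝 (E ^ 2))) : ∃ c, P.ReachesThroat E L κ c := by
  have hn' := cast_three_le hn
  have hc := h.rc_pos
  have hE' : 0 < |E| := abs_pos.2 hE
  have hpos : ∀ᶠ x in 𝓝[≠] (0 : ℝ), 0 < P.radial E L κ x :=
    hv.eventually (lt_mem_nhds (by positivity))
  have hsq : Tendsto (fun x => √(P.radial E L κ x)) (𝓝[≠] 0) (𝓝 |E|) := by
    have := hv.sqrt
    rwa [Real.sqrt_sq_eq_abs] at this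
  refine ⟨1 / (2 * P.rc ^ (n - 2)) / |E|, hpos, by positivity, by rw [hs]; linarith, ?_, ?_⟩
  · refine (h.tendsto_D_div.div hsq hE'.ne').congr' ?_
    filter_upwards [self_mem_nhdsWithin] with x hx
    rw [hs, show (n : ℝ) - 2 = ((n - 2 : ℕ) : ℝ) by rw [Nat.cast_sub h.hn]; push_cast; ring,
      Real.rpow_natCast]
    simp only [Pi.div_apply]
    rw [div_right_comm]
  · have hlim := (((h.tendsto_D hn).mul (h.tendsto_centrifugal L κ)).div
      (hsq.mul (hsq.const_add |E|)) (by positivity)).const_mul (E / |E|)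
    -- the sign of `dx/A` which compensates the singular part of the time:
    -- `(E / √radial - E / |E|) / A = (E / |E|) D (κ + L² / r²) / (√radial (|E| + √radial))`
    refine ⟨-(E / |E|), ?_, _, hlim.congr' ?_⟩
    · rcases lt_or_gt_of_ne hE with h0 | h0
      · left; rw [abs_of_neg h0, div_neg, div_self hE, neg_neg]
      · right; rw [abs_of_pos h0, div_self hE]
    · filter_upwards [hpos, h.eventually_A_ne_zero hn] with x hx hA
      have h1 : 0 < √(P.radial E L κ x) := Real.sqrt_pos.2 hx
      have h2 : √(P.radial E L κ x) ^ 2 = |E| ^ 2 - P.A x * P.D x * (κ + L ^ 2 / P.r x ^ 2) := by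
        rw [Real.sq_sqrt hx.le, sq_abs]; rfl
      simp only [Pi.div_apply]
      generalize √(P.radial E L κ x) = S at *
      have h3 : P.D x * (κ + L ^ 2 / P.r x ^ 2) = (|E| ^ 2 - S ^ 2) / P.A x := by
        rw [h2]; field_simp; ring
      rw [h3]
      have h4 : |E| + S ≠ 0 := by positivity
      field_simp
      ring

/-- If the mass function does not vanish at the throat, the effective potential of non-radial or massive
motion diverges as `1 / |x|`, with the sign of the mass function. -/
theorem tendsto_radial_mul_abs (h : P.Admissible n) (hn : 3 ≤ n) (hM : P.massThroat ≠ 0) :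
    Tendsto (fun x => P.radial E L κ x * |x|) (𝓝[≠] 0)
      (𝓝 (2 * P.massThroat / ((n : ℝ) - 1) * (1 / (2 * P.rc ^ (n - 2)))
        * (κ + L ^ 2 / P.rc ^ 2))) := by
  have habs : Tendsto (fun x : ℝ => |x|) (𝓝[≠] 0) (𝓝 0) := by
    simpa using tendsto_abs_pow_zero one_ne_zero
  have h1 := ((habs.const_mul (E ^ 2)).sub ((h.tendsto_AD_mul_abs hn hM).mul
    (h.tendsto_centrifugal L κ))).congr (f₂ := fun x => P.radial E L κ x * |x|) fun x => by
      simp only [radial]; ring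
  convert h1 using 2
  ring

/-- A time-like throat repels, unless the motion is radial and null. -/
theorem radial_neg_of_massThroat_neg (h : P.Admissible n) (hn : 3 ≤ n) (hκ : 0 ≤ κ)
    (hK : κ ≠ 0 ∨ L ≠ 0) (hM : P.massThroat < 0) : ∀ᶠ x in 𝓝[≠] (0 : ℝ), P.radial E L κ x < 0 := by
  have hn1 : 0 < (n : ℝ) - 1 := by have := cast_three_le hn; linarith
  have hc := h.rc_pos
  have hK0 := radial_pos_factor hκ hK hc
  have h2 : 2 * P.massThroat / ((n : ℝ) - 1) * (1 / (2 * P.rc ^ (n - 2)))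
      * (κ + L ^ 2 / P.rc ^ 2) < 0 :=
    mul_neg_of_neg_of_pos (mul_neg_of_neg_of_pos (div_neg_of_neg_of_pos (by linarith) hn1)
      (by positivity)) hK0
  filter_upwards [(h.tendsto_radial_mul_abs (E := E) (L := L) (κ := κ) hn hM.ne).eventually
    (gt_mem_nhds h2), self_mem_nhdsWithin] with x hx hx0
  exact neg_of_mul_neg_left hx (abs_nonneg x)

theorem differentiableAt_radial (h : P.Admissible n) {x : ℝ} (hx : x ≠ 0) :
    DifferentiableAt ℝ (P.radial E L κ) x := by
  refine DifferentiableAt.const_sub (DifferentiableAt.mul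
    ((h.hasDerivAt_A hx).differentiableAt.mul (h.hasDerivAt_D hx).differentiableAt) ?_) _
  exact ((differentiableAt_const _).div ((h.hasDerivAt_r' hx).differentiableAt.pow 2)
    (pow_ne_zero 2 (h.r_pos _).ne')).const_add _

/-- The possible radial motions near the throat: they are repelled, or at rest, or reach it. -/
theorem radial_cases (h : P.Admissible n) (hn : 3 ≤ n) (hκ : 0 ≤ κ) :
    (∀ᶠ x in 𝓝[≠] (0 : ℝ), P.radial E L κ x < 0) ∨ (E = 0 ∧ L = 0 ∧ κ = 0) ∨
      ∃ c, P.ReachesThroat E L κ c := by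
  have hn' := cast_three_le hn
  have hn1 : 0 < (n : ℝ) - 1 := by linarith
  have hc := h.rc_pos
  have hl := h.lε_pos
  obtain ⟨s1, s2, s3⟩ := h.throatExponent_eq hn E L κ
  have hcn : ((n - 2 : ℕ) : ℝ) = (n : ℝ) - 2 := by rw [Nat.cast_sub h.hn]; push_cast; ring
  by_cases hK : κ ≠ 0 ∨ L ≠ 0
  swap
  · push Not at hK
    obtain ⟨rfl, rfl⟩ := hK
    rcases eq_or_ne E 0 with hE | hE
    · exact Or.inr (Or.inl ⟨hE, rfl, rfl⟩)
    · refine Or.inr (Or.inr (h.reachesThroat_of_energy_ne_zero hn hE (s2 (by simp) hE) ?_))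
      have : P.radial E 0 0 = fun _ => E ^ 2 := by funext x; simp [radial]
      rw [this]
      exact tendsto_const_nhds
  have hK0 := radial_pos_factor hκ hK hc
  have hKt := h.tendsto_centrifugal L κ
  have habs : Tendsto (fun x : ℝ => |x|) (𝓝[≠] 0) (𝓝 0) := by
    simpa using tendsto_abs_pow_zero one_ne_zero
  rcases lt_trichotomy P.massThroat 0 with hM | hM | hM
  · exact Or.inl (h.radial_neg_of_massThroat_neg hn hκ hK hM)
  · have hADt := h.tendsto_AD_div hn hM
    have hns : ¬ (0 < P.massThroat ∧ (κ ≠ 0 ∨ L ≠ 0)) := fun hc => hM.not_gt hc.1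
    rcases eq_or_ne E 0 with hE | hE
    swap
    · refine Or.inr (Or.inr (h.reachesThroat_of_energy_ne_zero hn hE (s2 hns hE) ?_))
      have h1 : Tendsto (P.radial E L κ) (𝓝[≠] 0) (𝓝 (E ^ 2 - P.A₀ * 0 * (κ + L ^ 2 / P.rc ^ 2))) :=
        ((((h.tendsto_A_zero hn hM).mul (h.tendsto_D hn)).mul hKt)).const_sub (E ^ 2)
      simpa using h1
    -- with `E = 0` the sign of `A` near the throat decides
    rcases lt_trichotomy P.A₀ 0 with hA | hA | hA
    · right; right
      have hv : Tendsto (fun x => P.radial E L κ x / |x| ^ (n - 2)) (𝓝[≠] 0)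
          (𝓝 (-(P.A₀ * (1 / (2 * P.rc ^ (n - 2))) * (κ + L ^ 2 / P.rc ^ 2)))) := by
        refine (hADt.mul hKt).neg.congr fun x => ?_
        simp only [radial, hE]
        ring
      have hc1 : 0 < -(P.A₀ * (1 / (2 * P.rc ^ (n - 2))) * (κ + L ^ 2 / P.rc ^ 2)) := by
        have : 0 < 1 / (2 * P.rc ^ (n - 2)) * (κ + L ^ 2 / P.rc ^ 2) := by positivity
        nlinarith
      have hpos : ∀ᶠ x in 𝓝[≠] (0 : ℝ), 0 < P.radial E L κ x := by
        filter_upwards [hv.eventually (lt_mem_nhds hc1), self_mem_nhdsWithin] with x hx hx0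
        have hx' : 0 < |x| := abs_pos.2 hx0
        exact (div_pos_iff_of_pos_right (by positivity)).1 hx
      refine ⟨1 / (2 * P.rc ^ (n - 2)) /
        √(-(P.A₀ * (1 / (2 * P.rc ^ (n - 2))) * (κ + L ^ 2 / P.rc ^ 2))), hpos,
        div_pos (by positivity) (Real.sqrt_pos.2 hc1), by rw [s3 hns hE]; linarith, ?_,
        1, Or.inl rfl, 1 / P.A₀, ?_⟩
      · have := h.tendsto_D_div.div hv.sqrt (Real.sqrt_pos.2 hc1).ne'
        refine this.congr' ?_
        filter_upwards [self_mem_nhdsWithin] with x hx0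
        have hx' : 0 < |x| := abs_pos.2 hx0
        have e1 : √(|x| ^ (n - 2)) = |x| ^ (((n : ℝ) - 2) / 2) := by
          rw [Real.sqrt_eq_rpow, ← Real.rpow_natCast, ← Real.rpow_mul hx'.le, hcn]
          congr 1; ring
        have e2 : |x| ^ (n - 2) = |x| ^ (((n : ℝ) - 2) / 2) * |x| ^ (((n : ℝ) - 2) / 2) := by
          rw [← Real.rpow_add hx', ← Real.rpow_natCast, hcn]
          congr 1; ring
        have e3 : 0 < |x| ^ (((n : ℝ) - 2) / 2) := Real.rpow_pos_of_pos hx' _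
        simp only [Pi.div_apply]
        rw [s3 hns hE, Real.sqrt_div' _ (by positivity), e1, e2]
        field_simp
      · have := (tendsto_const_nhds (x := (1 : ℝ))).div (h.tendsto_A_zero hn hM) hA.ne
        refine this.congr fun x => ?_
        simp [hE]
    · left
      have h1 := h.tendsto_A_of_massThroat_eq_zero hn hM
      filter_upwards [h1.eventually (lt_mem_nhds (by positivity)), self_mem_nhdsWithin] with x hx hx0
      have hx2 : 0 < x ^ 2 := by have : x ≠ 0 := hx0
                                 positivity
      rw [hA, sub_zero] at hx
      have hAx := (div_pos_iff_of_pos_right hx2).1 hx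
      have := radial_pos_factor hκ hK (h.r_pos x)
      have := h.D_pos hx0
      simp only [radial, hE, ne_eq, OfNat.ofNat_ne_zero, not_false_eq_true, zero_pow, zero_sub]
      exact neg_lt_zero.2 (by positivity)
    · left
      filter_upwards [(h.tendsto_A_zero hn hM).eventually (lt_mem_nhds hA), self_mem_nhdsWithin]
        with x hAx hx0
      have := radial_pos_factor hκ hK (h.r_pos x)
      have := h.D_pos hx0
      simp only [radial, hE, ne_eq, OfNat.ofNat_ne_zero, not_false_eq_true, zero_pow, zero_sub]
      exact neg_lt_zero.2 (by positivity)
  · right; right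
    have hv := h.tendsto_radial_mul_abs (E := E) (L := L) (κ := κ) hn hM.ne'
    have hc1 : 0 < 2 * P.massThroat / ((n : ℝ) - 1) * (1 / (2 * P.rc ^ (n - 2)))
          * (κ + L ^ 2 / P.rc ^ 2) := by positivity
    have hpos : ∀ᶠ x in 𝓝[≠] (0 : ℝ), 0 < P.radial E L κ x := by
      filter_upwards [hv.eventually (lt_mem_nhds hc1), self_mem_nhdsWithin] with x hx hx0
      have hx' : 0 < |x| := abs_pos.2 hx0
      exact (mul_pos_iff_of_pos_right hx').1 hx
    obtain ⟨ℓ, hℓ⟩ := h.exists_tendsto_inv_A hn fun hex => hM.ne' ((h.exceptional_iff hn).1 hex).1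
    -- `radial` diverges as `1 / |x|`, so that `1 / √radial` vanishes as `√|x|`
    have hsx : Tendsto (fun x : ℝ => √|x|) (𝓝[≠] 0) (𝓝 0) := by simpa using habs.sqrt
    have hsv : ∀ᶠ x in 𝓝[≠] (0 : ℝ), √|x| / √(P.radial E L κ x * |x|) = 1 / √(P.radial E L κ x) := by
      filter_upwards [self_mem_nhdsWithin] with x hx0
      have hx' : 0 < √|x| := Real.sqrt_pos.2 (abs_pos.2 hx0)
      rw [Real.sqrt_mul' _ (abs_nonneg x)]
      field_simp
    refine ⟨1 / (2 * P.rc ^ (n - 2)) / √(2 * P.massThroat / ((n : ℝ) - 1)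
        * (1 / (2 * P.rc ^ (n - 2))) * (κ + L ^ 2 / P.rc ^ 2)), hpos,
      div_pos (by positivity) (Real.sqrt_pos.2 hc1), by rw [s1 hM hK]; linarith, ?_, 1, Or.inl rfl,
      E * ℓ * (0 / √(2 * P.massThroat / ((n : ℝ) - 1) * (1 / (2 * P.rc ^ (n - 2)))
          * (κ + L ^ 2 / P.rc ^ 2))) + ℓ, ?_⟩
    · have := h.tendsto_D_div.div hv.sqrt (Real.sqrt_pos.2 hc1).ne'
      refine this.congr' ?_
      filter_upwards [self_mem_nhdsWithin, hsv] with x hx0 hx1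
      have hx' : 0 < |x| := abs_pos.2 hx0
      have e2 : |x| ^ ((n : ℝ) - 3 / 2) = |x| ^ (n - 2) * √|x| := by
        rw [Real.sqrt_eq_rpow, ← Real.rpow_natCast, ← Real.rpow_add hx', hcn]
        congr 1; ring
      have e3 : 0 < √|x| := Real.sqrt_pos.2 hx'
      simp only [Pi.div_apply]
      rw [s1 hM hK, e2, div_eq_mul_one_div (P.D x) (√(P.radial E L κ x)), ← hx1]
      field_simp
    · refine (((hℓ.const_mul E).mul (hsx.div hv.sqrt (Real.sqrt_pos.2 hc1).ne')).add hℓ).congr' ?_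
      filter_upwards [hsv] with x hx
      simp only [Pi.div_apply]
      rw [hx]
      ring

end Admissible
end Params
end EiBI

/-! ### Differential equations across an end point -/

namespace EiBI
namespace RealLemmas

/-- Near a boundary point, an open interval is one-sided. -/
theorem exists_side {I : Set ℝ} (hI : I.OrdConnected) {s₀ : ℝ} (hs₀ : s₀ ∈ closure I \ I) :
    ∃ θ : ℝ, (θ = 1 ∨ θ = -1) ∧ ∃ ε > 0, ∀ s, |s - s₀| < ε → (s ∈ I ↔ 0 < θ * (s₀ - s)) := by
  obtain ⟨hcl, hnot⟩ := hs₀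
  obtain ⟨a, ha⟩ : I.Nonempty := by
    rw [← closure_nonempty_iff]; exact ⟨s₀, hcl⟩
  rw [Metric.mem_closure_iff] at hcl
  have hne : a ≠ s₀ := fun h => hnot (h ▸ ha)
  rcases lt_or_gt_of_ne hne with h | h
  · refine ⟨1, Or.inl rfl, s₀ - a, by linarith, fun s hs => ?_⟩
    rw [one_mul, sub_pos]
    constructor
    · intro hsI
      by_contra! hcon
      exact hnot (hI.out ha hsI ⟨h.le, hcon⟩)
    · intro hlt
      obtain ⟨b, hb, hd⟩ := hcl (s₀ - s) (by linarith)
      rw [Real.dist_eq] at hd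
      exact hI.out ha hb ⟨by linarith [(abs_lt.1 hs).1], by linarith [(abs_lt.1 hd).2]⟩
  · refine ⟨-1, Or.inr rfl, a - s₀, by linarith, fun s hs => ?_⟩
    rw [neg_one_mul, neg_sub, sub_pos]
    constructor
    · intro hsI
      by_contra! hcon
      exact hnot (hI.out hsI ha ⟨hcon, h.le⟩)
    · intro hlt
      obtain ⟨b, hb, hd⟩ := hcl (s - s₀) (by linarith)
      rw [Real.dist_eq] at hd
      exact hI.out hb ha ⟨by linarith [(abs_lt.1 hd).1], by linarith [(abs_lt.1 hs).2]⟩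

/-- A function that is continuous at a point, and whose derivative off the point extends continuously
to it, is differentiable there. -/
theorem hasDerivAt_of_eventually_ne {E : Type*} [NormedAddCommGroup E] [NormedSpace ℝ E]
    {f g : ℝ → E} {x : ℝ} (hd : ∀ᶠ y in 𝓝[≠] x, HasDerivAt f (g y) y) (hf : ContinuousAt f x)
    (hg : ContinuousAt g x) : HasDerivAt f (g x) x := by
  rw [eventually_nhdsWithin_iff, Metric.eventually_nhds_iff] at hd
  obtain ⟨ε, hε, hd⟩ := hd
  have hdr : ∀ y ∈ Ioo x (x + ε), HasDerivAt f (g y) y := fun y hy =>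
    hd (by rw [Real.dist_eq, abs_lt]; constructor <;> linarith [hy.1, hy.2]) hy.1.ne'
  have hdl : ∀ y ∈ Ioo (x - ε) x, HasDerivAt f (g y) y := fun y hy =>
    hd (by rw [Real.dist_eq, abs_lt]; constructor <;> linarith [hy.1, hy.2]) hy.2.ne
  have A : HasDerivWithinAt f (g x) (Ici x) x := by
    have hmem : Ioo x (x + ε) ∈ 𝓝[>] x := Ioo_mem_nhdsGT (by linarith)
    refine hasDerivWithinAt_Ici_of_tendsto_deriv (s := Ioo x (x + ε))
      (fun y hy => (hdr y hy).differentiableAt.differentiableWithinAt) hf.continuousWithinAt hmem ?_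
    refine (hg.tendsto.mono_left nhdsWithin_le_nhds).congr' ?_
    filter_upwards [hmem] with y hy
    exact (hdr y hy).deriv.symm
  have B : HasDerivWithinAt f (g x) (Iic x) x := by
    have hmem : Ioo (x - ε) x ∈ 𝓝[<] x := Ioo_mem_nhdsLT (by linarith)
    refine hasDerivWithinAt_Iic_of_tendsto_deriv (s := Ioo (x - ε) x)
      (fun y hy => (hdl y hy).differentiableAt.differentiableWithinAt) hf.continuousWithinAt hmem ?_
    refine (hg.tendsto.mono_left nhdsWithin_le_nhds).congr' ?_
    filter_upwards [hmem] with y hy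
    exact (hdl y hy).deriv.symm
  simpa using B.union A

/-- A bounded solution of `z' = ρ F(z)` on one side of `s₀` extends across `s₀`. The extension is a
solution of the autonomous equation, with the integral of `ρ` as its time. -/
theorem exists_ode_extension {E : Type*} [NormedAddCommGroup E] [NormedSpace ℝ E]
    [FiniteDimensional ℝ E] {F : E → E} {ρ : ℝ → ℝ} {z : ℝ → E} {s₀ θ ε B : ℝ} (hF : ContDiff ℝ 1 F)
    (hρ : Continuous ρ) (hθ : θ = 1 ∨ θ = -1) (hε : 0 < ε)
    (hz : ∀ s, |s - s₀| < ε → 0 < θ * (s₀ - s) → HasDerivAt z (ρ s • F (z s)) s)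
    (hB : ∀ s, |s - s₀| < ε → 0 < θ * (s₀ - s) → ‖z s‖ ≤ B) :
    ∃ ε' > 0, ∃ Z : ℝ → E, (∀ s, |s - s₀| < ε' → HasDerivAt Z (ρ s • F (Z s)) s) ∧
      ∀ s, |s - s₀| < ε' → 0 < θ * (s₀ - s) → Z s = z s := by
  have hθ2 : θ * θ = 1 := by rcases hθ with h | h <;> rw [h] <;> norm_num
  set H : Set ℝ := {s | |s - s₀| < ε ∧ 0 < θ * (s₀ - s)} with hH
  have hHc : Convex ℝ H := by
    have h1 : Convex ℝ {s : ℝ | |s - s₀| < ε} := by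
      have : {s : ℝ | |s - s₀| < ε} = Metric.ball s₀ ε := by ext s; simp [Real.dist_eq]
      rw [this]; exact convex_ball _ _
    have h2 : Convex ℝ {s : ℝ | 0 < θ * (s₀ - s)} := by
      rcases hθ with h | h
      · have : {s : ℝ | 0 < θ * (s₀ - s)} = Iio s₀ := by ext s; simp [h]
        rw [this]; exact convex_Iio _
      · have : {s : ℝ | 0 < θ * (s₀ - s)} = Ioi s₀ := by ext s; simp [h]
        rw [this]; exact convex_Ioi _
    exact h1.inter h2
  have hopen : IsOpen {s : ℝ | 0 < θ * (s₀ - s)} := isOpen_lt (by fun_prop) (by fun_prop)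
  have hopen' : IsOpen {s : ℝ | 0 < θ * (s - s₀)} := isOpen_lt (by fun_prop) (by fun_prop)
  have hballo : ∀ {e : ℝ}, IsOpen {s : ℝ | |s - s₀| < e} := isOpen_lt (by fun_prop) (by fun_prop)
  have hs₀H : s₀ ∈ closure H := by
    rw [Metric.mem_closure_iff]
    intro e he
    have hm : 0 < min e ε := lt_min he hε
    have habs : |θ| = 1 := by rcases hθ with h | h <;> simp [h]
    refine ⟨s₀ - θ * (min e ε / 2), ⟨?_, ?_⟩, ?_⟩
    · rw [show s₀ - θ * (min e ε / 2) - s₀ = -(θ * (min e ε / 2)) by ring, abs_neg, abs_mul, habs,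
        abs_of_pos (by positivity)]
      linarith [min_le_right e ε]
    · rw [show θ * (s₀ - (s₀ - θ * (min e ε / 2))) = θ * θ * (min e ε / 2) by ring, hθ2]
      positivity
    · rw [Real.dist_eq, show s₀ - (s₀ - θ * (min e ε / 2)) = (θ * (min e ε / 2)) by ring, abs_mul, habs,
        abs_of_pos (by positivity)]
      linarith [min_le_left e ε]
  have hne : (𝓝[H] s₀).NeBot := mem_closure_iff_nhdsWithin_neBot.1 hs₀H
  -- on bounded sets `F` is bounded, so that the solution is Lipschitz and has a limit
  obtain ⟨z₀, hz₀⟩ : ∃ z₀, Tendsto z (𝓝[H] s₀) (𝓝 z₀) := by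
    have : ProperSpace E := FiniteDimensional.proper ℝ E
    obtain ⟨C₁, hC₁⟩ := (isCompact_closedBall (0 : E) B).exists_bound_of_continuousOn
      hF.continuous.continuousOn
    obtain ⟨C₂, hC₂⟩ := (isCompact_closedBall s₀ ε).exists_bound_of_continuousOn hρ.continuousOn
    have hlip : LipschitzOnWith (Real.toNNReal (C₂ * C₁)) z H := by
      refine hHc.lipschitzOnWith_of_nnnorm_hasDerivWithin_le
        (fun s hs => (hz s hs.1 hs.2).hasDerivWithinAt) fun s hs => ?_
      rw [← NNReal.coe_le_coe, coe_nnnorm, Real.coe_toNNReal', norm_smul]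
      refine le_trans ?_ (le_max_left _ _)
      have h1 := hC₂ s (by rw [Metric.mem_closedBall, Real.dist_eq]; exact hs.1.le)
      have h2 := hC₁ (z s) (by rw [mem_closedBall_zero_iff]; exact hB s hs.1 hs.2)
      exact mul_le_mul h1 h2 (norm_nonneg _) ((norm_nonneg _).trans h1)
    have hcau : Cauchy (𝓝[H] s₀) := cauchy_nhds.mono nhdsWithin_le_nhds
    exact cauchy_iff_exists_le_nhds.1
      (hcau.map_of_le hlip.uniformContinuousOn (le_principal_iff.2 self_mem_nhdsWithin))
  obtain ⟨α, hα0, δ, hδ, hα⟩ :=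
    hF.contDiffAt.exists_forall_mem_closedBall_exists_eq_forall_mem_Ioo_hasDerivAt₀ (x₀ := z₀) 0
  set u : ℝ → ℝ := fun s => ∫ y in s₀..s, ρ y with hu
  have hud : ∀ s, HasDerivAt u (ρ s) s := fun s =>
    intervalIntegral.integral_hasDerivAt_right (hρ.intervalIntegrable _ _)
      (hρ.stronglyMeasurableAtFilter _ _) hρ.continuousAt
  have hu0 : u s₀ = 0 := by simp [hu]
  have huc : Continuous u := continuous_iff_continuousAt.2 fun s => (hud s).continuousAt
  obtain ⟨ε₁, hε₁, hε₁'⟩ : ∃ ε₁ > 0, ∀ s, |s - s₀| < ε₁ → u s ∈ Ioo (0 - δ) (0 + δ) := by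
    have := huc.continuousAt (x := s₀) (Ioo_mem_nhds (a := 0 - δ) (b := 0 + δ)
      (by rw [hu0]; linarith) (by rw [hu0]; linarith))
    obtain ⟨e, he, h⟩ := Metric.eventually_nhds_iff.1 this
    exact ⟨e, he, fun s hs => h (by rwa [Real.dist_eq])⟩
  have hαu : ∀ s, |s - s₀| < ε₁ → HasDerivAt (fun s => α (u s)) (ρ s • F (α (u s))) s := fun s hs =>
    (hα (u s) (hε₁' s hs)).scomp s (hud s)
  classical
  set Z : ℝ → E := fun s => if 0 < θ * (s₀ - s) then z s else α (u s) with hZ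
  have hZ0 : Z s₀ = z₀ := by simp [hZ, hu0, hα0]
  have hoff : ∀ s, |s - s₀| < min ε ε₁ → s ≠ s₀ → HasDerivAt Z (ρ s • F (Z s)) s := by
    intro s hs hne
    by_cases hc : 0 < θ * (s₀ - s)
    · have he : Z =ᶠ[𝓝 s] z := by
        filter_upwards [hopen.mem_nhds hc] with v hv
        exact if_pos hv
      rw [he.self_of_nhds]
      exact (hz s (hs.trans_le (min_le_left _ _)) hc).congr_of_eventuallyEq he
    · have hc' : 0 < θ * (s - s₀) := by
        rcases hθ with h | h <;> rw [h] at hc ⊢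
        · have : s₀ - s ≤ 0 := by linarith
          have := lt_of_le_of_ne this (sub_ne_zero.2 hne.symm)
          linarith
        · have : 0 ≤ s₀ - s := by linarith
          have := lt_of_le_of_ne this (sub_ne_zero.2 hne.symm).symm
          linarith
      have he : Z =ᶠ[𝓝 s] fun s => α (u s) := by
        filter_upwards [hopen'.mem_nhds hc'] with v hv
        have hv' : 0 < θ * (v - s₀) := hv
        exact if_neg (by linarith)
      rw [he.self_of_nhds]
      exact (hαu s (hs.trans_le (min_le_right _ _))).congr_of_eventuallyEq he
  have hcont : ContinuousAt Z s₀ := by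
    rw [ContinuousAt, hZ0]
    have h1 : Tendsto z (𝓝 s₀ ⊓ 𝓟 {s | 0 < θ * (s₀ - s)}) (𝓝 z₀) := by
      refine hz₀.mono_left ?_
      rw [nhdsWithin, le_inf_iff, hH]
      refine ⟨inf_le_left, le_principal_iff.2 ?_⟩
      exact inter_mem (mem_inf_of_left (hballo.mem_nhds (by simpa using hε)))
        (mem_inf_of_right (mem_principal_self _))
    have h2 : Tendsto (fun s => α (u s)) (𝓝 s₀) (𝓝 z₀) := by
      have := (hαu s₀ (by simpa using hε₁)).continuousAt
      rw [ContinuousAt, hu0, hα0] at this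
      exact this
    exact h1.if (h2.mono_left inf_le_left)
  have hmin : 0 < min ε ε₁ := lt_min hε hε₁
  refine ⟨min ε ε₁, hmin, Z, fun s hs => ?_, fun s hs hc => if_pos hc⟩
  rcases eq_or_ne s s₀ with rfl | hne
  · have hev : ∀ᶠ v in 𝓝 s, |v - s| < min ε ε₁ := hballo.mem_nhds (by simpa using hmin)
    refine hasDerivAt_of_eventually_ne (g := fun s => ρ s • F (Z s)) ?_ hcont
      (hρ.continuousAt.smul (hF.continuous.continuousAt.comp hcont))
    filter_upwards [hev.filter_mono nhdsWithin_le_nhds, self_mem_nhdsWithin] with v hv hne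
    exact hoff v hv hne
  · exact hoff s hs hne

end RealLemmas
end EiBI

/-! ### Angular motion -/

namespace EiBI

section
variable {m : ℕ}

/-- The vector field of the motion along great circles, in stereographic coordinates `y` and with the
velocity `V`. -/
def greatCircleField (z : (Fin m → ℝ) × (Fin m → ℝ)) : (Fin m → ℝ) × (Fin m → ℝ) :=
  (z.2, fun i => 2 / (1 + ∑ j, z.1 j ^ 2) *
    (2 * (∑ j, z.1 j * z.2 j) * z.2 i - (∑ j, z.2 j ^ 2) * z.1 i))

theorem contDiff_greatCircleField : ContDiff ℝ 1 (greatCircleField (m := m)) := by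
  unfold greatCircleField
  refine contDiff_snd.prodMk (contDiff_pi.2 fun i => ContDiff.mul (ContDiff.div ?_ ?_ ?_) ?_)
  · fun_prop
  · fun_prop
  · intro z; positivity
  · fun_prop

theorem hasDerivAt_greatCircleField_iff {Z : ℝ → (Fin m → ℝ) × (Fin m → ℝ)} {ρ s : ℝ} :
    HasDerivAt Z (ρ • greatCircleField (Z s)) s ↔
      (∀ i, HasDerivAt (fun s => (Z s).1 i) (ρ * (Z s).2 i) s) ∧
      ∀ i, HasDerivAt (fun s => (Z s).2 i) (ρ * (2 / (1 + ∑ j, (Z s).1 j ^ 2) *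
        (2 * (∑ j, (Z s).1 j * (Z s).2 j) * (Z s).2 i - (∑ j, (Z s).2 j ^ 2) * (Z s).1 i))) s := by
  rw [← hasDerivAt_pi (φ := fun s i => (Z s).1 i), ← hasDerivAt_pi (φ := fun s i => (Z s).2 i)]
  constructor
  · intro h
    exact ⟨h.fst, h.snd⟩
  · intro h
    exact h.1.prodMk h.2

/-- The speed on the unit sphere is constant along great circles. -/
theorem hasDerivAt_speed {Z : ℝ → (Fin m → ℝ) × (Fin m → ℝ)} {ρ s : ℝ}
    (h : HasDerivAt Z (ρ • greatCircleField (Z s)) s) :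
    HasDerivAt (fun s => (2 / (1 + ∑ j, (Z s).1 j ^ 2)) ^ 2 * ∑ j, (Z s).2 j ^ 2) 0 s := by
  obtain ⟨hy, hV⟩ := hasDerivAt_greatCircleField_iff.1 h
  have h0 : (1 + ∑ i, (Z s).1 i ^ 2 : ℝ) ≠ 0 := by positivity
  have h1 : HasDerivAt (fun s => 1 + ∑ i, (Z s).1 i ^ 2)
      (2 * ρ * ∑ i, (Z s).1 i * (Z s).2 i) s := by
    refine ((HasDerivAt.fun_sum fun i _ => (hy i).fun_pow 2).const_add 1).congr_deriv ?_
    rw [Finset.mul_sum]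
    exact Finset.sum_congr rfl fun i _ => by push_cast; ring
  have h2 : HasDerivAt (fun s => ∑ i, (Z s).2 i ^ 2) (2 * ρ * (2 / (1 + ∑ j, (Z s).1 j ^ 2)) *
      ((∑ j, (Z s).1 j * (Z s).2 j) * ∑ j, (Z s).2 j ^ 2)) s := by
    refine (HasDerivAt.fun_sum fun i _ => (hV i).fun_pow 2).congr_deriv ?_
    have : ∀ i, ((2 : ℕ) : ℝ) * (Z s).2 i ^ (2 - 1) * (ρ * (2 / (1 + ∑ j, (Z s).1 j ^ 2) *
        (2 * (∑ j, (Z s).1 j * (Z s).2 j) * (Z s).2 i - (∑ j, (Z s).2 j ^ 2) * (Z s).1 i)))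
        = 2 * ρ * (2 / (1 + ∑ j, (Z s).1 j ^ 2)) * (2 * (∑ j, (Z s).1 j * (Z s).2 j) * (Z s).2 i ^ 2
          - (∑ j, (Z s).2 j ^ 2) * ((Z s).1 i * (Z s).2 i)) := fun i => by push_cast; ring
    rw [Finset.sum_congr rfl fun i _ => this i, ← Finset.mul_sum, Finset.sum_sub_distrib,
      ← Finset.mul_sum, ← Finset.mul_sum]
    ring
  refine ((((hasDerivAt_const s (2 : ℝ)).fun_div h1 h0).fun_pow 2).fun_mul h2).congr_deriv ?_
  push_cast
  field_simp
  ring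

end

namespace Params
variable {P : Params} {n : ℕ} {γ : ℝ → Idx P.d → ℝ} {I : Set ℝ} {E L κ : ℝ}

namespace Admissible

/-- The angular motion of a geodesic follows a great circle, with `∫ dλ / r²` as its time. -/
theorem hasDerivAt_angular (h : P.Admissible n) (hγ : P.IsGeodesicWith γ I E L κ) {s : ℝ} (hs : s ∈ I) :
    HasDerivAt (fun s => ((fun i => γ s (.inr i), fun i => P.r (γ s iX) ^ 2 * deriv γ s (.inr i)) :
        (Fin (P.d - 2) → ℝ) × (Fin (P.d - 2) → ℝ)))
      ((P.r (γ s iX) ^ 2)⁻¹ • greatCircleField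
        (fun i => γ s (.inr i), fun i => P.r (γ s iX) ^ 2 * deriv γ s (.inr i))) s := by
  have hp := hγ.mem_domain s hs
  have hr := (h.r_pos (γ s iX)).ne'
  have hd := fun μ => hγ.geodesic.hasDerivAt hs μ
  have hacc := ((h.isAccel_metric_iff hp (deriv γ s) _).1 fun μ => rfl).y
  have hr' := (h.hasDerivAt_r' hp.1).comp s (hd iX).1
  refine (hasDerivAt_greatCircleField_iff (Z := fun s => (fun i => γ s (.inr i), fun i =>
    P.r (γ s iX) ^ 2 * deriv γ s (.inr i)))).2 ⟨fun i => ?_, fun i => ?_⟩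
  · refine (hd (.inr i)).1.congr_deriv ?_
    field_simp
  · refine ((hr'.fun_pow 2).fun_mul (hd (.inr i)).2).congr_deriv ?_
    rw [hacc i]
    have e1 : ∑ j, γ s (.inr j) * (P.r (γ s iX) ^ 2 * deriv γ s (.inr j))
        = P.r (γ s iX) ^ 2 * ∑ j, γ s (.inr j) * deriv γ s (.inr j) := by
      rw [Finset.mul_sum]; exact Finset.sum_congr rfl fun j _ => by ring
    have e2 : ∑ j, (P.r (γ s iX) ^ 2 * deriv γ s (.inr j)) ^ 2
        = P.r (γ s iX) ^ 4 * ∑ j, deriv γ s (.inr j) ^ 2 := by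
      rw [Finset.mul_sum]; exact Finset.sum_congr rfl fun j _ => by ring
    simp only [e1, e2, sphereFactor, Function.comp_def]
    push_cast
    field_simp
    ring

end Admissible

theorem IsGeodesicWith.angular_speed (hγ : P.IsGeodesicWith γ I E L κ) {s : ℝ} (hs : s ∈ I) :
    sphereFactor (γ s) ^ 2 * ∑ j, (P.r (γ s iX) ^ 2 * deriv γ s (.inr j)) ^ 2 = L ^ 2 := by
  have hL := angularMomentum_sq P γ s
  rw [hγ.angularMomentum_eq s hs] at hL
  rw [hL, Finset.mul_sum, Finset.mul_sum, Finset.mul_sum]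
  exact Finset.sum_congr rfl fun j _ => by ring

/-- Where the stereographic coordinates `y` are bounded, so are the velocities `r² y'`, since their norm on
the unit sphere is `L`. -/
theorem IsGeodesicWith.angular_bounded (hγ : P.IsGeodesicWith γ I E L κ) {s R : ℝ}
    (hs : s ∈ I) (hR : ∑ i, γ s (.inr i) ^ 2 ≤ R) :
    ‖((fun i => γ s (.inr i), fun i => P.r (γ s iX) ^ 2 * deriv γ s (.inr i)) :
      (Fin (P.d - 2) → ℝ) × (Fin (P.d - 2) → ℝ))‖ ≤ max √R √(L ^ 2 * (1 + R) ^ 2 / 4) := by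
  have h1 : ∀ {f : Fin (P.d - 2) → ℝ} {B : ℝ}, ∑ i, f i ^ 2 ≤ B → ‖f‖ ≤ √B := by
    intro f B hf
    refine (pi_norm_le_iff_of_nonneg (Real.sqrt_nonneg _)).2 fun i => ?_
    rw [Real.norm_eq_abs]
    refine Real.abs_le_sqrt (le_trans ?_ hf)
    exact Finset.single_le_sum (f := fun i => f i ^ 2) (fun j _ => sq_nonneg _) (Finset.mem_univ i)
  rw [Prod.norm_def]
  refine max_le_max (h1 hR) (h1 ?_)
  have h2 := hγ.angular_speed hs
  have h0 : 0 ≤ ∑ i, γ s (.inr i) ^ 2 := by positivity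
  rw [← h2, sphereFactor]
  have h3 : 0 ≤ ∑ j, (P.r (γ s iX) ^ 2 * deriv γ s (.inr j)) ^ 2 := by positivity
  have h4 : (1 + ∑ i, γ s (.inr i) ^ 2) ^ 2 ≤ (1 + R) ^ 2 := by gcongr
  rw [div_pow, div_mul_eq_mul_div, div_mul_eq_mul_div, div_div, le_div_iff₀ (by positivity)]
  nlinarith

end Params
end EiBI

/-! ### Continuation of geodesics -/

namespace EiBI
namespace RealLemmas

/-- A solution of `W(x) x' = ±1` is the inverse of the primitive `Λ` of `W`. -/
theorem exists_sign_of_quadrature {Λ W x x₁ : ℝ → ℝ} {H : Set ℝ} {s₀ ξ : ℝ} (hHo : IsOpen H)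
    (hH : H.OrdConnected) (hs₀ : s₀ ∈ closure H) (hΛ : ContinuousAt Λ ξ) (hΛ0 : Λ ξ = 0)
    (hx : ∀ s ∈ H, HasDerivAt x (x₁ s) s) (hΛ' : ∀ s ∈ H, HasDerivAt Λ (W (x s)) (x s))
    (hc : ContinuousOn (fun s => W (x s) * x₁ s) H) (hW : ∀ s ∈ H, (W (x s) * x₁ s) ^ 2 = 1)
    (hlim : Tendsto x (𝓝[H] s₀) (𝓝 ξ)) :
    ∃ σ : ℝ, (σ = 1 ∨ σ = -1) ∧ (∀ s ∈ H, W (x s) * x₁ s = σ) ∧ ∀ s ∈ H, Λ (x s) = σ * (s - s₀) := by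
  have hne : (𝓝[H] s₀).NeBot := mem_closure_iff_nhdsWithin_neBot.1 hs₀
  obtain ⟨σ, hσ, hσ'⟩ : ∃ σ : ℝ, (σ = 1 ∨ σ = -1) ∧ ∀ s ∈ H, W (x s) * x₁ s = σ := by
    rcases hH.isPreconnected.eq_or_eq_neg_of_sq_eq (f := fun s => W (x s) * x₁ s)
      (g := fun _ => (1 : ℝ)) hc continuousOn_const (fun s hs => by simpa using hW s hs)
      (fun _ => one_ne_zero) with h | h
    · exact ⟨1, Or.inl rfl, fun s hs => h hs⟩
    · exact ⟨-1, Or.inr rfl, fun s hs => h hs⟩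
  refine ⟨σ, hσ, hσ', fun s hs => ?_⟩
  have hd : ∀ s ∈ H, HasDerivAt (fun s => Λ (x s) - σ * s) 0 s := by
    intro s hs
    refine (((hΛ' s hs).comp s (hx s hs)).fun_sub ((hasDerivAt_id s).const_mul σ)).congr_deriv ?_
    rw [hσ' s hs]; ring
  have hconst : ∀ u ∈ H, Λ (x u) - σ * u = Λ (x s) - σ * s := fun u hu =>
    hHo.is_const_of_deriv_eq_zero hH.isPreconnected
      (fun v hv => (hd v hv).differentiableAt.differentiableWithinAt) (fun v hv => (hd v hv).deriv) hu hs
  have h1 : Tendsto (fun u => Λ (x u) - σ * u) (𝓝[H] s₀) (𝓝 (Λ ξ - σ * s₀)) :=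
    (hΛ.tendsto.comp hlim).sub ((tendsto_nhdsWithin_of_tendsto_nhds tendsto_id).const_mul σ)
  have h2 : Tendsto (fun u => Λ (x u) - σ * u) (𝓝[H] s₀) (𝓝 (Λ (x s) - σ * s)) :=
    tendsto_const_nhds.congr' (eventually_mem_nhdsWithin.mono fun u hu => (hconst u hu).symm)
  have := tendsto_nhds_unique h1 h2
  rw [hΛ0] at this
  linarith

end RealLemmas

namespace Params
variable {P : Params} {n : ℕ} {γ : ℝ → Idx P.d → ℝ} {I : Set ℝ} {E L κ : ℝ}

/-- The curve `c`, the affine parameter `lam` as a function of `x`, and the constants `σ`, `k` describe a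
continuation of the geodesic `γ` across the end `s₀` of its interval of parameters, where `x = ξ`. The
continuation is defined for `x` within `δ` of `ξ`; it may fail to be a geodesic only at `x = 0`. The
functions `W` and `T₀` are `|dλ/dx|` and the time on a geodesic with `dλ/dx > 0`. -/
structure IsContinuation (P : Params) (γ : ℝ → Idx P.d → ℝ) (I : Set ℝ) (E L κ s₀ ξ δ σ k : ℝ)
    (W T₀ lam : ℝ → ℝ) (c : ℝ → Idx P.d → ℝ) : Prop where
  sign : σ = 1 ∨ σ = -1
  lam_center : lam ξ = s₀
  hasDerivAt_lam : ∀ x ∈ Ioo (ξ - δ) (ξ + δ), HasDerivAt lam (σ * W x) x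
  monotone : StrictMonoOn lam (Ioo (ξ - δ) (ξ + δ)) ∨ StrictAntiOn lam (Ioo (ξ - δ) (ξ + δ))
  coord_x : ∀ x ∈ Ioo (ξ - δ) (ξ + δ), c (lam x) iX = x
  coord_t : ∀ x ∈ Ioo (ξ - δ) (ξ + δ), c (lam x) iT = σ * T₀ x + k
  isOpen_image : IsOpen (lam '' Ioo (ξ - δ) (ξ + δ))
  geodesic : P.IsGeodesicWith c (lam '' (Ioo (ξ - δ) (ξ + δ) \ {0})) E L κ
  eqOn : EqOn c γ (I ∩ lam '' Ioo (ξ - δ) (ξ + δ))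
  angular : ∀ i, ContDiffOn ℝ 1 (fun s => c s (Sum.inr i)) (lam '' Ioo (ξ - δ) (ξ + δ))

/-- If `x → ξ` at an end point of a geodesic, the quadratures for `λ` and `t` and the motion along the
great circle continue it to `x` near `ξ`. Near `ξ` the radial velocity may vanish or diverge only at
`x = 0`, where `W` and the angular equation are still continuous. -/
theorem Admissible.exists_isContinuation (h : P.Admissible n) (hI : IsOpen I) (hIc : I.OrdConnected)
    (hγ : P.IsGeodesicWith γ I E L κ) {s₀ ξ R η : ℝ} {W T₀ : ℝ → ℝ} (hs₀ : s₀ ∈ closure I \ I)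
    (hlim : Tendsto (fun s => γ s iX) (𝓝[I] s₀) (𝓝 ξ))
    (hR : ∀ᶠ s in 𝓝[I] s₀, ∑ i, γ s (Sum.inr i) ^ 2 ≤ R) (hη : 0 < η)
    (hpos : ∀ x ∈ Ioo (ξ - η) (ξ + η), x ≠ 0 → P.A x ≠ 0 ∧ 0 < P.radial E L κ x)
    (hW : ContinuousOn W (Ioo (ξ - η) (ξ + η)))
    (hW' : ∀ x ∈ Ioo (ξ - η) (ξ + η), x ≠ 0 → W x = P.D x / √(P.radial E L κ x))
    (hT : ∀ x ∈ Ioo (ξ - η) (ξ + η), x ≠ 0 → HasDerivAt T₀ (E / (P.A x * √(P.radial E L κ x))) x) :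
    ∃ δ > 0, δ ≤ η ∧ ∃ σ k lam c, P.IsContinuation γ I E L κ s₀ ξ δ σ k W T₀ lam c := by
  have hWpos : ∀ x ∈ Ioo (ξ - η) (ξ + η), x ≠ 0 → 0 < W x := fun x hx hx0 => by
    rw [hW' x hx hx0]
    exact div_pos (h.D_pos hx0) (Real.sqrt_pos.2 (hpos x hx hx0).2)
  have hsub : Ioo (ξ - η / 2) (ξ + η / 2) ⊆ Ioo (ξ - η) (ξ + η) :=
    Ioo_subset_Ioo (by linarith) (by linarith)
  obtain ⟨Λ, X, hΛm, hΛc, hXc, hXΛ, hΛX, hΛξ, hΛ'⟩ := RealLemmas.exists_quadrature (z := 0)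
    (half_pos hη) (hW.mono (Icc_subset_Ioo (by linarith) (by linarith)))
    fun x hx => hWpos x (hsub hx)
  obtain ⟨θ, hθ, ε₁, hε₁, hside⟩ := RealLemmas.exists_side hIc hs₀
  -- near `s₀`, on the side of `I`
  obtain ⟨ε₂, hε₂, hnear⟩ : ∃ ε₂ > 0, ∀ s, |s - s₀| < ε₂ → s ∈ I →
      γ s iX ∈ Ioo (ξ - η / 2) (ξ + η / 2) ∧ ∑ i, γ s (Sum.inr i) ^ 2 ≤ R := by
    have h1 := (hlim.eventually (Ioo_mem_nhds (a := ξ - η / 2) (b := ξ + η / 2) (by linarith)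
      (by linarith))).and hR
    rw [eventually_nhdsWithin_iff, Metric.eventually_nhds_iff] at h1
    obtain ⟨e, he, h1⟩ := h1
    exact ⟨e, he, fun s hs hsI => h1 (by rwa [Real.dist_eq]) hsI⟩
  set ε := min ε₁ ε₂ with hε
  have hε0 : 0 < ε := lt_min hε₁ hε₂
  set H : Set ℝ := I ∩ Metric.ball s₀ ε with hH
  have hHo : IsOpen H := hI.inter Metric.isOpen_ball
  have hHc : H.OrdConnected := by
    rw [hH, Real.ball_eq_Ioo]
    exact hIc.inter ordConnected_Ioo
  have hHs₀ : s₀ ∈ closure H := by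
    rw [hH, inter_comm]
    exact Metric.isOpen_ball.inter_closure ⟨Metric.mem_ball_self hε0, hs₀.1⟩
  have hHn := fun s (hs : s ∈ H) => hnear s
    (lt_of_lt_of_le (Metric.mem_ball.1 hs.2) (min_le_right _ _)) hs.1
  have hx0 := fun s (hs : s ∈ H) => (hγ.mem_domain s hs.1).1
  have hd := fun s (hs : s ∈ H) μ => hγ.geodesic.hasDerivAt hs.1 μ
  have hlimH : Tendsto (fun s => γ s iX) (𝓝[H] s₀) (𝓝 ξ) :=
    hlim.mono_left (nhdsWithin_mono _ inter_subset_left)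
  have hsq : ∀ s ∈ H, (W (γ s iX) * deriv γ s iX) ^ 2 = 1 := by
    intro s hs
    have h1 := h.first_integral hγ hs.1
    have h2 := hpos _ (hsub (hHn s hs).1) (hx0 s hs)
    rw [hW' _ (hsub (hHn s hs).1) (hx0 s hs), div_mul_eq_mul_div, div_pow, Real.sq_sqrt h2.2.le, h1,
      div_self h2.2.ne']
  obtain ⟨σ, hσ, hσ', hσΛ⟩ := RealLemmas.exists_sign_of_quadrature hHo hHc hHs₀ hΛc.continuousAt hΛξ
    (fun s hs => (hd s hs iX).1) (fun s hs => hΛ' _ (hHn s hs).1) (by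
      refine ContinuousOn.mul ?_ fun s hs => (hd s hs iX).2.continuousAt.continuousWithinAt
      exact hW.comp (fun s hs => (hd s hs iX).1.continuousAt.continuousWithinAt)
        fun s hs => hsub (hHn s hs).1) hsq hlimH
  have hσ2 : σ * σ = 1 := by rcases hσ with h | h <;> rw [h] <;> norm_num
  have hσ0 : σ ≠ 0 := by rintro rfl; norm_num at hσ2
  set lam : ℝ → ℝ := fun x => s₀ + σ * Λ x with hlam
  set Xs : ℝ → ℝ := fun s => X (σ * (s - s₀)) with hXs
  have hXlam : ∀ x, Xs (lam x) = x := fun x => by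
    simp only [hXs, hlam, add_sub_cancel_left, ← mul_assoc, hσ2, one_mul, hXΛ]
  have hlamX : ∀ s, lam (Xs s) = s := fun s => by
    simp only [hXs, hlam, hΛX, ← mul_assoc, hσ2]; ring
  have hXsc : Continuous Xs := hXc.comp (by fun_prop)
  have hlamc : Continuous lam := by fun_prop
  have hXγ : ∀ s ∈ H, γ s iX = Xs s := fun s hs => by
    simp only [hXs, ← hσΛ s hs, hXΛ]
  have hlam' : ∀ x ∈ Ioo (ξ - η / 2) (ξ + η / 2), HasDerivAt lam (σ * W x) x := fun x hx =>
    ((hΛ' x hx).const_mul σ).const_add s₀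
  have himage : ∀ S : Set ℝ, lam '' S = Xs ⁻¹' S := fun S =>
    congrFun (image_eq_preimage_of_inverse hXlam hlamX) S
  have hXs' : ∀ s, Xs s ∈ Ioo (ξ - η / 2) (ξ + η / 2) → Xs s ≠ 0 →
      HasDerivAt Xs (σ * (√(P.radial E L κ (Xs s)) / P.D (Xs s))) s := by
    intro s hs hs0
    have h1 := (hlam' _ hs).of_local_left_inverse hXsc.continuousAt
      (mul_ne_zero hσ0 (hWpos _ (hsub hs) hs0).ne') (Eventually.of_forall hlamX)
    refine h1.congr_deriv ?_
    rw [hW' _ (hsub hs) hs0, mul_inv, inv_div, ← eq_inv_of_mul_eq_one_left hσ2]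
  -- the time coordinate
  obtain ⟨k, hk⟩ : ∃ k, ∀ s ∈ H, γ s iT = σ * T₀ (Xs s) + k := by
    have hdt : ∀ s ∈ H, HasDerivAt (fun s => γ s iT - σ * T₀ (γ s iX)) 0 s := by
      intro s hs
      have hA := hpos _ (hsub (hHn s hs).1) (hx0 s hs)
      have hD := (h.D_pos (hx0 s hs)).ne'
      have hr := (Real.sqrt_pos.2 hA.2).ne'
      refine ((hd s hs iT).1.fun_sub (((hT _ (hsub (hHn s hs).1) (hx0 s hs)).comp s
        (hd s hs iX).1).const_mul σ)).congr_deriv ?_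
      have h1 := hσ' s hs
      rw [hW' _ (hsub (hHn s hs).1) (hx0 s hs)] at h1
      have h2 := hγ.energy_eq s hs.1
      rw [h.energy_eq', h.gtt_eq] at h2
      have hA' := hA.1
      have h3 : deriv γ s iX = σ * √(P.radial E L κ (γ s iX)) / P.D (γ s iX) := by
        rw [← h1]; field_simp
      have h4 : E / (P.A (γ s iX) * √(P.radial E L κ (γ s iX))) * deriv γ s iX
          = σ * deriv γ s iT := by
        rw [h3, div_mul_div_comm, div_eq_iff (by positivity)]
        linear_combination (-σ * √(P.radial E L κ (γ s iX))) * h2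
      rw [h4]
      linear_combination (-deriv γ s iT) * hσ2
    obtain ⟨s₁, hs₁⟩ : H.Nonempty := by rw [← closure_nonempty_iff]; exact ⟨_, hHs₀⟩
    refine ⟨γ s₁ iT - σ * T₀ (γ s₁ iX), fun s hs => ?_⟩
    have := hHo.is_const_of_deriv_eq_zero hHc.isPreconnected
      (fun v hv => (hdt v hv).differentiableAt.differentiableWithinAt) (fun v hv => (hdt v hv).deriv) hs hs₁
    rw [← hXγ s hs, ← this]; ring
  -- the angular coordinates
  have hmemH : ∀ s, |s - s₀| < ε → 0 < θ * (s₀ - s) → s ∈ H := fun s hs hs' =>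
    ⟨(hside s (hs.trans_le (min_le_left _ _))).2 hs', by simpa [Real.dist_eq] using hs⟩
  have hρc : Continuous fun s => (P.r (Xs s) ^ 2)⁻¹ :=
    ((h.continuous_r.comp hXsc).pow 2).inv₀ fun s => pow_ne_zero 2 (h.r_pos _).ne'
  obtain ⟨ε₃, hε₃, Z, hZ, hZγ⟩ := RealLemmas.exists_ode_extension contDiff_greatCircleField hρc hθ hε0
    (z := fun s => ((fun i => γ s (.inr i), fun i => P.r (γ s iX) ^ 2 * deriv γ s (.inr i)) :
        (Fin (P.d - 2) → ℝ) × (Fin (P.d - 2) → ℝ)))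
    (fun s hs hs' => by
      have := h.hasDerivAt_angular hγ (hmemH s hs hs').1
      rw [hXγ s (hmemH s hs hs')] at this
      simpa only [hXγ s (hmemH s hs hs')] using this)
    (fun s hs hs' => hγ.angular_bounded (hmemH s hs hs').1 (hHn s (hmemH s hs hs')).2)
  have hspeed : ∀ s, |s - s₀| < min ε ε₃ →
      (2 / (1 + ∑ j, (Z s).1 j ^ 2)) ^ 2 * ∑ j, (Z s).2 j ^ 2 = L ^ 2 := by
    intro s hs
    have hball : ∀ s, s ∈ Metric.ball s₀ (min ε ε₃) ↔ |s - s₀| < min ε ε₃ := fun s => by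
      simp [Real.dist_eq]
    have hds := fun s (hs : s ∈ Metric.ball s₀ (min ε ε₃)) => hasDerivAt_speed
      (hZ s (((hball s).1 hs).trans_le (min_le_right _ _)))
    have hm : 0 < min ε ε₃ := lt_min hε0 hε₃
    obtain ⟨s₁, hs₁, hs₁'⟩ := Metric.mem_closure_iff.1 hHs₀ _ hm
    rw [dist_comm, ← Metric.mem_ball] at hs₁'
    have hs₁'' := (hball s₁).1 hs₁'
    have h1 : Z s₁ = _ := hZγ s₁ (hs₁''.trans_le (min_le_right _ _))
      ((hside s₁ (hs₁''.trans_le ((min_le_left _ _).trans (min_le_left _ _)))).1 hs₁.1)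
    have h2 := Metric.isOpen_ball.is_const_of_deriv_eq_zero (convex_ball s₀ (min ε ε₃)).isPreconnected
      (fun v hv => (hds v hv).differentiableAt.differentiableWithinAt) (fun v hv => (hds v hv).deriv)
      ((hball s).2 hs) hs₁'
    rw [h2, h1]
    exact hγ.angular_speed hs₁.1
  -- the continuation
  obtain ⟨δ₁, hδ₁, hδ₁'⟩ : ∃ δ₁ > 0, ∀ x ∈ Ioo (ξ - δ₁) (ξ + δ₁), |lam x - s₀| < min ε ε₃ := by
    have h1 : lam ξ = s₀ := by simp [hlam, hΛξ]
    obtain ⟨e, he, h2⟩ := Metric.continuousAt_iff.1 (hlamc.continuousAt (x := ξ)) _ (lt_min hε0 hε₃)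
    refine ⟨e, he, fun x hx => ?_⟩
    have := h2 (x := x) (by rw [Real.dist_eq, abs_lt]; constructor <;> linarith [hx.1, hx.2])
    rwa [h1, Real.dist_eq] at this
  set δ := min δ₁ (η / 2) with hδ
  have hδ0 : 0 < δ := lt_min hδ₁ (half_pos hη)
  have hδs₁ : Ioo (ξ - δ) (ξ + δ) ⊆ Ioo (ξ - δ₁) (ξ + δ₁) := by
    have := min_le_left δ₁ (η / 2)
    exact Ioo_subset_Ioo (by linarith) (by linarith)
  have hδs : Ioo (ξ - δ) (ξ + δ) ⊆ Ioo (ξ - η / 2) (ξ + η / 2) := by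
    have := min_le_right δ₁ (η / 2)
    exact Ioo_subset_Ioo (by linarith) (by linarith)
  have hJ : ∀ s, Xs s ∈ Ioo (ξ - δ) (ξ + δ) → |s - s₀| < min ε ε₃ := fun s hs => by
    have := hδ₁' _ (hδs₁ hs)
    rwa [hlamX] at this
  set c : ℝ → Idx P.d → ℝ := fun s => Sum.elim ![σ * T₀ (Xs s) + k, Xs s] (Z s).1 with hc
  have hcX : ∀ s, c s iX = Xs s := fun s => rfl
  have hcT : ∀ s, c s iT = σ * T₀ (Xs s) + k := fun s => rfl
  have hcY : ∀ s i, c s (.inr i) = (Z s).1 i := fun s i => rfl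
  refine ⟨δ, hδ0, (min_le_right _ _).trans (by linarith), σ, k, lam, c, hσ, by simp [hlam, hΛξ],
    fun x hx => hlam' x (hδs hx), ?_, fun x _ => by rw [hcX, hXlam], fun x _ => by rw [hcT, hXlam],
    ?_, ?_, ?_, fun i => ?_⟩
  · rcases hσ with h | h
    · left; intro x _ y _ hxy
      have := hΛm hxy
      simp only [hlam, h]; linarith
    · right; intro x _ y _ hxy
      have := hΛm hxy
      simp only [hlam, h]; linarith
  · rw [himage]; exact isOpen_Ioo.preimage hXsc
  · rw [himage]
    have hL : 0 ≤ L := by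
      obtain ⟨s₁, hs₁⟩ : H.Nonempty := by rw [← closure_nonempty_iff]; exact ⟨_, hHs₀⟩
      rw [← hγ.angularMomentum_eq s₁ hs₁.1]
      exact P.angularMomentum_nonneg _ _
    refine h.isGeodesicWith_of_first_integrals (V := fun s => (Z s).2)
      (γ₁ := fun s => Sum.elim ![E / (P.A (Xs s) * P.D (Xs s)),
        σ * (√(P.radial E L κ (Xs s)) / P.D (Xs s))] fun i => (P.r (Xs s) ^ 2)⁻¹ * (Z s).2 i)
      (X₂ := deriv fun s => σ * (√(P.radial E L κ (Xs s)) / P.D (Xs s)))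
      hL ((isOpen_Ioo.sdiff isClosed_singleton).preimage hXsc) ?_ ?_ ?_ ?_ ?_ ?_ ?_ ?_ ?_ ?_ ?_
    · intro s hs
      exact ⟨hs.2, (hpos _ (hsub (hδs hs.1)) hs.2).1⟩
    · intro s hs
      exact hXs' s (hδs hs.1) hs.2
    · intro s hs
      have hA := hpos _ (hsub (hδs hs.1)) hs.2
      have hX := (hXs' s (hδs hs.1) hs.2).differentiableAt
      have hD := h.hasDerivAt_D hs.2
      have hrad := h.differentiableAt_radial (E := E) (L := L) (κ := κ) hs.2
      have : DifferentiableAt ℝ (fun s => σ * (√(P.radial E L κ (Xs s)) / P.D (Xs s))) s :=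
        DifferentiableAt.const_mul (DifferentiableAt.comp (g := fun x => √(P.radial E L κ x) / P.D x) s
          ((hrad.sqrt hA.2.ne').div hD.differentiableAt (h.D_pos hs.2).ne') hX) σ
      exact this.hasDerivAt
    · intro s hs
      have hA := hpos _ (hsub (hδs hs.1)) hs.2
      exact mul_ne_zero hσ0 (div_pos (Real.sqrt_pos.2 hA.2) (h.D_pos hs.2)).ne'
    · intro s hs
      have hA := hpos _ (hsub (hδs hs.1)) hs.2
      have hD := (h.D_pos hs.2).ne'
      change (P.D (Xs s) * (σ * (√(P.radial E L κ (Xs s)) / P.D (Xs s)))) ^ 2 = P.radial E L κ (Xs s)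
      rw [show P.D (Xs s) * (σ * (√(P.radial E L κ (Xs s)) / P.D (Xs s)))
        = σ * √(P.radial E L κ (Xs s)) by field_simp, mul_pow, Real.sq_sqrt hA.2.le, sq, hσ2, one_mul]
    · intro s hs
      have hA := hpos _ (hsub (hδs hs.1)) hs.2
      have hA' := hA.1
      have hD := (h.D_pos hs.2).ne'
      have hr := (Real.sqrt_pos.2 hA.2).ne'
      change HasDerivAt (fun s => σ * T₀ (Xs s) + k) (E / (P.A (Xs s) * P.D (Xs s))) s
      refine ((((hT _ (hsub (hδs hs.1)) hs.2).comp s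
        (hXs' s (hδs hs.1) hs.2)).const_mul σ).add_const k).congr_deriv ?_
      field_simp
      linear_combination E * hσ2
    · intro s hs; rfl
    · intro s hs i
      have := (hJ s hs.1).trans_le (min_le_right _ _)
      exact (hasDerivAt_greatCircleField_iff.1 (hZ s this)).1 i
    · intro s hs i
      exact inv_mul_eq_div _ _
    · intro s hs i
      have := (hJ s hs.1).trans_le (min_le_right _ _)
      refine ((hasDerivAt_greatCircleField_iff.1 (hZ s this)).2 i).congr_deriv ?_
      exact inv_mul_eq_div _ _
    · intro s hs
      exact hspeed s (hJ s hs.1)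
  · rw [himage]
    intro s hs
    have h1 := hJ s hs.2
    have h2 := (hside s (h1.trans_le ((min_le_left _ _).trans (min_le_left _ _)))).1 hs.1
    have hsH := hmemH s (h1.trans_le (min_le_left _ _)) h2
    have h3 : Z s = _ := hZγ s (h1.trans_le (min_le_right _ _)) h2
    funext μ
    revert μ
    refine forall_idx ?_ ?_ fun i => ?_
    · rw [hcT, hk s hsH]
    · rw [hcX, hXγ s hsH]
    · rw [hcY, h3]
  · rw [himage]
    have hZd := fun s (hs : Xs s ∈ Ioo (ξ - δ) (ξ + δ)) =>
      hZ s ((hJ s hs).trans_le (min_le_right _ _))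
    refine RealLemmas.contDiffOn_one_of_hasDerivAt (isOpen_Ioo.preimage hXsc)
      (fun s hs => (hasDerivAt_greatCircleField_iff.1 (hZd s hs)).1 i) ?_
    refine hρc.continuousOn.mul fun s hs => ?_
    exact ((continuous_apply i).continuousAt.comp
      (continuous_snd.continuousAt.comp (hZd s hs).continuousAt)).continuousWithinAt

end Params
end EiBI

/-! ### Repulsion by the throat and approach to it -/

namespace EiBI
namespace RealLemmas

theorem exists_pos_lower_bound {f : ℝ → ℝ} {η c : ℝ} (hf : ContinuousOn f (Ioc 0 η))
    (hpos : ∀ x ∈ Ioc 0 η, 0 < f x) (hc : 0 < c) (hev : ∀ᶠ x in 𝓝[>] (0 : ℝ), c ≤ f x) :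
    ∃ m > 0, ∀ x ∈ Ioc 0 η, m ≤ f x := by
  obtain ⟨e, he, hev⟩ := (mem_nhdsGT_iff_exists_Ioo_subset' (zero_lt_one)).1 hev
  rw [mem_Ioi] at he
  have hsub : Icc e η ⊆ Ioc 0 η := fun x hx => ⟨he.trans_le hx.1, hx.2⟩
  rcases (Icc e η).eq_empty_or_nonempty with h0 | h0
  · refine ⟨c, hc, fun x hx => hev ⟨hx.1, ?_⟩⟩
    by_contra! hcon
    have : x ∈ Icc e η := ⟨hcon, hx.2⟩
    rw [h0] at this
    exact this
  · obtain ⟨x₀, hx₀, hmin⟩ := isCompact_Icc.exists_isMinOn h0 (hf.mono hsub)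
    refine ⟨min c (f x₀), lt_min hc (hpos _ (hsub hx₀)), fun x hx => ?_⟩
    rcases lt_or_ge x e with h | h
    · exact (min_le_left _ _).trans (hev ⟨hx.1, h⟩)
    · exact (min_le_right _ _).trans (hmin ⟨h, hx.2⟩)

theorem exists_primitive {f : ℝ → ℝ} {S : Set ℝ} (hS : IsOpen S) (hSc : S.OrdConnected)
    (hf : ContinuousOn f S) : ∃ F : ℝ → ℝ, ∀ x ∈ S, HasDerivAt F (f x) x := by
  rcases S.eq_empty_or_nonempty with rfl | ⟨a, ha⟩
  · exact ⟨0, fun x hx => hx.elim⟩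
  refine ⟨fun x => ∫ u in a..x, f u, fun x hx => ?_⟩
  exact intervalIntegral.integral_hasDerivAt_right
    (hf.mono (hSc.uIcc_subset ha hx)).intervalIntegrable (hf.stronglyMeasurableAtFilter hS x hx)
    (hf.continuousAt (hS.mem_nhds hx))

/-- Without a condition at zero, primitives on the two sides can be chosen independently. -/
theorem exists_primitive_off_zero {f : ℝ → ℝ} {η : ℝ} (hf : ContinuousOn f (Ioo (-η) η \ {0})) :
    ∃ F : ℝ → ℝ, ∀ x ∈ Ioo (-η) η, x ≠ 0 → HasDerivAt F (f x) x := by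
  obtain ⟨F, hF⟩ := exists_primitive (f := f) (S := Ioo 0 η) isOpen_Ioo ordConnected_Ioo
    (hf.mono fun x hx => ⟨⟨by linarith [hx.1, hx.2], hx.2⟩, hx.1.ne'⟩)
  obtain ⟨F', hF'⟩ := exists_primitive (f := f) (S := Ioo (-η) 0) isOpen_Ioo ordConnected_Ioo
    (hf.mono fun x hx => ⟨⟨hx.1, by linarith [hx.1, hx.2]⟩, hx.2.ne⟩)
  classical
  refine ⟨fun x => if 0 < x then F x else F' x, fun x hx hx0 => ?_⟩
  rcases lt_or_gt_of_ne hx0 with h0 | h0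
  · refine (hF' x ⟨hx.1, h0⟩).congr_of_eventuallyEq ?_
    filter_upwards [Iio_mem_nhds h0] with y hy
    exact if_neg (not_lt.2 (le_of_lt hy))
  · refine (hF x ⟨h0, hx.2⟩).congr_of_eventuallyEq ?_
    filter_upwards [Ioi_mem_nhds h0] with y hy
    exact if_pos hy

/-- A function with a limit at zero has a primitive across zero. -/
theorem exists_primitive_of_tendsto {f : ℝ → ℝ} {η ℓ : ℝ} (hf : ContinuousOn f (Ioo (-η) η \ {0}))
    (hℓ : Tendsto f (𝓝[≠] 0) (𝓝 ℓ)) : ∃ F : ℝ → ℝ, ContDiffOn ℝ 1 F (Ioo (-η) η) ∧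
      ∀ x ∈ Ioo (-η) η, x ≠ 0 → HasDerivAt F (f x) x := by
  classical
  have hc : ContinuousOn (Function.update f 0 ℓ) (Ioo (-η) η) := by
    intro x hx
    rcases eq_or_ne x 0 with rfl | hx0
    · exact (continuousAt_update_same.2 hℓ).continuousWithinAt
    · have h1 : ContinuousAt f x := hf.continuousAt
        ((isOpen_Ioo.sdiff isClosed_singleton).mem_nhds ⟨hx, hx0⟩)
      exact ((continuousAt_update_of_ne hx0).2 h1).continuousWithinAt
  obtain ⟨F, hF⟩ := exists_primitive isOpen_Ioo ordConnected_Ioo hc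
  refine ⟨F, contDiffOn_one_of_hasDerivAt isOpen_Ioo hF hc, fun x hx hx0 => ?_⟩
  simpa [hx0] using hF x hx

end RealLemmas

namespace Params
variable {P : Params} {n : ℕ} {γ : ℝ → Idx P.d → ℝ} {I : Set ℝ} {E L κ : ℝ}

theorem ReachesThroat.tendsto_zero {c : ℝ} (hr : P.ReachesThroat E L κ c) :
    Tendsto (fun x => P.D x / √(P.radial E L κ x)) (𝓝[≠] 0) (𝓝 0) := by
  have h1 : Tendsto (fun x : ℝ => |x| ^ P.throatExponent E L κ) (𝓝[≠] 0) (𝓝 0) := by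
    have h2 : Tendsto (fun x : ℝ => |x|) (𝓝[≠] 0) (𝓝 0) := by
      simpa using tendsto_abs_pow_zero one_ne_zero
    have h3 := h2.rpow_const (p := P.throatExponent E L κ) (Or.inr hr.exponent_pos.le)
    rwa [Real.zero_rpow hr.exponent_pos.ne'] at h3
  have h2 := hr.rate.mul h1
  rw [mul_zero] at h2
  refine h2.congr' ?_
  filter_upwards [self_mem_nhdsWithin] with x hx
  have : 0 < |x| ^ P.throatExponent E L κ := Real.rpow_pos_of_pos (abs_pos.2 hx) _
  field_simp

/-- A geodesic in the domain stays on one side of the throat. -/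
theorem IsGeodesicWith.exists_abs_eq (hγ : P.IsGeodesicWith γ I E L κ) (hIc : I.OrdConnected) :
    ∃ θ : ℝ, (θ = 1 ∨ θ = -1) ∧ ∀ s ∈ I, |γ s iX| = θ * γ s iX := by
  have hc : ContinuousOn (fun s => γ s iX) I := fun s hs =>
    (hγ.geodesic.hasDerivAt hs iX).1.continuousAt.continuousWithinAt
  rcases hIc.isPreconnected.eq_or_eq_neg_of_sq_eq hc.abs hc (fun s _ => by simp)
    (fun hs => (hγ.mem_domain _ hs).1) with h | h
  · exact ⟨1, Or.inl rfl, fun s hs => by rw [one_mul]; exact h hs⟩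
  · exact ⟨-1, Or.inr rfl, fun s hs => by rw [neg_one_mul]; exact h hs⟩

namespace Admissible

theorem bounded_below_of_radial_neg (h : P.Admissible n) (hγ : P.IsGeodesicWith γ I E L κ)
    (hneg : ∀ᶠ x in 𝓝[≠] (0 : ℝ), P.radial E L κ x < 0) : ∃ m > 0, ∀ s ∈ I, m ≤ |γ s iX| := by
  rw [eventually_nhdsWithin_iff, Metric.eventually_nhds_iff] at hneg
  obtain ⟨m, hm, hneg⟩ := hneg
  refine ⟨m, hm, fun s hs => ?_⟩
  by_contra! hcon
  have h1 := hneg (y := γ s iX) (by rwa [Real.dist_eq, sub_zero]) (hγ.mem_domain s hs).1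
  rw [← h.first_integral hγ hs] at h1
  exact absurd h1 (not_lt.2 (sq_nonneg _))

/-- By `radial_cases`; a geodesic with `E = L = κ = 0` is at rest. -/
theorem bounded_below_or_reachesThroat (h : P.Admissible n) (hn : 3 ≤ n) (hκ : 0 ≤ κ) (hI : IsOpen I)
    (hIc : I.OrdConnected) (hγ : P.IsGeodesicWith γ I E L κ) :
    (∃ m > 0, ∀ s ∈ I, m ≤ |γ s iX|) ∨ ∃ c, P.ReachesThroat E L κ c := by
  have hd := fun s (hs : s ∈ I) => hγ.geodesic.hasDerivAt hs iX
  rcases h.radial_cases (E := E) (L := L) hn hκ with hc | ⟨rfl, rfl, rfl⟩ | ⟨c, hc⟩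
  · exact Or.inl (h.bounded_below_of_radial_neg hγ hc)
  · left
    rcases I.eq_empty_or_nonempty with rfl | ⟨s₁, hs₁⟩
    · exact ⟨1, one_pos, fun s hs => hs.elim⟩
    have hx' : ∀ s ∈ I, deriv γ s iX = 0 := by
      intro s hs
      have h1 := h.first_integral hγ hs
      have h2 := (h.D_pos (hγ.mem_domain s hs).1).ne'
      simp only [radial, ne_eq, OfNat.ofNat_ne_zero, not_false_eq_true, zero_pow, zero_div, add_zero,
        mul_zero, sub_zero, pow_eq_zero_iff, mul_eq_zero] at h1
      exact h1.resolve_left h2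
    refine ⟨|γ s₁ iX|, abs_pos.2 (hγ.mem_domain s₁ hs₁).1, fun s hs => ?_⟩
    have := hI.is_const_of_deriv_eq_zero hIc.isPreconnected
      (fun v hv => (hd v hv).1.differentiableAt.differentiableWithinAt)
      (fun v hv => (hd v hv).1.deriv.trans (hx' v hv)) hs₁ hs
    rw [this]
  · exact Or.inr ⟨c, hc⟩

/-- Close to the throat the radial speed `√radial / D` is at least `1`, so that a geodesic which gets
arbitrarily close to the throat runs into it within finite affine parameter. -/
theorem bounded_below_or_tendsto_throat (h : P.Admissible n) (hn : 3 ≤ n) (hκ : 0 ≤ κ) (hI : IsOpen I)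
    (hIc : I.OrdConnected) (hγ : P.IsGeodesicWith γ I E L κ) : (∃ m > 0, ∀ s ∈ I, m ≤ |γ s iX|) ∨
      ∃ s₀ ∈ closure I \ I, Tendsto (fun s => γ s iX) (𝓝[I] s₀) (𝓝 0) := by
  have hd := fun s (hs : s ∈ I) => hγ.geodesic.hasDerivAt hs iX
  rcases h.bounded_below_or_reachesThroat hn hκ hI hIc hγ with hb | ⟨c, hc⟩
  · exact Or.inl hb
  · obtain ⟨θ, hθ, habs⟩ := hγ.exists_abs_eq hIc
    obtain ⟨η, hη, hnear⟩ : ∃ η > 0, ∀ x : ℝ, |x| < η → x ≠ 0 →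
        0 < P.radial E L κ x ∧ P.D x / √(P.radial E L κ x) ≤ 1 := by
      have := hc.pos.and (hc.tendsto_zero.eventually (ge_mem_nhds one_pos))
      rw [eventually_nhdsWithin_iff, Metric.eventually_nhds_iff] at this
      obtain ⟨e, he, h1⟩ := this
      exact ⟨e, he, fun x hx hx0 => h1 (by rwa [Real.dist_eq, sub_zero]) hx0⟩
    have := RealLemmas.bounded_below_or_tendsto_zero (p := fun s => |γ s iX|)
      (p' := fun s => θ * deriv γ s iX) (η := η / 2) hIc hI
      (fun s hs => abs_pos.2 (hγ.mem_domain s hs).1)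
      (fun s hs => ((hd s hs).1.const_mul θ).congr_of_eventuallyEq
        (Filter.mem_of_superset (hI.mem_nhds hs) habs))
      (fun s hs => ((hd s hs).2.continuousAt.const_mul θ).continuousWithinAt) (half_pos hη) ?_
    · exact this.imp_right fun ⟨s₀, hs₀, hlim⟩ =>
        ⟨s₀, hs₀, (tendsto_zero_iff_abs_tendsto_zero _).2 hlim⟩
    · intro s hs hle
      have hx0 := (hγ.mem_domain s hs).1
      obtain ⟨h1, h2⟩ := hnear _ (hle.trans_lt (half_lt_self hη)) hx0
      have h3 := h.first_integral hγ hs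
      have hD := h.D_pos hx0
      have hS := Real.sqrt_pos.2 h1
      rw [div_le_one hS] at h2
      have h4 : P.D (γ s iX) * |deriv γ s iX| = √(P.radial E L κ (γ s iX)) := by
        rw [← h3, Real.sqrt_sq_eq_abs, abs_mul, abs_of_pos hD]
      have h5 : |θ * deriv γ s iX| = |deriv γ s iX| := by
        rcases hθ with h | h <;> simp [h]
      rw [h5]
      by_contra! hcon
      nlinarith

theorem radial_neg_arg (h : P.Admissible n) (x : ℝ) : P.radial E L κ (-x) = P.radial E L κ x := by
  unfold radial; rw [h.A_neg, h.D_neg, h.r_neg]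

/-- Between a space-like throat and a point with `A < 0` there is no horizon, since
`(A x^{n-1})' = x^{n-2} ((n-1) - (r² - x²)/l_ε²)` can change its sign only from negative to positive. -/
theorem A_neg_of_le (h : P.Admissible n) (hn : 3 ≤ n) (hM : 0 < P.massThroat) {x₁ : ℝ} (hx₁ : 0 < x₁)
    (hA : P.A x₁ < 0) {x : ℝ} (hx : 0 < x) (hxx : x ≤ x₁) : P.A x < 0 := by
  have hn' := cast_three_le hn
  have hl := h.lε_pos
  set φ : ℝ → ℝ := fun x => ((n : ℝ) - 1) - (P.r x ^ 2 - x ^ 2) / P.lε ^ 2 with hφ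
  have hφm : MonotoneOn φ (Ioi 0) := by
    have hd : ∀ x ∈ Ioi (0 : ℝ), HasDerivAt φ (2 * x * (1 - P.D x) / P.lε ^ 2) x := by
      intro x hx
      have hr := (h.r_pos x).ne'
      refine ((((h.hasDerivAt_r (ne_of_gt hx)).fun_pow 2).fun_sub
        (hasDerivAt_pow 2 x)).div_const (P.lε ^ 2)).const_sub _ |>.congr_deriv ?_
      push_cast
      field_simp
      ring
    refine monotoneOn_of_deriv_nonneg (convex_Ioi 0)
      (fun x hx => (hd x hx).continuousAt.continuousWithinAt)
      (fun x hx => (hd x (interior_subset hx)).differentiableAt.differentiableWithinAt) fun x hx => ?_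
    have hx' : 0 < x := interior_subset hx
    rw [(hd x hx').deriv]
    have := h.D_le_one x
    have : 0 ≤ 1 - P.D x := by linarith
    positivity
  set N : ℝ → ℝ := fun x => P.A x * x ^ (n - 1) with hN
  have hNd : ∀ x : ℝ, 0 < x → HasDerivAt N (x ^ (n - 2) * φ x) x := by
    intro x hx
    refine ((h.hasDerivAt_A hx.ne').fun_mul (hasDerivAt_pow (n - 1) x)).congr_deriv ?_
    rw [h.A₁_eq, Nat.cast_sub (by omega), show n - 1 - 1 = n - 2 by omega,
      show n - 1 = n - 2 + 1 by omega, pow_succ, hφ]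
    push_cast
    field_simp
    ring
  suffices N x < 0 from neg_of_mul_neg_left this (by positivity)
  by_contra! hcon
  -- otherwise `N` increases somewhere between the throat, where it is negative, and `x`; there `φ` is
  -- positive, and so it is from there on, so that `N` stays nonnegative up to `x₁`
  obtain ⟨y, hy0, hyx, hNy⟩ : ∃ y, 0 < y ∧ y < x ∧ N y < 0 := by
    have h1 := (h.throatRate_of_massThroat_ne_zero hn hM.ne').zeroth
    have h2 : -(2 * P.massThroat / ((n : ℝ) - 1)) < 0 :=
      neg_lt_zero.2 (div_pos (by linarith) (by linarith))
    have h3 := (h1.mono_left (nhdsGT_le_nhdsNE 0)).eventually (gt_mem_nhds h2)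
    obtain ⟨y, hy, hy'⟩ := (h3.and (Ioo_mem_nhdsGT hx)).exists
    have hy0 : 0 < y := hy'.1
    refine ⟨y, hy0, hy'.2, ?_⟩
    have : |y| ^ (2 * n - 1) / |y| ^ n = y ^ (n - 1) := by
      rw [abs_of_pos hy0, div_eq_iff (by positivity), ← pow_add]; congr 1; omega
    rwa [this] at hy
  obtain ⟨ζ, hζ, hζ'⟩ := exists_hasDerivAt_eq_slope N (fun x => x ^ (n - 2) * φ x) hyx
    (fun u hu => (hNd u (hy0.trans_le hu.1)).continuousAt.continuousWithinAt)
    (fun u hu => hNd u (hy0.trans hu.1))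
  have hζ0 : 0 < ζ := hy0.trans hζ.1
  have hφζ : 0 < φ ζ := by
    have : 0 < ζ ^ (n - 2) * φ ζ := by
      rw [hζ']; exact div_pos (by linarith) (by linarith)
    exact (pos_iff_pos_of_mul_pos this).1 (by positivity)
  have hmono : MonotoneOn N (Icc x x₁) := by
    refine monotoneOn_of_deriv_nonneg (convex_Icc _ _)
      (fun u hu => (hNd u (hx.trans_le hu.1)).continuousAt.continuousWithinAt)
      (fun u hu => (hNd u (hx.trans_le (interior_subset hu).1)).differentiableAt.differentiableWithinAt)
      fun u hu => ?_
    have hu' := interior_subset hu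
    have hu0 : 0 < u := hx.trans_le hu'.1
    rw [(hNd u hu0).deriv]
    have := hφm (mem_Ioi.2 hζ0) (mem_Ioi.2 hu0) (hζ.2.le.trans hu'.1)
    have : 0 ≤ φ u := by linarith
    positivity
  have h1 := hmono (left_mem_Icc.2 hxx) (right_mem_Icc.2 hxx) hxx
  have h2 : N x₁ < 0 := mul_neg_of_neg_of_pos hA (by positivity)
  linarith

/-- A geodesic with a limit off the throat and off the horizons can be continued. -/
theorem not_futureInextendible (h : P.Admissible n) (hI : IsOpen I) (hIc : I.OrdConnected)
    (hγ : P.IsGeodesicWith γ I E L κ) {s₀ ξ R : ℝ} (hs₀ : s₀ ∈ closure I \ I) (hlub : IsLUB I s₀)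
    (hlim : Tendsto (fun s => γ s iX) (𝓝[I] s₀) (𝓝 ξ)) (hξ : ξ ≠ 0) (hA : P.A ξ ≠ 0)
    (hrad : 0 < P.radial E L κ ξ)
    (hR : ∀ᶠ s in 𝓝[I] s₀, ∑ i, γ s (Sum.inr i) ^ 2 ≤ R) : ¬ P.FutureInextendible γ I := by
  obtain ⟨η, hη, hnear⟩ : ∃ η > 0, ∀ x ∈ Ioo (ξ - η) (ξ + η), x ≠ 0 ∧ P.A x ≠ 0 ∧
      0 < P.radial E L κ x := by
    have h1 := (eventually_mem_domain h hξ hA).and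
      ((h.differentiableAt_radial (E := E) (L := L) (κ := κ) hξ).continuousAt.eventually
        (lt_mem_nhds hrad))
    obtain ⟨e, he, h2⟩ := Metric.eventually_nhds_iff.1 h1
    refine ⟨e, he, fun x hx => ?_⟩
    have := h2 (y := x) (by rw [Real.dist_eq, abs_lt]; constructor <;> linarith [hx.1, hx.2])
    exact ⟨this.1.1, this.1.2, this.2⟩
  have hradc : ∀ x ∈ Ioo (ξ - η) (ξ + η), ContinuousAt (fun x => √(P.radial E L κ x)) x := fun x hx =>
    (h.differentiableAt_radial (hnear x hx).1).continuousAt.sqrt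
  have hsq : ∀ x ∈ Ioo (ξ - η) (ξ + η), √(P.radial E L κ x) ≠ 0 := fun x hx =>
    (Real.sqrt_pos.2 (hnear x hx).2.2).ne'
  have hW : ContinuousOn (fun x => P.D x / √(P.radial E L κ x)) (Ioo (ξ - η) (ξ + η)) := fun x hx =>
    (h.continuous_D.continuousAt.div (hradc x hx) (hsq x hx)).continuousWithinAt
  have hTc : ContinuousOn (fun x => E / (P.A x * √(P.radial E L κ x))) (Ioo (ξ - η) (ξ + η)) :=
    fun x hx => (continuousAt_const.div
      ((h.hasDerivAt_A (hnear x hx).1).continuousAt.mul (hradc x hx))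
      (mul_ne_zero (hnear x hx).2.1 (hsq x hx))).continuousWithinAt
  obtain ⟨T₀, hT₀⟩ := RealLemmas.exists_primitive isOpen_Ioo ordConnected_Ioo hTc
  obtain ⟨δ, hδ, hδη, σ, k, lam, c, hc⟩ := h.exists_isContinuation hI hIc hγ
    (W := fun x => P.D x / √(P.radial E L κ x))
    hs₀ hlim hR hη (fun x hx _ => (hnear x hx).2) hW (fun x hx _ => rfl) fun x hx _ => hT₀ x hx
  set S := Ioo (ξ - δ) (ξ + δ) with hS
  have hSsub : S ⊆ Ioo (ξ - η) (ξ + η) := Ioo_subset_Ioo (by linarith) (by linarith)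
  set J := lam '' S with hJ
  have hS0 : S \ {0} = S := sdiff_singleton_eq_self fun h0 => (hnear 0 (hSsub h0)).1 rfl
  have hgeo := hc.geodesic
  rw [← hS, hS0, ← hJ] at hgeo
  have hs₀J : s₀ ∈ J := ⟨ξ, ⟨by linarith, by linarith⟩, hc.lam_center⟩
  have hJo : IsOpen J := hc.isOpen_image
  have hJp : IsPreconnected J := (ordConnected_Ioo.isPreconnected).image _ fun x hx =>
    (hc.hasDerivAt_lam x hx).continuousAt.continuousWithinAt
  have hIJ : (I ∩ J).Nonempty := by
    rw [inter_comm]; exact mem_closure_iff.1 hs₀.1 J hJo hs₀J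
  classical
  set γ' : ℝ → Idx P.d → ℝ := I.piecewise γ c with hγ'
  have e1 : EqOn γ' γ I := piecewise_eqOn I γ c
  have e2 : EqOn γ' c J := by
    intro s hs
    by_cases hsI : s ∈ I
    · rw [e1 hsI, hc.eqOn ⟨hsI, hs⟩]
    · exact piecewise_eq_of_notMem I γ c hsI
  intro hfut
  obtain ⟨s', hs', hgt⟩ : ∃ s' ∈ J, s₀ < s' := by
    obtain ⟨e, he, hball⟩ := Metric.isOpen_iff.1 hJo s₀ hs₀J
    refine ⟨s₀ + e / 2, hball ?_, by linarith⟩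
    rw [Metric.mem_ball, Real.dist_eq, add_sub_cancel_left, abs_of_pos (by linarith)]
    linarith
  obtain ⟨s, hs, hle⟩ := hfut γ' (I ∪ J) (hI.union hJo)
    (hIc.isPreconnected.union' hIJ hJp).ordConnected subset_union_left
    (by
      rintro s (hs | hs)
      · rw [e1 hs]; exact hγ.mem_domain s hs
      · rw [e2 hs]; exact hgeo.mem_domain s hs)
    (by
      rintro s (hs | hs)
      · exact hγ.geodesic.congr hI e1 s hs
      · exact hgeo.geodesic.congr hJo e2 s hs)
    e1 s' (Or.inr hs')
  exact absurd (hlub.1 hs) (not_le.2 (hgt.trans_le hle))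

/-- Inside the horizon of a space-like throat the speed of approach is bounded below, so that the
throat is reached. -/
theorem reaches_throat_inside_horizon (h : P.Admissible n) (hn : 3 ≤ n) (hκ : 0 ≤ κ) (hI : IsOpen I)
    (hIc : I.OrdConnected) (hγ : P.IsGeodesicWith γ I E L κ) (hM : 0 < P.massThroat) {s₁ : ℝ}
    (hs₁ : s₁ ∈ I) (hA : P.A (γ s₁ iX) < 0) (hdec : γ s₁ iX * deriv γ s₁ iX < 0) :
    ∃ s₀, IsLUB I s₀ ∧ (P.FutureInextendible γ I →
      (∃ R : ℝ, ∀ᶠ s in 𝓝[I] s₀, ∑ i, γ s (Sum.inr i) ^ 2 ≤ R) →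
      Tendsto (fun s => γ s iX) (𝓝[I] s₀) (𝓝 0)) := by
  have hd := fun s (hs : s ∈ I) => hγ.geodesic.hasDerivAt hs iX
  have hx0 := fun s (hs : s ∈ I) => (hγ.mem_domain s hs).1
  set η := |γ s₁ iX| with hη
  have hη0 : 0 < η := abs_pos.2 (hx0 s₁ hs₁)
  have hAabs : ∀ x, P.A |x| = P.A x := fun x => by
    rcases abs_choice x with hx | hx <;> rw [hx]
    exact h.A_neg x
  have hRabs : ∀ x, P.radial E L κ |x| = P.radial E L κ x := fun x => by
    rcases abs_choice x with hx | hx <;> rw [hx]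
    exact h.radial_neg_arg x
  have hAη : ∀ x ∈ Ioc 0 η, P.A x < 0 := fun x hx =>
    h.A_neg_of_le hn hM hη0 (by rwa [hη, hAabs]) hx.1 hx.2
  have hx₁ : deriv γ s₁ iX ≠ 0 := fun h0 => by rw [h0, mul_zero] at hdec; exact lt_irrefl _ hdec
  have hK : ∀ x, 0 ≤ κ + L ^ 2 / P.r x ^ 2 := fun x => by positivity
  -- the radial velocity is bounded below
  obtain ⟨m, hm, hmr⟩ : ∃ m > 0, ∀ x ∈ Ioc 0 η, m ≤ P.radial E L κ x := by
    have hE2 : ∀ x ∈ Ioc 0 η, E ^ 2 ≤ P.radial E L κ x := fun x hx => by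
      have := mul_nonneg (mul_nonneg (neg_nonneg.2 (hAη x hx).le) (h.D_pos hx.1.ne').le) (hK x)
      unfold radial
      linarith
    by_cases hKL : κ ≠ 0 ∨ L ≠ 0
    · have hn1 : 0 < (n : ℝ) - 1 := by have := cast_three_le hn; linarith
      have hc := h.rc_pos
      have hK0 := radial_pos_factor hκ hKL hc
      have hlim := h.tendsto_radial_mul_abs (E := E) (L := L) (κ := κ) hn hM.ne'
      set C := 2 * P.massThroat / ((n : ℝ) - 1) * (1 / (2 * P.rc ^ (n - 2)))
        * (κ + L ^ 2 / P.rc ^ 2) with hC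
      have hC0 : 0 < C := by positivity
      refine RealLemmas.exists_pos_lower_bound (c := C / 2) (fun x hx =>
        (h.differentiableAt_radial hx.1.ne').continuousAt.continuousWithinAt) (fun x hx => ?_)
        (half_pos hC0) ?_
      · have := mul_pos (mul_pos (neg_pos.2 (hAη x hx)) (h.D_pos hx.1.ne'))
          (radial_pos_factor hκ hKL (h.r_pos x))
        have := sq_nonneg E
        unfold radial
        linarith
      · have h1 := (hlim.mono_left (nhdsGT_le_nhdsNE 0)).eventually (lt_mem_nhds (half_lt_self hC0))
        filter_upwards [h1, Ioo_mem_nhdsGT one_pos] with x hx hx1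
        rw [abs_of_pos hx1.1] at hx
        have hx2 := hx1.1
        have hx3 := hx1.2
        by_contra! hcon
        nlinarith
    · push Not at hKL
      obtain ⟨rfl, rfl⟩ := hKL
      refine ⟨E ^ 2, ?_, hE2⟩
      have h1 := h.first_integral hγ hs₁
      have h2 := (h.D_pos (hx0 s₁ hs₁)).ne'
      have h3 : P.radial E 0 0 (γ s₁ iX) = E ^ 2 := by simp [radial]
      rw [← h3, ← h1]
      positivity
  obtain ⟨θ, hθ, habs⟩ := hγ.exists_abs_eq hIc
  have hθ2 : θ * θ = 1 := by rcases hθ with h | h <;> rw [h] <;> norm_num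
  set p : ℝ → ℝ := fun s => |γ s iX| with hp
  have hp0 : ∀ s ∈ I, 0 < p s := fun s hs => abs_pos.2 (hx0 s hs)
  have hpd : ∀ s ∈ I, HasDerivAt p (θ * deriv γ s iX) s := fun s hs =>
    ((hd s hs).1.const_mul θ).congr_of_eventuallyEq (Filter.mem_of_superset (hI.mem_nhds hs) habs)
  have hpc : ContinuousOn (fun s => θ * deriv γ s iX) I := fun s hs =>
    ((hd s hs).2.continuousAt.const_mul θ).continuousWithinAt
  have hlow : ∀ s ∈ I, p s ≤ η → √m ≤ |θ * deriv γ s iX| := by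
    intro s hs hle
    have h1 := h.first_integral hγ hs
    have h2 := hmr (p s) ⟨hp0 s hs, hle⟩
    rw [hp, hRabs, ← h1] at h2
    have hD := h.D_pos (hx0 s hs)
    have hD1 := h.D_le_one (γ s iX)
    have h3 : |θ * deriv γ s iX| = |deriv γ s iX| := by rcases hθ with h | h <;> simp [h]
    rw [h3]
    refine Real.sqrt_le_iff.2 ⟨abs_nonneg _, h2.trans ?_⟩
    rw [mul_pow, sq_abs]
    have : P.D (γ s iX) ^ 2 ≤ 1 := pow_le_one₀ hD.le hD1
    nlinarith [sq_nonneg (deriv γ s iX)]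
  have hm' := Real.sqrt_pos.2 hm
  have hneg₁ : θ * deriv γ s₁ iX < 0 := by
    have h1 := habs s₁ hs₁
    have h2 : 0 < θ * γ s₁ iX := by rw [← h1]; exact hη0
    by_contra! hcon
    have := mul_nonneg h2.le hcon
    have h3 : θ * γ s₁ iX * (θ * deriv γ s₁ iX) = γ s₁ iX * deriv γ s₁ iX := by
      linear_combination (γ s₁ iX * deriv γ s₁ iX) * hθ2
    linarith
  have hdecr : ∀ u ∈ I, s₁ ≤ u → p u ≤ p s₁ - √m * (u - s₁) := fun u hu hsu =>
    RealLemmas.decreasing_of_abs_deriv_ge hIc hpd hpc hm' hlow hs₁ le_rfl hneg₁ hu hsu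
  have hpη : ∀ u ∈ I, s₁ ≤ u → p u ≤ η := fun u hu hsu => by
    have h1 := hdecr u hu hsu
    have h2 : 0 ≤ √m * (u - s₁) := mul_nonneg hm'.le (by linarith)
    have h3 : p s₁ = η := rfl
    linarith
  have hbdd : BddAbove I := by
    refine ⟨s₁ + p s₁ / √m, fun u hu => ?_⟩
    rcases le_total u s₁ with hus | hus
    · have : 0 ≤ p s₁ / √m := div_nonneg (hp0 _ hs₁).le hm'.le
      linarith
    · have h1 := hdecr u hu hus
      have h2 := hp0 u hu
      have : u - s₁ ≤ p s₁ / √m := by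
        rw [le_div_iff₀ hm']; linarith
      linarith
  have hlub := isLUB_csSup ⟨s₁, hs₁⟩ hbdd
  set s₀ := sSup I with hs₀
  refine ⟨s₀, hlub, fun hfut hR => ?_⟩
  obtain ⟨R, hR⟩ := hR
  have hs₀cl : s₀ ∈ closure I := hlub.mem_closure ⟨s₁, hs₁⟩
  have hs₀I : s₀ ∉ I := by
    intro hmem
    obtain ⟨e, he, hball⟩ := Metric.isOpen_iff.1 hI s₀ hmem
    have : s₀ + e / 2 ∈ I := hball (by
      rw [Metric.mem_ball, Real.dist_eq, add_sub_cancel_left, abs_of_pos (by linarith)]; linarith)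
    have := hlub.1 this
    linarith
  have hlt : ∀ s ∈ I, s < s₀ := fun s hs => lt_of_le_of_ne (hlub.1 hs) fun h => hs₀I (h ▸ hs)
  -- `|x|` is decreasing from `s₁` on, so that it has a limit
  set H := I ∩ Ici s₁ with hH
  have hHc : H.OrdConnected := hIc.inter ordConnected_Ici
  have hnegH : ∀ s ∈ H, θ * deriv γ s iX < 0 := by
    intro s hs
    by_contra! hcon
    obtain ⟨v, hv, hv0⟩ := hHc.isPreconnected.intermediate_value (f := fun s => θ * deriv γ s iX)
      ⟨hs₁, self_mem_Ici⟩ hs (hpc.mono inter_subset_left) ⟨hneg₁.le, hcon⟩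
    have := hlow v hv.1 (hpη v hv.1 hv.2)
    rw [show θ * deriv γ v iX = 0 from hv0, abs_zero] at this
    linarith
  have hanti : AntitoneOn p H := by
    refine antitoneOn_of_deriv_nonpos hHc.convex
      (fun s hs => (hpd s hs.1).continuousAt.continuousWithinAt)
      (fun s hs => (hpd s (interior_subset hs).1).differentiableAt.differentiableWithinAt) fun s hs => ?_
    rw [(hpd s (interior_subset hs).1).deriv]
    exact (hnegH s (interior_subset hs)).le
  have hbelow : BddBelow (p '' H) := ⟨0, by rintro _ ⟨s, hs, rfl⟩; exact (hp0 s hs.1).le⟩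
  have hHne : (p '' H).Nonempty := ⟨_, s₁, ⟨hs₁, self_mem_Ici⟩, rfl⟩
  set ℓ := sInf (p '' H) with hℓ
  have hℓle : ∀ s ∈ H, ℓ ≤ p s := fun s hs => csInf_le hbelow ⟨s, hs, rfl⟩
  have hℓ0 : 0 ≤ ℓ := le_csInf hHne (by rintro _ ⟨s, hs, rfl⟩; exact (hp0 s hs.1).le)
  have hplim : Tendsto p (𝓝[I] s₀) (𝓝 ℓ) := by
    rw [Metric.tendsto_nhds]
    intro e he
    obtain ⟨_, ⟨s₂, hs₂, rfl⟩, hlt₂⟩ := exists_lt_of_csInf_lt hHne (show ℓ < ℓ + e by linarith)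
    filter_upwards [self_mem_nhdsWithin, nhdsWithin_le_nhds (Ioi_mem_nhds (hlt s₂ hs₂.1))] with s hs hgt
    have hsH : s ∈ H := ⟨hs, (mem_Ici.1 hs₂.2).trans (le_of_lt hgt)⟩
    have h1 := hanti hs₂ hsH (le_of_lt hgt)
    have h2 := hℓle s hsH
    rw [Real.dist_eq, abs_of_nonneg (by linarith)]
    linarith
  rcases hℓ0.eq_or_lt with h0 | h0
  · rw [← h0] at hplim
    exact (tendsto_zero_iff_abs_tendsto_zero _).2 hplim
  · exfalso
    have hlim : Tendsto (fun s => γ s iX) (𝓝[I] s₀) (𝓝 (θ * ℓ)) := by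
      refine (hplim.const_mul θ).congr' (eventually_mem_nhdsWithin.mono fun s hs => ?_)
      rw [hp]
      simp only [habs s hs]
      linear_combination (γ s iX) * hθ2
    have hmem : ℓ ∈ Ioc 0 η := ⟨h0, hℓle s₁ ⟨hs₁, self_mem_Ici⟩⟩
    have hev : ∀ f : ℝ → ℝ, (∀ x, f (-x) = f x) → f (θ * ℓ) = f ℓ := fun f hf => by
      rcases hθ with h | h <;> rw [h]
      · rw [one_mul]
      · rw [neg_one_mul, hf]
    refine h.not_futureInextendible hI hIc hγ ⟨hs₀cl, hs₀I⟩ hlub hlim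
      (mul_ne_zero (by rintro rfl; norm_num at hθ2) h0.ne') ?_ ?_ hR hfut
    · rw [hev _ h.A_neg]; exact (hAη ℓ hmem).ne
    · rw [hev _ h.radial_neg_arg]; exact hm.trans_le (hmr ℓ hmem)

end Admissible
end Params
end EiBI

/-! ### Crossing the throat -/

namespace EiBI
namespace RealLemmas

theorem hasDerivAt_mul_abs_rpow {q x : ℝ} (hx : x ≠ 0) :
    HasDerivAt (fun x : ℝ => x * |x| ^ q) ((q + 1) * |x| ^ q) x := by
  have hx' : 0 < |x| := abs_pos.2 hx
  refine ((hasDerivAt_id' x).fun_mul ((hasDerivAt_abs hx).rpow_const (p := q)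
    (Or.inl hx'.ne'))).congr_deriv ?_
  have h1 : x * (SignType.sign x : ℝ) = |x| := self_mul_sign x
  rw [Real.rpow_sub_one hx'.ne']
  field_simp
  linear_combination q * h1

/-- L'Hôpital's rule for functions whose derivative behaves as a power of `|x|`. -/
theorem tendsto_div_mul_abs_rpow {f f' : ℝ → ℝ} {q c : ℝ} (hq : 0 < q)
    (hf : ∀ᶠ x in 𝓝[≠] (0 : ℝ), HasDerivAt f (f' x) x) (hf0 : Tendsto f (𝓝[≠] 0) (𝓝 0))
    (hlim : Tendsto (fun x => f' x / |x| ^ q) (𝓝[≠] 0) (𝓝 c)) :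
    Tendsto (fun x => f x / (x * |x| ^ q)) (𝓝[≠] 0) (𝓝 (c / (q + 1))) := by
  have hq1 : q + 1 ≠ 0 := by positivity
  refine HasDerivAt.lhopital_zero_nhdsNE hf
    (eventually_mem_nhdsWithin.mono fun x hx => hasDerivAt_mul_abs_rpow hx)
    (eventually_mem_nhdsWithin.mono fun x hx =>
      mul_ne_zero hq1 (Real.rpow_pos_of_pos (abs_pos.2 hx) _).ne') hf0 ?_ ?_
  · have h2 : Continuous fun x : ℝ => x * |x| ^ q :=
      continuous_id.mul (continuous_abs.rpow_const fun _ => Or.inr hq.le)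
    have h3 := h2.tendsto 0
    rw [zero_mul] at h3
    exact h3.mono_left nhdsWithin_le_nhds
  · refine (hlim.div_const (q + 1)).congr fun x => ?_
    rw [div_div, mul_comm (q + 1)]

end RealLemmas

namespace Params
variable {P : Params} {n : ℕ} {γ : ℝ → Idx P.d → ℝ} {I : Set ℝ} {E L κ : ℝ}

/-- A geodesic that tends to the throat crosses it: by the first integrals, `λ` as a function of `x` and
the null time `v` have derivatives that extend continuously to `x = 0`, and the angular motion is that
along a great circle, whose equation is regular at the throat. -/
theorem Admissible.crossesThroat (h : P.Admissible n) (hn : 3 ≤ n) (hκ : 0 ≤ κ) (hI : IsOpen I)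
    (hIc : I.OrdConnected) (hγ : P.IsGeodesicWith γ I E L κ) {s₀ R : ℝ} (hs₀ : s₀ ∈ closure I \ I)
    (hlim : Tendsto (fun s => γ s iX) (𝓝[I] s₀) (𝓝 0))
    (hR : ∀ᶠ s in 𝓝[I] s₀, ∑ i, γ s (Sum.inr i) ^ 2 ≤ R) : P.CrossesThroat γ I E L κ s₀ := by
  have hne : (𝓝[I] s₀).NeBot := mem_closure_iff_nhdsWithin_neBot.1 hs₀.1
  obtain ⟨C, hC⟩ : ∃ C, P.ReachesThroat E L κ C := by
    refine (h.bounded_below_or_reachesThroat hn hκ hI hIc hγ).resolve_left ?_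
    rintro ⟨m, hm, hb⟩
    have h1 : Tendsto (fun s => |γ s iX|) (𝓝[I] s₀) (𝓝 0) := by simpa using hlim.abs
    have := ge_of_tendsto h1 (eventually_mem_nhdsWithin.mono hb)
    linarith
  obtain ⟨η, hη, hnear⟩ : ∃ η > 0, ∀ x ∈ Ioo (-η) η, x ≠ 0 → P.A x ≠ 0 ∧ 0 < P.radial E L κ x := by
    have h1 := (h.eventually_A_ne_zero hn).and hC.pos
    rw [eventually_nhdsWithin_iff, Metric.eventually_nhds_iff] at h1
    obtain ⟨e, he, h1⟩ := h1
    refine ⟨e, he, fun x hx hx0 => h1 ?_ hx0⟩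
    rw [Real.dist_eq, sub_zero, abs_lt]
    exact hx
  obtain ⟨τ, hτ, ℓ, hℓ⟩ := hC.time
  have hAc : ∀ x ∈ Ioo (-η) η \ {0}, ContinuousAt P.A x := fun x hx =>
    (h.hasDerivAt_A hx.2).continuousAt
  have hSc : ∀ x ∈ Ioo (-η) η \ {0}, ContinuousAt (fun x => √(P.radial E L κ x)) x := fun x hx =>
    (h.differentiableAt_radial hx.2).continuousAt.sqrt
  have hS0 : ∀ x ∈ Ioo (-η) η \ {0}, √(P.radial E L κ x) ≠ 0 := fun x hx =>
    (Real.sqrt_pos.2 (hnear x hx.1 hx.2).2).ne'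
  have hA0 : ∀ x ∈ Ioo (-η) η \ {0}, P.A x ≠ 0 := fun x hx => (hnear x hx.1 hx.2).1
  have hinv : ContinuousOn (fun x => 1 / P.A x) (Ioo (-η) η \ {0}) := fun x hx =>
    (continuousAt_const.div (hAc x hx) (hA0 x hx)).continuousWithinAt
  -- `λ` as a function of `x`; note that `D` vanishes at the throat
  set W : ℝ → ℝ := fun x => P.D x / √(P.radial E L κ x) with hW
  have hWc : ContinuousOn W (Ioo (-η) η) := by
    intro x hx
    rcases eq_or_ne x 0 with rfl | hx0
    · have h0 : W 0 = 0 := by rw [hW]; simp only [h.D_zero hn, zero_div]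
      refine ContinuousAt.continuousWithinAt (continuousAt_iff_punctured_nhds.2 ?_)
      rw [h0]
      exact hC.tendsto_zero
    · exact (h.continuous_D.continuousAt.div (hSc x ⟨hx, hx0⟩) (hS0 x ⟨hx, hx0⟩)).continuousWithinAt
  -- the null time, and the time
  obtain ⟨v, hvc, hv⟩ := RealLemmas.exists_primitive_of_tendsto (η := η)
    (f := fun x => E / (P.A x * √(P.radial E L κ x)) + τ / P.A x)
    (fun x hx => ((continuousAt_const.div ((hAc x hx).mul (hSc x hx))
      (mul_ne_zero (hA0 x hx) (hS0 x hx))).add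
      (continuousAt_const.div (hAc x hx) (hA0 x hx))).continuousWithinAt) hℓ
  obtain ⟨α, hαc, hα⟩ : ∃ α : ℝ → ℝ, (¬ P.Exceptional → ContDiffOn ℝ 1 α (Ioo (-η) η)) ∧
      ∀ x ∈ Ioo (-η) η, x ≠ 0 → HasDerivAt α (1 / P.A x) x := by
    by_cases hex : P.Exceptional
    · obtain ⟨α, hα⟩ := RealLemmas.exists_primitive_off_zero hinv
      exact ⟨α, fun hn => absurd hex hn, hα⟩
    · obtain ⟨ℓ', hℓ'⟩ := h.exists_tendsto_inv_A hn hex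
      obtain ⟨α, hαc, hα⟩ := RealLemmas.exists_primitive_of_tendsto hinv hℓ'
      exact ⟨α, fun _ => hαc, hα⟩
  have hT : ∀ x ∈ Ioo (-η) η, x ≠ 0 →
      HasDerivAt (fun x => v x - τ * α x) (E / (P.A x * √(P.radial E L κ x))) x := fun x hx hx0 =>
    ((hv x hx hx0).fun_sub ((hα x hx hx0).const_mul τ)).congr_deriv (by ring)
  obtain ⟨δ, hδ, hδη, σ, k, lam, c, hc⟩ := h.exists_isContinuation hI hIc hγ (W := W)
    (T₀ := fun x => v x - τ * α x) hs₀ hlim hR hη (by simpa using hnear) (by simpa using hWc)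
    (fun x _ _ => rfl) (by simpa using hT)
  have hsub : Ioo (-δ) δ ⊆ Ioo (-η) η := Ioo_subset_Ioo (by linarith) hδη
  have hmem : (0 : ℝ) ∈ Ioo (-δ) δ := ⟨by linarith, hδ⟩
  have hσ0 : σ ≠ 0 := by rcases hc.sign with h | h <;> rw [h] <;> norm_num
  obtain ⟨hsign, hlam0, hlam', hmono, hcX, hcT, -, hgeo, heq, hang⟩ := hc
  simp only [zero_sub, zero_add] at hlam' hmono hcX hcT hgeo heq hang
  refine ⟨δ, hδ, lam, c, hlam0, ?_, hmono, ?_, hcX, hgeo, heq, hang, fun hex => ?_, σ * τ, ?_,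
    fun x => σ * v x + k, ?_, ?_⟩
  · exact RealLemmas.contDiffOn_one_of_hasDerivAt isOpen_Ioo hlam' ((hWc.mono hsub).const_mul σ)
  · refine ⟨σ * C / (P.throatExponent E L κ + 1), div_ne_zero (mul_ne_zero hσ0 hC.coeff_pos.ne')
      (by have := hC.exponent_pos; positivity), ?_⟩
    refine RealLemmas.tendsto_div_mul_abs_rpow (f' := fun x => σ * W x) hC.exponent_pos ?_ ?_ ?_
    · filter_upwards [nhdsWithin_le_nhds (isOpen_Ioo.mem_nhds hmem)] with x hx
      exact (hlam' x hx).sub_const s₀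
    · have h1 : Tendsto (fun x => lam x - s₀) (𝓝 0) (𝓝 (lam 0 - s₀)) :=
        (hlam' 0 hmem).continuousAt.sub_const s₀
      rw [hlam0, sub_self] at h1
      exact h1.mono_left nhdsWithin_le_nhds
    · refine (hC.rate.const_mul σ).congr fun x => ?_
      rw [← mul_div_assoc]
  · exact ((((hvc.mono hsub).sub (((hαc hex).mono hsub).const_smul τ)).const_smul σ).add
      contDiffOn_const).congr fun x hx => hcT x hx
  · rcases hsign with h1 | h1 <;> rcases hτ with h2 | h2 <;> rw [h1, h2] <;> norm_num
  · exact ((hvc.mono hsub).const_smul σ).add contDiffOn_const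
  · intro x hx
    have hd := ((hv x (hsub hx.1) hx.2).const_mul σ).add_const k
    refine ((((hT x (hsub hx.1) hx.2).const_mul σ).add_const k).congr_of_eventuallyEq
      (Filter.mem_of_superset (isOpen_Ioo.mem_nhds hx.1) hcT)).congr_deriv ?_
    rw [hd.deriv]
    ring

end Params
end EiBI

end

theorem mainTheorem7 (P : EiBI.Params) (hd : 4 ≤ P.d) (hε : P.ε < 0) (hlP : 0 < P.lP)
    (hQ : P.Q ≠ 0) :
    -- the metric, with the Levi-Civita connection of the auxiliary metric, solves the field equations
    (∀ p ∈ P.domain,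
      EiBI.IsSolutionAt P.d P.ε 1 P.lP P.metric (EiBI.christoffel P.auxMetric) P.field p ∧
      EiBI.auxiliary P.ε P.metric (EiBI.christoffel P.auxMetric) p = P.auxMetric p) ∧
    -- it is the general solution of its form, up to an affine change of the coordinate `x`
    (∀ (J : Set ℝ) (a b r B ρ : ℝ → ℝ), IsOpen J → J.OrdConnected → J.Nonempty →
      ContDiffOn ℝ 2 B J → ContDiffOn ℝ 2 ρ J →
      (∀ x ∈ J, B x ≠ 0 ∧ 0 < ρ x ∧ P.rc < r x) →
      (∀ p : EiBI.Idx P.d → ℝ, p EiBI.iX ∈ J →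
        EiBI.IsSolutionAt P.d P.ε 1 P.lP (EiBI.ssMetric a b r)
          (EiBI.christoffel (EiBI.ssMetric (fun x => -B x) (fun x => 1 / B x) ρ))
          (EiBI.coulombField P.Q a b r) p ∧
        EiBI.auxiliary P.ε (EiBI.ssMetric a b r)
          (EiBI.christoffel (EiBI.ssMetric (fun x => -B x) (fun x => 1 / B x) ρ)) p
          = EiBI.ssMetric (fun x => -B x) (fun x => 1 / B x) ρ p) →
      ∃ k m : ℝ, (∀ x ∈ J, ρ x = k * x + m) ∧
        (k ≠ 0 → ∃ M₀ : ℝ, ∀ x ∈ J,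
          B x = EiBI.Params.A { P with M₀ := M₀ } (ρ x) / k ^ 2 ∧
          a x = -(B x / P.Ω₂ (ρ x)) ∧ b x = 1 / (B x * P.Ω₂ (ρ x)) ∧ r x = P.r (ρ x))) ∧
    -- closed form of `A` in terms of the hypergeometric functions
    (P.M₀ ≠ 0 → ∀ x : ℝ, x ≠ 0 →
      P.A x = 1 - (1 + P.δ₁ * EiBI.G P.d (P.z x)) /
        (P.δ₂ * P.Ωₙ x ^ (((P.d : ℝ) - 3) / 2) * P.z x ^ (P.d - 3))) ∧
    -- `x = 0` is a throat of radius `r_c`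
    (P.r 0 = P.rc ∧ ∀ x : ℝ, x ≠ 0 → P.rc < P.r x) ∧
    (5 ≤ P.d →
      -- the curvature diverges at the throat
      (∀ᶠ x in 𝓝[≠] (0 : ℝ), P.A x ≠ 0) ∧
      Tendsto (EiBI.kretschmann P.metric)
        (comap (fun p : EiBI.Idx P.d → ℝ => p EiBI.iX) (𝓝[≠] 0)) atTop ∧
      (∃ C > 0, Tendsto (fun p => EiBI.kretschmann P.metric p *
          |p EiBI.iX| ^ P.kretschmannExponent)
        (comap (fun p : EiBI.Idx P.d → ℝ => p EiBI.iX) (𝓝[≠] 0)) (𝓝 C)) ∧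
      -- geodesics
      (∀ (γ : ℝ → EiBI.Idx P.d → ℝ) (I : Set ℝ), IsOpen I → I.OrdConnected → I.Nonempty →
        (∀ s ∈ I, γ s ∈ P.domain) → EiBI.IsGeodesicOn P.metric γ I →
        ∃ E L κ : ℝ, P.IsGeodesicWith γ I E L κ ∧
          (∀ s ∈ I, (deriv γ s EiBI.iX / P.Ω₂ (γ s EiBI.iX)) ^ 2 =
            E ^ 2 - P.A (γ s EiBI.iX) / P.Ω₂ (γ s EiBI.iX) *
              (κ + L ^ 2 / P.r (γ s EiBI.iX) ^ 2)) ∧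
          (0 ≤ κ →
            -- a time-like throat repels all causal geodesics that are not radial and null
            (P.TimelikeThroat → (κ ≠ 0 ∨ L ≠ 0) → ∃ m > 0, ∀ s ∈ I, m ≤ |γ s EiBI.iX|) ∧
            -- a space-like throat is reached in finite affine parameter from inside the horizon
            (P.SpacelikeThroat →
              (∃ s ∈ I, P.A (γ s EiBI.iX) < 0 ∧ γ s EiBI.iX * deriv γ s EiBI.iX < 0) →
              ∃ s₀, IsLUB I s₀ ∧
                (P.FutureInextendible γ I →
                  (∃ R : ℝ, ∀ᶠ s in 𝓝[I] s₀, ∑ i, γ s (Sum.inr i) ^ 2 ≤ R) →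
                  Tendsto (fun s => γ s EiBI.iX) (𝓝[I] s₀) (𝓝 0))) ∧
            -- a causal geodesic stays away from the throat, or tends to it at a finite parameter
            ((∃ m > 0, ∀ s ∈ I, m ≤ |γ s EiBI.iX|) ∨
              ∃ s₀ ∈ closure I \ I, Tendsto (fun s => γ s EiBI.iX) (𝓝[I] s₀) (𝓝 0)) ∧
            -- a causal geodesic that tends to the throat crosses it
            (∀ s₀ ∈ closure I \ I, Tendsto (fun s => γ s EiBI.iX) (𝓝[I] s₀) (𝓝 0) →
              (∃ R : ℝ, ∀ᶠ s in 𝓝[I] s₀, ∑ i, γ s (Sum.inr i) ^ 2 ≤ R) →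
              P.CrossesThroat γ I E L κ s₀)))) := by
  have h : P.Admissible (P.d - 2) := ⟨by omega, by omega, hε, hlP, hQ⟩
  refine ⟨fun p hp => ⟨h.isSolutionAt hp, h.auxiliary_eq hp⟩,
    fun J a b r B ρ hJ hJc hJn hB hρ hpos hsol => h.general_solution hJ hJc hJn hB hρ hpos hsol,
    fun hM x hx => h.A_closed_form hM hx, ⟨h.r_zero, fun x hx => h.rc_lt_r hx⟩, fun hd5 => ?_⟩
  have hn : 3 ≤ P.d - 2 := by omega
  refine ⟨h.eventually_A_ne_zero hn, h.tendsto_kretschmann_atTop hn, h.exists_tendsto_kretschmann hn,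
    fun γ I hI hIc hIn hdom hgeo => ?_⟩
  obtain ⟨E, L, κ, hγ⟩ := h.exists_isGeodesicWith hI hIc hIn hdom hgeo
  refine ⟨E, L, κ, hγ, fun s hs => ?_, fun hκ => ⟨fun ht hK => ?_, fun hM hex => ?_,
    h.bounded_below_or_tendsto_throat hn hκ hI hIc hγ, fun s₀ hs₀ hlim hR => ?_⟩⟩
  · have h1 := h.first_integral hγ hs
    simp only [EiBI.Params.radial] at h1
    rw [h.Ω₂_eq, div_inv_eq_mul, div_inv_eq_mul, mul_comm (deriv γ s EiBI.iX), h1]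
  · exact h.bounded_below_of_radial_neg hγ
      (h.radial_neg_of_massThroat_neg hn hκ hK ((h.timelikeThroat_iff hn).1 ht))
  · obtain ⟨s₁, hs₁, hA, hdec⟩ := hex
    exact h.reaches_throat_inside_horizon hn hκ hI hIc hγ ((h.spacelikeThroat_iff hn).1 hM) hs₁ hA hdec
  · obtain ⟨R, hR⟩ := hR
    exact h.crossesThroat hn hκ hI hIc hγ hs₀ hlim hR
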